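/- Let $M$ be a closed smooth manifold of dimension $m\ge 2$ (compact, without boundary, not necessarily connected or orientable), and let $f\colon M\to\mathbb{R}^2$ be a generic smooth map, i.e. a smooth map such that for every $k$ the $k$-jet extension of $f$ is transverse to every Thom–Boardman submanifold of the $k$-jet space, and such that $f$ satisfies the normal crossing condition: whenever $x_1,\dots,x_r$ are distinct singular points with $f(x_1)=\dots=f(x_r)$ and $x_j\in\Sigma^{I_j}(f)$, the subspaces $d_{x_j}f(T_{x_j}\Sigma^{I_j}(f))$ are in general position in $\mathbb{R}^2$. Let $\Sigma=\Sigma(f)$ be the set of singular points of $f$ (a closed curve), $A_1(f)$ and $A_2(f)$ the sets of fold points and of cusp points, that is, of points with Thom–Boardman symbol $(m-1,0)$ and $(m-1,1,0)$ respectively, and $A_{11}(f)$ the set of $x\in A_1(f)$ for which there is $y\in A_1(f)$, $y\neq x$, with $f(y)=f(x)$. The arcs of $\Sigma$ are the closures of the connected components of $\Sigma\setminus(A_2(f)\cup A_{11}(f))$. Suppose that at every self-intersection point of $f(\Sigma)$ the two intersecting branches are perpendicular. Let $c\colon\mathbb{R}^2\setminus f(\Sigma)\to\mathbb{Z}$ (respectively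 $\mathbb{Z}_2$) be an integral (respectively $\mathbb{Z}_2$-valued) chessboard function: $c$ is locally constant, and $c(\gamma(1))$ and $c(\gamma(-1))$ differ by exactly $1$ for every smooth curve $\gamma\colon[-1,1]\to\mathbb{R}^2$ that meets $f(\Sigma)$ only at $\gamma(0)$, where $\gamma(0)$ is the image of exactly one singular point and $\gamma$ is transverse there to the strata $f(\Sigma^I(f))$. The canonical local coorientation of $f(\Sigma)$ points to the side on which $c$ takes the smaller (respectively the even) value. Orient each arc $\alpha$ so that the orientation of $f(\alpha)$ followed by this coorientation is the standard orientation of $\mathbb{R}^2$, and let $\varphi(\alpha)\in\mathbb{R}$ be the winding number of the plane curve $f(\alpha)$, i.e. the total change, measured in full turns, of a continuous lift of its unit tangent vector (extended by continuity to the endpoints of the arc). Then there are finitely many arcs, each $\varphi(\alpha)$ is well defined, and the cumulative winding number $$\omega(f)=\sum_{\alpha}\varphi(\alpha),$$ where $\alpha$ ranges over all arcs of $\Sigma$, satisfies $\omega(f)\in\tfrac12\mathbb{Z}$. -/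

import Mathlib

open Set Filter Topology
open scoped Manifold ContDiff

noncomputable section

/-- The standard Euclidean space `ℝⁿ`. -/
abbrev Euc (n : ℕ) : Type := EuclideanSpace ℝ (Fin n)

/-! ### Tangent spaces of subsets and jets in Euclidean space -/

/-- The tangent space at `p` of a subset `S` of a normed space: the span of the velocities at `p`
of smooth curves lying in `S`. If `S` is a smooth submanifold, this is the usual tangent space. -/
def tangentSpan {E : Type*} [NormedAddCommGroup E] [NormedSpace ℝ E] (S : Set E) (p : E) :
    Submodule ℝ E :=
  Submodule.span ℝ {v | ∃ c : ℝ → E, ContDiffAt ℝ ∞ c 0 ∧ c 0 = p ∧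
    (∀ᶠ t in 𝓝 (0 : ℝ), c t ∈ S) ∧ deriv c 0 = v}

/-- Multi-indices in `m` variables of total order at most `k`. -/
abbrev MultiIdx (m k : ℕ) : Type := {s : Fin m → Fin (k + 1) // ∑ i, (s i : ℕ) ≤ k}

/-- The space of `k`-jets at a point of maps from `ℝᵐ` to `ℝⁿ`: a jet is given by its partial
derivatives of order at most `k` (the value of the map included). -/
abbrev Jet (m n k : ℕ) : Type := MultiIdx m k → Euc n

/-- The `i`-th partial derivative. -/
def partialDeriv {m n : ℕ} (i : Fin m) (g : Euc m → Euc n) : Euc m → Euc n :=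
  fun u => fderiv ℝ g u (EuclideanSpace.single i 1)

/-- The `k`-jet of `g` at `u`, as a function of `u`. -/
def jetExt {m n : ℕ} (k : ℕ) (g : Euc m → Euc n) (u : Euc m) : Jet m n k :=
  fun s => ((List.finRange m).foldr (fun i h => (partialDeriv i)^[(s.1 i : ℕ)] h) g) u

/-- The `j`-th component of the Taylor polynomial of a jet, without its constant term. -/
def jetPoly {m n k : ℕ} (z : Jet m n k) (j : Fin n) : MvPolynomial (Fin m) ℝ :=
  ∑ s : MultiIdx m k, if ∑ i, (s.1 i : ℕ) = 0 then 0 else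
    MvPolynomial.monomial (Finsupp.equivFunOnFinite.symm fun i => (s.1 i : ℕ))
      (z s j / ∏ i, ((s.1 i : ℕ).factorial : ℝ))

/-! ### Thom–Boardman symbols through iterated Jacobian extensions -/

/-- The rank at the origin of the differentials of the elements of an ideal. -/
def idealRank {m : ℕ} (J : Ideal (MvPolynomial (Fin m) ℝ)) : ℕ :=
  Module.finrank ℝ (Submodule.span ℝ {v : Fin m → ℝ |
    ∃ g ∈ J, v = fun j => MvPolynomial.eval 0 (MvPolynomial.pderiv j g)})

/-- The critical Jacobian extension of an ideal `J` of rank `r`: add to `J` all minors of size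
`r + 1` of Jacobian matrices of elements of `J`. -/
def criticalExtension {m : ℕ} (J : Ideal (MvPolynomial (Fin m) ℝ)) :
    Ideal (MvPolynomial (Fin m) ℝ) :=
  J ⊔ Ideal.span {d | ∃ (g : Fin (idealRank J + 1) → MvPolynomial (Fin m) ℝ)
    (c : Fin (idealRank J + 1) → Fin m), (∀ i, g i ∈ J) ∧
      d = Matrix.det (Matrix.of fun i j => MvPolynomial.pderiv (c j) (g i))}

/-- `J` has Boardman symbol `(i₁, i₂, …)`: the number `i₁` is the corank of `J`, the number `i₂`
is the corank of the critical extension of `J`, and so on. -/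
def HasBoardmanSymbol {m : ℕ} : Ideal (MvPolynomial (Fin m) ℝ) → List ℕ → Prop
  | _, [] => True
  | J, i :: I => idealRank J + i = m ∧ HasBoardmanSymbol (criticalExtension J) I

/-- The Thom–Boardman stratum `Σ^I` in the space of jets of order the length of `I`. -/
def jetStratum (m n : ℕ) (I : List ℕ) : Set (Jet m n I.length) :=
  {z | HasBoardmanSymbol (Ideal.span (range (jetPoly z))) I}

/-! ### Generic maps of manifolds to Euclidean spaces -/


/-- The expression of `f` in the preferred chart at `x`. -/
def localRep (m : ℕ) {n : ℕ} {M : Type*} [TopologicalSpace M] [ChartedSpace (Euc m) M]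
    (f : M → Euc n) (x : M) : Euc m → Euc n :=
  f ∘ (extChartAt (𝓡 m) x).symm

/-- The stratum `Σ^I(f)` of the source. -/
def stratum (m : ℕ) {n : ℕ} {M : Type*} [TopologicalSpace M] [ChartedSpace (Euc m) M]
    (f : M → Euc n) (I : List ℕ) : Set M :=
  {x | jetExt I.length (localRep m f x) (extChartAt (𝓡 m) x x) ∈ jetStratum m n I}

/-- The set `Σ(f)` of singular points: the differential is not surjective. -/
def singularSet (m : ℕ) {n : ℕ} {M : Type*} [TopologicalSpace M] [ChartedSpace (Euc m) M]
    (f : M → Euc n) : Set M :=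
  {x | ¬ Function.Surjective (mfderiv (𝓡 m) (𝓡 n) f x)}

/-- The differential of `f` at `x`, where the tangent space at `x` is identified with `ℝᵐ` by the
preferred chart. -/
def differential (m : ℕ) {n : ℕ} {M : Type*} [TopologicalSpace M] [ChartedSpace (Euc m) M]
    (f : M → Euc n) (x : M) : Euc m →L[ℝ] Euc n :=
  mfderiv (𝓡 m) (𝓡 n) f x

/-- The tangent space at `x` of a subset `S` of a manifold, in the preferred chart at `x`. -/
def tangentOf (m : ℕ) {M : Type*} [TopologicalSpace M] [ChartedSpace (Euc m) M]
    (S : Set M) (x : M) : Submodule ℝ (Euc m) :=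
  tangentSpan ((extChartAt (𝓡 m) x).target ∩ (extChartAt (𝓡 m) x).symm ⁻¹' S)
    (extChartAt (𝓡 m) x x)

/-- The subspace `d_x f (T_x S)`. -/
def imageTangent (m : ℕ) {n : ℕ} {M : Type*} [TopologicalSpace M] [ChartedSpace (Euc m) M]
    (f : M → Euc n) (S : Set M) (x : M) : Submodule ℝ (Euc n) :=
  (tangentOf m S x).map (differential m f x : Euc m →ₗ[ℝ] Euc n)

/-- `f` is a Thom–Boardman map: for each `k` its `k`-jet extension is transverse to each
Thom–Boardman stratum of the `k`-jet space. (The strata are products in the base directions, so it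
is enough to look at the jet components.) -/
def IsThomBoardman (m : ℕ) {n : ℕ} {M : Type*} [TopologicalSpace M] [ChartedSpace (Euc m) M]
    (f : M → Euc n) : Prop :=
  ∀ (I : List ℕ), ∀ x ∈ stratum m f I,
    LinearMap.range (fderiv ℝ (jetExt I.length (localRep m f x)) (extChartAt (𝓡 m) x x) :
        Euc m →ₗ[ℝ] Jet m n I.length) ⊔
      tangentSpan (jetStratum m n I)
        (jetExt I.length (localRep m f x) (extChartAt (𝓡 m) x x)) = ⊤

/-- Subspaces are in general position if codimensions of intersections add up. -/
def InGeneralPosition {V ι : Type*} [AddCommGroup V] [Module ℝ V] (H : ι → Submodule ℝ V) :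
    Prop :=
  ∀ s : Finset ι, Module.finrank ℝ (V ⧸ ⨅ i ∈ s, H i) = ∑ i ∈ s, Module.finrank ℝ (V ⧸ H i)

/-- The normal crossing condition. -/
def NormalCrossing (m : ℕ) {n : ℕ} {M : Type*} [TopologicalSpace M] [ChartedSpace (Euc m) M]
    (f : M → Euc n) : Prop :=
  ∀ (r : ℕ) (x : Fin r → M) (I : Fin r → List ℕ), Function.Injective x →
    (∀ j, x j ∈ singularSet m f) → (∀ j, x j ∈ stratum m f (I j)) →
    (∀ i j, f (x i) = f (x j)) →
    InGeneralPosition fun j => imageTangent m f (stratum m f (I j)) (x j)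

/-- Generic smooth maps. -/
def IsGenericMap (m : ℕ) {n : ℕ} {M : Type*} [TopologicalSpace M] [ChartedSpace (Euc m) M]
    (f : M → Euc n) : Prop :=
  ContMDiff (𝓡 m) (𝓡 n) ∞ f ∧ IsThomBoardman m f ∧ NormalCrossing m f


/-! ### Maps to the plane: folds, cusps, arcs -/

/-- Fold points `A₁(f)`: the points with Thom–Boardman symbol `(m - 1, 0)`. -/
def foldSet (m : ℕ) {M : Type*} [TopologicalSpace M] [ChartedSpace (Euc m) M]
    (f : M → Euc 2) : Set M := stratum m f [m - 1, 0]

/-- Cusp points `A₂(f)`: the points with Thom–Boardman symbol `(m - 1, 1, 0)`. -/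
def cuspSet (m : ℕ) {M : Type*} [TopologicalSpace M] [ChartedSpace (Euc m) M]
    (f : M → Euc 2) : Set M := stratum m f [m - 1, 1, 0]

/-- The set `A₁₁(f)` of fold points whose image is also the image of another fold point. -/
def doubleFoldSet (m : ℕ) {M : Type*} [TopologicalSpace M] [ChartedSpace (Euc m) M]
    (f : M → Euc 2) : Set M := {x ∈ foldSet m f | ∃ y ∈ foldSet m f, y ≠ x ∧ f y = f x}

/-- The singular set without the distinguished points (cusps and double fold points). -/
def openArcSet (m : ℕ) {M : Type*} [TopologicalSpace M] [ChartedSpace (Euc m) M]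
    (f : M → Euc 2) : Set M := singularSet m f \ (cuspSet m f ∪ doubleFoldSet m f)

/-- The arcs of `Σ(f)`, each given by its interior: the connected components of `Σ(f)` without the
distinguished points. The arc itself is the closure of such a component; a circle without
distinguished points is an arc, too. -/
def arcs (m : ℕ) {M : Type*} [TopologicalSpace M] [ChartedSpace (Euc m) M]
    (f : M → Euc 2) : Set (Set M) :=
  {A | ∃ x ∈ openArcSet m f, A = connectedComponentIn (openArcSet m f) x}

/-- At every self-intersection point of `f(Σ)` the two branches are perpendicular. -/
def PerpendicularCrossings (m : ℕ) {M : Type*} [TopologicalSpace M] [ChartedSpace (Euc m) M]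
    (f : M → Euc 2) : Prop :=
  ∀ x ∈ singularSet m f, ∀ y ∈ singularSet m f, x ≠ y → f x = f y →
    imageTangent m f (singularSet m f) x ⟂ imageTangent m f (singularSet m f) y

/-! ### Chessboard functions -/

/-- A smooth curve on `[-1, 1]` that meets `f(Σ)` exactly at time `0`, in the image of a unique
singular point, and is transverse to the strata there. -/
def IsGenericCrossing (m : ℕ) {M : Type*} [TopologicalSpace M] [ChartedSpace (Euc m) M]
    (f : M → Euc 2) (g : ℝ → Euc 2) : Prop :=
  ContDiff ℝ ∞ g ∧ (∀ t ∈ Icc (-1 : ℝ) 1, g t ∈ f '' singularSet m f ↔ t = 0) ∧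
    (∃! x, x ∈ singularSet m f ∧ f x = g 0) ∧
    ∀ x ∈ singularSet m f, f x = g 0 → ∀ I : List ℕ, x ∈ stratum m f I →
      Submodule.span ℝ {deriv g 0} ⊔ imageTangent m f (stratum m f I) x = ⊤

/-- Chessboard functions, integral for `R = ℤ` and `ℤ₂`-valued for `R = ZMod 2`. Only the values
off `f(Σ)` matter. -/
def IsChessboard {R : Type*} [Ring R] (m : ℕ) {M : Type*} [TopologicalSpace M]
    [ChartedSpace (Euc m) M] (f : M → Euc 2) (c : Euc 2 → R) : Prop :=
  (∀ y ∉ f '' singularSet m f, ∀ᶠ z in 𝓝 y, c z = c y) ∧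
    ∀ g, IsGenericCrossing m f g → c (g 1) - c (g (-1)) = 1 ∨ c (g 1) - c (g (-1)) = -1

/-- For integral chessboard functions the coorientation points to the side of smaller value. -/
def intSide (a b : ℤ) : Prop := a < b

/-- For `ℤ₂`-valued chessboard functions the coorientation points to the side of even value. -/
def modTwoSide (a b : ZMod 2) : Prop := a = 0 ∧ b ≠ 0

/-! ### Winding numbers -/

/-- Rotation of the plane by a quarter turn counterclockwise. -/
def quarterTurn (v : Euc 2) : Euc 2 := !₂[-v 1, v 0]

/-- `γ` parametrizes the arc with interior `A` by `[0, 1]`, smoothly inside. -/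
def IsArcParametrization (m : ℕ) {M : Type*} [TopologicalSpace M] [ChartedSpace (Euc m) M]
    (A : Set M) (γ : ℝ → M) : Prop :=
  ContinuousOn γ (Icc 0 1) ∧ ContMDiffOn 𝓘(ℝ, ℝ) (𝓡 m) ∞ γ (Ioo 0 1) ∧ InjOn γ (Ioo 0 1) ∧
    γ '' Ioo 0 1 ⊆ A ∧ γ '' Icc 0 1 = closure A

/-- The plane curve `β` runs in the direction of the canonical local orientation: this orientation
followed by the canonical local coorientation is the standard orientation of the plane, so the
coorientation points to the left of `β`. -/
def IsCanonicallyOriented {R : Type*} (side : R → R → Prop) (c : Euc 2 → R) (β : ℝ → Euc 2) :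
    Prop :=
  ∀ t ∈ Ioo (0 : ℝ) 1, ∀ᶠ s in 𝓝[>] (0 : ℝ),
    side (c (β t + s • quarterTurn (deriv β t))) (c (β t - s • quarterTurn (deriv β t)))

/-- The plane curve `β` is immersed on the open interval `(0, 1)`, its Gauss map extends
continuously to `[0, 1]`, and a lift `θ` of it (full turns being the unit) changes by `w`. -/
def HasWindingNumber (β : ℝ → Euc 2) (w : ℝ) : Prop :=
  ∃ θ : ℝ → ℝ, ContinuousOn θ (Icc 0 1) ∧
    (∀ t ∈ Ioo (0 : ℝ) 1, deriv β t ≠ 0 ∧ deriv β t =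
      ‖deriv β t‖ • !₂[Real.cos (2 * Real.pi * θ t), Real.sin (2 * Real.pi * θ t)]) ∧
    w = θ 1 - θ 0

/-- `w` is the winding number of the image of the arc `A` with its canonical orientation. -/
def IsArcWinding {R : Type*} (side : R → R → Prop) (m : ℕ) {M : Type*} [TopologicalSpace M]
    [ChartedSpace (Euc m) M] (f : M → Euc 2) (c : Euc 2 → R) (A : Set M) (w : ℝ) : Prop :=
  ∃ γ : ℝ → M, IsArcParametrization m A γ ∧ IsCanonicallyOriented side c (f ∘ γ) ∧
    HasWindingNumber (f ∘ γ) w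

/-- The winding function `φ` on arcs. -/
def arcWinding {R : Type*} (side : R → R → Prop) (m : ℕ) {M : Type*} [TopologicalSpace M]
    [ChartedSpace (Euc m) M] (f : M → Euc 2) (c : Euc 2 → R) (A : Set M) : ℝ :=
  Classical.epsilon (IsArcWinding side m f c A)

/-- The cumulative winding number `ω(f)`. -/
def cumulativeWinding {R : Type*} (side : R → R → Prop) (m : ℕ) {M : Type*} [TopologicalSpace M]
    [ChartedSpace (Euc m) M] (f : M → Euc 2) (c : Euc 2 → R) : ℝ :=
  ∑ᶠ A ∈ arcs m f, arcWinding side m f c A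

/-- The cumulative winding number is defined: there are finitely many arcs, and each of them has
exactly one winding number. -/
def CumulativeWindingDefined {R : Type*} (side : R → R → Prop) (m : ℕ) {M : Type*}
    [TopologicalSpace M] [ChartedSpace (Euc m) M] (f : M → Euc 2) (c : Euc 2 → R) : Prop :=
  (arcs m f).Finite ∧ ∀ A ∈ arcs m f, ∃! w, IsArcWinding side m f c A w

end

/-!
The idea of the proof is to compute each winding number modulo half turns from the tangent lines
at the two ends of the arc, and to see that the contributions of the ends cancel at every cusp and
at every self-intersection point of the image of the singular set.

Local structure. Near a singular point the differential of `f` has rank one, and transversality to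
the Thom–Boardman strata makes the singular set a smooth curve there (`IsSingularAt.exists_curve`).
A piece of it is a `SingularBranch`: its image in the plane has velocity `ρ E`, where `E` never
vanishes and `ρ` vanishes at cusps only. So the tangent line of the image, spanned by `E`, extends
continuously through a cusp; moreover a linear function of the plane increases strictly along the
image, even through a cusp. The type of a singular point is read off from the determinant of the
fold matrix, whose rows are the differentials of one component of `f` and of the minors of its
Jacobian matrix. The normal crossing condition, together with perpendicularity, leaves
finitely many distinguished points: cusps, with no other singular point over the same image, and
pairs of fold points whose images cross.

Signs. A chessboard function has adjacent values on the two sides of a branch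
(`SingularBranch.exists_sides`), which singles out the canonical direction of the image at all
points that are not distinguished. A half of a branch at a distinguished point has the sign `1` or
`-1` as its velocity agrees with the canonical direction or is opposite to it. The two halves at a
cusp have the same sign, because the two sides do not change on the way through it. At a crossing
the function takes four values in the four quadrants, and adding up its increments around the
crossing shows that the changes of sign along the two branches are opposite to each other
(`SingularBranch.exists_hasSigns_of_image_eq`). For values modulo two the integers `0` and `1` take
the place of the residues; only the increments along the branches matter (`IsPotential`).

Arcs. Parametrized by the arc length of their images, the arcs are the orbits of a flow in the
canonical direction: a connected component of the set of points that are not distinguished is the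
image of a maximal integral curve (`IsLocalFlow.image_eq`). Such a curve is periodic, or injective
with ends that converge to distinguished points along half-branches. This gives the existence of
parametrizations with continuous lifts of the angle (`IsEndSystem.exists_winding`) and the
independence of the winding number from all choices (`IsDirectedParam.winding_unique`).

The sum. Let `lineDirection v` be the square of the direction of `v` as a complex number. If `φ` is
the winding number of an arc, then `exp (4 π i φ)` is the quotient of the line directions at its
final and initial points. So the product of these numbers over all arcs is a product over the
distinguished points, in which each branch contributes its line direction with an exponent that
is the change of its sign. It equals one (`prod_lineDirection_eq_one`): the exponents are zero at
cusps, while at a crossing they are even and opposite to each other, and the line directions of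
perpendicular lines differ by the sign only. Therefore `2 ω(f)` is an integer.
-/

noncomputable section

/-! ### Iterated partial derivatives and jets -/

/-- The multi-index that counts the entries of a list of variables. -/
def multiIdxOfList {m k : ℕ} (l : List (Fin m)) (h : l.length ≤ k) : MultiIdx m k :=
  ⟨fun i => ⟨l.count i, Nat.lt_succ_of_le (le_trans List.count_le_length h)⟩, by
    have : ∑ i, l.count i = l.length := by
      have := Multiset.sum_count_eq_card (s := Finset.univ) (m := (l : Multiset (Fin m)))
        (by simp)
      simpa using this
    simpa [this] using h⟩

/-- The iterated partial derivative along a list of variables, the head of the list being the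
outermost derivative. -/
def iterPartial {m n : ℕ} (l : List (Fin m)) (g : Euc m → Euc n) : Euc m → Euc n :=
  l.foldr partialDeriv g

section iterPartial

variable {m n : ℕ} {U : Set (Euc m)} {g h : Euc m → Euc n}

lemma ContDiffOn.partialDeriv (hU : IsOpen U) (hg : ContDiffOn ℝ ∞ g U) (i : Fin m) :
    ContDiffOn ℝ ∞ (partialDeriv i g) U :=
  (hg.fderiv_of_isOpen hU (by norm_num)).clm_apply contDiffOn_const

lemma ContDiffOn.iterPartial (hU : IsOpen U) (hg : ContDiffOn ℝ ∞ g U) (l : List (Fin m)) :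
    ContDiffOn ℝ ∞ (iterPartial l g) U := by
  induction l with
  | nil => exact hg
  | cons i l ih => exact ih.partialDeriv hU i

lemma Set.EqOn.partialDeriv (hU : IsOpen U) (h₁ : EqOn g h U) (i : Fin m) :
    EqOn (partialDeriv i g) (partialDeriv i h) U := fun u hu => by
  have : g =ᶠ[𝓝 u] h := h₁.eventuallyEq_of_mem (hU.mem_nhds hu)
  simp only [_root_.partialDeriv, this.fderiv_eq]

lemma fderiv_partialDeriv (hU : IsOpen U) (hg : ContDiffOn ℝ ∞ g U) {u : Euc m} (hu : u ∈ U)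
    (i : Fin m) (v : Euc m) :
    fderiv ℝ (partialDeriv i g) u v
      = fderiv ℝ (fderiv ℝ g) u v (EuclideanSpace.single i 1) := by
  have h1 : DifferentiableAt ℝ (fderiv ℝ g) u :=
    ((hg.fderiv_of_isOpen hU (m := ∞) (by norm_num)).contDiffAt (hU.mem_nhds hu)).differentiableAt
      (by simp)
  have := (h1.hasFDerivAt.clm_apply (hasFDerivAt_const (EuclideanSpace.single i (1 : ℝ)) u)).fderiv
  change fderiv ℝ (fun y => (fderiv ℝ g y) (EuclideanSpace.single i 1)) u v = _
  rw [this]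
  simp

lemma partialDeriv_comm (hU : IsOpen U) (hg : ContDiffOn ℝ ∞ g U) (i j : Fin m) :
    EqOn (partialDeriv i (partialDeriv j g)) (partialDeriv j (partialDeriv i g)) U := by
  intro u hu
  have hs : IsSymmSndFDerivAt ℝ g u :=
    (hg.contDiffAt (hU.mem_nhds hu)).isSymmSndFDerivAt
      (by simpa using (WithTop.coe_le_coe.2 (le_top : (2 : ℕ∞) ≤ ⊤)))
  change fderiv ℝ (partialDeriv j g) u _ = fderiv ℝ (partialDeriv i g) u _
  rw [fderiv_partialDeriv hU hg hu, fderiv_partialDeriv hU hg hu]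
  exact hs.eq _ _

lemma iterPartial_perm (hU : IsOpen U) (hg : ContDiffOn ℝ ∞ g U) {l l' : List (Fin m)}
    (hl : l.Perm l') : EqOn (iterPartial l g) (iterPartial l' g) U := by
  induction hl with
  | nil => exact fun _ _ => rfl
  | cons i _ ih => exact ih.partialDeriv hU i
  | swap i j l => exact partialDeriv_comm hU (hg.iterPartial hU l) j i
  | trans _ _ ih₁ ih₂ => exact ih₁.trans ih₂

lemma foldr_iterate_partialDeriv (s : Fin m → ℕ) (L : List (Fin m)) (g : Euc m → Euc n) :
    L.foldr (fun i h => (partialDeriv i)^[s i] h) g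
      = iterPartial (L.flatMap fun i => List.replicate (s i) i) g := by
  induction L with
  | nil => rfl
  | cons i L ih =>
    have key : ∀ (k : ℕ) (q : Euc m → Euc n),
        (partialDeriv i)^[k] q = (List.replicate k i).foldr partialDeriv q := by
      intro k q
      induction k with
      | zero => rfl
      | succ k ih => rw [Function.iterate_succ_apply', ih]; rfl
    simp only [List.foldr_cons, ih, List.flatMap_cons, iterPartial, List.foldr_append]
    exact key _ _

lemma perm_flatMap_replicate_count (l : List (Fin m)) :
    ((List.finRange m).flatMap fun i => List.replicate (l.count i) i).Perm l := by
  rw [List.perm_iff_count]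
  intro a
  rw [List.count_flatMap]
  have : (List.count a ∘ fun i => List.replicate (l.count i) i)
      = fun i => if i = a then l.count i else 0 := by
    funext i
    simp [List.count_replicate]
  rw [this, ← List.ofFn_eq_map, List.sum_ofFn]
  simp

/-- An entry of the jet extension is an iterated partial derivative in any order of its indices. -/
lemma jetExt_multiIdxOfList (hU : IsOpen U) (hg : ContDiffOn ℝ ∞ g U) {u : Euc m} (hu : u ∈ U)
    {k : ℕ} (l : List (Fin m)) (h : l.length ≤ k) :
    jetExt k g u (multiIdxOfList l h) = iterPartial l g u := by
  change ((List.finRange m).foldr (fun i h => (partialDeriv i)^[l.count i] h) g) u = _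
  rw [foldr_iterate_partialDeriv]
  exact iterPartial_perm hU hg (perm_flatMap_replicate_count l) hu

lemma contDiffAt_jetExt (hU : IsOpen U) (hg : ContDiffOn ℝ ∞ g U) {u : Euc m} (hu : u ∈ U)
    (k : ℕ) : ContDiffAt ℝ ∞ (jetExt k g) u := by
  rw [contDiffAt_pi]
  intro s
  have : (fun x => jetExt k g x s) = iterPartial
      ((List.finRange m).flatMap fun i => List.replicate (s.1 i : ℕ) i) g := by
    funext x
    exact congrFun (foldr_iterate_partialDeriv (fun i => (s.1 i : ℕ)) _ g) x
  rw [this]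
  exact (hg.iterPartial hU _).contDiffAt (hU.mem_nhds hu)

end iterPartial

/-- The coefficients of iterated partial derivatives of a polynomial. Multiplying by the factorials
of the exponents clears the denominators of the falling factorials. -/
lemma factorial_mul_coeff_foldr_pderiv {m : ℕ} (l : List (Fin m)) (p : MvPolynomial (Fin m) ℝ)
    (t : Fin m →₀ ℕ) :
    (∏ i, ((t i).factorial : ℝ)) * (l.foldr (fun i q => MvPolynomial.pderiv i q) p).coeff t
      = (∏ i, ((t i + l.count i).factorial : ℝ)) *
        p.coeff (t + Finsupp.equivFunOnFinite.symm fun i => l.count i) := by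
  induction l generalizing t with
  | nil =>
    have : (Finsupp.equivFunOnFinite.symm fun _ : Fin m => 0) = 0 := by ext; simp
    simp [this]
  | cons a l ih =>
    rw [List.foldr_cons, MvPolynomial.coeff_pderiv]
    have h1 : (∏ i, (((t + Finsupp.single a 1 : Fin m →₀ ℕ) i).factorial : ℝ))
        = (∏ i, ((t i).factorial : ℝ)) * (t a + 1) := by
      rw [← Finset.mul_prod_erase _ _ (Finset.mem_univ a),
        ← Finset.mul_prod_erase _ (fun i => ((t i).factorial : ℝ)) (Finset.mem_univ a)]
      have : ∏ i ∈ Finset.univ.erase a, (((t + Finsupp.single a 1 : Fin m →₀ ℕ) i).factorial : ℝ)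
          = ∏ i ∈ Finset.univ.erase a, ((t i).factorial : ℝ) := by
        refine Finset.prod_congr rfl fun i hi => ?_
        have : i ≠ a := Finset.ne_of_mem_erase hi
        simp [this.symm]
      rw [this]
      simp [Nat.factorial_succ]
      ring
    have h2 := ih (t + Finsupp.single a 1)
    rw [h1] at h2
    have h3 : ∀ i : Fin m, (t + Finsupp.single a 1 : Fin m →₀ ℕ) i + l.count i
        = t i + (a :: l).count i := by
      intro i
      by_cases hi : a = i
      · subst hi; simp; ring
      · simp [hi]
    have h4 : t + Finsupp.single a 1 + (Finsupp.equivFunOnFinite.symm fun i => l.count i)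
        = t + Finsupp.equivFunOnFinite.symm fun i => (a :: l).count i := by
      ext i
      simpa using h3 i
    rw [h4] at h2
    simp only [h3] at h2
    rw [← h2]
    ring

/-- The derivatives at the origin of the Taylor polynomial of a jet are the entries of the jet. -/
lemma eval_foldr_pderiv_jetPoly {m n k : ℕ} (z : Jet m n k) (j : Fin n) (l : List (Fin m))
    (h : l.length ≤ k) (h0 : l ≠ []) :
    MvPolynomial.eval 0 (l.foldr (fun i q => MvPolynomial.pderiv i q) (jetPoly z j))
      = z (multiIdxOfList l h) j := by
  have e0 : ∀ q : MvPolynomial (Fin m) ℝ, MvPolynomial.eval 0 q = q.coeff 0 := fun q => by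
    rw [MvPolynomial.eval_zero]; rfl
  have h1 := factorial_mul_coeff_foldr_pderiv l (jetPoly z j) 0
  rw [e0]
  simp only [Finsupp.coe_zero, Pi.zero_apply, Nat.factorial_zero, Nat.cast_one,
    Finset.prod_const_one, one_mul, zero_add] at h1
  rw [h1, jetPoly, MvPolynomial.coeff_sum]
  rw [Finset.sum_eq_single (multiIdxOfList l h)]
  · have hs : ∑ i, ((multiIdxOfList l h).1 i : ℕ) ≠ 0 := by
      intro hs
      rw [Finset.sum_eq_zero_iff] at hs
      obtain ⟨a, ha⟩ := List.exists_mem_of_ne_nil l h0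
      have : l.count a = 0 := hs a (Finset.mem_univ a)
      exact (List.count_pos_iff.2 ha).ne' this
    rw [if_neg hs, MvPolynomial.coeff_monomial]
    simp only [multiIdxOfList, if_true]
    rw [mul_div_cancel₀]
    exact Finset.prod_ne_zero_iff.2 fun i _ => by positivity
  · intro s _ hs
    split_ifs with h2
    · simp
    · rw [MvPolynomial.coeff_monomial, if_neg]
      intro h3
      apply hs
      ext i
      exact DFunLike.congr_fun h3 i
  · simp

lemma eval_jetPoly {m n k : ℕ} (z : Jet m n k) (j : Fin n) :
    MvPolynomial.eval 0 (jetPoly z j) = 0 := by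
  rw [jetPoly, map_sum]
  refine Finset.sum_eq_zero fun s _ => ?_
  split_ifs with h
  · simp
  · rw [MvPolynomial.eval_monomial]
    have : ∃ i, (s.1 i : ℕ) ≠ 0 := by
      by_contra! h'
      exact h (Finset.sum_eq_zero fun i _ => h' i)
    obtain ⟨i, hi⟩ := this
    refine mul_eq_zero_of_right _ (Finset.prod_eq_zero (i := i) ?_ ?_)
    · rw [Finsupp.mem_support_iff]
      exact hi
    · exact zero_pow hi

end

noncomputable section

/-! ### Boardman symbols of ideals with two generators -/

/-- The cross product (oriented area) of two plane vectors. -/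
def cross (u v : Euc 2) : ℝ := u 0 * v 1 - u 1 * v 0

/-- For a map `F` to the plane with first derivatives `a j = ∂ⱼF` and second derivatives
`h l j = ∂ₗ∂ⱼF`, the Jacobian matrix of the map whose `i`-th component is `⟨e, F⟩` and whose `j`-th
component, `j ≠ i`, is the minor `∂ᵢF × ∂ⱼF`. -/
def foldMatrix {m : ℕ} (i : Fin m) (e : Euc 2) (a : Fin m → Euc 2) (h : Fin m → Fin m → Euc 2) :
    Matrix (Fin m) (Fin m) ℝ :=
  Matrix.of fun j l => if j = i then e 0 * a l 0 + e 1 * a l 1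
    else cross (h l i) (a j) + cross (a i) (h l j)

section Ideal

open MvPolynomial

variable {m : ℕ}

/-- The gradient of a polynomial at the origin. -/
def gradZero (g : MvPolynomial (Fin m) ℝ) : Fin m → ℝ := fun j => eval 0 (pderiv j g)

/-- The derivative of a polynomial at the origin in direction `v`. -/
def dirDeriv (v : Fin m → ℝ) (g : MvPolynomial (Fin m) ℝ) : ℝ := ∑ l, v l * eval 0 (pderiv l g)

lemma dirDeriv_add (v : Fin m → ℝ) (g h : MvPolynomial (Fin m) ℝ) :
    dirDeriv v (g + h) = dirDeriv v g + dirDeriv v h := by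
  simp [dirDeriv, mul_add, Finset.sum_add_distrib]

lemma dirDeriv_sub (v : Fin m → ℝ) (g h : MvPolynomial (Fin m) ℝ) :
    dirDeriv v (g - h) = dirDeriv v g - dirDeriv v h := by
  simp [dirDeriv, mul_sub, Finset.sum_sub_distrib]

lemma dirDeriv_mul (v : Fin m → ℝ) (g h : MvPolynomial (Fin m) ℝ) :
    dirDeriv v (g * h) = dirDeriv v g * eval 0 h + eval 0 g * dirDeriv v h := by
  simp only [dirDeriv, pderiv_mul, map_add, map_mul, Finset.sum_mul, Finset.mul_sum,
    ← Finset.sum_add_distrib]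
  exact Finset.sum_congr rfl fun l _ => by ring

lemma card_le_idealRank {ι : Type*} [Fintype ι] {J : Ideal (MvPolynomial (Fin m) ℝ)}
    {g : ι → MvPolynomial (Fin m) ℝ} (hg : ∀ r, g r ∈ J)
    (hl : LinearIndependent ℝ fun r => gradZero (g r)) : Fintype.card ι ≤ idealRank J := by
  rw [← finrank_span_eq_card hl]
  refine Submodule.finrank_mono (Submodule.span_mono ?_)
  rintro _ ⟨r, rfl⟩
  exact ⟨g r, hg r, rfl⟩

lemma idealRank_le {J : Ideal (MvPolynomial (Fin m) ℝ)} {W : Submodule ℝ (Fin m → ℝ)}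
    (hJ : ∀ g ∈ J, gradZero g ∈ W) : idealRank J ≤ Module.finrank ℝ W := by
  refine Submodule.finrank_mono (Submodule.span_le.2 ?_)
  rintro _ ⟨g, hg, rfl⟩
  exact hJ g hg

lemma idealRank_le_card (J : Ideal (MvPolynomial (Fin m) ℝ)) : idealRank J ≤ m := by
  simpa using (idealRank_le (J := J) (W := ⊤) (by simp))

lemma idealRank_mono {J J' : Ideal (MvPolynomial (Fin m) ℝ)} (h : J ≤ J') :
    idealRank J ≤ idealRank J' := by
  refine Submodule.finrank_mono (Submodule.span_mono ?_)
  rintro _ ⟨g, hg, rfl⟩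
  exact ⟨g, h hg, rfl⟩

/-- The ideal of the polynomials that vanish at the origin and have gradient there in `W`. -/
def gradIdeal (W : Submodule ℝ (Fin m → ℝ)) : Ideal (MvPolynomial (Fin m) ℝ) where
  carrier := {g | eval 0 g = 0 ∧ gradZero g ∈ W}
  zero_mem' := ⟨by simp, by
    have : gradZero (0 : MvPolynomial (Fin m) ℝ) = 0 := by ext; simp [gradZero]
    simp [this]⟩
  add_mem' := by
    rintro g h ⟨hg, hg'⟩ ⟨hh, hh'⟩
    refine ⟨by rw [map_add, hg, hh, add_zero], ?_⟩
    have : gradZero (g + h) = gradZero g + gradZero h := by ext; simp [gradZero]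
    rw [this]
    exact W.add_mem hg' hh'
  smul_mem' := by
    rintro q g ⟨hg, hg'⟩
    refine ⟨by rw [smul_eq_mul, map_mul, hg, mul_zero], ?_⟩
    have : gradZero (q • g) = (eval 0 q) • gradZero g := by
      ext j
      simp [gradZero, hg, -eval_zero]
    rw [this]
    exact W.smul_mem _ hg'

lemma det_mem_criticalExtension {J : Ideal (MvPolynomial (Fin m) ℝ)} {r : ℕ}
    (hr : idealRank J = r) (g : Fin (r + 1) → MvPolynomial (Fin m) ℝ) (c : Fin (r + 1) → Fin m)
    (hg : ∀ i, g i ∈ J) :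
    Matrix.det (Matrix.of fun i j => pderiv (c j) (g i)) ∈ criticalExtension J := by
  subst hr
  exact Ideal.mem_sup_right (Ideal.subset_span ⟨g, c, hg, rfl⟩)

lemma le_criticalExtension (J : Ideal (MvPolynomial (Fin m) ℝ)) : J ≤ criticalExtension J :=
  le_sup_left

lemma jacobian_mem_criticalExtension {J : Ideal (MvPolynomial (Fin m) ℝ)}
    (hr : idealRank J + 1 = m) (g : Fin m → MvPolynomial (Fin m) ℝ) (hg : ∀ i, g i ∈ J) :
    Matrix.det (Matrix.of fun i j => pderiv j (g i)) ∈ criticalExtension J := by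
  obtain ⟨r, hr'⟩ : ∃ r, idealRank J = r := ⟨_, rfl⟩
  rw [hr'] at hr
  subst hr
  exact det_mem_criticalExtension hr' g id hg

lemma criticalExtension_le {J K : Ideal (MvPolynomial (Fin m) ℝ)} (hr : idealRank J = 1)
    (hJ : J ≤ K) (hK : ∀ g₀ ∈ J, ∀ g₁ ∈ J, ∀ j l,
      pderiv j g₀ * pderiv l g₁ - pderiv l g₀ * pderiv j g₁ ∈ K) : criticalExtension J ≤ K := by
  refine sup_le hJ (Ideal.span_le.2 ?_)
  rintro _ ⟨g, c, hg, rfl⟩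
  revert g c
  rw [hr]
  intro g c hg
  rw [Matrix.det_fin_two]
  exact hK _ (hg 0) _ (hg 1) _ _

lemma minor_mem_criticalExtension {J : Ideal (MvPolynomial (Fin m) ℝ)} (hr : idealRank J = 1)
    {g₀ g₁ : MvPolynomial (Fin m) ℝ} (h₀ : g₀ ∈ J) (h₁ : g₁ ∈ J) (j l : Fin m) :
    pderiv j g₀ * pderiv l g₁ - pderiv l g₀ * pderiv j g₁ ∈ criticalExtension J := by
  have := det_mem_criticalExtension hr ![g₀, g₁] ![j, l] (by
    intro i; fin_cases i <;> simpa)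
  rw [Matrix.det_fin_two] at this
  simpa using this

lemma idealRank_criticalExtension_eq_of_dirDeriv_ne_zero {J : Ideal (MvPolynomial (Fin m) ℝ)}
    (hr : idealRank J + 1 = m) {v : Fin m → ℝ} (hv : ∀ g ∈ J, dirDeriv v g = 0)
    {d : MvPolynomial (Fin m) ℝ} (hd : d ∈ criticalExtension J) (hdv : dirDeriv v d ≠ 0) :
    idealRank (criticalExtension J) = m := by
  refine le_antisymm (idealRank_le_card _) ?_
  have : idealRank J < idealRank (criticalExtension J) := by
    refine Submodule.finrank_lt_finrank_of_lt (lt_of_le_of_ne (Submodule.span_mono ?_) ?_)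
    · rintro _ ⟨g, hg, rfl⟩
      exact ⟨g, le_criticalExtension J hg, rfl⟩
    · intro h
      have h1 : gradZero d ∈ Submodule.span ℝ {v : Fin m → ℝ |
          ∃ g ∈ J, v = fun j => MvPolynomial.eval 0 (MvPolynomial.pderiv j g)} := by
        rw [h]
        exact Submodule.subset_span ⟨d, hd, rfl⟩
      have h2 : Submodule.span ℝ {v : Fin m → ℝ |
          ∃ g ∈ J, v = fun j => MvPolynomial.eval 0 (MvPolynomial.pderiv j g)}
          ≤ LinearMap.ker (dotProductBilin ℝ ℝ v) := by
        rw [Submodule.span_le]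
        rintro _ ⟨g, hg, rfl⟩
        exact hv g hg
      exact hdv (h2 h1)
  omega

lemma hasBoardmanSymbol_replicate {J : Ideal (MvPolynomial (Fin m) ℝ)} (hJ : idealRank J = m)
    (n : ℕ) : HasBoardmanSymbol J (List.replicate n 0) := by
  induction n generalizing J with
  | zero => trivial
  | succ n ih =>
    exact ⟨by simpa using hJ, ih (le_antisymm (idealRank_le_card _)
      (hJ.symm.le.trans (idealRank_mono (le_criticalExtension J))))⟩

lemma HasBoardmanSymbol.eq_replicate {J : Ideal (MvPolynomial (Fin m) ℝ)} (hJ : idealRank J = m)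
    {I : List ℕ} (hI : HasBoardmanSymbol J I) : I = List.replicate I.length 0 := by
  induction I generalizing J with
  | nil => rfl
  | cons i I ih =>
    obtain ⟨h1, h2⟩ := hI
    have : i = 0 := by omega
    subst this
    rw [List.length_cons, List.replicate_succ, ← ih (le_antisymm (idealRank_le_card _)
      (hJ.symm.le.trans (idealRank_mono (le_criticalExtension J)))) h2]

/-! ### Ideals with two generators -/

variable {p : Fin 2 → MvPolynomial (Fin m) ℝ} {a : Fin m → Euc 2} {h : Fin m → Fin m → Euc 2}
  {i : Fin m}

lemma eq_smul_of_cross_eq_zero {e w : Euc 2} (he : e ≠ 0) (hw : cross e w = 0) :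
    w = ((e 0 * w 0 + e 1 * w 1) / (e 0 ^ 2 + e 1 ^ 2)) • e := by
  have : e 0 ^ 2 + e 1 ^ 2 ≠ 0 := by
    intro h0
    apply he
    ext k
    fin_cases k
    · simp; nlinarith [sq_nonneg (e 0), sq_nonneg (e 1)]
    · simp; nlinarith [sq_nonneg (e 0), sq_nonneg (e 1)]
  unfold cross at hw
  ext k
  fin_cases k
  · simp; field_simp; linear_combination (-e 1) * hw
  · simp; field_simp; linear_combination (e 0) * hw

lemma idealRank_eq_zero (hp : ∀ k, eval 0 (p k) = 0) (ha : ∀ j k, eval 0 (pderiv j (p k)) = 0) :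
    idealRank (Ideal.span (range p)) = 0 := by
  have h1 : Ideal.span (range p) ≤ gradIdeal ⊥ := by
    rw [Ideal.span_le]
    rintro _ ⟨k, rfl⟩
    exact ⟨hp k, by ext j; exact ha j k⟩
  simpa using idealRank_le (fun g hg => (h1 hg).2)

lemma idealRank_eq_one (hp : ∀ k, eval 0 (p k) = 0) (ha : ∀ j k, eval 0 (pderiv j (p k)) = a j k)
    (hi : a i ≠ 0) (hc : ∀ j, cross (a i) (a j) = 0) : idealRank (Ideal.span (range p)) = 1 := by
  choose α hα using fun j => (⟨_, eq_smul_of_cross_eq_zero hi (hc j)⟩ : ∃ t : ℝ, a j = t • a i)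
  have h0 : ∀ k, gradZero (p k) = (a i k) • α := by
    intro k
    ext j
    simp only [gradZero, ha]
    rw [hα j]
    simp [mul_comm]
  refine le_antisymm ?_ ?_
  · have h1 : Ideal.span (range p) ≤ gradIdeal (Submodule.span ℝ {α}) := by
      rw [Ideal.span_le]
      rintro _ ⟨k, rfl⟩
      refine ⟨hp k, ?_⟩
      rw [h0]
      exact Submodule.smul_mem _ _ (Submodule.mem_span_singleton_self _)
    exact (idealRank_le (fun g hg => (h1 hg).2)).trans (by
      simpa using finrank_span_le_card (R := ℝ) ({α} : Set (Fin m → ℝ)))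
  · obtain ⟨k, hk⟩ : ∃ k, a i k ≠ 0 := by
      by_contra! h'
      exact hi (by ext k; simpa using h' k)
    have := card_le_idealRank (ι := Unit) (J := Ideal.span (range p)) (g := fun _ => p k)
      (fun _ => Ideal.subset_span ⟨k, rfl⟩) (by
        rw [linearIndependent_unique_iff]
        intro h1
        have := congrFun h1 i
        simp [gradZero, ha, -eval_zero] at this
        exact hk this)
    simpa using this

lemma two_le_idealRank (ha : ∀ j k, eval 0 (pderiv j (p k)) = a j k) {j l : Fin m}
    (hc : cross (a j) (a l) ≠ 0) : 2 ≤ idealRank (Ideal.span (range p)) := by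
  have := card_le_idealRank (ι := Fin 2) (J := Ideal.span (range p)) (g := p)
    (fun k => Ideal.subset_span ⟨k, rfl⟩) (by
      rw [Fintype.linearIndependent_iff]
      intro t ht
      have hj := congrFun ht j
      have hl := congrFun ht l
      simp [gradZero, ha, -eval_zero] at hj hl
      unfold cross at hc
      have h0 : t 0 = 0 := by
        have : t 0 * (a j 0 * a l 1 - a j 1 * a l 0) = 0 := by
          linear_combination (a l 1) * hj - (a j 1) * hl
        exact (mul_eq_zero.1 this).resolve_right hc
      have h1 : t 1 = 0 := by
        have : t 1 * (a j 0 * a l 1 - a j 1 * a l 0) = 0 := by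
          linear_combination (-a l 0) * hj + (a j 0) * hl
        exact (mul_eq_zero.1 this).resolve_right hc
      intro k
      fin_cases k
      · exact h0
      · exact h1)
  simpa using this

/-- The elements of the critical extension whose Jacobian matrix is the fold matrix. -/
def foldPoly (p : Fin 2 → MvPolynomial (Fin m) ℝ) (i : Fin m) (e : Euc 2) (j : Fin m) :
    MvPolynomial (Fin m) ℝ :=
  if j = i then C (e 0) * p 0 + C (e 1) * p 1
  else pderiv i (p 0) * pderiv j (p 1) - pderiv j (p 0) * pderiv i (p 1)

lemma gradZero_foldPoly (e : Euc 2) (ha : ∀ j k, eval 0 (pderiv j (p k)) = a j k)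
    (hh : ∀ l j k, eval 0 (pderiv l (pderiv j (p k))) = h l j k) (j : Fin m) :
    gradZero (foldPoly p i e j) = foldMatrix i e a h j := by
  ext l
  by_cases hj : j = i
  · simp [gradZero, foldPoly, foldMatrix, hj, ha, -eval_zero]
  · simp only [gradZero, foldPoly, foldMatrix, hj, if_false, map_sub, pderiv_mul, map_add, map_mul,
      ha, hh, Matrix.of_apply, cross]
    ring

lemma foldPoly_mem (hr : idealRank (Ideal.span (range p)) = 1) (e : Euc 2) (j : Fin m) :
    foldPoly p i e j ∈ criticalExtension (Ideal.span (range p)) := by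
  have hp : ∀ k, p k ∈ Ideal.span (range p) := fun k => Ideal.subset_span ⟨k, rfl⟩
  unfold foldPoly
  split_ifs with hj
  · exact le_criticalExtension _ (Ideal.add_mem _ (Ideal.mul_mem_left _ _ (hp 0))
      (Ideal.mul_mem_left _ _ (hp 1)))
  · exact minor_mem_criticalExtension hr (hp 0) (hp 1) i j

lemma idealRank_criticalExtension_of_det_ne_zero (e : Euc 2)
    (ha : ∀ j k, eval 0 (pderiv j (p k)) = a j k)
    (hh : ∀ l j k, eval 0 (pderiv l (pderiv j (p k))) = h l j k)
    (hr : idealRank (Ideal.span (range p)) = 1) (hN : (foldMatrix i e a h).det ≠ 0) :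
    idealRank (criticalExtension (Ideal.span (range p))) = m := by
  refine le_antisymm (idealRank_le_card _) ?_
  have := card_le_idealRank (g := foldPoly p i e) (foldPoly_mem hr e) (by
    simp only [gradZero_foldPoly e ha hh]
    exact Matrix.linearIndependent_rows_of_det_ne_zero hN)
  simpa using this

lemma le_idealRank_criticalExtension (e : Euc 2)
    (ha : ∀ j k, eval 0 (pderiv j (p k)) = a j k)
    (hh : ∀ l j k, eval 0 (pderiv l (pderiv j (p k))) = h l j k)
    (hr : idealRank (Ideal.span (range p)) = 1)
    (hN : LinearIndependent ℝ fun j : {j // j ≠ i} => foldMatrix i e a h j) :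
    m ≤ idealRank (criticalExtension (Ideal.span (range p))) + 1 := by
  have := card_le_idealRank (g := fun j : {j // j ≠ i} => foldPoly p i e j)
    (fun j => foldPoly_mem hr e j) (by
    simpa only [gradZero_foldPoly e ha hh] using hN)
  rw [Fintype.card_subtype_compl] at this
  simp at this
  omega

/-- If the fold matrix kills `v`, then so do the differentials of all elements of the critical
extension. -/
lemma dirDeriv_eq_zero_of_mem_criticalExtension (hp : ∀ k, eval 0 (p k) = 0)
    (ha : ∀ j k, eval 0 (pderiv j (p k)) = a j k)
    (hh : ∀ l j k, eval 0 (pderiv l (pderiv j (p k))) = h l j k)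
    (hi : a i ≠ 0) (hc : ∀ j, cross (a i) (a j) = 0) {v : Fin m → ℝ}
    (hv : ∑ l, v l • a l = 0)
    (hv' : ∀ j, cross (∑ l, v l • h l i) (a j) + cross (a i) (∑ l, v l • h l j) = 0)
    {g : MvPolynomial (Fin m) ℝ} (hg : g ∈ criticalExtension (Ideal.span (range p))) :
    dirDeriv v g = 0 := by
  -- All first derivatives are multiples of `a i`. The hypotheses determine the rate of change of
  -- these multiples in direction `v`, up to a common factor.
  choose α hα using fun j => (⟨_, eq_smul_of_cross_eq_zero hi (hc j)⟩ : ∃ t : ℝ, a j = t • a i)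
  set H : Fin m → Euc 2 := fun j => ∑ l, v l • h l j with hH
  have hτ : ∀ j, ∃ t : ℝ, H j = α j • H i + t • a i := by
    intro j
    have h1 : cross (a i) (H j - α j • H i) = 0 := by
      have := hv' j
      rw [hα j] at this
      simp only [cross, PiLp.smul_apply, PiLp.sub_apply, smul_eq_mul, hH] at this ⊢
      linear_combination this
    obtain ⟨t, ht⟩ : ∃ t : ℝ, H j - α j • H i = t • a i := ⟨_, eq_smul_of_cross_eq_zero hi h1⟩
    exact ⟨t, by rw [← ht]; abel⟩
  choose τ hτ using hτ
  -- The ideal of polynomials with such data at the origin; it contains the components `p`.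
  let K : Ideal (MvPolynomial (Fin m) ℝ) :=
    { carrier := {g | eval 0 g = 0 ∧ dirDeriv v g = 0 ∧ ∃ A s : ℝ, ∀ j,
        eval 0 (pderiv j g) = A * α j ∧ dirDeriv v (pderiv j g) = s * α j + A * τ j}
      zero_mem' := ⟨by simp, by simp [dirDeriv], 0, 0, by simp [dirDeriv]⟩
      add_mem' := by
        rintro g g' ⟨h1, h2, A, s, h3⟩ ⟨h1', h2', A', s', h3'⟩
        refine ⟨by rw [map_add, h1, h1', add_zero], by rw [dirDeriv_add, h2, h2', add_zero],
          A + A', s + s', fun j => ⟨?_, ?_⟩⟩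
        · rw [map_add, map_add, (h3 j).1, (h3' j).1]; ring
        · rw [map_add, dirDeriv_add, (h3 j).2, (h3' j).2]; ring
      smul_mem' := by
        rintro q g ⟨h1, h2, A, s, h3⟩
        refine ⟨by rw [smul_eq_mul, map_mul, h1, mul_zero],
          by rw [smul_eq_mul, dirDeriv_mul, h1, h2]; ring, eval 0 q * A,
          eval 0 q * s + dirDeriv v q * A, fun j => ⟨?_, ?_⟩⟩
        · rw [smul_eq_mul, pderiv_mul, map_add, map_mul, map_mul, (h3 j).1, h1]; ring
        · rw [smul_eq_mul, pderiv_mul, dirDeriv_add, dirDeriv_mul, dirDeriv_mul, h1, h2, (h3 j).1,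
            (h3 j).2]
          ring }
  have hJK : Ideal.span (range p) ≤ K := by
    rw [Ideal.span_le]
    rintro _ ⟨k, rfl⟩
    refine ⟨hp k, ?_, a i k, H i k, fun j => ⟨?_, ?_⟩⟩
    · have := congrArg (fun w : Euc 2 => w k) hv
      simpa [dirDeriv, ha, -eval_zero] using this
    · rw [ha, hα j]; simp [mul_comm]
    · have := congrArg (fun w : Euc 2 => w k) (hτ j)
      simp only [dirDeriv, hh]
      simp only [hH] at this ⊢
      simp at this ⊢
      rw [this]
      ring
  have hr := idealRank_eq_one hp ha hi hc
  -- By these data the derivative of each minor in direction `v` cancels.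
  let L : Ideal (MvPolynomial (Fin m) ℝ) := gradIdeal (LinearMap.ker (dotProductBilin ℝ ℝ v))
  have hL : criticalExtension (Ideal.span (range p)) ≤ L := by
    refine criticalExtension_le hr (fun g hg => ⟨(hJK hg).1, (hJK hg).2.1⟩) ?_
    intro g₀ h₀ g₁ h₁ j l
    obtain ⟨-, -, A, s, h3⟩ := hJK h₀
    obtain ⟨-, -, A', s', h3'⟩ := hJK h₁
    refine ⟨?_, ?_⟩
    · rw [map_sub, map_mul, map_mul, (h3 j).1, (h3 l).1, (h3' j).1, (h3' l).1]; ring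
    · change dirDeriv v _ = 0
      rw [dirDeriv_sub, dirDeriv_mul, dirDeriv_mul, (h3 j).1, (h3 l).1, (h3' j).1, (h3' l).1,
        (h3 j).2, (h3 l).2, (h3' j).2, (h3' l).2]
      ring
  exact (hL hg).2

lemma idealRank_lt_of_dirDeriv_eq_zero {J : Ideal (MvPolynomial (Fin m) ℝ)} {v : Fin m → ℝ}
    (hv0 : v ≠ 0) (hv : ∀ g ∈ J, dirDeriv v g = 0) : idealRank J < m := by
  have h1 := idealRank_le (J := J) (W := LinearMap.ker (dotProductBilin ℝ ℝ v)) hv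
  have h2 : Module.finrank ℝ (LinearMap.ker (dotProductBilin ℝ ℝ v)) < m := by
    have := Submodule.finrank_lt (s := LinearMap.ker (dotProductBilin ℝ ℝ v)) (by
      rw [Ne, LinearMap.ker_eq_top]
      intro h0
      apply hv0
      have := LinearMap.congr_fun h0 v
      exact dotProduct_self_eq_zero.1 this)
    simpa using this
  omega

end Ideal

end

noncomputable section

/-! ### The fold matrix of a smooth map to the plane -/

lemma contDiff_det {m : ℕ} :
    ContDiff ℝ ∞ fun A : Fin m → Fin m → ℝ => (Matrix.of A).det := by
  simp only [Matrix.det_apply, Matrix.of_apply]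
  refine ContDiff.sum fun σ _ => ContDiff.const_smul _ (contDiff_prod fun j _ => ?_)
  exact contDiff_apply_apply ℝ ℝ _ _

lemma ContDiffAt.cross {E : Type*} [NormedAddCommGroup E] [NormedSpace ℝ E] {n : WithTop ℕ∞}
    {u v : E → Euc 2} {x : E} (hu : ContDiffAt ℝ n u x) (hv : ContDiffAt ℝ n v x) :
    ContDiffAt ℝ n (fun y => cross (u y) (v y)) x := by
  have h1 := contDiffAt_euclidean.1 hu
  have h2 := contDiffAt_euclidean.1 hv
  exact ((h1 0).mul (h2 1)).sub ((h1 1).mul (h2 0))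

lemma HasDerivAt.euc_apply {n : ℕ} {u : ℝ → Euc n} {u' : Euc n} {t : ℝ} (hu : HasDerivAt u u' t)
    (k : Fin n) : HasDerivAt (fun s => u s k) (u' k) t :=
  ((EuclideanSpace.proj k : Euc n →L[ℝ] ℝ).hasFDerivAt.comp_hasDerivAt t hu)

lemma HasDerivAt.cross {u v : ℝ → Euc 2} {u' v' : Euc 2} {t : ℝ} (hu : HasDerivAt u u' t)
    (hv : HasDerivAt v v' t) :
    HasDerivAt (fun s => cross (u s) (v s)) (cross u' (v t) + cross (u t) v') t := by
  have := ((hu.euc_apply 0).mul (hv.euc_apply 1)).sub ((hu.euc_apply 1).mul (hv.euc_apply 0))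
  refine this.congr_deriv ?_
  simp only [_root_.cross]
  ring

lemma fderiv_eq_sum_partialDeriv {m n : ℕ} (g : Euc m → Euc n) (u v : Euc m) :
    fderiv ℝ g u v = ∑ j, v j • partialDeriv j g u := by
  have : v = ∑ j, v j • EuclideanSpace.single j (1 : ℝ) := by
    ext k
    simp [Pi.single_apply]
  conv_lhs => rw [this]
  simp [partialDeriv]

/-- The fold matrix of a map at a point. -/
def foldMatrixAt {m : ℕ} (g : Euc m → Euc 2) (i : Fin m) (e : Euc 2) (u : Euc m) :
    Matrix (Fin m) (Fin m) ℝ :=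
  foldMatrix i e (fun j => partialDeriv j g u) fun l j => partialDeriv l (partialDeriv j g) u

section

variable {m : ℕ} {U : Set (Euc m)} {g : Euc m → Euc 2} {u : Euc m} {i : Fin m}

lemma foldMatrix_mulVec_self (e : Euc 2) (a : Fin m → Euc 2) (h : Fin m → Fin m → Euc 2)
    (v : Fin m → ℝ) : (foldMatrix i e a h).mulVec v i
      = e 0 * (∑ l, v l • a l) 0 + e 1 * (∑ l, v l • a l) 1 := by
  simp only [Matrix.mulVec, dotProduct, foldMatrix, Matrix.of_apply, if_true,
    WithLp.ofLp_sum, Finset.sum_apply, PiLp.smul_apply, smul_eq_mul, Finset.mul_sum,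
    ← Finset.sum_add_distrib]
  exact Finset.sum_congr rfl fun l _ => by ring

lemma foldMatrix_mulVec_of_ne (e : Euc 2) (a : Fin m → Euc 2) (h : Fin m → Fin m → Euc 2)
    (v : Fin m → ℝ) {j : Fin m} (hj : j ≠ i) : (foldMatrix i e a h).mulVec v j
      = cross (∑ l, v l • h l i) (a j) + cross (a i) (∑ l, v l • h l j) := by
  simp only [Matrix.mulVec, dotProduct, foldMatrix, Matrix.of_apply, hj, if_false, cross,
    WithLp.ofLp_sum, Finset.sum_apply, PiLp.smul_apply, smul_eq_mul, Finset.mul_sum,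
    Finset.sum_mul, ← Finset.sum_add_distrib, ← Finset.sum_sub_distrib]
  exact Finset.sum_congr rfl fun l _ => by ring

/-- The minor `∂ᵢg × ∂ⱼg` of the Jacobian matrix. -/
def minor (g : Euc m → Euc 2) (i j : Fin m) (u : Euc m) : ℝ :=
  cross (partialDeriv i g u) (partialDeriv j g u)

lemma surjective_iff_minor (hi : partialDeriv i g u ≠ 0) :
    ¬ Function.Surjective (fderiv ℝ g u) ↔ ∀ j, minor g i j u = 0 := by
  constructor
  · intro hs j
    by_contra hj
    apply hs
    intro w
    unfold minor cross at hj
    set A := partialDeriv i g u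
    set B := partialDeriv j g u
    refine ⟨((w 0 * B 1 - w 1 * B 0) / (A 0 * B 1 - A 1 * B 0)) • EuclideanSpace.single i 1 +
      ((A 0 * w 1 - A 1 * w 0) / (A 0 * B 1 - A 1 * B 0)) • EuclideanSpace.single j 1, ?_⟩
    rw [map_add, map_smul, map_smul]
    change _ • A + _ • B = w
    ext k
    fin_cases k
    · simp only [Fin.zero_eta, PiLp.add_apply, PiLp.smul_apply, smul_eq_mul]
      rw [div_mul_eq_mul_div, div_mul_eq_mul_div, ← add_div, div_eq_iff hj]
      ring
    · simp only [Fin.mk_one, PiLp.add_apply, PiLp.smul_apply, smul_eq_mul]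
      rw [div_mul_eq_mul_div, div_mul_eq_mul_div, ← add_div, div_eq_iff hj]
      ring
  · intro h hs
    obtain ⟨w, hw⟩ := hs !₂[-partialDeriv i g u 1, partialDeriv i g u 0]
    have h1 : cross (partialDeriv i g u) (fderiv ℝ g u w) = 0 := by
      rw [fderiv_eq_sum_partialDeriv]
      simp only [cross, WithLp.ofLp_sum, Finset.sum_apply, PiLp.smul_apply, smul_eq_mul,
        Finset.mul_sum, ← Finset.sum_sub_distrib]
      refine Finset.sum_eq_zero fun j _ => ?_
      have := h j
      unfold minor cross at this
      linear_combination (w j) * this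
    rw [hw] at h1
    simp [cross] at h1
    apply hi
    ext k
    fin_cases k
    · simp; nlinarith [sq_nonneg (partialDeriv i g u 0), sq_nonneg (partialDeriv i g u 1)]
    · simp; nlinarith [sq_nonneg (partialDeriv i g u 0), sq_nonneg (partialDeriv i g u 1)]

lemma contDiffAt_minor (hU : IsOpen U) (hg : ContDiffOn ℝ ∞ g U) (hu : u ∈ U) (j : Fin m) :
    ContDiffAt ℝ ∞ (minor g i j) u :=
  ((hg.partialDeriv hU i).contDiffAt (hU.mem_nhds hu)).cross
    ((hg.partialDeriv hU j).contDiffAt (hU.mem_nhds hu))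

lemma hasDerivAt_comp_partial (hU : IsOpen U) (hg : ContDiffOn ℝ ∞ g U) {x : ℝ → Euc m}
    {x' : Euc m} {t : ℝ} (hx : HasDerivAt x x' t) (hu : x t ∈ U) (l : List (Fin m)) :
    HasDerivAt (fun s => iterPartial l g (x s))
      (∑ k, x' k • iterPartial (k :: l) g (x t)) t := by
  have h1 := (((hg.iterPartial hU l).contDiffAt (hU.mem_nhds hu)).differentiableAt
    (by simp)).hasFDerivAt
  have h2 := h1.comp_hasDerivAt t hx
  rw [fderiv_eq_sum_partialDeriv] at h2
  exact h2

lemma hasDerivAt_minor (hU : IsOpen U) (hg : ContDiffOn ℝ ∞ g U) {x : ℝ → Euc m}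
    {x' : Euc m} {t : ℝ} (hx : HasDerivAt x x' t) (hu : x t ∈ U) (e : Euc 2) {j : Fin m}
    (hj : j ≠ i) :
    HasDerivAt (fun s => minor g i j (x s)) ((foldMatrixAt g i e (x t)).mulVec x' j) t := by
  have := (hasDerivAt_comp_partial hU hg hx hu [i]).cross
    (hasDerivAt_comp_partial hU hg hx hu [j])
  rw [foldMatrixAt, foldMatrix_mulVec_of_ne _ _ _ _ hj]
  exact this

/-- The derivatives of the entries of the fold matrix along a curve are given by the derivatives
of the map up to third order. -/
lemma hasDerivAt_foldMatrixAt (hU : IsOpen U) (hg : ContDiffOn ℝ ∞ g U) {x : ℝ → Euc m}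
    {x' : Euc m} {t : ℝ} (hx : HasDerivAt x x' t) (hu : x t ∈ U) (e : Euc 2) (j l : Fin m) :
    HasDerivAt (fun s => foldMatrixAt g i e (x s) j l)
      (if j = i then e 0 * (∑ k, x' k • iterPartial [k, l] g (x t)) 0
          + e 1 * (∑ k, x' k • iterPartial [k, l] g (x t)) 1
        else (cross (∑ k, x' k • iterPartial [k, l, i] g (x t)) (iterPartial [j] g (x t))
          + cross (iterPartial [l, i] g (x t)) (∑ k, x' k • iterPartial [k, j] g (x t)))
          + (cross (∑ k, x' k • iterPartial [k, i] g (x t)) (iterPartial [l, j] g (x t))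
          + cross (iterPartial [i] g (x t)) (∑ k, x' k • iterPartial [k, l, j] g (x t)))) t := by
  have key := fun L => hasDerivAt_comp_partial hU hg hx hu L
  split_ifs with hj
  · subst hj
    have := (((key [l]).euc_apply 0).const_mul (e 0)).add (((key [l]).euc_apply 1).const_mul (e 1))
    refine this.congr_of_eventuallyEq (Eventually.of_forall fun s => ?_)
    simp [foldMatrixAt, foldMatrix, iterPartial]
  · have := ((key [l, i]).cross (key [j])).add ((key [i]).cross (key [l, j]))
    refine this.congr_of_eventuallyEq (Eventually.of_forall fun s => ?_)
    simp [foldMatrixAt, foldMatrix, iterPartial, hj]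

lemma contDiffAt_foldMatrixAt (hU : IsOpen U) (hg : ContDiffOn ℝ ∞ g U) (hu : u ∈ U) (e : Euc 2) :
    ContDiffAt ℝ ∞ (fun y j l => foldMatrixAt g i e y j l) u := by
  have key := fun L => (hg.iterPartial hU L).contDiffAt (hU.mem_nhds hu)
  rw [contDiffAt_pi]
  intro j
  rw [contDiffAt_pi]
  intro l
  by_cases hj : j = i
  · subst hj
    have := ((contDiffAt_const (c := e 0)).mul ((contDiffAt_euclidean.1 (key [l])) 0)).add
      ((contDiffAt_const (c := e 1)).mul ((contDiffAt_euclidean.1 (key [l])) 1))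
    refine this.congr_of_eventuallyEq (Eventually.of_forall fun s => ?_)
    simp [foldMatrixAt, foldMatrix, iterPartial]
  · have := ((key [l, i]).cross (key [j])).add ((key [i]).cross (key [l, j]))
    refine this.congr_of_eventuallyEq (Eventually.of_forall fun s => ?_)
    simp [foldMatrixAt, foldMatrix, iterPartial, hj]

end

/-! ### Transversality to the Boardman strata -/

/-- Transversality of `j` to `S` allows to realize every derivative of a map that vanishes on `S`
by a derivative of its composition with `j`. -/
lemma exists_hasDerivAt_comp {E J W : Type*} [NormedAddCommGroup E] [NormedSpace ℝ E]
    [NormedAddCommGroup J] [NormedSpace ℝ J] [NormedAddCommGroup W] [NormedSpace ℝ W]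
    {j : E → J} {u : E} {S : Set J} (hj : DifferentiableAt ℝ j u)
    (htr : LinearMap.range (fderiv ℝ j u : E →ₗ[ℝ] J) ⊔ tangentSpan S (j u) = ⊤)
    {Φ : J → W} (hΦ : DifferentiableAt ℝ Φ (j u)) (hS : ∀ z ∈ S, Φ z = 0) {δ : J} {w : W}
    (hw : HasDerivAt (fun s : ℝ => Φ (j u + s • δ)) w 0) :
    ∃ y : E, HasDerivAt (fun s : ℝ => Φ (j (u + s • y))) w 0 := by
  have hT : tangentSpan S (j u) ≤ LinearMap.ker (fderiv ℝ Φ (j u) : J →ₗ[ℝ] W) := by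
    refine Submodule.span_le.2 ?_
    rintro v ⟨c, hc, hc0, hcS, rfl⟩
    have h1 : HasDerivAt c (deriv c 0) 0 := (hc.differentiableAt (by simp)).hasDerivAt
    have h2 : HasFDerivAt Φ (fderiv ℝ Φ (j u)) (c 0) := by
      rw [hc0]
      exact hΦ.hasFDerivAt
    have h3 := h2.comp_hasDerivAt (0 : ℝ) h1
    have h4 : (Φ ∘ c) =ᶠ[𝓝 0] fun _ => 0 := hcS.mono fun t ht => hS _ ht
    exact h3.unique ((hasDerivAt_const (0 : ℝ) (0 : W)).congr_of_eventuallyEq h4)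
  have hδ : δ ∈ LinearMap.range (fderiv ℝ j u : E →ₗ[ℝ] J) ⊔ tangentSpan S (j u) := by
    rw [htr]; trivial
  obtain ⟨_, ⟨y, rfl⟩, t, ht, rfl⟩ := Submodule.mem_sup.1 hδ
  have h1 : fderiv ℝ Φ (j u) t = 0 := hT ht
  refine ⟨y, ?_⟩
  have hx : HasDerivAt (fun s : ℝ => u + s • y) y 0 := by
    simpa using ((hasDerivAt_id (0 : ℝ)).smul_const y).const_add u
  have hx0 : u + (0 : ℝ) • y = u := by simp
  have hz : HasDerivAt (fun s : ℝ => j u + s • (fderiv ℝ j u y + t)) (fderiv ℝ j u y + t) 0 := by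
    simpa using ((hasDerivAt_id (0 : ℝ)).smul_const (fderiv ℝ j u y + t)).const_add (j u)
  have hz0 : j u + (0 : ℝ) • (fderiv ℝ j u y + t) = j u := by simp
  have h3 : HasFDerivAt Φ (fderiv ℝ Φ (j u)) (j u + (0 : ℝ) • (fderiv ℝ j u y + t)) := by
    rw [hz0]
    exact hΦ.hasFDerivAt
  have h4 := (h3.comp_hasDerivAt (0 : ℝ) hz).unique hw
  rw [map_add, h1, add_zero] at h4
  have h5 : HasFDerivAt (Φ ∘ j) ((fderiv ℝ Φ (j u)).comp (fderiv ℝ j u)) (u + (0 : ℝ) • y) := by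
    rw [hx0]
    exact hΦ.hasFDerivAt.comp u hj.hasFDerivAt
  have h6 := h5.comp_hasDerivAt (0 : ℝ) hx
  rw [← h4]
  exact h6

/-- The first order entries of a jet. -/
def jetFst {m k : ℕ} (hk : 1 ≤ k) (z : Jet m 2 k) (j : Fin m) : Euc 2 :=
  z (multiIdxOfList [j] hk)

/-- The second order entries of a jet. -/
def jetSnd {m k : ℕ} (hk : 2 ≤ k) (z : Jet m 2 k) (l j : Fin m) : Euc 2 :=
  z (multiIdxOfList [l, j] hk)

section

variable {m k : ℕ} {i : Fin m}

/-- The ideal whose Boardman symbol is that of the jet. -/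
abbrev jetIdeal (z : Jet m 2 k) : Ideal (MvPolynomial (Fin m) ℝ) := Ideal.span (range (jetPoly z))

lemma eval_pderiv_jetPoly (hk : 1 ≤ k) (z : Jet m 2 k) (j : Fin m) (c : Fin 2) :
    MvPolynomial.eval 0 (MvPolynomial.pderiv j (jetPoly z c)) = jetFst hk z j c :=
  eval_foldr_pderiv_jetPoly z c [j] hk (by simp)

lemma eval_pderiv_pderiv_jetPoly (hk : 2 ≤ k) (z : Jet m 2 k) (l j : Fin m) (c : Fin 2) :
    MvPolynomial.eval 0 (MvPolynomial.pderiv l (MvPolynomial.pderiv j (jetPoly z c)))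
      = jetSnd hk z l j c :=
  eval_foldr_pderiv_jetPoly z c [l, j] hk (by simp)

lemma idealRank_jet_eq_one (hk : 1 ≤ k) {z : Jet m 2 k} (hi : jetFst hk z i ≠ 0)
    (hc : ∀ j, cross (jetFst hk z i) (jetFst hk z j) = 0) : idealRank (jetIdeal z) = 1 :=
  idealRank_eq_one (eval_jetPoly z) (eval_pderiv_jetPoly hk z) hi hc

lemma cross_eq_zero_of_idealRank (hk : 1 ≤ k) {z : Jet m 2 k} (h : idealRank (jetIdeal z) = 1)
    (j l : Fin m) : cross (jetFst hk z j) (jetFst hk z l) = 0 := by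
  by_contra hc
  have := two_le_idealRank (eval_pderiv_jetPoly hk z) hc
  simp only [jetIdeal] at h
  omega

lemma jetFst_eq_zero_of_idealRank (hk : 1 ≤ k) {z : Jet m 2 k} (h : idealRank (jetIdeal z) = 0)
    (j : Fin m) : jetFst hk z j = 0 := by
  by_contra hc
  by_cases h' : ∀ l, cross (jetFst hk z j) (jetFst hk z l) = 0
  · have := idealRank_jet_eq_one hk hc h'
    omega
  · push Not at h'
    obtain ⟨l, hl⟩ := h'
    have := two_le_idealRank (eval_pderiv_jetPoly hk z) hl
    simp only [jetIdeal] at h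
    omega

end

end

noncomputable section

/-! ### Linear algebra of the fold matrix -/

/-- Along a rank one direction in which an invertible matrix is met, the determinant of a singular
matrix grows linearly. -/
lemma det_add_smul_vecMulVec {m : ℕ} {N : Matrix (Fin m) (Fin m) ℝ} {u v : Fin m → ℝ}
    (h0 : N.det = 0) (h1 : (N + Matrix.vecMulVec u v).det ≠ 0) (s : ℝ) :
    (N + s • Matrix.vecMulVec u v).det = s * (N + Matrix.vecMulVec u v).det := by
  set A := N + Matrix.vecMulVec u v with hA
  obtain ⟨q, hq⟩ : ∃ q : ℝ, ∀ s : ℝ, (N + s • Matrix.vecMulVec u v).det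
      = A.det * (1 + (s - 1) * q) := by
    refine ⟨(Matrix.replicateRow Unit v * A⁻¹ * Matrix.replicateCol Unit u) () (), fun s => ?_⟩
    have h2 : N + s • Matrix.vecMulVec u v
        = A + Matrix.replicateCol Unit ((s - 1) • u) * Matrix.replicateRow Unit v := by
      rw [hA]
      ext j l
      simp [Matrix.vecMulVec_apply, Matrix.mul_apply]
      ring
    rw [h2, Matrix.det_add_replicateCol_mul_replicateRow (isUnit_iff_ne_zero.2 h1),
      Matrix.det_unique (n := Unit), Matrix.replicateCol_smul, Matrix.mul_smul]
    rfl
  have h3 := hq 0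
  rw [zero_smul, add_zero, h0] at h3
  have h4 : 1 + (0 - 1) * q = 0 := by
    rcases mul_eq_zero.1 h3.symm with h | h
    · exact absurd h h1
    · exact h
  have h5 : q = 1 := by linarith
  rw [hq s, h5]
  ring

/-- A surjective system of `m - 1` linear equations in `m` unknowns has a line of solutions. -/
lemma exists_eq_smul_of_mulVec_eq_zero {m : ℕ} {i : Fin m} {N : Matrix (Fin m) (Fin m) ℝ}
    (hN : ∀ r : Fin m → ℝ, ∃ y, ∀ j, j ≠ i → N.mulVec y j = r j) {v y : Fin m → ℝ} (hv0 : v ≠ 0)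
    (hv : ∀ j, j ≠ i → N.mulVec v j = 0) (hy : ∀ j, j ≠ i → N.mulVec y j = 0) :
    ∃ c : ℝ, y = c • v := by
  let T : (Fin m → ℝ) →ₗ[ℝ] ({j // j ≠ i} → ℝ) :=
    LinearMap.pi fun j => (LinearMap.proj (j : Fin m)).comp N.mulVecLin
  have hT : ∀ w j, T w j = N.mulVec w j := fun _ _ => rfl
  have hsurj : LinearMap.range T = ⊤ := by
    rw [LinearMap.range_eq_top]
    intro r
    obtain ⟨w, hw⟩ := hN fun j => if h : j ≠ i then r ⟨j, h⟩ else 0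
    refine ⟨w, ?_⟩
    ext ⟨j, hj⟩
    rw [hT, hw j hj, dif_pos hj]
  have h1 := LinearMap.finrank_range_add_finrank_ker T
  rw [hsurj, finrank_top] at h1
  simp only [Module.finrank_fintype_fun_eq_card, Fintype.card_subtype_compl, Fintype.card_fin,
    Fintype.card_unique] at h1
  have hm : 0 < m := i.pos
  have h2 : Module.finrank ℝ (LinearMap.ker T) = 1 := by omega
  have hv' : v ∈ LinearMap.ker T := by ext ⟨j, hj⟩; exact hv j hj
  have hy' : y ∈ LinearMap.ker T := by ext ⟨j, hj⟩; exact hy j hj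
  obtain ⟨c, hc⟩ := (finrank_eq_one_iff_of_nonzero' (⟨v, hv'⟩ : LinearMap.ker T)
    (by simpa [Subtype.ext_iff] using hv0)).1 h2 ⟨y, hy'⟩
  exact ⟨c, (congrArg Subtype.val hc).symm⟩

lemma linearIndependent_rows_of_surjective {m : ℕ} {i : Fin m} {N : Matrix (Fin m) (Fin m) ℝ}
    (hN : ∀ r : Fin m → ℝ, ∃ y, ∀ j, j ≠ i → N.mulVec y j = r j) :
    LinearIndependent ℝ fun j : {j // j ≠ i} => N j := by
  rw [Fintype.linearIndependent_iff]
  intro t ht j₀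
  obtain ⟨y, hy⟩ := hN fun j => if j = j₀ then 1 else 0
  have h1 : ∑ j : {j // j ≠ i}, t j * N.mulVec y j = 0 := by
    have := congrArg (fun w => dotProduct w y) ht
    simp only [sum_dotProduct, smul_dotProduct, zero_dotProduct, smul_eq_mul] at this
    exact this
  have h2 : ∑ j : {j // j ≠ i}, t j * N.mulVec y j = t j₀ := by
    rw [Finset.sum_eq_single j₀]
    · rw [hy _ j₀.2]; simp
    · intro j _ hj
      rw [hy _ j.2, if_neg (fun h => hj (Subtype.ext h)), mul_zero]
    · simp
  rw [← h2, h1]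

section

variable {m : ℕ} {i : Fin m} {a : Fin m → Euc 2} {h : Fin m → Fin m → Euc 2}

lemma cross_sum_right (e : Euc 2) (v : Fin m → ℝ) (w : Fin m → Euc 2) :
    cross e (∑ j, v j • w j) = ∑ j, v j * cross e (w j) := by
  simp only [cross, WithLp.ofLp_sum, Finset.sum_apply, PiLp.smul_apply, smul_eq_mul,
    Finset.mul_sum, mul_sub, Finset.sum_sub_distrib]
  congr 1 <;> exact Finset.sum_congr rfl fun _ _ => by ring

lemma eq_zero_of_inner_cross {e w : Euc 2} (he : e ≠ 0) (h0 : e 0 * w 0 + e 1 * w 1 = 0)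
    (h1 : cross e w = 0) : w = 0 := by
  rw [eq_smul_of_cross_eq_zero he h1, h0]
  simp

lemma sum_smul_eq_zero_of_foldMatrix (hi : a i ≠ 0) (hc : ∀ j, cross (a i) (a j) = 0)
    {v : Fin m → ℝ} (hv : (foldMatrix i (a i) a h).mulVec v i = 0) : ∑ l, v l • a l = 0 := by
  rw [foldMatrix_mulVec_self] at hv
  refine eq_zero_of_inner_cross hi hv ?_
  rw [cross_sum_right]
  simp [hc]

/-- The second derivative in the direction `a i`-normal is a symmetric form on the kernel of the
first derivative. -/
lemma sum_mul_foldRow (hs : ∀ l j, h l j = h j l) {v y : Fin m → ℝ} (hv : ∑ l, v l • a l = 0)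
    (hy : ∑ l, y l • a l = 0) :
    ∑ j, v j * (cross (∑ l, y l • h l i) (a j) + cross (a i) (∑ l, y l • h l j))
      = ∑ j, y j * (cross (∑ l, v l • h l i) (a j) + cross (a i) (∑ l, v l • h l j)) := by
  simp only [mul_add, Finset.sum_add_distrib]
  have h0 : ∀ e : Euc 2, cross e 0 = 0 := fun e => by simp [cross]
  rw [← cross_sum_right _ v a, ← cross_sum_right _ y a, hv, hy, h0, h0, zero_add, zero_add]
  simp only [cross_sum_right, Finset.mul_sum]
  rw [Finset.sum_comm]
  refine Finset.sum_congr rfl fun l _ => Finset.sum_congr rfl fun j _ => ?_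
  rw [hs l j]
  ring

lemma cross_comm_add (e w : Euc 2) : cross w e + cross e w = 0 := by simp only [cross]; ring

lemma foldRow_eq_zero {e : Euc 2} {v : Fin m → ℝ}
    (hv : ∀ j, j ≠ i → (foldMatrix i e a h).mulVec v j = 0) (j : Fin m) :
    cross (∑ l, v l • h l i) (a j) + cross (a i) (∑ l, v l • h l j) = 0 := by
  by_cases hj : j = i
  · subst hj; exact cross_comm_add _ _
  · rw [← foldMatrix_mulVec_of_ne e a h v hj, hv j hj]

/-- At a degenerate point the direction of the image line moves. -/
lemma cross_ne_zero_of_kernel (hi : a i ≠ 0) (hc : ∀ j, cross (a i) (a j) = 0)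
    (hN : ∀ r : Fin m → ℝ, ∃ y, ∀ j, j ≠ i → (foldMatrix i (a i) a h).mulVec y j = r j)
    (hs : ∀ l j, h l j = h j l) {v : Fin m → ℝ} (hv0 : v ≠ 0)
    (hv : (foldMatrix i (a i) a h).mulVec v = 0) :
    cross (a i) (∑ l, v l • h l i) ≠ 0 := by
  intro h0
  have hva := sum_smul_eq_zero_of_foldMatrix (h := h) hi hc (congrFun hv i)
  have hR := foldRow_eq_zero (i := i) (e := a i) (a := a) (h := h) (v := v)
    fun j _ => congrFun hv j
  -- if the image line did not move, all of the second derivatives in direction `v` would lie in it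
  have h1 : ∀ j, cross (a i) (∑ l, v l • h l j) = 0 := by
    intro j
    have h2 := hR j
    rw [eq_smul_of_cross_eq_zero hi (hc j)] at h2
    simp only [cross, PiLp.smul_apply, smul_eq_mul] at h0 h2 ⊢
    linear_combination h2 + ((a i 0 * a j 0 + a i 1 * a j 1) / (a i 0 ^ 2 + a i 1 ^ 2)) * h0
  -- Choose `y` whose image under the fold matrix agrees with `v` off the `i`-th entry. By symmetry
  -- of the second derivative, the pairing of this image with `v` vanishes, so that `v j = 0` for
  -- `j ≠ i`.
  obtain ⟨y, hy⟩ := hN v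
  have h3 : ∑ j, v j * (cross (∑ l, y l • h l i) (a j) + cross (a i) (∑ l, y l • h l j)) = 0 := by
    simp only [mul_add, Finset.sum_add_distrib]
    rw [← cross_sum_right, hva]
    have : ∑ j, v j * cross (a i) (∑ l, y l • h l j)
        = ∑ l, y l * cross (a i) (∑ j, v j • h j l) := by
      simp only [cross_sum_right, Finset.mul_sum]
      rw [Finset.sum_comm]
      refine Finset.sum_congr rfl fun l _ => Finset.sum_congr rfl fun j _ => ?_
      rw [hs l j]
      ring
    rw [this]
    simp only [h1, mul_zero, Finset.sum_const_zero, add_zero]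
    simp [cross]
  have h4 : ∀ j, v j * (cross (∑ l, y l • h l i) (a j) + cross (a i) (∑ l, y l • h l j))
      = if j = i then 0 else v j ^ 2 := by
    intro j
    split_ifs with hj
    · subst hj; rw [cross_comm_add, mul_zero]
    · rw [← foldMatrix_mulVec_of_ne (a i) a h y hj, hy j hj]; ring
  simp only [h4] at h3
  rw [Finset.sum_eq_zero_iff_of_nonneg (fun j _ => by split_ifs <;> positivity)] at h3
  have h5 : ∀ j, j ≠ i → v j = 0 := by
    intro j hj
    have := h3 j (Finset.mem_univ j)
    rw [if_neg hj] at this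
    exact pow_eq_zero_iff two_ne_zero |>.1 this
  rw [Finset.sum_eq_single i (fun j _ hj => by rw [h5 j hj, zero_smul]) (by simp)] at hva
  apply hv0
  ext j
  by_cases hj : j = i
  · subst hj
    exact (smul_eq_zero.1 hva).resolve_right hi
  · exact h5 j hj

/-- The variation of the second derivatives by `v ⊗ v` times a vector normal to the image line
makes a singular fold matrix with kernel `v` invertible. -/
lemma det_foldMatrix_add_ne_zero (hi : a i ≠ 0) (hc : ∀ j, cross (a i) (a j) = 0)
    (hN : ∀ r : Fin m → ℝ, ∃ y, ∀ j, j ≠ i → (foldMatrix i (a i) a h).mulVec y j = r j)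
    (hs : ∀ l j, h l j = h j l) {v : Fin m → ℝ} (hv0 : v ≠ 0)
    (hv : (foldMatrix i (a i) a h).mulVec v = 0) {w : Euc 2} (hw : cross (a i) w = 1) :
    (foldMatrix i (a i) a h
      + Matrix.vecMulVec (fun j => v j + v i * cross w (a j)) v).det ≠ 0 := by
  intro hdet
  obtain ⟨y, hy0, hy⟩ := Matrix.exists_mulVec_eq_zero_iff.2 hdet
  have hva := sum_smul_eq_zero_of_foldMatrix (h := h) hi hc (congrFun hv i)
  have hR := foldRow_eq_zero (i := i) (e := a i) (a := a) (h := h) (v := v)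
    fun j _ => congrFun hv j
  have hy' : ∀ j, (foldMatrix i (a i) a h).mulVec y j
      + (v j + v i * cross w (a j)) * dotProduct v y = 0 := by
    intro j
    have := congrFun hy j
    rw [Matrix.add_mulVec, Pi.add_apply, Matrix.vecMulVec_mulVec] at this
    simpa only [Pi.smul_apply, op_smul_eq_smul, smul_eq_mul, mul_comm,
      Pi.zero_apply] using this
  have hu0 : v i + v i * cross w (a i) = 0 := by
    simp only [cross] at hw ⊢
    linear_combination (-v i) * hw
  have hya : ∑ l, y l • a l = 0 := by
    refine sum_smul_eq_zero_of_foldMatrix (h := h) hi hc ?_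
    have := hy' i
    rwa [hu0, zero_mul, add_zero] at this
  have h1 : ∀ j, cross (∑ l, y l • h l i) (a j) + cross (a i) (∑ l, y l • h l j)
      = -((v j + v i * cross w (a j)) * dotProduct v y) := by
    intro j
    by_cases hj : j = i
    · subst hj; rw [cross_comm_add, hu0]; ring
    · rw [← foldMatrix_mulVec_of_ne (a i) a h y hj]
      linarith [hy' j]
  -- pairing with `v`, the symmetry of the second derivative yields `(v ⬝ v) (v ⬝ y) = 0`
  have h2 := sum_mul_foldRow (i := i) hs hva hya
  simp only [h1, hR, mul_zero, Finset.sum_const_zero] at h2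
  have h3 : ∑ j, v j * (v j + v i * cross w (a j)) = dotProduct v v := by
    simp only [mul_add, Finset.sum_add_distrib, dotProduct]
    have : ∑ j, v j * (v i * cross w (a j)) = v i * cross w (∑ j, v j • a j) := by
      rw [cross_sum_right, Finset.mul_sum]
      exact Finset.sum_congr rfl fun _ _ => by ring
    rw [this, hva]
    simp [cross]
  have h4 : dotProduct v v * dotProduct v y = 0 := by
    rw [← h3, Finset.sum_mul]
    have : ∑ j, v j * (v j + v i * cross w (a j)) * dotProduct v y
        = -∑ j, v j * -((v j + v i * cross w (a j)) * dotProduct v y) := by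
      rw [← Finset.sum_neg_distrib]
      exact Finset.sum_congr rfl fun _ _ => by ring
    rw [this, h2, neg_zero]
  have h5 : dotProduct v v ≠ 0 := fun h => hv0 (dotProduct_self_eq_zero.1 h)
  have h6 : dotProduct v y = 0 := (mul_eq_zero.1 h4).resolve_left h5
  obtain ⟨c, rfl⟩ := exists_eq_smul_of_mulVec_eq_zero hN hv0 (fun j _ => congrFun hv j)
    (fun j _ => by simpa [h6] using hy' j)
  rw [dotProduct_smul, smul_eq_mul] at h6
  rw [(mul_eq_zero.1 h6).resolve_right h5, zero_smul] at hy0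
  exact hy0 rfl

end

end

noncomputable section

/-! ### Singular points of maps with transverse jets -/

/-- The jets of `g` are transverse at `u` to all Thom–Boardman strata. -/
def JetTransverse {m n : ℕ} (g : Euc m → Euc n) (u : Euc m) : Prop :=
  ∀ I : List ℕ, jetExt I.length g u ∈ jetStratum m n I →
    LinearMap.range (fderiv ℝ (jetExt I.length g) u : Euc m →ₗ[ℝ] Jet m n I.length) ⊔
      tangentSpan (jetStratum m n I) (jetExt I.length g u) = ⊤

section

variable {m : ℕ} {U : Set (Euc m)} {g : Euc m → Euc 2} {u : Euc m} {i : Fin m}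

lemma jetFst_jetExt (hU : IsOpen U) (hg : ContDiffOn ℝ ∞ g U) (hu : u ∈ U) {k : ℕ} (hk : 1 ≤ k)
    (j : Fin m) : jetFst hk (jetExt k g u) j = partialDeriv j g u :=
  jetExt_multiIdxOfList hU hg hu [j] hk

lemma jetSnd_jetExt (hU : IsOpen U) (hg : ContDiffOn ℝ ∞ g U) (hu : u ∈ U) {k : ℕ} (hk : 2 ≤ k)
    (l j : Fin m) : jetSnd hk (jetExt k g u) l j = partialDeriv l (partialDeriv j g) u :=
  jetExt_multiIdxOfList hU hg hu [l, j] hk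

lemma multiIdxOfList_singleton_injective {k : ℕ} (hk : 1 ≤ k) :
    Function.Injective fun j : Fin m => multiIdxOfList (k := k) [j] hk := by
  intro j l hjl
  have h1 := congrArg (fun s : MultiIdx m k => ((s.1 j : Fin (k + 1)) : ℕ)) hjl
  by_contra hne
  have h2 : List.count j [j] = List.count j [l] := h1
  rw [List.count_singleton_self, List.count_singleton, beq_false_of_ne (Ne.symm hne)] at h2
  simp at h2

/-- The jet all of whose entries vanish but those of first order. -/
def firstOrderJet {k : ℕ} (hk : 1 ≤ k) (w : Fin m → Euc 2) : Jet m 2 k :=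
  Function.extend (fun j : Fin m => multiIdxOfList (k := k) [j] hk) w 0

lemma jetFst_firstOrderJet {k : ℕ} (hk : 1 ≤ k) (w : Fin m → Euc 2) (j : Fin m) :
    jetFst hk (firstOrderJet hk w) j = w j :=
  (multiIdxOfList_singleton_injective hk).extend_apply _ _ _

/-- The differential does not vanish at any point: the stratum of jets with vanishing differential
has codimension `2 * m > m`. -/
lemma exists_partialDeriv_ne_zero (hm : 2 ≤ m) (hU : IsOpen U) (hg : ContDiffOn ℝ ∞ g U)
    (hu : u ∈ U) (htr : JetTransverse g u) : ∃ i, partialDeriv i g u ≠ 0 := by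
  by_contra! h0
  have hk : 1 ≤ ([m] : List ℕ).length := le_rfl
  have hmem : jetExt ([m] : List ℕ).length g u ∈ jetStratum m 2 [m] := by
    refine ⟨?_, trivial⟩
    rw [idealRank_eq_zero (eval_jetPoly _), zero_add]
    intro j k
    rw [eval_pderiv_jetPoly hk, jetFst_jetExt hU hg hu hk, h0]
    rfl
  have h1 := htr [m] hmem
  let Φ : Jet m 2 ([m] : List ℕ).length → (Fin m → Euc 2) := fun z j => jetFst hk z j
  have hΦ : Differentiable ℝ Φ := by
    unfold Φ jetFst
    fun_prop
  -- the first derivatives would form a submersion to a space of dimension `2 * m`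
  have hsurj : ∀ w : Fin m → Euc 2, ∃ y, fderiv ℝ (fun u j => partialDeriv j g u) u y = w := by
    intro w
    have hw : HasDerivAt (fun s : ℝ => Φ (jetExt ([m] : List ℕ).length g u
        + s • firstOrderJet hk w)) w 0 := by
      rw [hasDerivAt_pi]
      intro j
      have h2 : (fun s : ℝ => Φ (jetExt ([m] : List ℕ).length g u + s • firstOrderJet hk w) j)
          = fun s : ℝ => jetFst hk (jetExt ([m] : List ℕ).length g u) j + s • w j := by
        funext s
        rw [← jetFst_firstOrderJet hk w j]
        rfl
      rw [h2]
      simpa using ((hasDerivAt_id (0 : ℝ)).smul_const (w j)).const_add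
        (jetFst hk (jetExt ([m] : List ℕ).length g u) j)
    obtain ⟨y, hy⟩ := exists_hasDerivAt_comp
      ((contDiffAt_jetExt hU hg hu _).differentiableAt (by simp)) h1 hΦ.differentiableAt
      (fun z hz => by
        have : idealRank (jetIdeal z) = 0 := by
          have := hz.1
          simp only [jetIdeal]
          omega
        funext j
        exact jetFst_eq_zero_of_idealRank hk this j) hw
    refine ⟨y, ?_⟩
    have hd : DifferentiableAt ℝ (fun u j => partialDeriv j g u) u := by
      rw [differentiableAt_pi]
      exact fun j => ((hg.partialDeriv hU j).contDiffAt (hU.mem_nhds hu)).differentiableAt (by simp)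
    have hx : HasDerivAt (fun s : ℝ => u + s • y) y 0 := by
      simpa using ((hasDerivAt_id (0 : ℝ)).smul_const y).const_add u
    have h3 : HasFDerivAt (fun u j => partialDeriv j g u)
        (fderiv ℝ (fun u j => partialDeriv j g u) u) (u + (0 : ℝ) • y) := by
      simpa using hd.hasFDerivAt
    have h4 := h3.comp_hasDerivAt (0 : ℝ) hx
    refine h4.unique (hy.congr_of_eventuallyEq ?_)
    have : ∀ᶠ s : ℝ in 𝓝 0, u + s • y ∈ U :=
      hx.continuousAt.eventually_mem (by simpa using hU.mem_nhds hu)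
    filter_upwards [this] with s hs
    funext j
    exact (jetFst_jetExt hU hg hs hk j).symm
  have h2 := LinearMap.finrank_le_finrank_of_surjective
    (f := (fderiv ℝ (fun u j => partialDeriv j g u) u : Euc m →ₗ[ℝ] (Fin m → Euc 2))) hsurj
  rw [Module.finrank_pi_fintype] at h2
  simp at h2
  omega

lemma exists_cross_eq_one {e : Euc 2} (he : e ≠ 0) : ∃ w, cross e w = 1 := by
  have : e 0 ^ 2 + e 1 ^ 2 ≠ 0 := by
    intro h0
    apply he
    ext k
    fin_cases k
    · simp; nlinarith [sq_nonneg (e 0), sq_nonneg (e 1)]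
    · simp; nlinarith [sq_nonneg (e 0), sq_nonneg (e 1)]
  refine ⟨!₂[-e 1 / (e 0 ^ 2 + e 1 ^ 2), e 0 / (e 0 ^ 2 + e 1 ^ 2)], ?_⟩
  simp [cross]
  field_simp
  ring

/-- A point of the plane-valued map `g` where the differential has rank one, the `i`-th partial
derivative being nonzero. -/
structure IsSingularAt (g : Euc m → Euc 2) (i : Fin m) (u : Euc m) : Prop where
  ne_zero : partialDeriv i g u ≠ 0
  minor_eq_zero : ∀ j, minor g i j u = 0

/-- The fold matrix at a point, the fixed vector being the `i`-th partial derivative there. -/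
abbrev foldMatrixSelf (g : Euc m → Euc 2) (i : Fin m) (u : Euc m) : Matrix (Fin m) (Fin m) ℝ :=
  foldMatrixAt g i (partialDeriv i g u) u

lemma IsSingularAt.idealRank_jet (hs : IsSingularAt g i u) (hU : IsOpen U)
    (hg : ContDiffOn ℝ ∞ g U) (hu : u ∈ U) {k : ℕ} (hk : 1 ≤ k) :
    idealRank (jetIdeal (jetExt k g u)) = 1 := by
  refine idealRank_jet_eq_one (i := i) hk ?_ fun j => ?_
  · rw [jetFst_jetExt hU hg hu]; exact hs.ne_zero
  · rw [jetFst_jetExt hU hg hu, jetFst_jetExt hU hg hu]; exact hs.minor_eq_zero j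

/-- Transversality to the first singular stratum: the minors are a regular system of equations. -/
lemma IsSingularAt.surjective (hs : IsSingularAt g i u) (hm : 2 ≤ m) (hU : IsOpen U)
    (hg : ContDiffOn ℝ ∞ g U) (hu : u ∈ U) (htr : JetTransverse g u) (r : Fin m → ℝ) :
    ∃ y, ∀ j, j ≠ i → (foldMatrixSelf g i u).mulVec y j = r j := by
  have hk : 1 ≤ ([m - 1] : List ℕ).length := le_rfl
  have hmem : jetExt ([m - 1] : List ℕ).length g u ∈ jetStratum m 2 [m - 1] := by
    refine ⟨?_, trivial⟩
    have := hs.idealRank_jet hU hg hu hk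
    simp only [jetIdeal] at this
    omega
  have h1 := htr [m - 1] hmem
  -- `Φ` vanishes on the stratum, and varying the first derivatives transversally to the image line
  -- moves its components independently.
  let Φ : Jet m 2 ([m - 1] : List ℕ).length → (Fin m → ℝ) :=
    fun z j => cross (jetFst hk z i) (jetFst hk z j)
  have hΦ : Differentiable ℝ Φ := by
    unfold Φ jetFst cross
    fun_prop
  obtain ⟨w, hw⟩ := exists_cross_eq_one hs.ne_zero
  have hd : HasDerivAt (fun s : ℝ => Φ (jetExt ([m - 1] : List ℕ).length g u
      + s • firstOrderJet hk fun j => if j = i then 0 else r j • w))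
      (fun j => if j = i then 0 else r j) 0 := by
    rw [hasDerivAt_pi]
    intro j
    have h2 : (fun s : ℝ => Φ (jetExt ([m - 1] : List ℕ).length g u
        + s • firstOrderJet hk fun j => if j = i then 0 else r j • w) j)
        = fun s : ℝ => s * (if j = i then 0 else r j) := by
      funext s
      have h3 : ∀ l, jetFst hk (jetExt ([m - 1] : List ℕ).length g u
          + s • firstOrderJet hk fun j => if j = i then 0 else r j • w) l
          = partialDeriv l g u + s • (if l = i then 0 else r l • w) := by
        intro l
        rw [← jetFst_jetExt hU hg hu hk l,
          ← jetFst_firstOrderJet hk (fun j => if j = i then 0 else r j • w) l]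
        rfl
      simp only [Φ, h3, if_true]
      have h4 := hs.minor_eq_zero j
      unfold minor at h4
      by_cases hj : j = i
      · rw [if_pos hj, if_pos hj, smul_zero, add_zero, add_zero, h4, mul_zero]
      · rw [if_neg hj, if_neg hj]
        simp only [cross, PiLp.add_apply, PiLp.smul_apply, smul_eq_mul,
          PiLp.zero_apply] at hw h4 ⊢
        linear_combination h4 + s * r j * hw
    rw [h2]
    simpa using (hasDerivAt_id (0 : ℝ)).mul_const (if j = i then 0 else r j)
  obtain ⟨y, hy⟩ := exists_hasDerivAt_comp
    ((contDiffAt_jetExt hU hg hu _).differentiableAt (by simp)) h1 hΦ.differentiableAt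
    (fun z hz => by
      have : idealRank (jetIdeal z) = 1 := by
        have := hz.1
        simp only [jetIdeal]
        omega
      funext j
      exact cross_eq_zero_of_idealRank hk this _ _) hd
  refine ⟨y, fun j hj => ?_⟩
  have hx : HasDerivAt (fun s : ℝ => u + s • y) y 0 := by
    simpa using ((hasDerivAt_id (0 : ℝ)).smul_const y).const_add u
  have hx0 : u + (0 : ℝ) • y = u := by simp
  have h5 := hasDerivAt_minor (x := fun s : ℝ => u + s • y) hU hg hx (by rwa [hx0])
    (partialDeriv i g u) hj
  rw [hx0] at h5
  have h6 := hasDerivAt_pi.1 hy j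
  rw [if_neg hj] at h6
  refine h5.unique (h6.congr_of_eventuallyEq ?_)
  have : ∀ᶠ s : ℝ in 𝓝 0, u + s • y ∈ U :=
    hx.continuousAt.eventually_mem (by simpa using hU.mem_nhds hu)
  filter_upwards [this] with s hs
  simp only [Φ, jetFst_jetExt hU hg hs]
  rfl

lemma foldMatrixAt_eq_jet (hU : IsOpen U) (hg : ContDiffOn ℝ ∞ g U) (hu : u ∈ U) {k : ℕ}
    (hk : 1 ≤ k) (hk' : 2 ≤ k) (e : Euc 2) : foldMatrix i e (jetFst hk (jetExt k g u))
      (jetSnd hk' (jetExt k g u)) = foldMatrixAt g i e u := by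
  have h1 : jetFst hk (jetExt k g u) = fun j => partialDeriv j g u :=
    funext fun j => jetFst_jetExt hU hg hu hk j
  have h2 : jetSnd hk' (jetExt k g u) = fun l j => partialDeriv l (partialDeriv j g) u :=
    funext fun l => funext fun j => jetSnd_jetExt hU hg hu hk' l j
  rw [h1, h2, foldMatrixAt]

lemma IsSingularAt.idealRank_criticalExtension_of_det_ne_zero (hs : IsSingularAt g i u)
    (hU : IsOpen U) (hg : ContDiffOn ℝ ∞ g U) (hu : u ∈ U) {k : ℕ} (hk : 2 ≤ k)
    (hdet : (foldMatrixSelf g i u).det ≠ 0) :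
    idealRank (criticalExtension (jetIdeal (jetExt k g u))) = m := by
  have hk1 : 1 ≤ k := by omega
  refine _root_.idealRank_criticalExtension_of_det_ne_zero (partialDeriv i g u)
    (eval_pderiv_jetPoly hk1 _) (eval_pderiv_pderiv_jetPoly hk _)
    (hs.idealRank_jet hU hg hu hk1) (i := i) ?_
  rwa [foldMatrixAt_eq_jet hU hg hu]

lemma IsSingularAt.dirDeriv_eq_zero (hs : IsSingularAt g i u) (hU : IsOpen U)
    (hg : ContDiffOn ℝ ∞ g U) (hu : u ∈ U) {k : ℕ} (hk : 2 ≤ k) {v : Fin m → ℝ}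
    (hv : (foldMatrixSelf g i u).mulVec v = 0) :
    ∀ q ∈ criticalExtension (jetIdeal (jetExt k g u)), dirDeriv v q = 0 := by
  intro q hq
  have hk1 : 1 ≤ k := by omega
  have ha := eval_pderiv_jetPoly hk1 (jetExt k g u)
  have hh := eval_pderiv_pderiv_jetPoly hk (jetExt k g u)
  simp only [jetFst_jetExt hU hg hu] at ha
  simp only [jetSnd_jetExt hU hg hu] at hh
  refine dirDeriv_eq_zero_of_mem_criticalExtension (i := i) (eval_jetPoly _)
    (a := fun j => partialDeriv j g u) ha (h := fun l j => partialDeriv l (partialDeriv j g) u) hh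
    hs.ne_zero hs.minor_eq_zero ?_ ?_ hq
  · exact sum_smul_eq_zero_of_foldMatrix (a := fun j => partialDeriv j g u)
      (h := fun l j => partialDeriv l (partialDeriv j g) u) hs.ne_zero hs.minor_eq_zero
      (congrFun hv i)
  · exact foldRow_eq_zero (e := partialDeriv i g u) (a := fun j => partialDeriv j g u)
      (h := fun l j => partialDeriv l (partialDeriv j g) u) (fun j _ => congrFun hv j)

lemma IsSingularAt.idealRank_criticalExtension_of_det_eq_zero (hs : IsSingularAt g i u)
    (hm : 2 ≤ m) (hU : IsOpen U) (hg : ContDiffOn ℝ ∞ g U) (hu : u ∈ U) (htr : JetTransverse g u)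
    {k : ℕ} (hk : 2 ≤ k) (hdet : (foldMatrixSelf g i u).det = 0) :
    idealRank (criticalExtension (jetIdeal (jetExt k g u))) + 1 = m := by
  have hk1 : 1 ≤ k := by omega
  obtain ⟨v, hv0, hv⟩ := Matrix.exists_mulVec_eq_zero_iff.2 hdet
  have h1 := idealRank_lt_of_dirDeriv_eq_zero hv0 (hs.dirDeriv_eq_zero hU hg hu hk hv)
  have h2 := le_idealRank_criticalExtension (i := i) (partialDeriv i g u)
    (eval_pderiv_jetPoly hk1 _) (eval_pderiv_pderiv_jetPoly hk _)
    (hs.idealRank_jet hU hg hu hk1) (by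
      rw [foldMatrixAt_eq_jet hU hg hu]
      exact linearIndependent_rows_of_surjective (hs.surjective hm hU hg hu htr))
  simp only [jetIdeal] at h1 h2 ⊢
  omega

end

end

noncomputable section

section

variable {m : ℕ} {U : Set (Euc m)} {g : Euc m → Euc 2} {u : Euc m} {i : Fin m}

/-- The jet all of whose entries vanish but those of second order, which are those of the map
`x ↦ (⟨v, x⟩² / 2) w`. -/
def secondOrderJet {k : ℕ} (v : Fin m → ℝ) (w : Euc 2) : Jet m 2 k := fun s =>
  if ∑ i, (s.1 i : ℕ) = 2 then (∏ i, v i ^ (s.1 i : ℕ)) • w else 0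

lemma sum_count_eq_length (l : List (Fin m)) : ∑ i, l.count i = l.length := by
  simpa using Multiset.sum_count_eq_card (s := Finset.univ) (m := (l : Multiset (Fin m)))
    (by simp)

lemma secondOrderJet_multiIdxOfList {k : ℕ} (v : Fin m → ℝ) (w : Euc 2) (l : List (Fin m))
    (h : l.length ≤ k) : (secondOrderJet v w : Jet m 2 k) (multiIdxOfList l h)
      = if l.length = 2 then (l.map v).prod • w else 0 := by
  have h1 : ∏ i : Fin m, v i ^ l.count i = (l.map v).prod := by
    have h2 := Finset.prod_multiset_map_count (l : Multiset (Fin m)) v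
    simp only [Multiset.map_coe, Multiset.prod_coe, Multiset.coe_count] at h2
    rw [h2]
    symm
    refine Finset.prod_subset (Finset.subset_univ _) fun j _ hj => ?_
    have : l.count j = 0 := List.count_eq_zero.2 (by simpa using hj)
    rw [this, pow_zero]
  rw [← h1, ← sum_count_eq_length]
  rfl

/-- Transversality to the stratum of degenerate singular points: the determinant of the fold
matrix vanishes there to first order only along the singular curve. -/
lemma IsSingularAt.fderiv_det_ne_zero (hs : IsSingularAt g i u) (hm : 2 ≤ m) (hU : IsOpen U)
    (hg : ContDiffOn ℝ ∞ g U) (hu : u ∈ U) (htr : JetTransverse g u)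
    (hdet : (foldMatrixSelf g i u).det = 0) {v : Euc m} (hv0 : v ≠ 0)
    (hv : ∀ j, j ≠ i → (foldMatrixSelf g i u).mulVec v j = 0) :
    fderiv ℝ (fun y => (foldMatrixAt g i (partialDeriv i g u) y).det) u v ≠ 0 := by
  have hk1 : 1 ≤ ([m - 1, 1] : List ℕ).length := by simp
  have hk2 : 2 ≤ ([m - 1, 1] : List ℕ).length := le_rfl
  have hmem : jetExt ([m - 1, 1] : List ℕ).length g u ∈ jetStratum m 2 [m - 1, 1] := by
    have h1 := hs.idealRank_jet hU hg hu hk1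
    have h2 := hs.idealRank_criticalExtension_of_det_eq_zero hm hU hg hu htr hk2 hdet
    refine ⟨?_, h2, trivial⟩
    simp only [jetIdeal] at h1
    omega
  have h1 := htr [m - 1, 1] hmem
  set e := partialDeriv i g u with he
  have hsurj := hs.surjective hm hU hg hu htr
  obtain ⟨v', hv'0, hv'⟩ := Matrix.exists_mulVec_eq_zero_iff.2 hdet
  obtain ⟨w, hw⟩ := exists_cross_eq_one hs.ne_zero
  have hsymm : ∀ l j, partialDeriv l (partialDeriv j g) u = partialDeriv j (partialDeriv l g) u :=
    fun l j => partialDeriv_comm hU hg l j hu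
  -- equations that hold on the stratum of jets with symbol `(m - 1, 1)`
  let Φ : Jet m 2 ([m - 1, 1] : List ℕ).length → (Fin m → ℝ) × ℝ := fun z =>
    (fun j => cross (jetFst hk1 z i) (jetFst hk1 z j),
      (foldMatrix i e (jetFst hk1 z) (jetSnd hk2 z)).det)
  have hΦ : Differentiable ℝ Φ := by
    have hent : Differentiable ℝ fun z : Jet m 2 ([m - 1, 1] : List ℕ).length =>
        (fun j l => foldMatrix i e (jetFst hk1 z) (jetSnd hk2 z) j l) := by
      rw [differentiable_pi]
      intro j
      rw [differentiable_pi]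
      intro l
      unfold foldMatrix jetFst jetSnd cross
      simp only [Matrix.of_apply]
      split_ifs <;> fun_prop
    refine Differentiable.prodMk ?_ ((contDiff_det.differentiable (by simp)).comp hent)
    unfold jetFst cross
    fun_prop
  have hΦ0 : ∀ z ∈ jetStratum m 2 [m - 1, 1], Φ z = 0 := by
    intro z hz
    obtain ⟨hz1, hz2, -⟩ := hz
    have hr : idealRank (jetIdeal z) = 1 := by
      simp only [jetIdeal]
      omega
    refine Prod.ext ?_ ?_
    · funext j
      exact cross_eq_zero_of_idealRank hk1 hr _ _
    · by_contra hne
      have := _root_.idealRank_criticalExtension_of_det_ne_zero e (eval_pderiv_jetPoly hk1 z)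
        (eval_pderiv_pderiv_jetPoly hk2 z) hr hne
      omega
  -- the variation of the second derivatives by `v' ⊗ v'` changes the determinant to first order
  -- and keeps the minors
  set D := (foldMatrixSelf g i u
      + Matrix.vecMulVec (fun j => v' j + v' i * cross w (partialDeriv j g u)) v').det with hD
  have hD0 : D ≠ 0 := det_foldMatrix_add_ne_zero (a := fun j => partialDeriv j g u)
    (h := fun l j => partialDeriv l (partialDeriv j g) u) hs.ne_zero hs.minor_eq_zero hsurj hsymm
    hv'0 hv' hw
  have hd : HasDerivAt (fun s : ℝ => Φ (jetExt ([m - 1, 1] : List ℕ).length g u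
      + s • secondOrderJet v' w)) ((0 : Fin m → ℝ), D) 0 := by
    have h3 : ∀ (s : ℝ) l, jetFst hk1 (jetExt ([m - 1, 1] : List ℕ).length g u
        + s • secondOrderJet v' w) l = partialDeriv l g u := by
      intro s l
      have : (secondOrderJet v' w : Jet m 2 ([m - 1, 1] : List ℕ).length)
          (multiIdxOfList [l] hk1) = 0 := by
        rw [secondOrderJet_multiIdxOfList]; simp
      rw [← jetFst_jetExt hU hg hu hk1 l]
      simp [jetFst, this]
    have h4 : ∀ (s : ℝ) l j, jetSnd hk2 (jetExt ([m - 1, 1] : List ℕ).length g u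
        + s • secondOrderJet v' w) l j
        = partialDeriv l (partialDeriv j g) u + (s * (v' l * v' j)) • w := by
      intro s l j
      have : (secondOrderJet v' w : Jet m 2 ([m - 1, 1] : List ℕ).length)
          (multiIdxOfList [l, j] hk2) = (v' l * v' j) • w := by
        rw [secondOrderJet_multiIdxOfList]; simp
      rw [← jetSnd_jetExt hU hg hu hk2 l j]
      simp [jetSnd, this, smul_smul]
    refine HasDerivAt.prodMk ?_ ?_
    · refine (hasDerivAt_const (0 : ℝ) (0 : Fin m → ℝ)).congr_of_eventuallyEq
        (Eventually.of_forall fun s => ?_)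
      funext j
      simp only [h3]
      exact hs.minor_eq_zero j
    · have h5 : ∀ s : ℝ, (foldMatrix i e (jetFst hk1 (jetExt ([m - 1, 1] : List ℕ).length g u
          + s • secondOrderJet v' w)) (jetSnd hk2 (jetExt ([m - 1, 1] : List ℕ).length g u
          + s • secondOrderJet v' w))).det = s * D := by
        intro s
        rw [hD, ← det_add_smul_vecMulVec hdet hD0 s]
        congr 1
        ext j l
        simp only [foldMatrix, foldMatrixAt, Matrix.of_apply, Matrix.add_apply, Matrix.smul_apply,
          Matrix.vecMulVec_apply, h3, h4, smul_eq_mul]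
        by_cases hj : j = i
        · rw [if_pos hj, if_pos hj, hj]
          have : v' i + v' i * cross w e = 0 := by
            simp only [cross] at hw ⊢
            linear_combination (-v' i) * hw
          rw [← he, this]
          ring
        · rw [if_neg hj, if_neg hj]
          simp only [cross, PiLp.add_apply, PiLp.smul_apply, smul_eq_mul] at hw ⊢
          linear_combination s * v' l * v' j * hw
      simp only [h5]
      simpa using (hasDerivAt_id (0 : ℝ)).mul_const D
  -- by transversality, some direction `y` in the source produces the same first-order change
  obtain ⟨y, hy⟩ := exists_hasDerivAt_comp
    ((contDiffAt_jetExt hU hg hu _).differentiableAt (by simp)) h1 hΦ.differentiableAt hΦ0 hd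
  have hx : HasDerivAt (fun s : ℝ => u + s • y) y 0 := by
    simpa using ((hasDerivAt_id (0 : ℝ)).smul_const y).const_add u
  have hx0 : u + (0 : ℝ) • y = u := by simp
  have hev : ∀ᶠ s : ℝ in 𝓝 0, u + s • y ∈ U :=
    hx.continuousAt.eventually_mem (by simpa using hU.mem_nhds hu)
  have hy1 : ∀ j, j ≠ i → (foldMatrixSelf g i u).mulVec y j = 0 := by
    intro j hj
    have h5 := hasDerivAt_minor (x := fun s : ℝ => u + s • y) hU hg hx (by rwa [hx0])
      (partialDeriv i g u) hj
    rw [hx0] at h5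
    have h6 := hasDerivAt_pi.1 (hasFDerivAt_fst.comp_hasDerivAt (0 : ℝ) hy) j
    refine h5.unique (h6.congr_of_eventuallyEq ?_)
    filter_upwards [hev] with s hs'
    simp only [Function.comp, Φ, jetFst_jetExt hU hg hs']
    rfl
  have hyD : fderiv ℝ (fun y => (foldMatrixAt g i e y).det) u y = D := by
    have h7 : DifferentiableAt ℝ (fun y => (foldMatrixAt g i e y).det) u :=
      (contDiff_det.contDiffAt.comp u (contDiffAt_foldMatrixAt hU hg hu e)).differentiableAt
        (by simp)
    have h8 : HasFDerivAt (fun y => (foldMatrixAt g i e y).det)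
        (fderiv ℝ (fun y => (foldMatrixAt g i e y).det) u) (u + (0 : ℝ) • y) := by
      rw [hx0]; exact h7.hasFDerivAt
    have h9 := h8.comp_hasDerivAt (0 : ℝ) hx
    refine h9.unique ((hasFDerivAt_snd.comp_hasDerivAt (0 : ℝ) hy).congr_of_eventuallyEq ?_)
    filter_upwards [hev] with s hs'
    simp only [Function.comp, Φ, foldMatrixAt_eq_jet hU hg hs']
  -- as `y` preserves the minors to first order, it is a multiple of `v`
  obtain ⟨c, hc⟩ := exists_eq_smul_of_mulVec_eq_zero hsurj (v := v) (y := y)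
    (by simpa using hv0) hv hy1
  intro h0
  apply hD0
  have hyc : y = c • v := by
    ext k
    exact congrFun hc k
  rw [← hyD, hyc, map_smul, h0, smul_zero]

end

end

noncomputable section

section

variable {m : ℕ} {U : Set (Euc m)} {g : Euc m → Euc 2} {u : Euc m} {i : Fin m}

lemma hasDerivAt_eval_smul (v : Fin m → ℝ) (q : MvPolynomial (Fin m) ℝ) :
    HasDerivAt (fun t : ℝ => MvPolynomial.eval (t • v) q) (dirDeriv v q) 0 := by
  induction q using MvPolynomial.induction_on with
  | C a => simpa [dirDeriv] using hasDerivAt_const (0 : ℝ) a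
  | add p q hp hq =>
    rw [dirDeriv_add]
    exact (hp.add hq).congr_of_eventuallyEq (Eventually.of_forall fun t => by simp)
  | mul_X p l hp =>
    rw [dirDeriv_mul]
    have h1 : HasDerivAt (fun t : ℝ => t * v l) (v l) 0 := by
      simpa using (hasDerivAt_id (0 : ℝ)).mul_const (v l)
    have h2 : dirDeriv v (MvPolynomial.X l) = v l := by
      classical
      simp [dirDeriv, MvPolynomial.pderiv_X, Pi.single_apply]
    have h3 := hp.mul h1
    simp only [zero_smul, zero_mul, mul_zero, zero_add, map_mul, MvPolynomial.eval_X,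
      Pi.smul_apply, smul_eq_mul, h2, Pi.zero_apply] at h3 ⊢
    exact h3

lemma dirDeriv_pderiv_pderiv_jetPoly (hU : IsOpen U) (hg : ContDiffOn ℝ ∞ g U) (hu : u ∈ U)
    {k : ℕ} (hk : 3 ≤ k) (v : Fin m → ℝ) (l j : Fin m) (c : Fin 2) :
    dirDeriv v (MvPolynomial.pderiv l (MvPolynomial.pderiv j (jetPoly (jetExt k g u) c)))
      = (∑ a, v a • iterPartial [a, l, j] g u) c := by
  simp only [dirDeriv, WithLp.ofLp_sum, Finset.sum_apply, PiLp.smul_apply, smul_eq_mul]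
  refine Finset.sum_congr rfl fun a _ => ?_
  rw [← jetExt_multiIdxOfList hU hg hu [a, l, j] hk]
  congr 1
  exact eval_foldr_pderiv_jetPoly _ c [a, l, j] hk (by simp)

lemma dirDeriv_pderiv_jetPoly (hU : IsOpen U) (hg : ContDiffOn ℝ ∞ g U) (hu : u ∈ U)
    {k : ℕ} (hk : 2 ≤ k) (v : Fin m → ℝ) (j : Fin m) (c : Fin 2) :
    dirDeriv v (MvPolynomial.pderiv j (jetPoly (jetExt k g u) c))
      = (∑ a, v a • iterPartial [a, j] g u) c := by
  simp only [dirDeriv, WithLp.ofLp_sum, Finset.sum_apply, PiLp.smul_apply, smul_eq_mul]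
  refine Finset.sum_congr rfl fun a _ => ?_
  rw [← jetExt_multiIdxOfList hU hg hu [a, j] hk]
  congr 1
  exact eval_foldr_pderiv_jetPoly _ c [a, j] hk (by simp)

/-- The determinant of the fold matrix of the Taylor polynomial has the same derivative as that of
the map. -/
lemma dirDeriv_det_foldPoly (hU : IsOpen U) (hg : ContDiffOn ℝ ∞ g U) (hu : u ∈ U)
    {k : ℕ} (hk : 3 ≤ k) (e : Euc 2) (v : Euc m) :
    dirDeriv v (Matrix.det (Matrix.of fun j l =>
        MvPolynomial.pderiv l (foldPoly (jetPoly (jetExt k g u)) i e j)))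
      = fderiv ℝ (fun y => (foldMatrixAt g i e y).det) u v := by
  have hk1 : 1 ≤ k := by omega
  have hk2 : 2 ≤ k := by omega
  set z := jetExt k g u with hz
  have hx : HasDerivAt (fun s : ℝ => u + s • v) v 0 := by
    simpa using ((hasDerivAt_id (0 : ℝ)).smul_const v).const_add u
  have hx0 : u + (0 : ℝ) • v = u := by simp
  -- the matrices `A` of the Taylor polynomial and `B` of the map agree to first order at `u` along
  -- the line in direction `v`
  let A : ℝ → Fin m → Fin m → ℝ := fun t j l =>
    MvPolynomial.eval (t • v.ofLp) (MvPolynomial.pderiv l (foldPoly (jetPoly z) i e j))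
  let A' : Fin m → Fin m → ℝ := fun j l =>
    dirDeriv v (MvPolynomial.pderiv l (foldPoly (jetPoly z) i e j))
  let B : ℝ → Fin m → Fin m → ℝ := fun t j l => foldMatrixAt g i e (u + t • v) j l
  have hA : HasDerivAt A A' 0 := by
    rw [hasDerivAt_pi]
    intro j
    rw [hasDerivAt_pi]
    intro l
    exact hasDerivAt_eval_smul _ _
  have e1 : ∀ j c, MvPolynomial.eval 0 (MvPolynomial.pderiv j (jetPoly z c))
      = iterPartial [j] g u c := fun j c => by
    rw [eval_pderiv_jetPoly hk1, jetFst_jetExt hU hg hu]; rfl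
  have e2 : ∀ l j c, MvPolynomial.eval 0 (MvPolynomial.pderiv l (MvPolynomial.pderiv j
      (jetPoly z c))) = iterPartial [l, j] g u c := fun l j c => by
    rw [eval_pderiv_pderiv_jetPoly hk2, jetSnd_jetExt hU hg hu]; rfl
  have hB : HasDerivAt B A' 0 := by
    rw [hasDerivAt_pi]
    intro j
    rw [hasDerivAt_pi]
    intro l
    refine (hasDerivAt_foldMatrixAt (x := fun s : ℝ => u + s • v) hU hg hx (by rwa [hx0]) e
      j l).congr_deriv ?_
    rw [hx0]
    change _ = dirDeriv v (MvPolynomial.pderiv l (foldPoly (jetPoly z) i e j))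
    by_cases hj : j = i
    · rw [if_pos hj]
      simp only [foldPoly, if_pos hj, map_add, MvPolynomial.pderiv_C_mul]
      have hC : ∀ (r : ℝ) q, dirDeriv v (MvPolynomial.C r * q) = r * dirDeriv v q := fun r q => by
        rw [dirDeriv_mul, MvPolynomial.eval_C]
        simp [dirDeriv]
      rw [dirDeriv_add, hC, hC, hz]
      rw [dirDeriv_pderiv_jetPoly hU hg hu hk2, dirDeriv_pderiv_jetPoly hU hg hu hk2]
    · rw [if_neg hj]
      simp only [foldPoly, if_neg hj, map_sub, MvPolynomial.pderiv_mul, dirDeriv_sub, dirDeriv_add,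
        dirDeriv_mul, e1, e2]
      simp only [hz, dirDeriv_pderiv_jetPoly hU hg hu hk2,
        dirDeriv_pderiv_pderiv_jetPoly hU hg hu hk, cross]
      ring
  have hAB : A 0 = B 0 := by
    funext j l
    have := congrFun (gradZero_foldPoly (p := jetPoly z) (i := i) e (eval_pderiv_jetPoly hk1 z)
      (eval_pderiv_pderiv_jetPoly hk2 z) j) l
    rw [foldMatrixAt_eq_jet hU hg hu] at this
    simp only [A, B, zero_smul, add_zero]
    exact this
  have hdet := (contDiff_det (m := m)).differentiable (by simp)
  have h1 := (hdet (A 0)).hasFDerivAt.comp_hasDerivAt (0 : ℝ) hA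
  have h2 := (hdet (B 0)).hasFDerivAt.comp_hasDerivAt (0 : ℝ) hB
  have h3 : HasDerivAt (fun t : ℝ => MvPolynomial.eval (t • v.ofLp) (Matrix.det (Matrix.of
      fun j l => MvPolynomial.pderiv l (foldPoly (jetPoly z) i e j)))) _ 0 :=
    hasDerivAt_eval_smul v.ofLp _
  have h4 := h3.unique (h1.congr_of_eventuallyEq (Eventually.of_forall fun t => by
    exact RingHom.map_det (MvPolynomial.eval (t • v.ofLp)) _))
  have h5 : HasFDerivAt (fun y => (foldMatrixAt g i e y).det)
      (fderiv ℝ (fun y => (foldMatrixAt g i e y).det) u) (u + (0 : ℝ) • v) := by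
    rw [hx0]
    exact ((contDiff_det.contDiffAt.comp u (contDiffAt_foldMatrixAt hU hg hu e)).differentiableAt
        (by simp)).hasFDerivAt
  have h6 := (h5.comp_hasDerivAt (0 : ℝ) hx).unique h2
  rw [h4, h6, hAB]

/-- The singular points with singular fold matrix have Boardman symbol `(m - 1, 1, 0)`. -/
lemma IsSingularAt.jet_mem_cuspStratum (hs : IsSingularAt g i u) (hm : 2 ≤ m) (hU : IsOpen U)
    (hg : ContDiffOn ℝ ∞ g U) (hu : u ∈ U) (htr : JetTransverse g u)
    (hdet : (foldMatrixSelf g i u).det = 0) :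
    jetExt ([m - 1, 1, 0] : List ℕ).length g u ∈ jetStratum m 2 [m - 1, 1, 0] := by
  have hk : ([m - 1, 1, 0] : List ℕ).length = 3 := rfl
  have h1 := hs.idealRank_jet hU hg hu (k := ([m - 1, 1, 0] : List ℕ).length) (by simp)
  have h2 := hs.idealRank_criticalExtension_of_det_eq_zero hm hU hg hu htr
    (k := ([m - 1, 1, 0] : List ℕ).length) (by simp) hdet
  obtain ⟨v, hv0, hv⟩ := Matrix.exists_mulVec_eq_zero_iff.2 hdet
  have h3 := hs.fderiv_det_ne_zero hm hU hg hu htr hdet (v := WithLp.toLp 2 v)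
    (by simpa using hv0) (fun j _ => congrFun hv j)
  rw [← dirDeriv_det_foldPoly hU hg hu (k := ([m - 1, 1, 0] : List ℕ).length) (by simp)] at h3
  have h4 := idealRank_criticalExtension_eq_of_dirDeriv_ne_zero h2
    (hs.dirDeriv_eq_zero hU hg hu (by simp) hv)
    (jacobian_mem_criticalExtension h2 _ fun j => foldPoly_mem h1 (partialDeriv i g u) j) h3
  refine ⟨?_, h2, h4, trivial⟩
  simp only [jetIdeal] at h1
  omega

/-- The singular points with invertible fold matrix are the points with Boardman symbol
`(m - 1, 0)`. -/
lemma IsSingularAt.jet_mem_foldStratum_iff (hs : IsSingularAt g i u) (hm : 2 ≤ m) (hU : IsOpen U)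
    (hg : ContDiffOn ℝ ∞ g U) (hu : u ∈ U) (htr : JetTransverse g u) :
    jetExt ([m - 1, 0] : List ℕ).length g u ∈ jetStratum m 2 [m - 1, 0]
      ↔ (foldMatrixSelf g i u).det ≠ 0 := by
  have h1 := hs.idealRank_jet hU hg hu (k := ([m - 1, 0] : List ℕ).length) (by simp)
  constructor
  · rintro ⟨-, h2, -⟩ hdet
    have h3 := hs.idealRank_criticalExtension_of_det_eq_zero hm hU hg hu htr
      (k := ([m - 1, 0] : List ℕ).length) (by simp) hdet
    simp only [jetIdeal] at h3
    omega
  · intro hdet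
    refine ⟨?_, hs.idealRank_criticalExtension_of_det_ne_zero hU hg hu (by simp) hdet, trivial⟩
    simp only [jetIdeal] at h1
    omega

/-- A point whose jet is in the stratum of a symbol that starts like that of a fold. -/
lemma IsSingularAt.jet_mem_stratum (hs : IsSingularAt g i u) (hm : 2 ≤ m) (hU : IsOpen U)
    (hg : ContDiffOn ℝ ∞ g U) (hu : u ∈ U) (hdet : (foldMatrixSelf g i u).det ≠ 0) (n : ℕ) :
    jetExt ((m - 1) :: List.replicate n 0).length g u
      ∈ jetStratum m 2 ((m - 1) :: List.replicate n 0) := by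
  have h1 := hs.idealRank_jet hU hg hu (k := ((m - 1) :: List.replicate n 0).length) (by simp)
  refine ⟨?_, ?_⟩
  · simp only [jetIdeal] at h1
    omega
  · rcases Nat.eq_zero_or_pos n with rfl | hn
    · trivial
    · exact hasBoardmanSymbol_replicate (hs.idealRank_criticalExtension_of_det_ne_zero hU hg hu
        (by simp; omega) hdet) n

/-- The symbols of a fold point are the initial segments of `(m - 1, 0, 0, …)`. -/
lemma IsSingularAt.eq_of_jet_mem_stratum (hs : IsSingularAt g i u) (hU : IsOpen U)
    (hg : ContDiffOn ℝ ∞ g U) (hu : u ∈ U) (hdet : (foldMatrixSelf g i u).det ≠ 0) {I : List ℕ}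
    (hI : jetExt I.length g u ∈ jetStratum m 2 I) :
    I = [] ∨ ∃ n, I = (m - 1) :: List.replicate n 0 := by
  rcases I with _ | ⟨i₁, I⟩
  · exact Or.inl rfl
  · right
    have h1 := hs.idealRank_jet hU hg hu (k := (i₁ :: I).length) (by simp)
    obtain ⟨h2, h3⟩ := hI
    simp only [jetIdeal] at h1
    have : i₁ = m - 1 := by omega
    subst this
    refine ⟨I.length, ?_⟩
    rcases I with _ | ⟨i₂, I⟩
    · rfl
    · have h4 := hs.idealRank_criticalExtension_of_det_ne_zero hU hg hu
        (k := ((m - 1) :: i₂ :: I).length) (by simp) hdet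
      exact congrArg _ (h3.eq_replicate h4)

end

end

noncomputable section

/-! ### The singular curve in a chart -/

lemma eventually_pos_mul_of_deriv {p q : ℝ → ℝ} {p' q' : ℝ} (hp : HasDerivAt p p' 0)
    (hq : HasDerivAt q q' 0) (hp0 : p 0 = 0) (hq0 : q 0 = 0) (hp' : p' ≠ 0) (hq' : q' ≠ 0) :
    ∀ᶠ t in 𝓝[≠] (0 : ℝ), 0 < (p' * q') * (p t * q t) := by
  have h1 := hasDerivAt_iff_tendsto_slope_zero.1 hp
  have h2 := hasDerivAt_iff_tendsto_slope_zero.1 hq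
  have h3 := (h1.mul h2).const_mul (p' * q')
  have h4 : 0 < p' * q' * (p' * q') := mul_self_pos.2 (mul_ne_zero hp' hq')
  filter_upwards [h3.eventually (lt_mem_nhds h4), self_mem_nhdsWithin] with t ht ht0
  have ht0 : t ≠ 0 := ht0
  simp only [zero_add, hp0, hq0, sub_zero, smul_eq_mul] at ht
  have h5 : p' * q' * (p t * q t) = (p' * q' * (t⁻¹ * p t * (t⁻¹ * q t))) * t ^ 2 := by
    field_simp
  rw [h5]
  positivity

section

variable {m : ℕ} {U : Set (Euc m)} {g : Euc m → Euc 2} {u : Euc m} {i : Fin m}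

lemma contDiff_adjugate_entry (j l : Fin m) :
    ContDiff ℝ ∞ fun A : Fin m → Fin m → ℝ => (Matrix.of A).adjugate j l := by
  simp only [Matrix.adjugate_apply]
  have h1 : ContDiff ℝ ∞ fun A : Fin m → Fin m → ℝ =>
      (fun a b => (Matrix.of A).updateRow l (Pi.single j 1) a b) := by
    rw [contDiff_pi]
    intro a
    rw [contDiff_pi]
    intro b
    simp only [Matrix.updateRow_apply, Matrix.of_apply]
    split_ifs
    · exact contDiff_const
    · exact contDiff_apply_apply ℝ ℝ _ _
  exact contDiff_det.comp h1

/-- The map whose `j`-th component is the minor `∂ᵢg × ∂ⱼg` for `j ≠ i` and whose `i`-th component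
is the coordinate in direction `v`. -/
def singularChart (g : Euc m → Euc 2) (i : Fin m) (u v y : Euc m) : Euc m :=
  WithLp.toLp 2 fun j => if j = i then ∑ l, v l * (y l - u l) else minor g i j y

lemma contDiffAt_singularChart (hU : IsOpen U) (hg : ContDiffOn ℝ ∞ g U) (v : Euc m) {y : Euc m}
    (hy : y ∈ U) : ContDiffAt ℝ ∞ (singularChart g i u v) y := by
  rw [contDiffAt_euclidean]
  intro j
  by_cases hj : j = i
  · simp only [singularChart, hj, if_true]
    fun_prop
  · simp only [singularChart, hj, if_false]
    exact contDiffAt_minor hU hg hy j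

lemma fderiv_singularChart_apply (hU : IsOpen U) (hg : ContDiffOn ℝ ∞ g U) (v : Euc m) {y : Euc m}
    (hy : y ∈ U) (e : Euc 2) (w : Euc m) (j : Fin m) :
    fderiv ℝ (singularChart g i u v) y w j
      = if j = i then ∑ l, v l * w l else (foldMatrixAt g i e y).mulVec w j := by
  have h1 := ((contDiffAt_singularChart (u := u) (i := i) hU hg v hy).differentiableAt
    (by simp)).hasFDerivAt
  have hx : HasDerivAt (fun s : ℝ => y + s • w) w 0 := by
    simpa using ((hasDerivAt_id (0 : ℝ)).smul_const w).const_add y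
  have hx0 : y + (0 : ℝ) • w = y := by simp
  have h2 : HasFDerivAt (singularChart g i u v) (fderiv ℝ (singularChart g i u v) y)
      (y + (0 : ℝ) • w) := by rwa [hx0]
  have h3 := (h2.comp_hasDerivAt (0 : ℝ) hx).euc_apply j
  refine h3.unique ?_
  by_cases hj : j = i
  · simp only [Function.comp, singularChart, hj, if_true]
    refine HasDerivAt.fun_sum fun l _ => ?_
    refine ((hx.euc_apply l).sub_const (u l)).const_mul (v l) |>.congr_deriv ?_
    rfl
  · simp only [Function.comp, singularChart, hj, if_false]
    have := hasDerivAt_minor (i := i) (x := fun s : ℝ => y + s • w) hU hg hx (by rwa [hx0]) e hj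
    rwa [hx0] at this

/-- Near a singular point with transverse jets the singular set is a smooth curve `x`. The curve
has velocity `ρ ∂ᵢg` in the plane, and there is a direction `N` in the plane to the positive
side of which it runs, except possibly for the one moment at which it is singular. -/
theorem IsSingularAt.exists_curve (hs : IsSingularAt g i u) (hm : 2 ≤ m) (hU : IsOpen U)
    (hg : ContDiffOn ℝ ∞ g U) (hu : u ∈ U) (htr : JetTransverse g u) :
    ∃ (ε : ℝ) (x : ℝ → Euc m) (W : Set (Euc m)) (ρ : ℝ → ℝ) (π : Euc m → ℝ) (N : Euc 2),
      0 < ε ∧ IsOpen W ∧ W ⊆ U ∧ x 0 = u ∧ ContDiffOn ℝ ∞ x (Ioo (-ε) ε) ∧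
      (∀ y, y ∈ W ∧ ¬ Function.Surjective (fderiv ℝ g y) ↔ y ∈ x '' Ioo (-ε) ε) ∧
      ContDiff ℝ ∞ π ∧ (∀ t ∈ Ioo (-ε) ε, π (x t) = t) ∧
      (∀ t ∈ Ioo (-ε) ε, partialDeriv i g (x t) ≠ 0) ∧
      (∀ t ∈ Ioo (-ε) ε, HasDerivAt (g ∘ x) (ρ t • partialDeriv i g (x t)) t) ∧
      (∀ t ∈ Ioo (-ε) ε, t ≠ 0 → 0 < ρ t * cross (partialDeriv i g (x t)) N) ∧
      ((foldMatrixSelf g i u).det ≠ 0 → 0 < ρ 0 * cross (partialDeriv i g (x 0)) N) ∧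
      ((foldMatrixSelf g i u).det = 0 → ρ 0 = 0) := by
  have hm0 : 0 < m := by omega
  set e := partialDeriv i g u with he
  have hsurj := hs.surjective hm hU hg hu htr
  -- a nonzero vector killed by the differentials of the minors
  obtain ⟨v, hv0, hv⟩ : ∃ v : Euc m, v ≠ 0 ∧
      ∀ j, j ≠ i → (foldMatrixSelf g i u).mulVec v j = 0 := by
    have : ((foldMatrixSelf g i u).updateRow i 0).det = 0 :=
      Matrix.det_eq_zero_of_row_eq_zero i (by simp)
    obtain ⟨v, hv0, hv⟩ := Matrix.exists_mulVec_eq_zero_iff.2 this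
    refine ⟨WithLp.toLp 2 v, by simpa using hv0, fun j hj => ?_⟩
    have h1 := congrFun hv j
    simpa [Matrix.mulVec, Matrix.updateRow_ne hj] using h1
  -- the singular set is mapped to the `i`-th coordinate axis by a local diffeomorphism `G`
  set G := singularChart g i u v with hG
  have hGu : G u = 0 := by
    ext j
    by_cases hj : j = i
    · simp [hG, singularChart, hj]
    · simp [hG, singularChart, hj, hs.minor_eq_zero j]
  have hinj : Function.Injective (fderiv ℝ G u) := by
    rw [injective_iff_map_eq_zero]
    intro w hw
    have h1 : ∀ j, (if j = i then ∑ l, v l * w l else (foldMatrixSelf g i u).mulVec w j) = 0 := by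
      intro j
      rw [← fderiv_singularChart_apply hU hg v hu, hw]
      rfl
    obtain ⟨c, hc⟩ := exists_eq_smul_of_mulVec_eq_zero hsurj (v := v) (y := w)
      (by simpa using hv0) hv (fun j hj => by simpa [hj] using h1 j)
    have h2 := h1 i
    rw [if_pos rfl, hc] at h2
    have h3 : c * dotProduct v.ofLp v.ofLp = 0 := by
      rw [← h2, dotProduct, Finset.mul_sum]
      exact Finset.sum_congr rfl fun l _ => by simp; ring
    have h4 : dotProduct v.ofLp v.ofLp ≠ 0 := fun h => hv0 (by
      ext k; exact congrFun (dotProduct_self_eq_zero.1 h) k)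
    rw [(mul_eq_zero.1 h3).resolve_right h4, zero_smul] at hc
    ext k
    exact congrFun hc k
  let L : Euc m ≃L[ℝ] Euc m :=
    (LinearEquiv.ofInjectiveEndo (fderiv ℝ G u : Euc m →ₗ[ℝ] Euc m) hinj).toContinuousLinearEquiv
  have hL : (L : Euc m →L[ℝ] Euc m) = fderiv ℝ G u := by ext1 w; rfl
  have hGc : ContDiffAt ℝ ∞ G u := contDiffAt_singularChart hU hg v hu
  have hGd : HasFDerivAt G (L : Euc m →L[ℝ] Euc m) u := by
    rw [hL]
    exact (hGc.differentiableAt (by simp)).hasFDerivAt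
  let Φ := hGc.toOpenPartialHomeomorph G hGd (by simp)
  have hΦ : ∀ y, Φ y = G y := fun y => rfl
  have huΦ : u ∈ Φ.source := hGc.mem_toOpenPartialHomeomorph_source hGd (by simp)
  -- the neighbourhood on which everything is nondegenerate
  have hPc : ContinuousAt (partialDeriv i g) u :=
    ((hg.partialDeriv hU i).contDiffAt (hU.mem_nhds hu)).continuousAt
  have hfd : ContinuousAt (fderiv ℝ G) u :=
    (hGc.fderiv_right (m := ∞) (by norm_num)).continuousAt
  have hev : ∀ᶠ y in 𝓝 u, y ∈ U ∧ y ∈ Φ.source ∧ partialDeriv i g y ≠ 0 ∧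
      fderiv ℝ G y ∈ range ((↑) : (Euc m ≃L[ℝ] Euc m) → Euc m →L[ℝ] Euc m) := by
    refine (hU.eventually_mem hu).and ((Φ.open_source.eventually_mem huΦ).and
      ((hPc.eventually_ne hs.ne_zero).and (hfd.eventually_mem ?_)))
    rw [← hL]
    exact ContinuousLinearEquiv.nhds L
  obtain ⟨W₀, hW₀, hW₀o, huW₀⟩ := eventually_nhds_iff.1 hev
  set x : ℝ → Euc m := fun t => Φ.symm (t • EuclideanSpace.single i (1 : ℝ)) with hx
  have hx0 : x 0 = u := by
    simp only [hx, zero_smul]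
    rw [← hGu, ← hΦ, Φ.left_inv huΦ]
  have h0t : (0 : ℝ) • EuclideanSpace.single i (1 : ℝ) ∈ Φ.target := by
    rw [zero_smul, ← hGu, ← hΦ]
    exact Φ.map_source huΦ
  have hline : Continuous fun t : ℝ => t • EuclideanSpace.single i (1 : ℝ) := by fun_prop
  have hxc : ContinuousAt x 0 :=
    (Φ.continuousAt_symm h0t).comp (f := fun t : ℝ => t • EuclideanSpace.single i (1 : ℝ))
      hline.continuousAt
  have hxev : ∀ᶠ t in 𝓝 (0 : ℝ), t • EuclideanSpace.single i (1 : ℝ) ∈ Φ.target ∧ x t ∈ W₀ :=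
    (hline.continuousAt.eventually_mem (Φ.open_target.mem_nhds h0t)).and
      (hxc.eventually_mem (hW₀o.mem_nhds (by rwa [hx0])))
  have hGx : ∀ t, t • EuclideanSpace.single i (1 : ℝ) ∈ Φ.target →
      G (x t) = t • EuclideanSpace.single i (1 : ℝ) := fun t ht => by
    rw [← hΦ]; exact Φ.right_inv ht
  have hxsm : ∀ t, t • EuclideanSpace.single i (1 : ℝ) ∈ Φ.target → x t ∈ W₀ →
      ContDiffAt ℝ ∞ x t := by
    intro t ht hxt
    obtain ⟨L', hL'⟩ := (hW₀ _ hxt).2.2.2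
    have h1 : ContDiffAt ℝ ∞ G (x t) := contDiffAt_singularChart hU hg v (hW₀ _ hxt).1
    have h2 : HasFDerivAt Φ (L' : Euc m →L[ℝ] Euc m)
        (Φ.symm (t • EuclideanSpace.single i (1 : ℝ))) := by
      rw [hL']
      exact (h1.differentiableAt (by simp)).hasFDerivAt
    have h3 : ContDiffAt ℝ ∞ Φ.symm (t • EuclideanSpace.single i (1 : ℝ)) :=
      Φ.contDiffAt_symm ht h2 h1
    exact h3.comp t (f := fun t : ℝ => t • EuclideanSpace.single i (1 : ℝ))
      (contDiff_id.smul contDiff_const).contDiffAt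
  set π : Euc m → ℝ := fun y => ∑ l, v l * (y l - u l) with hπ
  have hπc : ContDiff ℝ ∞ π := by
    rw [hπ]
    fun_prop
  have hGi : ∀ y, G y i = π y := fun y => by simp [hG, singularChart, hπ]
  have hGj : ∀ y j, j ≠ i → G y j = minor g i j y := fun y j hj => by
    simp [hG, singularChart, hj]
  have hπx : ∀ t, t • EuclideanSpace.single i (1 : ℝ) ∈ Φ.target → π (x t) = t := fun t ht => by
    rw [← hGi, hGx t ht]; simp
  have hmx : ∀ t, t • EuclideanSpace.single i (1 : ℝ) ∈ Φ.target → ∀ j,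
      minor g i j (x t) = 0 := by
    intro t ht j
    by_cases hj : j = i
    · subst hj; simp only [minor, cross]; ring
    · rw [← hGj _ _ hj, hGx t ht]; simp [hj]
  -- the velocity in the plane
  set E : ℝ → Euc 2 := fun t => partialDeriv i g (x t) with hE
  set ρ : ℝ → ℝ := fun t => (E t 0 * deriv (g ∘ x) t 0 + E t 1 * deriv (g ∘ x) t 1) /
    (E t 0 ^ 2 + E t 1 ^ 2) with hρ
  have hgx : ∀ t, t • EuclideanSpace.single i (1 : ℝ) ∈ Φ.target → x t ∈ W₀ →
      HasDerivAt (g ∘ x) (∑ l, deriv x t l • partialDeriv l g (x t)) t := by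
    intro t ht hxt
    exact hasDerivAt_comp_partial hU hg ((hxsm t ht hxt).differentiableAt (by simp)).hasDerivAt
      (hW₀ _ hxt).1 []
  have hβ : ∀ t, t • EuclideanSpace.single i (1 : ℝ) ∈ Φ.target → x t ∈ W₀ →
      HasDerivAt (g ∘ x) (ρ t • E t) t := by
    intro t ht hxt
    have h1 := hgx t ht hxt
    have h2 : cross (E t) (∑ l, deriv x t l • partialDeriv l g (x t)) = 0 := by
      rw [cross_sum_right]
      exact Finset.sum_eq_zero fun j _ => by
        have := hmx t ht j
        unfold minor at this
        rw [this, mul_zero]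
    have h3 := eq_smul_of_cross_eq_zero (hW₀ _ hxt).2.2.1 h2
    have h4 := h1.deriv
    simp only [hρ, h4]
    rwa [← h3]
  have hxd0 : HasDerivAt x (deriv x 0) 0 :=
    ((hxsm 0 h0t (by rwa [hx0])).differentiableAt (by simp)).hasDerivAt
  have hx'0 : deriv x 0 ≠ 0 := by
    intro h0
    have h1 : HasFDerivAt π (fderiv ℝ π (x 0)) (x 0) :=
      (hπc.differentiable (by simp) _).hasFDerivAt
    have h2 := h1.comp_hasDerivAt (0 : ℝ) hxd0
    rw [h0, map_zero] at h2
    have h3 : HasDerivAt (π ∘ x) 1 0 :=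
      (hasDerivAt_id (0 : ℝ)).congr_of_eventuallyEq (hxev.mono fun t ht => hπx t ht.1)
    exact zero_ne_one (h2.unique h3)
  have hx'k : ∀ j, j ≠ i → (foldMatrixSelf g i u).mulVec (deriv x 0).ofLp j = 0 := by
    intro j hj
    have h1 := hasDerivAt_minor hU hg hxd0 (by rwa [hx0]) e hj
    rw [hx0] at h1
    exact h1.unique ((hasDerivAt_const (0 : ℝ) (0 : ℝ)).congr_of_eventuallyEq
      (hxev.mono fun t ht => hmx t ht.1 j))
  -- only the `i`-th entry of the image of the velocity under the fold matrix may be nonzero, and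
  -- it is a multiple of `ρ`
  have hNx : ∀ t, t • EuclideanSpace.single i (1 : ℝ) ∈ Φ.target → x t ∈ W₀ → ∀ j,
      (foldMatrixAt g i e (x t)).mulVec (deriv x t).ofLp j
        = if j = i then ρ t * (e 0 * E t 0 + e 1 * E t 1) else 0 := by
    intro t ht hxt j
    have hxd := ((hxsm t ht hxt).differentiableAt (by simp)).hasDerivAt
    by_cases hj : j = i
    · rw [if_pos hj, hj, foldMatrixAt, foldMatrix_mulVec_self,
        (hgx t ht hxt).unique (hβ t ht hxt)]
      simp only [PiLp.smul_apply, smul_eq_mul]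
      ring
    · rw [if_neg hj]
      have h1 := hasDerivAt_minor hU hg hxd (hW₀ _ hxt).1 e hj
      refine h1.unique ((hasDerivAt_const t (0 : ℝ)).congr_of_eventuallyEq ?_)
      have : ∀ᶠ s in 𝓝 t, s • EuclideanSpace.single i (1 : ℝ) ∈ Φ.target :=
        hline.continuousAt.eventually_mem (Φ.open_target.mem_nhds ht)
      exact this.mono fun s hs => hmx s hs j
  have he2 : e 0 * e 0 + e 1 * e 1 ≠ 0 := by
    intro h0
    apply hs.ne_zero
    ext k
    fin_cases k
    · simp; nlinarith [sq_nonneg (e 0), sq_nonneg (e 1)]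
    · simp; nlinarith [sq_nonneg (e 0), sq_nonneg (e 1)]
  have hE0 : E 0 = e := by simp only [hE, hx0, he]
  have hEd : HasDerivAt E (∑ k, deriv x 0 k • partialDeriv k (partialDeriv i g) u) 0 := by
    have := hasDerivAt_comp_partial hU hg hxd0 (by rwa [hx0]) [i]
    rwa [hx0] at this
  have hβd : ContDiffAt ℝ ∞ (g ∘ x) 0 := by
    refine ContDiffAt.comp 0 ?_ (hxsm 0 h0t (by rwa [hx0]))
    rw [hx0]
    exact hg.contDiffAt (hU.mem_nhds hu)
  have hρd : DifferentiableAt ℝ ρ 0 := by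
    have h1 : DifferentiableAt ℝ (deriv (g ∘ x)) 0 := by
      have : ContDiffAt ℝ ∞ (deriv (g ∘ x)) 0 :=
        (hβd.fderiv_right (m := ∞) (by norm_num)).clm_apply contDiffAt_const
      exact this.differentiableAt (by simp)
    have h2 := fun k => (h1.hasDerivAt.euc_apply k).differentiableAt
    have h3 := fun k => (hEd.euc_apply k).differentiableAt
    refine DifferentiableAt.fun_div (((h3 0).mul (h2 0)).add ((h3 1).mul (h2 1)))
      (((h3 0).pow 2).add ((h3 1).pow 2)) ?_
    intro h
    simp only [hE0] at h
    apply he2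
    rw [← h]
    ring
  -- the choice of the direction in the plane
  obtain ⟨N, hN⟩ : ∃ N : Euc 2, (∀ᶠ t in 𝓝[≠] (0 : ℝ), 0 < ρ t * cross (E t) N) ∧
      ((foldMatrixSelf g i u).det ≠ 0 → 0 < ρ 0 * cross (E 0) N) ∧
      ((foldMatrixSelf g i u).det = 0 → ρ 0 = 0) := by
    by_cases hdet : (foldMatrixSelf g i u).det = 0
    · obtain ⟨v', hv'0, hv'⟩ := Matrix.exists_mulVec_eq_zero_iff.2 hdet
      obtain ⟨c, hc⟩ := exists_eq_smul_of_mulVec_eq_zero hsurj hv'0 (fun j _ => congrFun hv' j) hx'k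
      have hk : (foldMatrixSelf g i u).mulVec (deriv x 0).ofLp = 0 := by
        rw [hc, Matrix.mulVec_smul, hv', smul_zero]
      have hρ0 : ρ 0 = 0 := by
        have h1 := hNx 0 h0t (by rwa [hx0]) i
        rw [if_pos rfl, hx0, hE0] at h1
        have h2 := congrFun hk i
        change (foldMatrixAt g i e u).mulVec (deriv x 0).ofLp i = 0 at h2
        rw [h2] at h1
        exact (mul_eq_zero.1 h1.symm).resolve_right he2
      have hcr : cross e (∑ k, deriv x 0 k • partialDeriv k (partialDeriv i g) u) ≠ 0 :=
        cross_ne_zero_of_kernel (a := fun j => partialDeriv j g u)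
          (h := fun l j => partialDeriv l (partialDeriv j g) u) hs.ne_zero hs.minor_eq_zero hsurj
          (fun l j => partialDeriv_comm hU hg l j hu) (by simpa using hx'0) hk
      -- Multiplying by the adjugate, the product of the determinant and a nonzero component of the
      -- velocity is a multiple of `ρ`. As the former has a simple zero, so has `ρ`.
      have hρ' : deriv ρ 0 ≠ 0 := by
        intro h0
        obtain ⟨l, hl⟩ : ∃ l, deriv x 0 l ≠ 0 := by
          by_contra! h'
          exact hx'0 (by ext l; exact h' l)
        have hNd : ContDiffAt ℝ ∞ (fun t j l => foldMatrixAt g i e (x t) j l) 0 := by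
          refine ContDiffAt.comp (g := fun y j l => foldMatrixAt g i e y j l) 0 ?_
            (hxsm 0 h0t (by rwa [hx0]))
          rw [hx0]
          exact contDiffAt_foldMatrixAt hU hg hu e
        have hx'd : DifferentiableAt ℝ (fun t => deriv x t l) 0 := by
          have : ContDiffAt ℝ ∞ (deriv x) 0 :=
            ((hxsm 0 h0t (by rwa [hx0])).fderiv_right (m := ∞) (by norm_num)).clm_apply
              contDiffAt_const
          exact ((this.differentiableAt (by simp)).hasDerivAt.euc_apply l).differentiableAt
        have had : DifferentiableAt ℝ (fun t => (foldMatrixAt g i e (x t)).adjugate l i) 0 :=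
          ((contDiff_adjugate_entry l i).contDiffAt.comp 0 hNd).differentiableAt (by simp)
        have hdd : HasDerivAt (fun t => (foldMatrixAt g i e (x t)).det)
            (fderiv ℝ (fun y => (foldMatrixAt g i e y).det) u (deriv x 0)) 0 := by
          have h1 : DifferentiableAt ℝ (fun y => (foldMatrixAt g i e y).det) u :=
            (contDiff_det.contDiffAt.comp u (contDiffAt_foldMatrixAt hU hg hu e)).differentiableAt
              (by simp)
          have h2 := h1.hasFDerivAt
          rw [← hx0] at h2
          have h3 := h2.comp_hasDerivAt (0 : ℝ) hxd0
          rwa [hx0] at h3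
        have hEdd : DifferentiableAt ℝ (fun t => e 0 * E t 0 + e 1 * E t 1) 0 :=
          (((hEd.euc_apply 0).const_mul (e 0)).add
            ((hEd.euc_apply 1).const_mul (e 1))).differentiableAt
        have hl1 := hdd.mul hx'd.hasDerivAt
        have hl2 := hρd.hasDerivAt.mul (hEdd.mul had).hasDerivAt
        have hdet0 : (foldMatrixAt g i e (x 0)).det = 0 := by rw [hx0]; exact hdet
        simp only [hdet0, zero_mul, add_zero, h0, hρ0] at hl1 hl2
        have h1 := hl1.unique (hl2.congr_of_eventuallyEq (hxev.mono fun t ht => ?_))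
        · have h2 := hs.fderiv_det_ne_zero hm hU hg hu htr hdet hx'0 hx'k
          exact (mul_ne_zero h2 hl) h1
        · have h2 : (foldMatrixAt g i e (x t)).adjugate.mulVec
              ((foldMatrixAt g i e (x t)).mulVec (deriv x t).ofLp) l
              = (foldMatrixAt g i e (x t)).det * deriv x t l := by
            rw [Matrix.mulVec_mulVec, Matrix.adjugate_mul, Matrix.smul_mulVec, Matrix.one_mulVec]
            rfl
          simp only [Pi.mul_apply]
          rw [← h2]
          have h3 : (foldMatrixAt g i e (x t)).mulVec (deriv x t).ofLp
              = Pi.single i (ρ t * (e 0 * E t 0 + e 1 * E t 1)) := by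
            funext j
            rw [hNx t ht.1 ht.2 j, Pi.single_apply]
          rw [h3, Matrix.mulVec_single]
          simp
          ring
      have hq : HasDerivAt (fun t => cross e (E t))
          (cross e (∑ k, deriv x 0 k • partialDeriv k (partialDeriv i g) u)) 0 := by
        refine ((hasDerivAt_const (0 : ℝ) e).cross hEd).congr_deriv ?_
        simp [cross]
      -- both `ρ` and the component of `E` normal to `e` have a simple zero, so that their product
      -- keeps its sign
      have h1 := eventually_pos_mul_of_deriv hρd.hasDerivAt hq hρ0
        (by rw [hE0]; simp only [cross]; ring) hρ' hcr
      refine ⟨-(deriv ρ 0 * cross e (∑ k, deriv x 0 k • partialDeriv k (partialDeriv i g) u)) • e,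
        h1.mono fun t ht => ?_, fun h => absurd hdet h, fun _ => hρ0⟩
      refine ht.trans_eq ?_
      simp only [cross, PiLp.smul_apply, smul_eq_mul]
      ring
    · have hρ0 : ρ 0 ≠ 0 := by
        intro h0
        apply hdet
        refine Matrix.exists_mulVec_eq_zero_iff.1 ⟨(deriv x 0).ofLp, by simpa using hx'0, ?_⟩
        funext j
        have h1 := hNx 0 h0t (by rwa [hx0]) j
        rw [h0, zero_mul, ite_self, hx0] at h1
        exact h1
      obtain ⟨w, hw⟩ := exists_cross_eq_one hs.ne_zero
      have hpos : 0 < ρ 0 * cross (E 0) (ρ 0 • w) := by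
        have : ρ 0 * cross (E 0) (ρ 0 • w) = ρ 0 ^ 2 * cross e w := by
          rw [hE0]
          simp only [cross, PiLp.smul_apply, smul_eq_mul]
          ring
        rw [this, hw]
        positivity
      refine ⟨ρ 0 • w, ?_, fun _ => hpos, fun h => absurd h hdet⟩
      have hc : ContinuousAt (fun t => ρ t * cross (E t) (ρ 0 • w)) 0 :=
        hρd.continuousAt.mul (hEd.cross (hasDerivAt_const (0 : ℝ) (ρ 0 • w))).continuousAt
      exact (hc.eventually (lt_mem_nhds hpos)).filter_mono nhdsWithin_le_nhds
  obtain ⟨hN1, hN2, hN3⟩ := hN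
  rw [eventually_nhdsWithin_iff] at hN1
  obtain ⟨ε, hε, hball⟩ := Metric.eventually_nhds_iff.1 (hxev.and hN1)
  have hIoo : ∀ t ∈ Ioo (-ε) ε, dist t 0 < ε := fun t ht => by
    rw [Real.dist_eq, sub_zero, abs_lt]; exact ht
  refine ⟨ε, x, W₀ ∩ {y | π y ∈ Ioo (-ε) ε}, ρ, π, N, hε,
    hW₀o.inter (isOpen_Ioo.preimage hπc.continuous), fun y hy => (hW₀ y hy.1).1, hx0,
    fun t ht => ?_, fun y => ⟨?_, ?_⟩, hπc, fun t ht => ?_, fun t ht => ?_, fun t ht => ?_,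
    fun t ht ht0 => ?_, hN2, hN3⟩
  · have := hball (hIoo t ht)
    exact (hxsm t this.1.1 this.1.2).contDiffWithinAt
  · rintro ⟨⟨hy, hyπ⟩, hys⟩
    have h1 := (surjective_iff_minor (hW₀ y hy).2.2.1).1 hys
    refine ⟨π y, hyπ, ?_⟩
    have h2 : G y = π y • EuclideanSpace.single i (1 : ℝ) := by
      ext j
      by_cases hj : j = i
      · rw [hj, hGi]; simp
      · rw [hGj _ _ hj, h1 j]; simp [hj]
    simp only [hx]
    rw [← h2, ← hΦ, Φ.left_inv (hW₀ y hy).2.1]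
  · rintro ⟨t, ht, rfl⟩
    have := hball (hIoo t ht)
    refine ⟨⟨this.1.2, ?_⟩, ?_⟩
    · rw [mem_ofPred_eq, hπx t this.1.1]; exact ht
    · exact (surjective_iff_minor (hW₀ _ this.1.2).2.2.1).2 (hmx t this.1.1)
  · exact hπx t (hball (hIoo t ht)).1.1
  · exact (hW₀ _ (hball (hIoo t ht)).1.2).2.2.1
  · exact hβ t (hball (hIoo t ht)).1.1 (hball (hIoo t ht)).1.2
  · exact (hball (hIoo t ht)).2 ht0

end

end

noncomputable section

/-! ### Passage to the manifold -/

lemma differential_eq {m n : ℕ} {M : Type*} [TopologicalSpace M] [ChartedSpace (Euc m) M]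
    {f : M → Euc n} (hf : ContMDiff (𝓡 m) (𝓡 n) ∞ f) (p : M) :
    differential m f p = fderiv ℝ (localRep m f p) (extChartAt (𝓡 m) p p) := by
  have h1 : MDifferentiableAt (𝓡 m) (𝓡 n) f p := (hf p).mdifferentiableAt (by simp)
  have h2 : localRep m f p = writtenInExtChartAt (𝓡 m) (𝓡 n) p f := by
    simp [writtenInExtChartAt, localRep]
    rfl
  rw [h2, ← fderivWithin_univ, ← ModelWithCorners.range_eq_univ (𝓡 m)]
  exact h1.mfderiv

section

variable {m : ℕ} {n : ℕ} {M : Type*} [TopologicalSpace M] [ChartedSpace (Euc m) M]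
  [IsManifold (𝓡 m) ∞ M] {f : M → Euc n}

lemma contDiffOn_localRep (hf : ContMDiff (𝓡 m) (𝓡 n) ∞ f) (p : M) :
    ContDiffOn ℝ ∞ (localRep m f p) (extChartAt (𝓡 m) p).target := by
  rw [← contMDiffOn_iff_contDiffOn]
  exact hf.comp_contMDiffOn (contMDiffOn_extChartAt_symm p)

lemma mfderiv_eq_comp (hf : ContMDiff (𝓡 m) (𝓡 n) ∞ f) {p y : M}
    (hy : y ∈ (extChartAt (𝓡 m) p).source) :
    mfderiv (𝓡 m) (𝓡 n) f y
      = (fderiv ℝ (localRep m f p) (extChartAt (𝓡 m) p y)).comp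
        (mfderiv (𝓡 m) 𝓘(ℝ, Euc m) (extChartAt (𝓡 m) p) y) := by
  have h1 : f =ᶠ[𝓝 y] localRep m f p ∘ extChartAt (𝓡 m) p := by
    filter_upwards [(isOpen_extChartAt_source p).mem_nhds hy] with z hz
    exact (congrArg f ((extChartAt (𝓡 m) p).left_inv hz)).symm
  rw [h1.mfderiv_eq, ← mfderiv_eq_fderiv]
  have h2 : ContDiffAt ℝ ∞ (localRep m f p) (extChartAt (𝓡 m) p y) :=
    (contDiffOn_localRep hf p).contDiffAt
      ((isOpen_extChartAt_target p).mem_nhds ((extChartAt (𝓡 m) p).map_source hy))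
  refine mfderiv_comp y (I' := 𝓘(ℝ, Euc m)) (h2.differentiableAt (by simp)).mdifferentiableAt ?_
  exact mdifferentiableAt_extChartAt (by simpa using hy)

lemma range_mfderiv_eq (hf : ContMDiff (𝓡 m) (𝓡 n) ∞ f) {p y : M}
    (hy : y ∈ (extChartAt (𝓡 m) p).source) :
    range (mfderiv (𝓡 m) (𝓡 n) f y)
      = range (fderiv ℝ (localRep m f p) (extChartAt (𝓡 m) p y)) := by
  rw [mfderiv_eq_comp hf hy]
  have h1 := isInvertible_mfderiv_extChartAt (I := 𝓡 m) hy
  have h2 : Function.Surjective (mfderiv (𝓡 m) 𝓘(ℝ, Euc m) (extChartAt (𝓡 m) p) y) := by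
    obtain ⟨e, he⟩ := h1
    rw [← he]
    exact e.surjective
  exact h2.range_comp _

lemma mem_singularSet_iff (hf : ContMDiff (𝓡 m) (𝓡 n) ∞ f) {p y : M}
    (hy : y ∈ (extChartAt (𝓡 m) p).source) :
    y ∈ singularSet m f
      ↔ ¬ Function.Surjective (fderiv ℝ (localRep m f p) (extChartAt (𝓡 m) p y)) := by
  rw [← range_eq_univ, ← range_mfderiv_eq hf hy]
  exact not_congr range_eq_univ.symm

/-- The subspace `d_y f (T_y S)` is spanned by the velocities of the images of the smooth curves
in `S` through `y`. -/
lemma imageTangent_eq (hf : ContMDiff (𝓡 m) (𝓡 n) ∞ f) (S : Set M) (y : M) :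
    imageTangent m f S y = Submodule.span ℝ {w | ∃ δ : ℝ → M,
      ContMDiffAt 𝓘(ℝ, ℝ) (𝓡 m) ∞ δ 0 ∧ δ 0 = y ∧ (∀ᶠ t in 𝓝 (0 : ℝ), δ t ∈ S) ∧
      HasDerivAt (f ∘ δ) w 0} := by
  have hg : HasFDerivAt (localRep m f y) (differential m f y) (extChartAt (𝓡 m) y y) := by
    rw [differential_eq hf]
    exact (((contDiffOn_localRep hf y).contDiffAt ((isOpen_extChartAt_target y).mem_nhds
      (mem_extChartAt_target y))).differentiableAt (by simp)).hasFDerivAt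
  rw [imageTangent, tangentOf, tangentSpan, Submodule.map_span]
  congr 1
  ext w
  constructor
  · rintro ⟨v, ⟨c, hc, hc0, hcS, rfl⟩, rfl⟩
    refine ⟨(extChartAt (𝓡 m) y).symm ∘ c, ?_, ?_, ?_, ?_⟩
    · have h1 : ContMDiffAt 𝓘(ℝ, Euc m) (𝓡 m) ∞ (extChartAt (𝓡 m) y).symm (c 0) := by
        rw [hc0]
        exact (contMDiffOn_extChartAt_symm y).contMDiffAt
          ((isOpen_extChartAt_target y).mem_nhds (mem_extChartAt_target y))
      exact h1.comp 0 hc.contMDiffAt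
    · simp [hc0]
    · exact hcS.mono fun t ht => ht.2
    · rw [← hc0] at hg
      exact hg.comp_hasDerivAt (0 : ℝ) (hc.differentiableAt (by simp)).hasDerivAt
  · rintro ⟨δ, hδ, hδ0, hδS, hw⟩
    have h1 : ContMDiffAt 𝓘(ℝ, ℝ) 𝓘(ℝ, Euc m) ∞ (extChartAt (𝓡 m) y ∘ δ) 0 := by
      refine ContMDiffAt.comp 0 ?_ hδ
      rw [hδ0]
      exact contMDiffAt_extChartAt
    have hc : ContDiffAt ℝ ∞ (extChartAt (𝓡 m) y ∘ δ) 0 := h1.contDiffAt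
    have hsrc : ∀ᶠ t in 𝓝 (0 : ℝ), δ t ∈ (extChartAt (𝓡 m) y).source :=
      hδ.continuousAt.eventually_mem (by
        rw [hδ0]; exact (isOpen_extChartAt_source y).mem_nhds (mem_extChartAt_source y))
    refine ⟨deriv (extChartAt (𝓡 m) y ∘ δ) 0, ⟨_, hc, by simp [hδ0], ?_, rfl⟩, ?_⟩
    · filter_upwards [hsrc, hδS] with t ht htS
      refine ⟨(extChartAt (𝓡 m) y).map_source ht, ?_⟩
      rw [mem_preimage, Function.comp_apply, (extChartAt (𝓡 m) y).left_inv ht]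
      exact htS
    · have h2 : HasFDerivAt (localRep m f y) (differential m f y)
          ((extChartAt (𝓡 m) y ∘ δ) 0) := by
        rw [Function.comp_apply, hδ0]; exact hg
      have h3 := h2.comp_hasDerivAt (0 : ℝ) (hc.differentiableAt (by simp)).hasDerivAt
      refine h3.unique (hw.congr_of_eventuallyEq ?_)
      filter_upwards [hsrc] with t ht
      exact congrArg f ((extChartAt (𝓡 m) y).left_inv ht)

lemma imageTangent_mono_of_nhds (hf : ContMDiff (𝓡 m) (𝓡 n) ∞ f) {S S' : Set M} {y : M}
    (h : ∀ᶠ z in 𝓝 y, z ∈ S → z ∈ S') : imageTangent m f S y ≤ imageTangent m f S' y := by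
  rw [imageTangent_eq hf, imageTangent_eq hf]
  refine Submodule.span_mono ?_
  rintro w ⟨δ, hδ, hδ0, hδS, hw⟩
  refine ⟨δ, hδ, hδ0, ?_, hw⟩
  have h1 : ∀ᶠ t in 𝓝 (0 : ℝ), δ t ∈ S → δ t ∈ S' :=
    hδ.continuousAt.eventually (by rwa [hδ0])
  filter_upwards [h1, hδS] with t ht hts using ht hts

end

/-! ### Branches of the singular set -/

/-- A smooth parametrization `γ` of a piece of the singular set by an open interval around `0`.
The function `π` is a smooth left inverse of it. Its image in the plane has velocity `ρ E`, where
`E` spans the image of the differential of `f`, and the linear function `cross · N` of the plane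
increases along the image. The image may be singular at the time `0` only. -/
structure SingularBranch (m : ℕ) {M : Type*} [TopologicalSpace M] [ChartedSpace (Euc m) M]
    (f : M → Euc 2) (p : M) where
  ε : ℝ
  γ : ℝ → M
  U : Set M
  π : M → ℝ
  ρ : ℝ → ℝ
  E : ℝ → Euc 2
  N : Euc 2
  pos : 0 < ε
  zero : γ 0 = p
  isOpen : IsOpen U
  smooth : ∀ t ∈ Ioo (-ε) ε, ContMDiffAt 𝓘(ℝ, ℝ) (𝓡 m) ∞ γ t
  mem_iff : ∀ y, y ∈ U ∧ y ∈ singularSet m f ↔ y ∈ γ '' Ioo (-ε) ε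
  smooth_π : ∀ y ∈ U, ContMDiffAt (𝓡 m) 𝓘(ℝ, ℝ) ∞ π y
  π_γ : ∀ t ∈ Ioo (-ε) ε, π (γ t) = t
  continuousAt : ∀ t ∈ Ioo (-ε) ε, ContinuousAt E t
  mem_range : ∀ t ∈ Ioo (-ε) ε, E t ∈ range (mfderiv (𝓡 m) (𝓡 2) f (γ t))
  hasDerivAt : ∀ t ∈ Ioo (-ε) ε, HasDerivAt (f ∘ γ) (ρ t • E t) t
  cross_pos : ∀ t ∈ Ioo (-ε) ε, t ≠ 0 → 0 < cross (ρ t • E t) N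
  cross_zero : 0 < cross (ρ 0 • E 0) N ∨ ρ 0 = 0
  ne_zero : ∀ t ∈ Ioo (-ε) ε, E t ≠ 0
  tangent : ∀ t ∈ Ioo (-ε) ε, imageTangent m f (singularSet m f) (γ t)
    = Submodule.span ℝ {ρ t • E t}

lemma IsGenericMap.jetTransverse {m : ℕ} {M : Type*} [TopologicalSpace M]
    [ChartedSpace (Euc m) M] {f : M → Euc 2} (hf : IsGenericMap m f) (p : M) :
    JetTransverse (localRep m f p) (extChartAt (𝓡 m) p p) := fun I hI => hf.2.1 I p hI

section

variable {m : ℕ} {M : Type*} [TopologicalSpace M] [ChartedSpace (Euc m) M]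
  [IsManifold (𝓡 m) ∞ M] {f : M → Euc 2}

lemma IsGenericMap.exists_ne_zero (hf : IsGenericMap m f) (hm : 2 ≤ m) (p : M) :
    ∃ i, partialDeriv i (localRep m f p) (extChartAt (𝓡 m) p p) ≠ 0 :=
  exists_partialDeriv_ne_zero hm (isOpen_extChartAt_target p) (contDiffOn_localRep hf.1 p)
    (mem_extChartAt_target p) (hf.jetTransverse p)

lemma IsGenericMap.exists_isSingularAt (hf : IsGenericMap m f) (hm : 2 ≤ m) {p : M}
    (hp : p ∈ singularSet m f) :
    ∃ i, IsSingularAt (localRep m f p) i (extChartAt (𝓡 m) p p) := by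
  obtain ⟨i, hi⟩ := hf.exists_ne_zero hm p
  exact ⟨i, hi, (surjective_iff_minor hi).1
    ((mem_singularSet_iff hf.1 (mem_extChartAt_source p)).1 hp)⟩

lemma IsGenericMap.isClosed_singularSet (hf : IsGenericMap m f) (hm : 2 ≤ m) :
    IsClosed (singularSet m f) := by
  rw [← isOpen_compl_iff, isOpen_iff_mem_nhds]
  intro p hp
  obtain ⟨i, hi⟩ := hf.exists_ne_zero hm p
  have hU := isOpen_extChartAt_target (I := 𝓡 m) p
  have hg := contDiffOn_localRep hf.1 p
  have hu := mem_extChartAt_target (I := 𝓡 m) p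
  rw [mem_compl_iff, mem_singularSet_iff hf.1 (mem_extChartAt_source p),
    surjective_iff_minor hi, not_forall] at hp
  obtain ⟨j, hj⟩ := hp
  have h1 : ∀ᶠ u in 𝓝 (extChartAt (𝓡 m) p p), partialDeriv i (localRep m f p) u ≠ 0 ∧
      minor (localRep m f p) i j u ≠ 0 :=
    (((hg.partialDeriv hU i).contDiffAt (hU.mem_nhds hu)).continuousAt.eventually_ne hi).and
      ((contDiffAt_minor hU hg hu j).continuousAt.eventually_ne hj)
  have h2 := (continuousAt_extChartAt (I := 𝓡 m) p).eventually h1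
  filter_upwards [h2, (isOpen_extChartAt_source (I := 𝓡 m) p).mem_nhds
    (mem_extChartAt_source p)] with y hy hys
  rw [mem_compl_iff, mem_singularSet_iff hf.1 hys, surjective_iff_minor hy.1]
  exact fun h => hy.2 (h j)

/-- Every singular point lies on a branch of the singular set; the branch is singular in its middle
if and only if the fold matrix is. -/
lemma IsGenericMap.exists_branch (hf : IsGenericMap m f) (hm : 2 ≤ m) {p : M} {i : Fin m}
    (hs : IsSingularAt (localRep m f p) i (extChartAt (𝓡 m) p p)) :
    ∃ B : SingularBranch m f p, B.ρ 0 = 0 ↔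
      (foldMatrixSelf (localRep m f p) i (extChartAt (𝓡 m) p p)).det = 0 := by
  have hU := isOpen_extChartAt_target (I := 𝓡 m) p
  have hg := contDiffOn_localRep hf.1 p
  have hu := mem_extChartAt_target (I := 𝓡 m) p
  obtain ⟨ε, x, W, ρ, π, N, hε, hWo, hWU, hx0, hxs, hxW, hπ, hπx, hE, hβ, hN, hN1, hN2⟩ :=
    hs.exists_curve hm hU hg hu (hf.jetTransverse p)
  set φ := extChartAt (𝓡 m) p with hφ
  set g := localRep m f p with hgdef
  have h0 : (0 : ℝ) ∈ Ioo (-ε) ε := ⟨by linarith, hε⟩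
  have hxmem : ∀ t ∈ Ioo (-ε) ε, x t ∈ W := fun t ht => ((hxW (x t)).2 ⟨t, ht, rfl⟩).1
  have hxd : ∀ t ∈ Ioo (-ε) ε, ContDiffAt ℝ ∞ x t := fun t ht =>
    hxs.contDiffAt (isOpen_Ioo.mem_nhds ht)
  have hsrc : ∀ t ∈ Ioo (-ε) ε, φ.symm (x t) ∈ φ.source := fun t ht =>
    φ.map_target (hWU (hxmem t ht))
  have hφx : ∀ t ∈ Ioo (-ε) ε, φ (φ.symm (x t)) = x t := fun t ht =>
    φ.right_inv (hWU (hxmem t ht))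
  have hγ : ∀ t ∈ Ioo (-ε) ε, ContMDiffAt 𝓘(ℝ, ℝ) (𝓡 m) ∞ (φ.symm ∘ x) t := by
    intro t ht
    have h1 : ContMDiffAt 𝓘(ℝ, Euc m) (𝓡 m) ∞ φ.symm (x t) :=
      (contMDiffOn_extChartAt_symm p).contMDiffAt (hU.mem_nhds (hWU (hxmem t ht)))
    exact h1.comp t (hxd t ht).contMDiffAt
  have hpos : ∀ t ∈ Ioo (-ε) ε, t ≠ 0 → 0 < cross (ρ t • partialDeriv i g (x t)) N := by
    intro t ht ht0
    refine (hN t ht ht0).trans_eq ?_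
    simp only [cross, PiLp.smul_apply, smul_eq_mul]
    ring
  have hmem : ∀ y, y ∈ (φ.source ∩ φ ⁻¹' W) ∧ y ∈ singularSet m f
      ↔ y ∈ (φ.symm ∘ x) '' Ioo (-ε) ε := by
    intro y
    constructor
    · rintro ⟨⟨hy, hyW⟩, hys⟩
      rw [mem_singularSet_iff hf.1 hy] at hys
      obtain ⟨t, ht, hty⟩ := (hxW _).1 ⟨hyW, hys⟩
      exact ⟨t, ht, by rw [Function.comp_apply, hty, φ.left_inv hy]⟩
    · rintro ⟨t, ht, rfl⟩
      refine ⟨⟨hsrc t ht, ?_⟩, ?_⟩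
      · rw [mem_preimage, Function.comp_apply, hφx t ht]; exact hxmem t ht
      · rw [Function.comp_apply, mem_singularSet_iff hf.1 (hsrc t ht), ← hφ, hφx t ht]
        exact ((hxW _).2 ⟨t, ht, rfl⟩).2
  have hβγ : ∀ t ∈ Ioo (-ε) ε, HasDerivAt (f ∘ φ.symm ∘ x) (ρ t • partialDeriv i g (x t)) t := hβ
  refine ⟨⟨ε, φ.symm ∘ x, φ.source ∩ φ ⁻¹' W, π ∘ φ, ρ, fun t => partialDeriv i g (x t), N, hε,
    ?_, ?_, hγ, hmem, ?_, ?_, ?_, ?_, hβγ, hpos, ?_, hE, ?_⟩, ?_, hN2⟩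
  · simp [hx0, hφ]
  · exact (continuousOn_extChartAt p).isOpen_inter_preimage (isOpen_extChartAt_source p) hWo
  · intro y hy
    exact hπ.contDiffAt.contMDiffAt.comp y
      (contMDiffAt_extChartAt' (by rw [← extChartAt_source (𝓡 m)]; exact hy.1))
  · intro t ht
    rw [Function.comp_apply, Function.comp_apply, hφx t ht, hπx t ht]
  · intro t ht
    exact ((hg.partialDeriv hU i).contDiffAt (hU.mem_nhds (hWU (hxmem t ht)))).continuousAt.comp
      (hxd t ht).continuousAt
  · intro t ht
    rw [Function.comp_apply, range_mfderiv_eq hf.1 (hsrc t ht), ← hφ, hφx t ht]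
    exact ⟨EuclideanSpace.single i 1, rfl⟩
  · by_cases hdet : (foldMatrixSelf g i (φ p)).det = 0
    · exact Or.inr (hN2 hdet)
    · left
      refine (hN1 hdet).trans_eq ?_
      simp only [cross, PiLp.smul_apply, smul_eq_mul]
      ring
  · intro t ht
    rw [imageTangent_eq hf.1]
    refine le_antisymm (Submodule.span_le.2 ?_) (Submodule.span_mono ?_)
    · rintro w ⟨δ, hδ, hδ0, hδS, hw⟩
      -- a curve in the singular set is a reparametrization of the branch
      have hδU : ∀ᶠ s in 𝓝 (0 : ℝ), δ s ∈ φ.source ∩ φ ⁻¹' W := by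
        refine hδ.continuousAt.eventually_mem ?_
        rw [hδ0]
        exact ((continuousOn_extChartAt p).isOpen_inter_preimage (isOpen_extChartAt_source p)
          hWo).mem_nhds ((hmem _).2 ⟨t, ht, rfl⟩).1
      set τ : ℝ → ℝ := π ∘ φ ∘ δ with hτ
      have hτ0 : τ 0 = t := by
        simp only [hτ, Function.comp_apply, hδ0, hφx t ht, hπx t ht]
      have hτd : DifferentiableAt ℝ τ 0 := by
        have h1 : ContMDiffAt 𝓘(ℝ, ℝ) 𝓘(ℝ, Euc m) ∞ (φ ∘ δ) 0 := by
          refine ContMDiffAt.comp 0 ?_ hδ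
          refine contMDiffAt_extChartAt' ?_
          rw [hδ0, Function.comp_apply, ← extChartAt_source (𝓡 m)]
          exact hsrc t ht
        exact (hπ.contDiffAt.comp 0 h1.contDiffAt).differentiableAt (by simp)
      have h2 : HasDerivAt (f ∘ φ.symm ∘ x) (ρ t • partialDeriv i g (x t)) (τ 0) := by
        rw [hτ0]; exact hβγ t ht
      have h3 := h2.scomp (0 : ℝ) hτd.hasDerivAt
      have h4 : f ∘ δ =ᶠ[𝓝 0] (f ∘ φ.symm ∘ x) ∘ τ := by
        filter_upwards [hδU, hδS] with s hs hs'
        obtain ⟨r, hr, hrs⟩ := (hmem _).1 ⟨hs, hs'⟩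
        have : τ s = r := by
          simp only [hτ, Function.comp_apply, ← hrs, hφx r hr, hπx r hr]
        simp only [Function.comp_apply, this, ← hrs]
      rw [hw.unique (h3.congr_of_eventuallyEq h4)]
      exact Submodule.smul_mem _ _ (Submodule.mem_span_singleton_self _)
    · rintro w rfl
      refine ⟨fun s => (φ.symm ∘ x) (t + s), ?_, by simp, ?_, ?_⟩
      · have h1 : ContMDiffAt 𝓘(ℝ, ℝ) 𝓘(ℝ, ℝ) ∞ (fun s : ℝ => t + s) 0 :=
          (contDiff_const.add contDiff_id).contDiffAt.contMDiffAt
        have h2 : ContMDiffAt 𝓘(ℝ, ℝ) (𝓡 m) ∞ (φ.symm ∘ x) (t + 0) := by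
          rw [add_zero]; exact hγ t ht
        exact h2.comp (0 : ℝ) h1
      · have h1 : ∀ᶠ s in 𝓝 (0 : ℝ), t + s ∈ Ioo (-ε) ε := by
          have : ContinuousAt (fun s : ℝ => t + s) 0 := by fun_prop
          exact this.eventually_mem (by simpa using isOpen_Ioo.mem_nhds ht)
        exact h1.mono fun s hs => ((hmem _).2 ⟨_, hs, rfl⟩).2
      · have h2 : HasDerivAt (f ∘ φ.symm ∘ x) (ρ t • partialDeriv i g (x t)) (t + 0) := by
          rw [add_zero]; exact hβγ t ht
        exact h2.comp_const_add t 0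
  · intro h0
    by_contra hdet
    have := hN1 hdet
    rw [show ρ 0 = 0 from h0, zero_mul] at this
    exact lt_irrefl _ this

end

end

noncomputable section

/-! ### Fold points and cusps -/

section

variable {m : ℕ} {M : Type*} [TopologicalSpace M] [ChartedSpace (Euc m) M]
  {f : M → Euc 2} {p : M}

namespace SingularBranch

variable (B : SingularBranch m f p)

lemma zero_mem : (0 : ℝ) ∈ Ioo (-B.ε) B.ε := ⟨neg_lt_zero.2 B.pos, B.pos⟩

lemma γ_mem {t : ℝ} (ht : t ∈ Ioo (-B.ε) B.ε) : B.γ t ∈ B.U ∧ B.γ t ∈ singularSet m f :=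
  (B.mem_iff _).2 ⟨t, ht, rfl⟩

lemma mem : p ∈ B.U ∧ p ∈ singularSet m f := by
  simpa only [B.zero] using B.γ_mem B.zero_mem

lemma mem_nhds : B.U ∈ 𝓝 p := B.isOpen.mem_nhds B.mem.1

lemma N_ne_zero : B.N ≠ 0 := by
  intro h
  have := B.cross_pos (B.ε / 2) ⟨by linarith [B.pos], by linarith [B.pos]⟩ (by linarith [B.pos])
  simp [h, cross] at this

lemma ρ_ne_zero {t : ℝ} (ht : t ∈ Ioo (-B.ε) B.ε) (h0 : t ≠ 0) : B.ρ t ≠ 0 := by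
  intro h
  have := B.cross_pos t ht h0
  simp [h, cross] at this

lemma cross_pos_of_ne {t : ℝ} (ht : t ∈ Ioo (-B.ε) B.ε) (h0 : B.ρ t ≠ 0) :
    0 < cross (B.ρ t • B.E t) B.N := by
  rcases eq_or_ne t 0 with rfl | h
  · exact B.cross_zero.resolve_right h0
  · exact B.cross_pos t ht h

lemma tangent_eq_bot_iff {t : ℝ} (ht : t ∈ Ioo (-B.ε) B.ε) :
    imageTangent m f (singularSet m f) (B.γ t) = ⊥ ↔ B.ρ t = 0 := by
  rw [B.tangent t ht, Submodule.span_singleton_eq_bot, smul_eq_zero, or_iff_left (B.ne_zero t ht)]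

/-- The linear function `cross · N` increases along the image of a branch. -/
lemma strictMonoOn : StrictMonoOn (fun t => cross (f (B.γ t)) B.N) (Ioo (-B.ε) B.ε) := by
  have hd : ∀ t ∈ Ioo (-B.ε) B.ε,
      HasDerivAt (fun t => cross (f (B.γ t)) B.N) (cross (B.ρ t • B.E t) B.N) t := by
    intro t ht
    have h := (B.hasDerivAt t ht).cross (hasDerivAt_const t B.N)
    simpa [cross] using h
  have hc : ContinuousOn (fun t => cross (f (B.γ t)) B.N) (Ioo (-B.ε) B.ε) :=
    fun t ht => (hd t ht).continuousAt.continuousWithinAt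
  have h1 : StrictMonoOn (fun t => cross (f (B.γ t)) B.N) (Ioc (-B.ε) 0) := by
    refine strictMonoOn_of_deriv_pos (convex_Ioc _ _)
      (hc.mono (Ioc_subset_Ioo_right B.pos)) fun t ht => ?_
    rw [interior_Ioc] at ht
    have ht' : t ∈ Ioo (-B.ε) B.ε := ⟨ht.1, ht.2.trans B.pos⟩
    rw [(hd t ht').deriv]
    exact B.cross_pos t ht' ht.2.ne
  have h2 : StrictMonoOn (fun t => cross (f (B.γ t)) B.N) (Ico 0 B.ε) := by
    refine strictMonoOn_of_deriv_pos (convex_Ico _ _)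
      (hc.mono (Ico_subset_Ioo_left (neg_lt_zero.2 B.pos))) fun t ht => ?_
    rw [interior_Ico] at ht
    have ht' : t ∈ Ioo (-B.ε) B.ε := ⟨(neg_lt_zero.2 B.pos).trans ht.1, ht.2⟩
    rw [(hd t ht').deriv]
    exact B.cross_pos t ht' ht.1.ne'
  have h3 := h1.union h2 (c := 0) ⟨⟨neg_lt_zero.2 B.pos, le_rfl⟩, fun x hx => hx.2⟩
    ⟨⟨le_rfl, B.pos⟩, fun x hx => hx.1⟩
  rwa [Ioc_union_Ico_eq_Ioo (neg_lt_zero.2 B.pos) B.pos] at h3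

/-- The restriction of a branch to a shorter interval. -/
def shrink (δ : ℝ) (h0 : 0 < δ) (hδ : δ ≤ B.ε) : SingularBranch m f p :=
  have hsub : Ioo (-δ) δ ⊆ Ioo (-B.ε) B.ε := Ioo_subset_Ioo (neg_le_neg hδ) hδ
  { B with
    ε := δ
    U := B.U ∩ B.π ⁻¹' Ioo (-δ) δ
    pos := h0
    isOpen := ContinuousOn.isOpen_inter_preimage
      (fun y hy => (B.smooth_π y hy).continuousAt.continuousWithinAt) B.isOpen isOpen_Ioo
    smooth := fun t ht => B.smooth t (hsub ht)
    mem_iff := by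
      intro y
      constructor
      · rintro ⟨⟨hy, hyπ⟩, hys⟩
        obtain ⟨t, ht, rfl⟩ := (B.mem_iff y).1 ⟨hy, hys⟩
        rw [mem_preimage, B.π_γ t ht] at hyπ
        exact ⟨t, hyπ, rfl⟩
      · rintro ⟨t, ht, rfl⟩
        have h := B.γ_mem (hsub ht)
        refine ⟨⟨h.1, ?_⟩, h.2⟩
        rwa [mem_preimage, B.π_γ t (hsub ht)]
    smooth_π := fun y hy => B.smooth_π y hy.1
    π_γ := fun t ht => B.π_γ t (hsub ht)
    continuousAt := fun t ht => B.continuousAt t (hsub ht)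
    mem_range := fun t ht => B.mem_range t (hsub ht)
    hasDerivAt := fun t ht => B.hasDerivAt t (hsub ht)
    cross_pos := fun t ht => B.cross_pos t (hsub ht)
    ne_zero := fun t ht => B.ne_zero t (hsub ht)
    tangent := fun t ht => B.tangent t (hsub ht) }

end SingularBranch

lemma mem_singularSet_of_mem_stratum [IsManifold (𝓡 m) ∞ M] (hf : IsGenericMap m f) (hm : 2 ≤ m)
    {I : List ℕ} (hp : p ∈ stratum m f ((m - 1) :: I)) : p ∈ singularSet m f := by
  obtain ⟨i, hi⟩ := hf.exists_ne_zero hm p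
  rw [mem_singularSet_iff hf.1 (mem_extChartAt_source p), surjective_iff_minor hi]
  intro j
  have h1 : idealRank (jetIdeal (jetExt ((m - 1) :: I).length (localRep m f p)
      (extChartAt (𝓡 m) p p))) = 1 := by
    have h2 := hp.1
    simp only [jetIdeal]
    omega
  have h2 := cross_eq_zero_of_idealRank (k := ((m - 1) :: I).length) (by simp) h1 i j
  rwa [jetFst_jetExt (isOpen_extChartAt_target p) (contDiffOn_localRep hf.1 p)
      (mem_extChartAt_target p), jetFst_jetExt (isOpen_extChartAt_target p)
      (contDiffOn_localRep hf.1 p) (mem_extChartAt_target p)] at h2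

variable [IsManifold (𝓡 m) ∞ M] (hf : IsGenericMap m f) (hm : 2 ≤ m)
include hf hm

lemma foldSet_subset : foldSet m f ⊆ singularSet m f :=
  fun _ hp => mem_singularSet_of_mem_stratum hf hm hp

lemma cuspSet_subset : cuspSet m f ⊆ singularSet m f :=
  fun _ hp => mem_singularSet_of_mem_stratum hf hm hp

lemma nonempty_branch (hp : p ∈ singularSet m f) : Nonempty (SingularBranch m f p) := by
  obtain ⟨i, hs⟩ := hf.exists_isSingularAt hm hp
  obtain ⟨B, -⟩ := hf.exists_branch hm hs
  exact ⟨B⟩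

lemma imageTangent_eq_bot_iff_det {i : Fin m}
    (hs : IsSingularAt (localRep m f p) i (extChartAt (𝓡 m) p p)) :
    imageTangent m f (singularSet m f) p = ⊥
      ↔ (foldMatrixSelf (localRep m f p) i (extChartAt (𝓡 m) p p)).det = 0 := by
  obtain ⟨B, hB⟩ := hf.exists_branch hm hs
  rw [← hB, ← B.tangent_eq_bot_iff B.zero_mem, B.zero]

lemma mem_foldSet_iff : p ∈ foldSet m f ↔
    p ∈ singularSet m f ∧ imageTangent m f (singularSet m f) p ≠ ⊥ := by
  by_cases hp : p ∈ singularSet m f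
  · obtain ⟨i, hs⟩ := hf.exists_isSingularAt hm hp
    rw [ne_eq, imageTangent_eq_bot_iff_det hf hm hs]
    refine Iff.trans ?_ (and_iff_right hp).symm
    exact hs.jet_mem_foldStratum_iff hm (isOpen_extChartAt_target p) (contDiffOn_localRep hf.1 p)
      (mem_extChartAt_target p) (hf.jetTransverse p)
  · exact iff_of_false (fun h => hp (foldSet_subset hf hm h)) fun h => hp h.1

lemma mem_cuspSet_iff : p ∈ cuspSet m f ↔
    p ∈ singularSet m f ∧ imageTangent m f (singularSet m f) p = ⊥ := by
  by_cases hp : p ∈ singularSet m f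
  · obtain ⟨i, hs⟩ := hf.exists_isSingularAt hm hp
    rw [imageTangent_eq_bot_iff_det hf hm hs]
    refine Iff.trans ?_ (and_iff_right hp).symm
    constructor
    · intro h
      by_contra hdet
      rcases hs.eq_of_jet_mem_stratum (isOpen_extChartAt_target p) (contDiffOn_localRep hf.1 p)
        (mem_extChartAt_target p) hdet h with h1 | ⟨n, h1⟩
      · simp at h1
      · rcases n with _ | _ | n <;> simp [List.replicate_succ] at h1
    · exact hs.jet_mem_cuspStratum hm (isOpen_extChartAt_target p) (contDiffOn_localRep hf.1 p)
        (mem_extChartAt_target p) (hf.jetTransverse p)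
  · exact iff_of_false (fun h => hp (cuspSet_subset hf hm h)) fun h => hp h.1

lemma SingularBranch.mem_foldSet_iff (B : SingularBranch m f p) {t : ℝ}
    (ht : t ∈ Ioo (-B.ε) B.ε) : B.γ t ∈ foldSet m f ↔ B.ρ t ≠ 0 := by
  rw [_root_.mem_foldSet_iff hf hm, ne_eq, B.tangent_eq_bot_iff ht]
  exact and_iff_right (B.γ_mem ht).2

lemma mem_foldSet_or_mem_cuspSet (hp : p ∈ singularSet m f) :
    p ∈ foldSet m f ∨ p ∈ cuspSet m f := by
  rw [mem_foldSet_iff hf hm, mem_cuspSet_iff hf hm]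
  tauto

/-- Near a fold point all singular points are fold points, and they lie in the same strata. -/
lemma imageTangent_le_stratum (hp : p ∈ foldSet m f) {I : List ℕ} (hI : p ∈ stratum m f I) :
    imageTangent m f (singularSet m f) p ≤ imageTangent m f (stratum m f I) p := by
  have hps := foldSet_subset hf hm hp
  obtain ⟨B⟩ := nonempty_branch hf hm hps
  have hB0 : B.ρ 0 ≠ 0 := by
    rw [← B.mem_foldSet_iff hf hm B.zero_mem, B.zero]
    exact hp
  have hfold : ∀ {z : M}, z ∈ foldSet m f → ∃ i,
      IsSingularAt (localRep m f z) i (extChartAt (𝓡 m) z z) ∧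
      (foldMatrixSelf (localRep m f z) i (extChartAt (𝓡 m) z z)).det ≠ 0 := by
    intro z hz
    obtain ⟨i, hs⟩ := hf.exists_isSingularAt hm (foldSet_subset hf hm hz)
    exact ⟨i, hs, fun h => ((mem_foldSet_iff hf hm).1 hz).2
      ((imageTangent_eq_bot_iff_det hf hm hs).2 h)⟩
  refine imageTangent_mono_of_nhds hf.1 ?_
  filter_upwards [B.mem_nhds] with z hzU hzs
  obtain ⟨t, ht, rfl⟩ := (B.mem_iff z).1 ⟨hzU, hzs⟩
  have hz : B.γ t ∈ foldSet m f := by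
    rw [B.mem_foldSet_iff hf hm ht]
    rcases eq_or_ne t 0 with rfl | h
    exacts [hB0, B.ρ_ne_zero ht h]
  obtain ⟨i, hs, hdet⟩ := hfold hp
  rcases hs.eq_of_jet_mem_stratum (isOpen_extChartAt_target p) (contDiffOn_localRep hf.1 p)
    (mem_extChartAt_target p) hdet hI with rfl | ⟨n, rfl⟩
  · trivial
  · obtain ⟨j, hs', hdet'⟩ := hfold hz
    exact hs'.jet_mem_stratum hm (isOpen_extChartAt_target _) (contDiffOn_localRep hf.1 _)
      (mem_extChartAt_target _) hdet' n

lemma finrank_imageTangent_le (hp : p ∈ singularSet m f) :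
    Module.finrank ℝ (imageTangent m f (singularSet m f) p) ≤ 1 := by
  obtain ⟨B⟩ := nonempty_branch hf hm hp
  have h := B.tangent 0 B.zero_mem
  rw [B.zero] at h
  rw [h]
  exact (finrank_span_le_card _).trans (by simp)

/-- By the normal crossing condition, a cusp has no other singular point over its image. -/
lemma mem_foldSet_of_image_eq {x y : M} (hx : x ∈ singularSet m f) (hy : y ∈ singularSet m f)
    (hxy : x ≠ y) (h : f x = f y) : x ∈ foldSet m f := by
  by_contra hxf
  have hxc := (mem_foldSet_or_mem_cuspSet hf hm hx).resolve_left hxf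
  obtain ⟨I, hI⟩ : ∃ I, y ∈ stratum m f ((m - 1) :: I) := by
    rcases mem_foldSet_or_mem_cuspSet hf hm hy with h1 | h1
    exacts [⟨_, h1⟩, ⟨_, h1⟩]
  -- otherwise the zero subspace at `x` and a proper subspace at `y` would be in general position
  have h1 := hf.2.2 2 ![x, y] ![[m - 1, 1, 0], (m - 1) :: I]
    (by
      intro a b hab
      fin_cases a <;> fin_cases b <;> simp_all [eq_comm])
    (by intro j; fin_cases j <;> simpa) (by intro j; fin_cases j <;> simpa)
    (by intro a b; fin_cases a <;> fin_cases b <;> simp [h]) Finset.univ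
  have h2 : imageTangent m f (stratum m f [m - 1, 1, 0]) x = ⊥ := by
    refine le_bot_iff.1 ?_
    rw [← ((mem_cuspSet_iff hf hm).1 hxc).2]
    exact imageTangent_mono_of_nhds hf.1
      (Eventually.of_forall fun z hz => mem_singularSet_of_mem_stratum hf hm hz)
  have h3 : imageTangent m f (stratum m f ((m - 1) :: I)) y
      ≤ imageTangent m f (singularSet m f) y :=
    imageTangent_mono_of_nhds hf.1
      (Eventually.of_forall fun z hz => mem_singularSet_of_mem_stratum hf hm hz)
  have h4 := (Submodule.finrank_mono h3).trans (finrank_imageTangent_le hf hm hy)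
  have h5 : (⨅ i ∈ (Finset.univ : Finset (Fin 2)), imageTangent m f
      (stratum m f ((![[m - 1, 1, 0], (m - 1) :: I] : Fin 2 → List ℕ) i)) (![x, y] i)) = ⊥ :=
    le_bot_iff.1 ((iInf₂_le (0 : Fin 2) (Finset.mem_univ _)).trans h2.le)
  rw [h5, Fin.sum_univ_two] at h1
  have h6 := Submodule.finrank_quotient_add_finrank
    (imageTangent m f (stratum m f ((m - 1) :: I)) y)
  have h7 := Submodule.finrank_quotient_add_finrank (⊥ : Submodule ℝ (Euc 2))
  change _ = Module.finrank ℝ (Euc 2 ⧸ imageTangent m f (stratum m f [m - 1, 1, 0]) x)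
    + Module.finrank ℝ (Euc 2 ⧸ imageTangent m f (stratum m f ((m - 1) :: I)) y) at h1
  rw [h2] at h1
  rw [finrank_euclideanSpace_fin] at h6
  omega

end

end

noncomputable section

/-! ### Sums of two transverse plane curves -/

lemma cross_smul_left (r : ℝ) (u v : Euc 2) : cross (r • u) v = r * cross u v := by
  simp only [cross, PiLp.smul_apply, smul_eq_mul]; ring

lemma cross_smul_right (r : ℝ) (u v : Euc 2) : cross u (r • v) = r * cross u v := by
  simp only [cross, PiLp.smul_apply, smul_eq_mul]; ring

lemma cross_add_left (u v w : Euc 2) : cross (u + v) w = cross u w + cross v w := by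
  simp only [cross, PiLp.add_apply]; ring

lemma cross_add_right (u v w : Euc 2) : cross u (v + w) = cross u v + cross u w := by
  simp only [cross, PiLp.add_apply]; ring

lemma cross_self_eq_zero (u : Euc 2) : cross u u = 0 := by simp only [cross]; ring

lemma cross_swap (u v : Euc 2) : cross u v = -cross v u := by simp only [cross]; ring

/-- Coordinates of the plane with respect to a basis. -/
def planeEquiv (v w : Euc 2) (h : cross v w ≠ 0) : (ℝ × ℝ) ≃L[ℝ] Euc 2 :=
  (LinearEquiv.ofInjectiveOfFinrankEq
    ((LinearMap.toSpanSingleton ℝ (Euc 2) v).coprod (LinearMap.toSpanSingleton ℝ (Euc 2) w))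
    (by
      rw [injective_iff_map_eq_zero]
      rintro ⟨a, b⟩ hab
      have hab' : a • v + b • w = 0 := by simpa using hab
      have h1 : cross (a • v + b • w) w = 0 := by rw [hab']; simp [cross]
      have h2 : cross v (a • v + b • w) = 0 := by rw [hab']; simp [cross]
      rw [cross_add_left, cross_smul_left, cross_smul_left, cross_self_eq_zero, mul_zero,
        add_zero] at h1
      rw [cross_add_right, cross_smul_right, cross_smul_right, cross_self_eq_zero, mul_zero,
        zero_add] at h2
      rw [Prod.mk_eq_zero]
      exact ⟨(mul_eq_zero.1 h1).resolve_right h, (mul_eq_zero.1 h2).resolve_right h⟩)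
    (by simp [Module.finrank_prod])).toContinuousLinearEquiv

lemma planeEquiv_apply (v w : Euc 2) (h : cross v w ≠ 0) (q : ℝ × ℝ) :
    planeEquiv v w h q = q.1 • v + q.2 • w := rfl

section

variable {β₁ β₂ : ℝ → Euc 2} {v₁ v₂ : Euc 2} {t s : ℝ}

lemma hasStrictFDerivAt_sum (h₁ : HasStrictDerivAt β₁ v₁ t) (h₂ : HasStrictDerivAt β₂ v₂ s)
    (h : cross v₁ v₂ ≠ 0) :
    HasStrictFDerivAt (fun q : ℝ × ℝ => β₁ q.1 + β₂ q.2)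
      (planeEquiv v₁ v₂ h : (ℝ × ℝ) →L[ℝ] Euc 2) (t, s) := by
  have h3 := (h₁.hasStrictFDerivAt.comp (t, s) (hasStrictFDerivAt_fst (𝕜 := ℝ))).add
    (h₂.hasStrictFDerivAt.comp (t, s) (hasStrictFDerivAt_snd (𝕜 := ℝ)))
  exact h3.congr_fderiv (by ext q <;> simp [planeEquiv_apply])

lemma exists_injOn_sum (h₁ : HasStrictDerivAt β₁ v₁ t) (h₂ : HasStrictDerivAt β₂ v₂ s)
    (h : cross v₁ v₂ ≠ 0) :
    ∃ δ > 0, InjOn (fun q : ℝ × ℝ => β₁ q.1 + β₂ q.2) (Metric.ball (t, s) δ) := by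
  have h3 := hasStrictFDerivAt_sum h₁ h₂ h
  obtain ⟨δ, hδ, hsub⟩ := Metric.isOpen_iff.1 (h3.toOpenPartialHomeomorph _).open_source (t, s)
    h3.mem_toOpenPartialHomeomorph_source
  refine ⟨δ, hδ, ?_⟩
  have h4 := (h3.toOpenPartialHomeomorph _).injOn.mono hsub
  rwa [h3.toOpenPartialHomeomorph_coe] at h4

/-- A curve through a point where two curves cross transversally, in the coordinates given by the
two curves. -/
lemma exists_sum_eq (h₁ : HasStrictDerivAt β₁ v₁ t) (h₂ : HasStrictDerivAt β₂ v₂ s)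
    (h : cross v₁ v₂ ≠ 0) {g : ℝ → Euc 2} {n : Euc 2} (hg : HasDerivAt g n 0)
    (hg0 : g 0 = β₁ t + β₂ s) :
    ∃ (τ σ : ℝ → ℝ) (a b : ℝ), HasDerivAt τ a 0 ∧ HasDerivAt σ b 0 ∧ τ 0 = t ∧ σ 0 = s ∧
      n = a • v₁ + b • v₂ ∧ ∀ᶠ r in 𝓝 0, β₁ (τ r) + β₂ (σ r) = g r := by
  have h3 := hasStrictFDerivAt_sum h₁ h₂ h
  have h4 := h3.to_localInverse
  have h5 := h3.eventually_right_inverse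
  have h6 : h3.localInverse _ _ _ (g 0) = (t, s) := by
    rw [hg0]
    exact h3.localInverse_apply_image
  set k : ℝ → ℝ × ℝ := fun r => h3.localInverse _ _ _ (g r) with hk
  have h7 : HasDerivAt k ((planeEquiv v₁ v₂ h).symm n) 0 := by
    have h8 := h4.hasFDerivAt
    simp only at h8
    rw [← hg0] at h8
    exact h8.comp_hasDerivAt (0 : ℝ) hg
  refine ⟨fun r => (k r).1, fun r => (k r).2, _, _, h7.fst, h7.snd, ?_, ?_, ?_, ?_⟩
  · simp only [hk, h6]
  · simp only [hk, h6]
  · rw [← planeEquiv_apply v₁ v₂ h, ContinuousLinearEquiv.apply_symm_apply]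
  · simp only at h5
    rw [← hg0] at h5
    exact hg.continuousAt.eventually h5

end

/-! ### Finiteness of the set of distinguished points -/

lemma IsCompact.finite_inter_of_nhds {X : Type*} [TopologicalSpace X] {K S : Set X}
    (hK : IsCompact K) (h : ∀ x ∈ K, ∃ U ∈ 𝓝 x, (U ∩ S).Finite) : (K ∩ S).Finite := by
  choose! U hU hUf using h
  obtain ⟨t, ht, htK⟩ := hK.elim_nhds_subcover U hU
  refine (t.finite_toSet.biUnion fun x hx => hUf x (ht x hx)).subset ?_
  rintro y ⟨hyK, hyS⟩
  obtain ⟨x, hx, hyx⟩ := mem_iUnion₂.1 (htK hyK)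
  exact mem_iUnion₂.2 ⟨x, hx, hyx, hyS⟩

lemma SingularBranch.hasStrictDerivAt {m : ℕ} {M : Type*} [TopologicalSpace M]
    [ChartedSpace (Euc m) M] {f : M → Euc 2} {p : M} (hf : ContMDiff (𝓡 m) (𝓡 2) ∞ f)
    (B : SingularBranch m f p) {t : ℝ} (ht : t ∈ Ioo (-B.ε) B.ε) :
    HasStrictDerivAt (f ∘ B.γ) (B.ρ t • B.E t) t := by
  have h1 : ContMDiffAt 𝓘(ℝ, ℝ) (𝓡 2) ∞ (f ∘ B.γ) t := (hf _).comp t (B.smooth t ht)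
  exact (h1.contDiffAt).hasStrictDerivAt' (B.hasDerivAt t ht) (by simp)

section

variable {m : ℕ} {M : Type*} [TopologicalSpace M] [ChartedSpace (Euc m) M]
  [IsManifold (𝓡 m) ∞ M] {f : M → Euc 2} (hf : IsGenericMap m f) (hm : 2 ≤ m)
include hf hm

lemma cross_ne_zero_of_image_eq (hperp : PerpendicularCrossings m f) {x y : M} (hxy : x ≠ y)
    (h : f x = f y) (Bx : SingularBranch m f x) (By : SingularBranch m f y) :
    cross (Bx.ρ 0 • Bx.E 0) (By.ρ 0 • By.E 0) ≠ 0 ∧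
      inner ℝ (Bx.ρ 0 • Bx.E 0) (By.ρ 0 • By.E 0) = 0 := by
  have hx := Bx.mem.2
  have hy := By.mem.2
  have h1 := mem_foldSet_of_image_eq hf hm hx hy hxy h
  have h2 := mem_foldSet_of_image_eq hf hm hy hx hxy.symm h.symm
  rw [← Bx.zero, Bx.mem_foldSet_iff hf hm Bx.zero_mem] at h1
  rw [← By.zero, By.mem_foldSet_iff hf hm By.zero_mem] at h2
  have h3 := hperp x hx y hy hxy h
  have hx0 : Bx.ρ 0 • Bx.E 0 ≠ 0 := smul_ne_zero h1 (Bx.ne_zero 0 Bx.zero_mem)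
  have hy0 : By.ρ 0 • By.E 0 ≠ 0 := smul_ne_zero h2 (By.ne_zero 0 By.zero_mem)
  have hxt := Bx.tangent 0 Bx.zero_mem
  have hyt := By.tangent 0 By.zero_mem
  rw [Bx.zero] at hxt
  rw [By.zero] at hyt
  rw [hxt, hyt, Submodule.isOrtho_span] at h3
  have h4 : inner ℝ (Bx.ρ 0 • Bx.E 0) (By.ρ 0 • By.E 0) = 0 := h3 rfl rfl
  refine ⟨fun hc => hy0 (eq_zero_of_inner_cross hx0 ?_ hc), h4⟩
  rw [PiLp.inner_apply, Fin.sum_univ_two] at h4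
  simp only [RCLike.inner_apply, conj_trivial] at h4
  linarith

/-- Near a pair of singular points, no other pair of distinct singular points has the same image. -/
lemma exists_nhds_isolated (hperp : PerpendicularCrossings m f) {x y : M}
    (hx : x ∈ singularSet m f) (hy : y ∈ singularSet m f) :
    ∃ U ∈ 𝓝 x, ∃ V ∈ 𝓝 y, ∀ x' ∈ U ∩ singularSet m f, ∀ y' ∈ V ∩ singularSet m f,
      x' ≠ y' → f x' = f y' → x' = x ∧ y' = y := by
  obtain ⟨Bx⟩ := nonempty_branch hf hm hx
  obtain ⟨By⟩ := nonempty_branch hf hm hy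
  rcases eq_or_ne x y with rfl | hxy
  · refine ⟨Bx.U, Bx.mem_nhds, Bx.U, Bx.mem_nhds, fun x' hx' y' hy' hne h => (hne ?_).elim⟩
    obtain ⟨t, ht, rfl⟩ := (Bx.mem_iff x').1 hx'
    obtain ⟨s, hs, rfl⟩ := (Bx.mem_iff y').1 hy'
    rw [Bx.strictMonoOn.injOn ht hs (by simp only [h])]
  by_cases h : f x = f y
  · obtain ⟨hc, -⟩ := cross_ne_zero_of_image_eq hf hm hperp hxy h Bx By
    -- The sum of the two image curves is injective near the crossing. Common values of the curves
    -- correspond to equal values at `(t, 0)` and `(0, s)`.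
    obtain ⟨δ, hδ, hinj⟩ := exists_injOn_sum (Bx.hasStrictDerivAt hf.1 Bx.zero_mem)
      (By.hasStrictDerivAt hf.1 By.zero_mem) hc
    set Bx' := Bx.shrink (min δ Bx.ε) (lt_min hδ Bx.pos) (min_le_right _ _)
    set By' := By.shrink (min δ By.ε) (lt_min hδ By.pos) (min_le_right _ _)
    refine ⟨Bx'.U, Bx'.mem_nhds, By'.U, By'.mem_nhds, ?_⟩
    intro x' hx' y' hy' hne h'
    obtain ⟨t, ht, rfl⟩ := (Bx'.mem_iff x').1 hx'
    obtain ⟨s, hs, rfl⟩ := (By'.mem_iff y').1 hy'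
    change f (Bx.γ t) = f (By.γ s) at h'
    have ht' : |t| < δ := abs_lt.2 ⟨(neg_le_neg (min_le_left _ _)).trans_lt ht.1,
      ht.2.trans_le (min_le_left _ _)⟩
    have hs' : |s| < δ := abs_lt.2 ⟨(neg_le_neg (min_le_left _ _)).trans_lt hs.1,
      hs.2.trans_le (min_le_left _ _)⟩
    have h5 : ((t, 0) : ℝ × ℝ) = (0, s) := by
      refine hinj ?_ ?_ ?_
      · rw [← ball_prod_same]; simpa using ⟨ht', hδ⟩
      · rw [← ball_prod_same]; simpa using ⟨hδ, hs'⟩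
      · simp only [Function.comp_apply, Bx.zero, By.zero, h']
        rw [h, add_comm]
    rw [Prod.mk.injEq] at h5
    rw [h5.1, ← h5.2]
    exact ⟨Bx'.zero, By'.zero⟩
  · obtain ⟨U, V, hU, hV, hxU, hyV, hd⟩ := t2_separation h
    refine ⟨f ⁻¹' U, hf.1.continuous.continuousAt (hU.mem_nhds hxU), f ⁻¹' V,
      hf.1.continuous.continuousAt (hV.mem_nhds hyV), fun x' hx' y' hy' _ h' => ?_⟩
    refine (disjoint_left.1 hd hx'.1 ?_).elim
    rw [h']
    exact hy'.1

/-- Three pairwise perpendicular lines do not fit into the plane. -/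
lemma eq_of_image_eq (hperp : PerpendicularCrossings m f) {x y z : M} (hx : x ∈ singularSet m f)
    (hy : y ∈ singularSet m f) (hz : z ∈ singularSet m f) (hxy : x ≠ y) (hxz : x ≠ z)
    (h : f x = f y) (h' : f x = f z) : y = z := by
  by_contra hyz
  obtain ⟨Bx⟩ := nonempty_branch hf hm hx
  obtain ⟨By⟩ := nonempty_branch hf hm hy
  obtain ⟨Bz⟩ := nonempty_branch hf hm hz
  obtain ⟨h1, h2⟩ := cross_ne_zero_of_image_eq hf hm hperp hxy h Bx By
  obtain ⟨h3, h4⟩ := cross_ne_zero_of_image_eq hf hm hperp hxz h' Bx Bz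
  obtain ⟨h5, h6⟩ := cross_ne_zero_of_image_eq hf hm hperp hyz (h.symm.trans h') By Bz
  set u := Bx.ρ 0 • Bx.E 0
  set v := By.ρ 0 • By.E 0
  set w := Bz.ρ 0 • Bz.E 0
  rw [PiLp.inner_apply, Fin.sum_univ_two] at h2 h4
  simp only [RCLike.inner_apply, conj_trivial] at h2 h4
  have h7 : u 0 * cross v w = 0 ∧ u 1 * cross v w = 0 := by
    simp only [cross]
    constructor
    · linear_combination w 1 * h2 - v 1 * h4
    · linear_combination v 0 * h4 - w 0 * h2
  refine h1 ?_
  simp only [cross, (mul_eq_zero.1 h7.1).resolve_right h5, (mul_eq_zero.1 h7.2).resolve_right h5]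
  ring

variable [CompactSpace M]

lemma finite_cuspSet : (cuspSet m f).Finite := by
  have h := (hf.isClosed_singularSet hm).isCompact.finite_inter_of_nhds (S := cuspSet m f) ?_
  · rwa [inter_eq_right.2 (cuspSet_subset hf hm)] at h
  · intro x hx
    obtain ⟨B⟩ := nonempty_branch hf hm hx
    refine ⟨B.U, B.mem_nhds, (finite_singleton x).subset ?_⟩
    rintro y ⟨hyU, hyc⟩
    obtain ⟨t, ht, rfl⟩ := (B.mem_iff y).1 ⟨hyU, cuspSet_subset hf hm hyc⟩
    rw [mem_cuspSet_iff hf hm, B.tangent_eq_bot_iff ht] at hyc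
    by_contra hne
    refine B.ρ_ne_zero ht ?_ hyc.2
    rintro rfl
    exact hne B.zero

lemma finite_doubleFoldSet (hperp : PerpendicularCrossings m f) : (doubleFoldSet m f).Finite := by
  have hc := (hf.isClosed_singularSet hm).isCompact
  have h := (hc.prod hc).finite_inter_of_nhds (S := {q : M × M | q.1 ∈ singularSet m f ∧
    q.2 ∈ singularSet m f ∧ q.1 ≠ q.2 ∧ f q.1 = f q.2}) ?_
  · refine (h.image Prod.fst).subset ?_
    rintro x ⟨hx, y, hy, hne, hxy⟩
    have hx' := foldSet_subset hf hm hx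
    have hy' := foldSet_subset hf hm hy
    exact ⟨(x, y), ⟨⟨hx', hy'⟩, hx', hy', hne.symm, hxy.symm⟩, rfl⟩
  · rintro ⟨x, y⟩ ⟨hx, hy⟩
    obtain ⟨U, hU, V, hV, h⟩ := exists_nhds_isolated hf hm hperp hx hy
    refine ⟨U ×ˢ V, prod_mem_nhds hU hV, (finite_singleton (x, y)).subset ?_⟩
    rintro ⟨x', y'⟩ ⟨⟨hx', hy'⟩, hxs, hys, hne, h'⟩
    obtain ⟨rfl, rfl⟩ := h x' ⟨hx', hxs⟩ y' ⟨hy', hys⟩ hne h'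
    rfl

end

end

noncomputable section

/-! ### The values of a chessboard function on the two sides of a curve -/

/-- The function `c` has the value `a` on the left and the value `b` on the right of the direction
`v` at the point `q`: these are the values along each curve that crosses `v` at `q` from the right
to the left, immediately after and before the crossing. -/
def SidesAt {R : Type*} (c : Euc 2 → R) (q v : Euc 2) (a b : R) : Prop :=
  ∀ (g : ℝ → Euc 2) (n : Euc 2), HasDerivAt g n 0 → g 0 = q → 0 < cross v n →
    (∀ᶠ s in 𝓝[>] (0 : ℝ), c (g s) = a) ∧ (∀ᶠ s in 𝓝[<] (0 : ℝ), c (g s) = b)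

lemma exists_cross_pos {v : Euc 2} (hv : v ≠ 0) : 0 < cross v (quarterTurn v) := by
  have h : cross v (quarterTurn v) = v 0 ^ 2 + v 1 ^ 2 := by simp [cross, quarterTurn]; ring
  rw [h]
  have h2 : v 0 ^ 2 + v 1 ^ 2 ≠ 0 := by
    intro h0
    apply hv
    ext i
    fin_cases i
    · exact pow_eq_zero_iff two_ne_zero |>.1 (by
        simp only [Fin.zero_eta]; nlinarith [sq_nonneg (v 0), sq_nonneg (v 1)])
    · exact pow_eq_zero_iff two_ne_zero |>.1 (by
        simp only [Fin.mk_one]; nlinarith [sq_nonneg (v 0), sq_nonneg (v 1)])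
  positivity

lemma eventually_pos_of_hasDerivAt {σ : ℝ → ℝ} {a s : ℝ} (h : HasDerivAt σ a 0) (h0 : σ 0 = s)
    (ha : 0 < a) : (∀ᶠ r in 𝓝[>] (0 : ℝ), s < σ r) ∧ (∀ᶠ r in 𝓝[<] (0 : ℝ), σ r < s) := by
  have h1 := hasDerivAt_iff_tendsto_slope_zero.1 h
  have h2 := h1.eventually (lt_mem_nhds ha)
  constructor
  · filter_upwards [nhdsWithin_mono _ (fun x (hx : 0 < x) => hx.ne') h2, self_mem_nhdsWithin]
      with r hr (hr0 : 0 < r)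
    rw [zero_add, h0, smul_eq_mul] at hr
    have := (mul_pos_iff_of_pos_left (inv_pos.2 hr0)).1 hr
    linarith
  · filter_upwards [nhdsWithin_mono _ (fun x (hx : x < 0) => hx.ne) h2, self_mem_nhdsWithin]
      with r hr (hr0 : r < 0)
    rw [zero_add, h0, smul_eq_mul] at hr
    by_contra h4
    have h5 := mul_nonpos_of_nonpos_of_nonneg (inv_lt_zero.2 hr0).le
      (show 0 ≤ σ r - s by linarith)
    linarith

namespace SidesAt

variable {R : Type*} {c : Euc 2 → R} {q v w : Euc 2} {a b a' b' : R}

lemma smul_pos (h : SidesAt c q v a b) {r : ℝ} (hr : 0 < r) : SidesAt c q (r • v) a b := by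
  intro g n hg h0 hn
  rw [cross_smul_left] at hn
  exact h g n hg h0 ((mul_pos_iff_of_pos_left hr).1 hn)

lemma neg (h : SidesAt c q v a b) : SidesAt c q (-v) b a := by
  intro g n hg h0 hn
  have h1 : HasDerivAt (fun s : ℝ => g (-s)) (-n) 0 := by
    have h2 : HasDerivAt g n (-0) := by rwa [neg_zero]
    have h3 := h2.scomp (0 : ℝ) (hasDerivAt_neg (0 : ℝ))
    rw [neg_one_smul] at h3
    exact h3
  obtain ⟨h2, h3⟩ := h _ _ h1 (by simpa using h0) (by
    simp only [cross, PiLp.neg_apply] at hn ⊢; linarith)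
  constructor
  · have h4 : Tendsto (fun s : ℝ => -s) (𝓝[>] 0) (𝓝[<] 0) := by
      simpa using tendsto_neg_nhdsGT_neg (a := (0 : ℝ))
    simpa using h4.eventually h3
  · have h4 : Tendsto (fun s : ℝ => -s) (𝓝[<] 0) (𝓝[>] 0) := by
      simpa using tendsto_neg_nhdsLT_neg (a := (0 : ℝ))
    simpa using h4.eventually h2

lemma smul_neg (h : SidesAt c q v a b) {r : ℝ} (hr : r < 0) : SidesAt c q (r • v) b a := by
  have := h.neg.smul_pos (neg_pos.2 hr)
  rwa [neg_smul_neg] at this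

lemma unique (h : SidesAt c q v a b) (h' : SidesAt c q v a' b') (hv : v ≠ 0) :
    a = a' ∧ b = b' := by
  have hg : HasDerivAt (fun s : ℝ => q + s • quarterTurn v) (quarterTurn v) 0 := by
    simpa using ((hasDerivAt_id (0 : ℝ)).smul_const (quarterTurn v)).const_add q
  obtain ⟨h1, h2⟩ := h _ _ hg (by simp) (exists_cross_pos hv)
  obtain ⟨h3, h4⟩ := h' _ _ hg (by simp) (exists_cross_pos hv)
  obtain ⟨s, hs, hs'⟩ := (h1.and h3).exists
  obtain ⟨r, hr, hr'⟩ := (h2.and h4).exists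
  exact ⟨hs.symm.trans hs', hr.symm.trans hr'⟩

end SidesAt

section

variable {R : Type*} {c : Euc 2 → R} {a b : R} {β₁ β₂ : ℝ → Euc 2} {v₁ v₂ : Euc 2} {t s : ℝ}

/-- The sides of the first of two transverse curves, read off in the coordinates given by the two
curves. -/
lemma sidesAt_fst (h₁ : HasStrictDerivAt β₁ v₁ t) (h₂ : HasStrictDerivAt β₂ v₂ s)
    (h : 0 < cross v₁ v₂)
    (ha : ∀ᶠ q : ℝ × ℝ in 𝓝 (t, s), s < q.2 → c (β₁ q.1 + β₂ q.2) = a)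
    (hb : ∀ᶠ q : ℝ × ℝ in 𝓝 (t, s), q.2 < s → c (β₁ q.1 + β₂ q.2) = b) :
    SidesAt c (β₁ t + β₂ s) v₁ a b := by
  intro g n hg h0 hn
  obtain ⟨τ, σ, x, y, hτ, hσ, hτ0, hσ0, rfl, hgs⟩ := exists_sum_eq h₁ h₂ h.ne' hg h0
  rw [cross_add_right, cross_smul_right, cross_smul_right, cross_self_eq_zero, mul_zero,
    zero_add] at hn
  obtain ⟨h3, h4⟩ := eventually_pos_of_hasDerivAt hσ hσ0 ((mul_pos_iff_of_pos_right h).1 hn)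
  have h5 : Tendsto (fun r => (τ r, σ r)) (𝓝 0) (𝓝 (t, s)) := by
    rw [← hτ0, ← hσ0]
    exact hτ.continuousAt.prodMk_nhds hσ.continuousAt
  constructor
  · filter_upwards [h3, nhdsWithin_le_nhds (h5.eventually ha), nhdsWithin_le_nhds hgs]
      with r h6 h7 h8
    rw [← h8, h7 h6]
  · filter_upwards [h4, nhdsWithin_le_nhds (h5.eventually hb), nhdsWithin_le_nhds hgs]
      with r h6 h7 h8
    rw [← h8, h7 h6]

/-- The analogue of `sidesAt_fst` for the second curve; the first coordinate decreases from its
right to its left. -/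
lemma sidesAt_snd (h₁ : HasStrictDerivAt β₁ v₁ t) (h₂ : HasStrictDerivAt β₂ v₂ s)
    (h : 0 < cross v₁ v₂)
    (ha : ∀ᶠ q : ℝ × ℝ in 𝓝 (t, s), q.1 < t → c (β₁ q.1 + β₂ q.2) = a)
    (hb : ∀ᶠ q : ℝ × ℝ in 𝓝 (t, s), t < q.1 → c (β₁ q.1 + β₂ q.2) = b) :
    SidesAt c (β₁ t + β₂ s) v₂ a b := by
  have h3 : HasStrictDerivAt (fun r => β₁ (-r)) (-v₁) (-t) := by
    have h4 : HasStrictDerivAt β₁ v₁ (- -t) := by rwa [neg_neg]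
    have h5 := h4.scomp (-t) (hasStrictDerivAt_neg (-t))
    rw [neg_one_smul] at h5
    exact h5
  have hc : 0 < cross v₂ (-v₁) := by
    rw [cross_swap] at h
    simp only [cross, PiLp.neg_apply] at h ⊢
    linarith
  have h5 : Tendsto (fun q : ℝ × ℝ => (-q.2, q.1)) (𝓝 (s, -t)) (𝓝 (t, s)) := by
    have : Continuous fun q : ℝ × ℝ => (-q.2, q.1) := by fun_prop
    simpa using this.tendsto (s, -t)
  have h6 := sidesAt_fst (c := c) (a := a) (b := b) h₂ h3 hc
    ((h5.eventually ha).mono fun q hq h => by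
      rw [add_comm]; exact hq (neg_lt.1 h))
    ((h5.eventually hb).mono fun q hq h => by
      rw [add_comm]; exact hq (lt_neg.1 h))
  simpa [add_comm] using h6

end

/-! ### The sides of the branches -/

/-- A chessboard function is constant on connected sets off the image of the singular set. -/
lemma IsChessboard.eq_of_isPreconnected {R : Type*} [Ring R] {m : ℕ} {M : Type*}
    [TopologicalSpace M] [ChartedSpace (Euc m) M] {f : M → Euc 2} {c : Euc 2 → R}
    (hc : IsChessboard m f c) {T : Set (Euc 2)} (hT : IsPreconnected T)
    (hd : ∀ y ∈ T, y ∉ f '' singularSet m f) {y z : Euc 2} (hy : y ∈ T) (hz : z ∈ T) :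
    c y = c z := by
  let _ : TopologicalSpace R := ⊥
  have : DiscreteTopology R := ⟨rfl⟩
  refine hT.constant (fun x hx => ContinuousAt.continuousWithinAt ?_) hy hz
  exact continuousAt_const.congr ((hc.1 x (hd x hx)).mono fun _ h => h.symm)

section

variable {m : ℕ} {M : Type*} [TopologicalSpace M] [ChartedSpace (Euc m) M]
  [IsManifold (𝓡 m) ∞ M] {f : M → Euc 2} (hf : IsGenericMap m f) (hm : 2 ≤ m)
include hf hm

lemma eq_of_mem_openArcSet {x y : M} (hx : x ∈ openArcSet m f) (hy : y ∈ singularSet m f)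
    (h : f y = f x) : y = x := by
  by_contra hne
  exact hx.2 (Or.inr ⟨mem_foldSet_of_image_eq hf hm hx.1 hy (Ne.symm hne) h.symm, y,
    mem_foldSet_of_image_eq hf hm hy hx.1 hne h, hne, h⟩)

lemma openArcSet_subset_foldSet : openArcSet m f ⊆ foldSet m f := fun _ hx =>
  (mem_foldSet_or_mem_cuspSet hf hm hx.1).resolve_right fun h => hx.2 (Or.inl h)

variable [CompactSpace M]

lemma exists_ball_subset {U : Set M} (hU : IsOpen U) {q : Euc 2}
    (h : ∀ x ∈ singularSet m f, f x = q → x ∈ U) :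
    ∃ r > 0, ∀ x ∈ singularSet m f, f x ∈ Metric.ball q r → x ∈ U := by
  have h1 : IsCompact (f '' (singularSet m f \ U)) :=
    ((hf.isClosed_singularSet hm).isCompact.diff hU).image hf.1.continuous
  have h2 : q ∈ (f '' (singularSet m f \ U))ᶜ := by
    rintro ⟨x, hx, rfl⟩
    exact hx.2 (h x hx.1 rfl)
  obtain ⟨r, hr, hsub⟩ := Metric.isOpen_iff.1 h1.isClosed.isOpen_compl q h2
  refine ⟨r, hr, fun x hx hxr => ?_⟩
  by_contra hxU
  exact hsub hxr ⟨x, ⟨hx, hxU⟩, rfl⟩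

lemma SingularBranch.exists_mem_openArcSet [T1Space M] (hperp : PerpendicularCrossings m f) {p : M}
    (B : SingularBranch m f p) :
    ∃ δ > 0, ∀ t ∈ Ioo (-B.ε) B.ε, |t| < δ → t ≠ 0 → B.γ t ∈ openArcSet m f := by
  have hfin : ((cuspSet m f ∪ doubleFoldSet m f) \ {p}).Finite :=
    ((finite_cuspSet hf hm).union (finite_doubleFoldSet hf hm hperp)).subset sdiff_subset
  have h1 : ∀ᶠ t in 𝓝 (0 : ℝ), B.γ t ∈ ((cuspSet m f ∪ doubleFoldSet m f) \ {p})ᶜ := by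
    refine (B.smooth 0 B.zero_mem).continuousAt.eventually_mem
      (hfin.isClosed.isOpen_compl.mem_nhds ?_)
    rw [B.zero]
    exact fun h => h.2 rfl
  obtain ⟨δ, hδ, h⟩ := Metric.eventually_nhds_iff.1 h1
  refine ⟨δ, hδ, fun t ht htδ h0 => ⟨(B.γ_mem ht).2, fun hd => h (by simpa using htδ) ⟨hd, ?_⟩⟩⟩
  intro hp
  have h2 := congrArg B.π (show B.γ t = B.γ 0 by rw [B.zero]; exact hp)
  rw [B.π_γ t ht, B.π_γ 0 B.zero_mem] at h2
  exact h0 h2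

end

end

noncomputable section

lemma SingularBranch.continuousAt_velocity {m : ℕ} {M : Type*} [TopologicalSpace M]
    [ChartedSpace (Euc m) M] {f : M → Euc 2} {p : M} (hf : ContMDiff (𝓡 m) (𝓡 2) ∞ f)
    (B : SingularBranch m f p) {t : ℝ} (ht : t ∈ Ioo (-B.ε) B.ε) :
    ContinuousAt (fun t => B.ρ t • B.E t) t := by
  have h1 : ContMDiffAt 𝓘(ℝ, ℝ) (𝓡 2) ∞ (f ∘ B.γ) t := (hf _).comp t (B.smooth t ht)
  have h2 := (h1.contDiffAt.continuousAt_fderiv (by simp)).clm_apply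
    (continuousAt_const (y := (1 : ℝ)))
  refine h2.congr ?_
  filter_upwards [isOpen_Ioo.mem_nhds ht] with s hs
  rw [fderiv_apply_one_eq_deriv, (B.hasDerivAt s hs).deriv]

section

variable {R : Type*} [Ring R] {m : ℕ} {M : Type*} [TopologicalSpace M] [CompactSpace M]
  [ChartedSpace (Euc m) M] [IsManifold (𝓡 m) ∞ M] {f : M → Euc 2} {c : Euc 2 → R}
  (hf : IsGenericMap m f) (hm : 2 ≤ m) (hc : IsChessboard m f c)
include hf hm hc

/-- If no other singular point lies over the image of `p`, then the chessboard function has the same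
values on the two sides along the whole branch at `p`, even through a cusp, if the branch is
directed such that its image crosses the lines parallel to `N` always in the same direction. The
reason is that the strips swept out by short translations along `±N` do not meet the image of the
singular set. -/
lemma SingularBranch.exists_sides [T1Space M] (hperp : PerpendicularCrossings m f) {p : M}
    (B : SingularBranch m f p) (hu : ∀ x ∈ singularSet m f, f x = f p → x = p) :
    ∃ δ > 0, ∃ a b : R, (a - b = 1 ∨ a - b = -1) ∧ ∀ t ∈ Ioo (-B.ε) B.ε, |t| < δ → B.ρ t ≠ 0 →
      SidesAt c (f (B.γ t)) (B.ρ t • B.E t) a b := by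
  obtain ⟨r, hr, hrU⟩ := exists_ball_subset hf hm B.isOpen (q := f p)
    (fun x hx h => by rw [hu x hx h]; exact B.mem.1)
  obtain ⟨δ₀, hδ₀, hO⟩ := B.exists_mem_openArcSet hf hm hperp
  set Ψ : ℝ × ℝ → Euc 2 := fun q => f (B.γ q.1) + q.2 • B.N with hΨ
  have hΨc : ∀ t ∈ Ioo (-B.ε) B.ε, ∀ s, ContinuousAt Ψ (t, s) := by
    intro t ht s
    have h1 : ContinuousAt (f ∘ B.γ) t := (B.hasDerivAt t ht).continuousAt
    have h2 : ContinuousAt (fun q : ℝ × ℝ => (f ∘ B.γ) q.1) (t, s) :=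
      ContinuousAt.comp (f := Prod.fst) (x := (t, s)) h1 continuousAt_fst
    exact h2.add (by fun_prop)
  -- a small rectangle is mapped to the ball
  obtain ⟨δ₁, hδ₁, hball⟩ : ∃ δ > 0, ∀ q : ℝ × ℝ, q ∈ Metric.ball (0, 0) δ →
      Ψ q ∈ Metric.ball (f p) r := by
    have h0 : Ψ (0, 0) = f p := by simp [hΨ, B.zero]
    have h1 : ∀ᶠ q in 𝓝 ((0, 0) : ℝ × ℝ), Ψ q ∈ Metric.ball (f p) r :=
      (hΨc 0 B.zero_mem 0).eventually_mem (by rw [h0]; exact Metric.ball_mem_nhds _ hr)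
    exact Metric.eventually_nhds_iff_ball.1 h1
  set δ := min δ₀ (min δ₁ B.ε) with hδ
  have hδpos : 0 < δ := lt_min hδ₀ (lt_min hδ₁ B.pos)
  have hδε : ∀ {t : ℝ}, |t| < δ → t ∈ Ioo (-B.ε) B.ε := fun ht =>
    abs_lt.1 (ht.trans_le ((min_le_right _ _).trans (min_le_right _ _)))
  -- the image of the singular set in the rectangle is the axis `s = 0`, since `cross · N` is
  -- constant on the lines parallel to `N` and injective along the branch
  have havoid : ∀ t s : ℝ, |t| < δ → |s| < δ → ∀ x ∈ singularSet m f, f x = Ψ (t, s) →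
      s = 0 ∧ x = B.γ t := by
    intro t s ht hs x hx hxΨ
    have h1 : Ψ (t, s) ∈ Metric.ball (f p) r := by
      refine hball _ ?_
      rw [← ball_prod_same]
      have : δ ≤ δ₁ := (min_le_right _ _).trans (min_le_left _ _)
      simpa using ⟨ht.trans_le this, hs.trans_le this⟩
    obtain ⟨t', ht', rfl⟩ := (B.mem_iff x).1 ⟨hrU x hx (hxΨ ▸ h1), hx⟩
    have h2 : t' = t := by
      refine B.strictMonoOn.injOn ht' (hδε ht) ?_
      simp only [hxΨ, hΨ, cross_add_left, cross_smul_left, cross_self_eq_zero, mul_zero, add_zero]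
    subst h2
    refine ⟨?_, rfl⟩
    simp only [hΨ, left_eq_add, smul_eq_zero, B.N_ne_zero, or_false] at hxΨ
    exact hxΨ
  -- hence the chessboard function is constant on each of the two halves of the rectangle
  have hconst : ∀ I : Set ℝ, I ⊆ Ioo (-δ) δ → OrdConnected I → 0 ∉ I →
      ∀ q ∈ Ioo (-δ) δ ×ˢ I, ∀ q' ∈ Ioo (-δ) δ ×ˢ I, c (Ψ q) = c (Ψ q') := by
    intro I hI hIo hI0 q hq q' hq'
    have h1 : IsPreconnected (Ψ '' (Ioo (-δ) δ ×ˢ I)) := by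
      refine (isPreconnected_Ioo.prod hIo.isPreconnected).image _ fun q hq => ?_
      exact (hΨc q.1 (hδε (abs_lt.2 hq.1)) q.2).continuousWithinAt
    refine hc.eq_of_isPreconnected h1 ?_ ⟨q, hq, rfl⟩ ⟨q', hq', rfl⟩
    rintro _ ⟨q, hq, rfl⟩ ⟨x, hx, hxq⟩
    refine hI0 ?_
    rw [← (havoid q.1 q.2 (abs_lt.2 hq.1) (abs_lt.2 (hI hq.2)) x hx hxq).1]
    exact hq.2
  have hhalf : |δ / 2| < δ := by rw [abs_of_pos (half_pos hδpos)]; exact half_lt_self hδpos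
  set a := c (Ψ (0, δ / 2)) with ha
  set b := c (Ψ (0, -(δ / 2))) with hb
  have hca : ∀ t s : ℝ, |t| < δ → |s| < δ → 0 < s → c (Ψ (t, s)) = a := fun t s ht hs h0 =>
    hconst (Ioo 0 δ) (Ioo_subset_Ioo_left (by linarith)) ordConnected_Ioo (fun h => lt_irrefl _ h.1)
      _ ⟨abs_lt.1 ht, h0, (abs_lt.1 hs).2⟩ _
      ⟨⟨by simpa using hδpos, hδpos⟩, half_pos hδpos, half_lt_self hδpos⟩
  have hcb : ∀ t s : ℝ, |t| < δ → |s| < δ → s < 0 → c (Ψ (t, s)) = b := fun t s ht hs h0 =>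
    hconst (Ioo (-δ) 0) (Ioo_subset_Ioo_right (by linarith)) ordConnected_Ioo
      (fun h => lt_irrefl _ h.2)
      _ ⟨abs_lt.1 ht, (abs_lt.1 hs).1, h0⟩ _
      ⟨⟨by simpa using hδpos, hδpos⟩, by
        simp only [mem_Ioo, neg_lt_neg_iff, Left.neg_neg_iff]
        exact ⟨half_lt_self hδpos, half_pos hδpos⟩⟩
  refine ⟨δ, hδpos, a, b, ?_, ?_⟩
  · -- a short segment parallel to `N` through a fold point is a generic crossing
    set t₀ := δ / 2 with ht₀
    have ht₀' : t₀ ≠ 0 := (half_pos hδpos).ne'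
    have hmem : B.γ t₀ ∈ openArcSet m f :=
      hO t₀ (hδε hhalf) (hhalf.trans_le (min_le_left _ _)) ht₀'
    set g : ℝ → Euc 2 := fun s => f (B.γ t₀) + s • t₀ • B.N with hg
    have hgΨ : ∀ s, g s = Ψ (t₀, s * t₀) := fun s => by simp only [hg, hΨ, smul_smul]
    have hst : ∀ s ∈ Icc (-1 : ℝ) 1, |s * t₀| < δ := by
      intro s hs
      rw [abs_mul]
      have := mul_le_mul_of_nonneg_right (abs_le.2 hs) (abs_nonneg t₀)
      rw [one_mul] at this
      exact this.trans_lt hhalf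
    have hgd : ∀ s, HasDerivAt g (t₀ • B.N) s := fun s => by
      have h := ((hasDerivAt_id s).smul_const (t₀ • B.N)).const_add (f (B.γ t₀))
      rw [one_smul] at h
      exact h
    have hgen : IsGenericCrossing m f g := by
      refine ⟨by fun_prop, ?_, ?_, ?_⟩
      · intro s hs
        constructor
        · rintro ⟨x, hx, hxg⟩
          rw [hgΨ] at hxg
          exact (mul_eq_zero.1 (havoid _ _ hhalf (hst s hs) x hx hxg).1).resolve_right ht₀'
        · rintro rfl
          exact ⟨B.γ t₀, hmem.1, by simp [hg]⟩
      · refine ⟨B.γ t₀, ⟨hmem.1, by simp [hg]⟩, ?_⟩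
        rintro x ⟨hx, hxg⟩
        exact eq_of_mem_openArcSet hf hm hmem hx (by simpa [hg] using hxg)
      · intro x hx hxg I hI
        obtain rfl := eq_of_mem_openArcSet hf hm hmem hx (by simpa [hg] using hxg)
        have h1 := imageTangent_le_stratum hf hm (openArcSet_subset_foldSet hf hm hmem) hI
        rw [B.tangent _ (hδε hhalf)] at h1
        rw [(hgd 0).deriv, eq_top_iff]
        refine le_trans ?_ (sup_le_sup_left h1 _)
        intro w _
        have h2 := (B.cross_pos t₀ (hδε hhalf) ht₀').ne'
        have h3 := planeEquiv_apply _ _ h2 ((planeEquiv _ _ h2).symm w)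
        rw [ContinuousLinearEquiv.apply_symm_apply] at h3
        rw [h3, add_comm]
        refine Submodule.add_mem_sup ?_
          (Submodule.smul_mem _ _ (Submodule.mem_span_singleton_self _))
        refine Submodule.smul_mem _ _ ?_
        have h4 : t₀⁻¹ • t₀ • B.N ∈ Submodule.span ℝ {t₀ • B.N} :=
          Submodule.smul_mem _ _ (Submodule.mem_span_singleton_self _)
        rwa [inv_smul_smul₀ ht₀'] at h4
    have h1 := hc.2 g hgen
    rw [hgΨ, hgΨ,
      hca t₀ (1 * t₀) hhalf (hst 1 ⟨by norm_num, le_rfl⟩) (by linarith [half_pos hδpos]),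
      hcb t₀ (-1 * t₀) hhalf (hst (-1) ⟨le_rfl, by norm_num⟩) (by linarith [half_pos hδpos])] at h1
    exact h1
  · intro t ht htδ hρ
    have h1 : HasStrictDerivAt (fun s : ℝ => s • B.N) B.N 0 := by
      simpa using (hasStrictDerivAt_id (0 : ℝ)).smul_const B.N
    have h2 : ∀ᶠ q : ℝ × ℝ in 𝓝 (t, 0), |q.1| < δ ∧ |q.2| < δ := by
      have h3 : ContinuousAt (fun q : ℝ × ℝ => |q.1|) (t, 0) := by fun_prop
      have h4 : ContinuousAt (fun q : ℝ × ℝ => |q.2|) (t, 0) := by fun_prop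
      exact (h3.eventually_lt_const htδ).and (h4.eventually_lt_const (by simpa using hδpos))
    have h3 := sidesAt_fst (c := c) (a := a) (b := b) (B.hasStrictDerivAt hf.1 ht) h1
      (B.cross_pos_of_ne ht hρ) (h2.mono fun q hq h => hca q.1 q.2 hq.1 hq.2 h)
      (h2.mono fun q hq h => hcb q.1 q.2 hq.1 hq.2 h)
    simpa using h3

/-- At a crossing of the images of two branches the chessboard function is constant on each of the
four quadrants. Its values there, counterclockwise and beginning between the two positive
half-branches, are `a₁`, `a₂`, `a₃` and `a₄`. -/
lemma SingularBranch.exists_sides_of_crossing (hperp : PerpendicularCrossings m f) {x y : M}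
    (hxy : x ≠ y) (h : f x = f y) (Bx : SingularBranch m f x) (By : SingularBranch m f y)
    (hpos : 0 < cross (Bx.ρ 0 • Bx.E 0) (By.ρ 0 • By.E 0)) :
    ∃ δ > 0, ∃ a₁ a₂ a₃ a₄ : R,
      (∀ t ∈ Ioo (-Bx.ε) Bx.ε, |t| < δ →
        (0 < t → SidesAt c (f (Bx.γ t)) (Bx.ρ t • Bx.E t) a₁ a₄) ∧
        (t < 0 → SidesAt c (f (Bx.γ t)) (Bx.ρ t • Bx.E t) a₂ a₃)) ∧
      (∀ t ∈ Ioo (-By.ε) By.ε, |t| < δ →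
        (0 < t → SidesAt c (f (By.γ t)) (By.ρ t • By.E t) a₂ a₁) ∧
        (t < 0 → SidesAt c (f (By.γ t)) (By.ρ t • By.E t) a₃ a₄)) := by
  have hdx : ∀ t ∈ Ioo (-Bx.ε) Bx.ε,
      HasStrictDerivAt (fun t => f (Bx.γ t)) (Bx.ρ t • Bx.E t) t :=
    fun t ht => Bx.hasStrictDerivAt hf.1 ht
  have hdy : ∀ t ∈ Ioo (-By.ε) By.ε,
      HasStrictDerivAt (fun t => f (By.γ t) - f x) (By.ρ t • By.E t) t :=
    fun t ht => (By.hasStrictDerivAt hf.1 ht).sub_const (f x)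
  -- the plane coordinates given by the two branches
  set Ψ : ℝ × ℝ → Euc 2 := fun q => f (Bx.γ q.1) + (f (By.γ q.2) - f x) with hΨ
  have hΨx : ∀ t, Ψ (t, 0) = f (Bx.γ t) := fun t => by simp [hΨ, By.zero, h]
  have hΨy : ∀ s, Ψ (0, s) = f (By.γ s) := fun s => by simp [hΨ, Bx.zero]
  have hΨc : ∀ t ∈ Ioo (-Bx.ε) Bx.ε, ∀ s ∈ Ioo (-By.ε) By.ε, ContinuousAt Ψ (t, s) := by
    intro t ht s hs
    have h1 : ContinuousAt (fun q : ℝ × ℝ => f (Bx.γ q.1)) (t, s) :=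
      ContinuousAt.comp (f := Prod.fst) (x := (t, s)) (hdx t ht).hasDerivAt.continuousAt
        continuousAt_fst
    have h2 : ContinuousAt (fun q : ℝ × ℝ => f (By.γ q.2) - f x) (t, s) :=
      ContinuousAt.comp (f := Prod.snd) (g := fun r => f (By.γ r) - f x) (x := (t, s))
        (hdy s hs).hasDerivAt.continuousAt continuousAt_snd
    exact h1.add h2
  obtain ⟨δ₁, hδ₁, hinj⟩ := exists_injOn_sum (hdx 0 Bx.zero_mem) (hdy 0 By.zero_mem) hpos.ne'
  set Bx' := Bx.shrink (min δ₁ Bx.ε) (lt_min hδ₁ Bx.pos) (min_le_right _ _)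
  set By' := By.shrink (min δ₁ By.ε) (lt_min hδ₁ By.pos) (min_le_right _ _)
  obtain ⟨r, hr, hrU⟩ := exists_ball_subset hf hm (Bx'.isOpen.union By'.isOpen) (q := f x) (by
    intro z hz hzx
    rcases eq_or_ne x z with rfl | hne
    · exact Or.inl Bx'.mem.1
    · rw [← eq_of_image_eq hf hm hperp Bx.mem.2 By.mem.2 hz hxy hne h hzx.symm]
      exact Or.inr By'.mem.1)
  obtain ⟨δ₂, hδ₂, hball⟩ : ∃ δ > 0, ∀ q : ℝ × ℝ, q ∈ Metric.ball (0, 0) δ →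
      Ψ q ∈ Metric.ball (f x) r := by
    have h0 : Ψ (0, 0) = f x := by rw [hΨx, Bx.zero]
    have h1 : ∀ᶠ q in 𝓝 ((0, 0) : ℝ × ℝ), Ψ q ∈ Metric.ball (f x) r :=
      (hΨc 0 Bx.zero_mem 0 By.zero_mem).eventually_mem (by rw [h0]; exact Metric.ball_mem_nhds _ hr)
    exact Metric.eventually_nhds_iff_ball.1 h1
  obtain ⟨δ₃, hδ₃, hcr⟩ : ∃ δ > 0, ∀ t, |t| < δ →
      0 < cross (Bx.ρ t • Bx.E t) (By.ρ 0 • By.E 0) ∧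
      0 < cross (Bx.ρ 0 • Bx.E 0) (By.ρ t • By.E t) := by
    have hcr : Continuous fun q : Euc 2 × Euc 2 => cross q.1 q.2 := by
      unfold cross; fun_prop
    have h1 := (hcr.continuousAt.comp (f := fun t => (Bx.ρ t • Bx.E t, By.ρ 0 • By.E 0))
      ((Bx.continuousAt_velocity hf.1 Bx.zero_mem).prodMk continuousAt_const)).eventually
      (lt_mem_nhds hpos)
    have h2 := (hcr.continuousAt.comp (f := fun t => (Bx.ρ 0 • Bx.E 0, By.ρ t • By.E t))
      (continuousAt_const.prodMk (By.continuousAt_velocity hf.1 By.zero_mem))).eventually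
      (lt_mem_nhds hpos)
    obtain ⟨δ, hδ, h3⟩ := Metric.eventually_nhds_iff.1 (h1.and h2)
    exact ⟨δ, hδ, fun t ht => h3 (by simpa using ht)⟩
  obtain ⟨δ, hδpos, hδ1, hδ2, hδ3, hδx, hδy⟩ : ∃ δ > 0, δ ≤ δ₁ ∧ δ ≤ δ₂ ∧ δ ≤ δ₃ ∧ δ ≤ Bx.ε ∧
      δ ≤ By.ε :=
    ⟨min δ₁ (min δ₂ (min δ₃ (min Bx.ε By.ε))),
      lt_min hδ₁ (lt_min hδ₂ (lt_min hδ₃ (lt_min Bx.pos By.pos))), by simp, by simp, by simp,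
      by simp, by simp⟩
  -- in these coordinates the image of the singular set is the union of the two axes
  have havoid : ∀ t s : ℝ, |t| < δ → |s| < δ → ∀ z ∈ singularSet m f, f z = Ψ (t, s) →
      t = 0 ∨ s = 0 := by
    intro t s ht hs z hz hzΨ
    have h1 : Ψ (t, s) ∈ Metric.ball (f x) r := by
      refine hball _ ?_
      rw [← ball_prod_same]
      simpa using ⟨ht.trans_le hδ2, hs.trans_le hδ2⟩
    have hts : ((t, s) : ℝ × ℝ) ∈ Metric.ball (0, 0) δ₁ := by
      rw [← ball_prod_same]
      simpa using ⟨ht.trans_le hδ1, hs.trans_le hδ1⟩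
    have habs : ∀ {ε u : ℝ}, u ∈ Ioo (-(min δ₁ ε)) (min δ₁ ε) → |u| < δ₁ := fun hu =>
      (abs_lt.2 hu).trans_le (min_le_left _ _)
    rcases hrU z hz (hzΨ ▸ h1) with hzU | hzU
    · obtain ⟨t', ht', rfl⟩ := (Bx'.mem_iff z).1 ⟨hzU, hz⟩
      have h2 : ((t', 0) : ℝ × ℝ) = (t, s) := by
        refine hinj ?_ hts ((hΨx t').trans hzΨ)
        rw [← ball_prod_same]
        simpa using ⟨habs ht', hδ₁⟩
      exact Or.inr (Prod.mk.inj h2).2.symm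
    · obtain ⟨s', hs', rfl⟩ := (By'.mem_iff z).1 ⟨hzU, hz⟩
      have h2 : ((0, s') : ℝ × ℝ) = (t, s) := by
        refine hinj ?_ hts ((hΨy s').trans hzΨ)
        rw [← ball_prod_same]
        simpa using ⟨hδ₁, habs hs'⟩
      exact Or.inl (Prod.mk.inj h2).1.symm
  have hconst : ∀ I J : Set ℝ, I ⊆ Ioo (-δ) δ → J ⊆ Ioo (-δ) δ → OrdConnected I → OrdConnected J →
      0 ∉ I → 0 ∉ J → ∀ q ∈ I ×ˢ J, ∀ q' ∈ I ×ˢ J, c (Ψ q) = c (Ψ q') := by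
    intro I J hI hJ hIo hJo hI0 hJ0 q hq q' hq'
    have h1 : IsPreconnected (Ψ '' (I ×ˢ J)) := by
      refine (hIo.isPreconnected.prod hJo.isPreconnected).image _ fun q hq => ?_
      exact (hΨc q.1 (abs_lt.1 ((abs_lt.2 (hI hq.1)).trans_le hδx)) q.2
        (abs_lt.1 ((abs_lt.2 (hJ hq.2)).trans_le hδy))).continuousWithinAt
    refine hc.eq_of_isPreconnected h1 ?_ ⟨q, hq, rfl⟩ ⟨q', hq', rfl⟩
    rintro _ ⟨q, hq, rfl⟩ ⟨z, hz, hzq⟩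
    rcases havoid q.1 q.2 (abs_lt.2 (hI hq.1)) (abs_lt.2 (hJ hq.2)) z hz hzq with h2 | h2
    · exact hI0 (h2 ▸ hq.1)
    · exact hJ0 (h2 ▸ hq.2)
  have hP : Ioo 0 δ ⊆ Ioo (-δ) δ := Ioo_subset_Ioo_left (by linarith)
  have hN : Ioo (-δ) 0 ⊆ Ioo (-δ) δ := Ioo_subset_Ioo_right (by linarith)
  have hP0 : (0 : ℝ) ∉ Ioo 0 δ := fun h => lt_irrefl _ h.1
  have hN0 : (0 : ℝ) ∉ Ioo (-δ) 0 := fun h => lt_irrefl _ h.2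
  have hPm : δ / 2 ∈ Ioo 0 δ := ⟨half_pos hδpos, half_lt_self hδpos⟩
  have hNm : -(δ / 2) ∈ Ioo (-δ) 0 :=
    ⟨by linarith [half_lt_self hδpos], by linarith [half_pos hδpos]⟩
  set a₁ := c (Ψ (δ / 2, δ / 2))
  set a₂ := c (Ψ (-(δ / 2), δ / 2))
  set a₃ := c (Ψ (-(δ / 2), -(δ / 2)))
  set a₄ := c (Ψ (δ / 2, -(δ / 2)))
  have h₁ : ∀ t s : ℝ, |t| < δ → |s| < δ → 0 < t → 0 < s → c (Ψ (t, s)) = a₁ :=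
    fun t s ht hs ht0 hs0 => hconst _ _ hP hP ordConnected_Ioo ordConnected_Ioo hP0 hP0 _
      ⟨⟨ht0, (abs_lt.1 ht).2⟩, hs0, (abs_lt.1 hs).2⟩ _ ⟨hPm, hPm⟩
  have h₂ : ∀ t s : ℝ, |t| < δ → |s| < δ → t < 0 → 0 < s → c (Ψ (t, s)) = a₂ :=
    fun t s ht hs ht0 hs0 => hconst _ _ hN hP ordConnected_Ioo ordConnected_Ioo hN0 hP0 _
      ⟨⟨(abs_lt.1 ht).1, ht0⟩, hs0, (abs_lt.1 hs).2⟩ _ ⟨hNm, hPm⟩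
  have h₃ : ∀ t s : ℝ, |t| < δ → |s| < δ → t < 0 → s < 0 → c (Ψ (t, s)) = a₃ :=
    fun t s ht hs ht0 hs0 => hconst _ _ hN hN ordConnected_Ioo ordConnected_Ioo hN0 hN0 _
      ⟨⟨(abs_lt.1 ht).1, ht0⟩, (abs_lt.1 hs).1, hs0⟩ _ ⟨hNm, hNm⟩
  have h₄ : ∀ t s : ℝ, |t| < δ → |s| < δ → 0 < t → s < 0 → c (Ψ (t, s)) = a₄ :=
    fun t s ht hs ht0 hs0 => hconst _ _ hP hN ordConnected_Ioo ordConnected_Ioo hP0 hN0 _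
      ⟨⟨ht0, (abs_lt.1 ht).2⟩, (abs_lt.1 hs).1, hs0⟩ _ ⟨hPm, hNm⟩
  have hnear : ∀ t s : ℝ, |t| < δ → |s| < δ →
      ∀ᶠ q : ℝ × ℝ in 𝓝 (t, s), |q.1| < δ ∧ |q.2| < δ := by
    intro t s ht hs
    have h3 : ContinuousAt (fun q : ℝ × ℝ => |q.1|) (t, s) := by fun_prop
    have h4 : ContinuousAt (fun q : ℝ × ℝ => |q.2|) (t, s) := by fun_prop
    exact (h3.eventually_lt_const ht).and (h4.eventually_lt_const hs)
  have hfst : ∀ t s : ℝ, ContinuousAt (fun q : ℝ × ℝ => q.1) (t, s) :=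
    fun t s => continuousAt_fst
  have hsnd : ∀ t s : ℝ, ContinuousAt (fun q : ℝ × ℝ => q.2) (t, s) :=
    fun t s => continuousAt_snd
  have h00 : |(0 : ℝ)| < δ := by simpa using hδpos
  refine ⟨δ, hδpos, a₁, a₂, a₃, a₄, fun t ht htδ => ?_, fun s hs hsδ => ?_⟩
  · have hcr' := (hcr t (htδ.trans_le hδ3)).1
    have hn := hnear t 0 htδ h00
    rw [← hΨx]
    constructor
    · intro ht0
      have h5 := (hfst t 0).eventually_const_lt ht0
      exact sidesAt_fst (hdx t ht) (hdy 0 By.zero_mem) hcr'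
        ((hn.and h5).mono fun q hq h => h₁ _ _ hq.1.1 hq.1.2 hq.2 h)
        ((hn.and h5).mono fun q hq h => h₄ _ _ hq.1.1 hq.1.2 hq.2 h)
    · intro ht0
      have h5 := (hfst t 0).eventually_lt_const ht0
      exact sidesAt_fst (hdx t ht) (hdy 0 By.zero_mem) hcr'
        ((hn.and h5).mono fun q hq h => h₂ _ _ hq.1.1 hq.1.2 hq.2 h)
        ((hn.and h5).mono fun q hq h => h₃ _ _ hq.1.1 hq.1.2 hq.2 h)
  · have hcr' := (hcr s (hsδ.trans_le hδ3)).2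
    have hn := hnear 0 s h00 hsδ
    rw [← hΨy]
    constructor
    · intro hs0
      have h5 := (hsnd 0 s).eventually_const_lt hs0
      exact sidesAt_snd (hdx 0 Bx.zero_mem) (hdy s hs) hcr'
        ((hn.and h5).mono fun q hq h => h₂ _ _ hq.1.1 hq.1.2 h hq.2)
        ((hn.and h5).mono fun q hq h => h₁ _ _ hq.1.1 hq.1.2 h hq.2)
    · intro hs0
      have h5 := (hsnd 0 s).eventually_lt_const hs0
      exact sidesAt_snd (hdx 0 Bx.zero_mem) (hdy s hs) hcr'
        ((hn.and h5).mono fun q hq h => h₃ _ _ hq.1.1 hq.1.2 h hq.2)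
        ((hn.and h5).mono fun q hq h => h₄ _ _ hq.1.1 hq.1.2 h hq.2)

end

end

noncomputable section

/-! ### The canonical direction -/

/-- The condition under which a relation `side` orients the branches consistently: of two adjacent
values of a chessboard function exactly one precedes the other, and `h` increases by one from the
former to the latter. -/
def IsPotential {R : Type*} [Ring R] (side : R → R → Prop) (h : R → ℤ) : Prop :=
  ∀ a b, a - b = 1 ∨ a - b = -1 →
    (side a b ∧ ¬ side b a ∧ h b = h a + 1) ∨ (side b a ∧ ¬ side a b ∧ h a = h b + 1)

lemma isPotential_intSide : IsPotential intSide id := by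
  intro a b hab
  simp only [intSide, id]
  omega

lemma isPotential_modTwoSide : IsPotential modTwoSide fun a => (a.val : ℤ) := by
  unfold IsPotential modTwoSide
  decide

/-- A unit vector tangent to the image of the singular set at the image of `p`, with the canonical
coorientation on its left. -/
def IsCanonicalDirection {R : Type*} (side : R → R → Prop) (m : ℕ) {M : Type*} [TopologicalSpace M]
    [ChartedSpace (Euc m) M] (f : M → Euc 2) (c : Euc 2 → R) (p : M) (v : Euc 2) : Prop :=
  ‖v‖ = 1 ∧ v ∈ range (mfderiv (𝓡 m) (𝓡 2) f p) ∧ ∃ a b, SidesAt c (f p) v a b ∧ side a b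

/-- The unit tangent vector of the image of the singular set that is given by the canonical local
orientation; it matters only off the distinguished points. -/
def canonicalDirection {R : Type*} (side : R → R → Prop) (m : ℕ) {M : Type*} [TopologicalSpace M]
    [ChartedSpace (Euc m) M] (f : M → Euc 2) (c : Euc 2 → R) (p : M) : Euc 2 :=
  Classical.epsilon (IsCanonicalDirection side m f c p)

/-- The signs of a branch with respect to a field of directions, in the two halves of the branch:
they tell whether the image of the branch runs in the given direction or in the opposite one. -/
def SingularBranch.HasSigns {m : ℕ} {M : Type*} [TopologicalSpace M] [ChartedSpace (Euc m) M]
    {f : M → Euc 2} {p : M} (B : SingularBranch m f p) (V : M → Euc 2) (s s' : ℤ) : Prop :=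
  (∀ᶠ t in 𝓝[>] (0 : ℝ), B.ρ t • B.E t = (s * ‖B.ρ t • B.E t‖) • V (B.γ t)) ∧
    ∀ᶠ t in 𝓝[<] (0 : ℝ), B.ρ t • B.E t = (s' * ‖B.ρ t • B.E t‖) • V (B.γ t)

lemma exists_smul_add_smul_eq {v w : Euc 2} (h : cross v w ≠ 0) (u : Euc 2) :
    ∃ a b : ℝ, a • v + b • w = u :=
  ⟨_, _, (planeEquiv_apply v w h ((planeEquiv v w h).symm u)).symm.trans
    ((planeEquiv v w h).apply_symm_apply u)⟩

lemma cross_eq_zero_of_mem_range {m : ℕ} {M : Type*} [TopologicalSpace M] [ChartedSpace (Euc m) M]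
    {f : M → Euc 2} {p : M} (hp : p ∈ singularSet m f) {v w : Euc 2}
    (hv : v ∈ range (mfderiv (𝓡 m) (𝓡 2) f p)) (hw : w ∈ range (mfderiv (𝓡 m) (𝓡 2) f p)) :
    cross v w = 0 := by
  by_contra h
  apply hp
  intro u
  obtain ⟨a, b, hab⟩ := exists_smul_add_smul_eq h u
  obtain ⟨x, hx⟩ := hv
  obtain ⟨y, hy⟩ := hw
  refine ⟨a • x + b • y, ?_⟩
  rw [map_add, map_smul, map_smul, hx, hy]
  exact hab

lemma exists_smul_of_mem_range {m : ℕ} {M : Type*} [TopologicalSpace M] [ChartedSpace (Euc m) M]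
    {f : M → Euc 2} {p : M} (hp : p ∈ singularSet m f) {v w : Euc 2}
    (hv : v ∈ range (mfderiv (𝓡 m) (𝓡 2) f p)) (hw : w ∈ range (mfderiv (𝓡 m) (𝓡 2) f p))
    (hv0 : v ≠ 0) (hw0 : w ≠ 0) : ∃ r : ℝ, r ≠ 0 ∧ w = r • v := by
  have h := eq_smul_of_cross_eq_zero hv0 (cross_eq_zero_of_mem_range hp hv hw)
  refine ⟨_, ?_, h⟩
  intro h0
  rw [h0, zero_smul] at h
  exact hw0 h

lemma SingularBranch.velocity_mem_range {m : ℕ} {M : Type*} [TopologicalSpace M]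
    [ChartedSpace (Euc m) M] {f : M → Euc 2} {p : M} (B : SingularBranch m f p) {t : ℝ}
    (ht : t ∈ Ioo (-B.ε) B.ε) : B.ρ t • B.E t ∈ range (mfderiv (𝓡 m) (𝓡 2) f (B.γ t)) := by
  obtain ⟨x, hx⟩ := B.mem_range t ht
  exact ⟨B.ρ t • x, by rw [map_smul, hx]; rfl⟩

section

variable {R : Type*} [Ring R] {side : R → R → Prop} {h : R → ℤ} {m : ℕ} {M : Type*}
  [TopologicalSpace M] [T1Space M] [CompactSpace M]
  [ChartedSpace (Euc m) M] [IsManifold (𝓡 m) ∞ M] {f : M → Euc 2} {c : Euc 2 → R}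
  (hf : IsGenericMap m f) (hm : 2 ≤ m) (hperp : PerpendicularCrossings m f)
  (hc : IsChessboard m f c)
include hf hm hperp hc

/-- At points that are not distinguished, a chessboard function has adjacent values on the two
sides of each tangent vector. -/
lemma exists_sidesAt {p : M} (hp : p ∈ openArcSet m f) {v : Euc 2}
    (hv : v ∈ range (mfderiv (𝓡 m) (𝓡 2) f p)) (hv0 : v ≠ 0) :
    ∃ a b, (a - b = 1 ∨ a - b = -1) ∧ SidesAt c (f p) v a b := by
  obtain ⟨B⟩ := nonempty_branch hf hm hp.1
  obtain ⟨δ, hδ, a, b, hab, hs⟩ := B.exists_sides hf hm hc hperp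
    fun x hx h => eq_of_mem_openArcSet hf hm hp hx h
  have hρ : B.ρ 0 ≠ 0 := by
    rw [← B.mem_foldSet_iff hf hm B.zero_mem, B.zero]
    exact openArcSet_subset_foldSet hf hm hp
  have h1 := hs 0 B.zero_mem (by simpa using hδ) hρ
  have h2 := B.velocity_mem_range B.zero_mem
  rw [B.zero] at h1 h2
  obtain ⟨r, hr, rfl⟩ := exists_smul_of_mem_range hp.1 h2 hv
    (smul_ne_zero hρ (B.ne_zero 0 B.zero_mem)) hv0
  rcases lt_or_gt_of_ne hr with hr | hr
  · exact ⟨b, a, by rw [← neg_sub a b, neg_eq_iff_eq_neg, neg_inj]; exact hab.symm, h1.smul_neg hr⟩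
  · exact ⟨a, b, hab, h1.smul_pos hr⟩

variable (hh : IsPotential side h)
include hh

/-- The canonical direction is well defined off the distinguished points. -/
lemma existsUnique_canonicalDirection {p : M} (hp : p ∈ openArcSet m f) :
    ∃! v, IsCanonicalDirection side m f c p v := by
  obtain ⟨B⟩ := nonempty_branch hf hm hp.1
  have hv := B.mem_range 0 B.zero_mem
  have hv0 := B.ne_zero 0 B.zero_mem
  rw [B.zero] at hv
  set v := B.E 0
  obtain ⟨a, b, hab, hs⟩ := exists_sidesAt hf hm hperp hc hp hv hv0
  have hn : 0 < ‖v‖⁻¹ := inv_pos.2 (norm_pos_iff.2 hv0)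
  -- opposite directions exchange the two sides, and just one of the two orders is admitted by
  -- `side`
  have huniq : ∀ {u w : Euc 2}, IsCanonicalDirection side m f c p u →
      IsCanonicalDirection side m f c p w → w = u := by
    rintro u w ⟨hu1, hur, a, b, hus, huab⟩ ⟨hw1, hwr, a', b', hws, hwab⟩
    have hu0 : u ≠ 0 := fun h0 => by simp [h0] at hu1
    have hw0 : w ≠ 0 := fun h0 => by simp [h0] at hw1
    obtain ⟨r, hr, rfl⟩ := exists_smul_of_mem_range hp.1 hur hwr hu0 hw0
    rw [norm_smul, hu1, mul_one, Real.norm_eq_abs] at hw1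
    rcases eq_or_eq_neg_of_abs_eq hw1 with rfl | rfl
    · rw [one_smul]
    · exfalso
      obtain ⟨rfl, rfl⟩ := hws.unique (hus.smul_neg (neg_one_lt_zero)) hw0
      obtain ⟨a'', b'', hab'', hs''⟩ := exists_sidesAt hf hm hperp hc hp hur hu0
      obtain ⟨rfl, rfl⟩ := hs''.unique hus hu0
      rcases hh _ _ hab'' with h1 | h1
      · exact h1.2.1 hwab
      · exact h1.2.1 huab
  have hn1 : ‖‖v‖⁻¹ • v‖ = 1 := norm_smul_inv_norm hv0
  obtain ⟨x, hx⟩ := hv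
  rcases hh a b hab with h1 | h1
  · have h2 : IsCanonicalDirection side m f c p (‖v‖⁻¹ • v) :=
      ⟨hn1, ⟨‖v‖⁻¹ • x, by rw [map_smul, hx]; rfl⟩, a, b, hs.smul_pos hn, h1.1⟩
    exact ⟨_, h2, fun w hw => huniq h2 hw⟩
  · have h2 : IsCanonicalDirection side m f c p ((-‖v‖⁻¹) • v) :=
      ⟨by rw [neg_smul, norm_neg, hn1], ⟨(-‖v‖⁻¹) • x, by rw [map_smul, hx]; rfl⟩, b, a,
        hs.smul_neg (neg_lt_zero.2 hn), h1.1⟩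
    exact ⟨_, h2, fun w hw => huniq h2 hw⟩

lemma isCanonicalDirection_canonicalDirection {p : M} (hp : p ∈ openArcSet m f) :
    IsCanonicalDirection side m f c p (canonicalDirection side m f c p) :=
  Classical.epsilon_spec (existsUnique_canonicalDirection hf hm hperp hc hh hp).exists

/-- A tangent vector of the image of the singular set is a multiple of the canonical direction; the
sign is the increment of the potential from the left to the right. -/
lemma eq_smul_canonicalDirection {p : M} (hp : p ∈ openArcSet m f) {v : Euc 2}
    (hv : v ∈ range (mfderiv (𝓡 m) (𝓡 2) f p)) (hv0 : v ≠ 0) {a b : R}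
    (hs : SidesAt c (f p) v a b) :
    (h b - h a = 1 ∨ h b - h a = -1) ∧
      v = (((h b - h a : ℤ) : ℝ) * ‖v‖) • canonicalDirection side m f c p := by
  obtain ⟨a', b', hab, hs'⟩ := exists_sidesAt hf hm hperp hc hp hv hv0
  obtain ⟨rfl, rfl⟩ := hs'.unique hs hv0
  obtain ⟨hV1, hVr, x, y, hVs, hxy⟩ := isCanonicalDirection_canonicalDirection hf hm hperp hc hh hp
  set V := canonicalDirection side m f c p
  have hV0 : V ≠ 0 := fun h0 => by simp [h0] at hV1
  obtain ⟨r, hr, rfl⟩ := exists_smul_of_mem_range hp.1 hVr hv hV0 hv0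
  rw [norm_smul, hV1, mul_one, Real.norm_eq_abs]
  rcases lt_or_gt_of_ne hr with hr' | hr'
  · obtain ⟨rfl, rfl⟩ := hs'.unique (hVs.smul_neg hr') hv0
    rcases hh _ _ hab with h1 | h1
    · exact (h1.2.1 hxy).elim
    · have h2 : h b' - h a' = -1 := by omega
      refine ⟨Or.inr h2, ?_⟩
      rw [h2, abs_of_neg hr']
      simp
  · obtain ⟨rfl, rfl⟩ := hs'.unique (hVs.smul_pos hr') hv0
    rcases hh _ _ hab with h1 | h1
    · have h2 : h b' - h a' = 1 := by omega
      refine ⟨Or.inl h2, ?_⟩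
      rw [h2, abs_of_pos hr']
      simp
    · exact (h1.2.1 hxy).elim

lemma SingularBranch.velocity_eq {p : M} (B : SingularBranch m f p) {t : ℝ}
    (ht : t ∈ Ioo (-B.ε) B.ε) (hO : B.γ t ∈ openArcSet m f) {a b : R}
    (hs : SidesAt c (f (B.γ t)) (B.ρ t • B.E t) a b) :
    (h b - h a = 1 ∨ h b - h a = -1) ∧ B.ρ t • B.E t
      = (((h b - h a : ℤ) : ℝ) * ‖B.ρ t • B.E t‖) • canonicalDirection side m f c (B.γ t) :=
  eq_smul_canonicalDirection hf hm hperp hc hh hO (B.velocity_mem_range ht)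
    (smul_ne_zero ((B.mem_foldSet_iff hf hm ht).1 (openArcSet_subset_foldSet hf hm hO))
      (B.ne_zero t ht)) hs

/-- A branch whose base point is the only singular point over its image has the same sign with
respect to the canonical direction all along. -/
lemma SingularBranch.exists_sign {p : M} (B : SingularBranch m f p)
    (hu : ∀ x ∈ singularSet m f, f x = f p → x = p) :
    ∃ s : ℤ, (s = 1 ∨ s = -1) ∧ ∀ᶠ t in 𝓝 (0 : ℝ), B.γ t ∈ openArcSet m f →
      B.ρ t • B.E t = (s * ‖B.ρ t • B.E t‖) • canonicalDirection side m f c (B.γ t) := by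
  obtain ⟨δ, hδ, a, b, hab, hs⟩ := B.exists_sides hf hm hc hperp hu
  refine ⟨h b - h a, ?_, ?_⟩
  · rcases hh a b hab with h1 | h1 <;> omega
  · filter_upwards [isOpen_Ioo.mem_nhds B.zero_mem, Metric.ball_mem_nhds (0 : ℝ) hδ]
      with t ht htδ hO
    exact (B.velocity_eq hf hm hperp hc hh ht hO (hs t ht (by simpa using htδ)
      ((B.mem_foldSet_iff hf hm ht).1 (openArcSet_subset_foldSet hf hm hO)))).2

omit hc hh in
lemma SingularBranch.eventually_mem_openArcSet {p : M} (B : SingularBranch m f p) :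
    ∀ᶠ t in 𝓝[≠] (0 : ℝ), t ∈ Ioo (-B.ε) B.ε ∧ B.γ t ∈ openArcSet m f := by
  obtain ⟨δ, hδ, hO⟩ := B.exists_mem_openArcSet hf hm hperp
  filter_upwards [nhdsWithin_le_nhds (isOpen_Ioo.mem_nhds B.zero_mem),
    nhdsWithin_le_nhds (Metric.ball_mem_nhds (0 : ℝ) hδ), self_mem_nhdsWithin] with t ht htδ h0
  exact ⟨ht, hO t ht (by simpa using htδ) h0⟩

/-- The two halves of the branch at a cusp have the same sign. -/
lemma SingularBranch.exists_hasSigns_of_mem_cuspSet {p : M} (B : SingularBranch m f p)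
    (hp : p ∈ cuspSet m f) :
    ∃ s : ℤ, (s = 1 ∨ s = -1) ∧ B.HasSigns (canonicalDirection side m f c) s s := by
  have hu : ∀ x ∈ singularSet m f, f x = f p → x = p := by
    intro x hx hxp
    by_contra hne
    have h1 := mem_foldSet_of_image_eq hf hm B.mem.2 hx (Ne.symm hne) hxp.symm
    exact ((_root_.mem_foldSet_iff hf hm).1 h1).2 ((mem_cuspSet_iff hf hm).1 hp).2
  obtain ⟨s, hs, h1⟩ := B.exists_sign hf hm hperp hc hh hu
  have h2 := B.eventually_mem_openArcSet hf hm hperp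
  refine ⟨s, hs, ?_, ?_⟩
  · filter_upwards [nhdsWithin_le_nhds h1, nhdsWithin_mono _ (fun x (hx : 0 < x) => hx.ne') h2]
      with t h3 h4 using h3 h4.2
  · filter_upwards [nhdsWithin_le_nhds h1, nhdsWithin_mono _ (fun x (hx : x < 0) => hx.ne) h2]
      with t h3 h4 using h3 h4.2

/-- The four half-branches at a crossing point: the signs balance, since the potential is defined in
the four quadrants. -/
lemma SingularBranch.exists_hasSigns_of_image_eq {x y : M} (hxy : x ≠ y) (hfxy : f x = f y)
    (Bx : SingularBranch m f x) (By : SingularBranch m f y) :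
    ∃ s₁ s₂ s₃ s₄ : ℤ, (s₁ = 1 ∨ s₁ = -1) ∧ (s₂ = 1 ∨ s₂ = -1) ∧ (s₃ = 1 ∨ s₃ = -1) ∧
      (s₄ = 1 ∨ s₄ = -1) ∧ Bx.HasSigns (canonicalDirection side m f c) s₁ s₂ ∧
      By.HasSigns (canonicalDirection side m f c) s₃ s₄ ∧ s₁ + s₃ = s₂ + s₄ := by
  wlog hpos : 0 < cross (Bx.ρ 0 • Bx.E 0) (By.ρ 0 • By.E 0) generalizing x y
  · obtain ⟨hne, -⟩ := cross_ne_zero_of_image_eq hf hm hperp hxy hfxy Bx By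
    obtain ⟨s₁, s₂, s₃, s₄, h1, h2, h3, h4, h5, h6, h7⟩ := this hxy.symm hfxy.symm By Bx (by
      rw [cross_swap, neg_pos]
      exact lt_of_le_of_ne (not_lt.1 hpos) hne)
    exact ⟨s₃, s₄, s₁, s₂, h3, h4, h1, h2, h6, h5, by omega⟩
  obtain ⟨δ, hδ, a₁, a₂, a₃, a₄, hx, hy⟩ :=
    Bx.exists_sides_of_crossing hf hm hc hperp hxy hfxy By hpos
  -- the signs are increments of the potential from the left to the right of the half-branches
  have key : ∀ {z : M} (B : SingularBranch m f z) (a b a' b' : R),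
      (∀ t ∈ Ioo (-B.ε) B.ε, |t| < δ →
        (0 < t → SidesAt c (f (B.γ t)) (B.ρ t • B.E t) a b) ∧
        (t < 0 → SidesAt c (f (B.γ t)) (B.ρ t • B.E t) a' b')) →
      (h b - h a = 1 ∨ h b - h a = -1) ∧ (h b' - h a' = 1 ∨ h b' - h a' = -1) ∧
        B.HasSigns (canonicalDirection side m f c) (h b - h a) (h b' - h a') := by
    intro z B a b a' b' hB
    have h2 := B.eventually_mem_openArcSet hf hm hperp
    have h3 := h2.and (nhdsWithin_le_nhds (Metric.ball_mem_nhds (0 : ℝ) hδ))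
    have hP : ∀ᶠ t in 𝓝[>] (0 : ℝ), (h b - h a = 1 ∨ h b - h a = -1) ∧ B.ρ t • B.E t
        = (((h b - h a : ℤ) : ℝ) * ‖B.ρ t • B.E t‖) • canonicalDirection side m f c (B.γ t) := by
      filter_upwards [nhdsWithin_mono _ (fun x (hx : 0 < x) => hx.ne') h3, self_mem_nhdsWithin]
        with t ht ht0
      exact B.velocity_eq hf hm hperp hc hh ht.1.1 ht.1.2
        ((hB t ht.1.1 (by simpa using ht.2)).1 ht0)
    have hN : ∀ᶠ t in 𝓝[<] (0 : ℝ), (h b' - h a' = 1 ∨ h b' - h a' = -1) ∧ B.ρ t • B.E t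
        = (((h b' - h a' : ℤ) : ℝ) * ‖B.ρ t • B.E t‖) • canonicalDirection side m f c (B.γ t) := by
      filter_upwards [nhdsWithin_mono _ (fun x (hx : x < 0) => hx.ne) h3, self_mem_nhdsWithin]
        with t ht ht0
      exact B.velocity_eq hf hm hperp hc hh ht.1.1 ht.1.2
        ((hB t ht.1.1 (by simpa using ht.2)).2 ht0)
    obtain ⟨_, h4, -⟩ := hP.exists
    obtain ⟨_, h5, -⟩ := hN.exists
    exact ⟨h4, h5, hP.mono fun _ h => h.2, hN.mono fun _ h => h.2⟩
  obtain ⟨h1, h2, h3⟩ := key Bx _ _ _ _ hx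
  obtain ⟨h4, h5, h6⟩ := key By _ _ _ _ hy
  -- `(h a₄ - h a₁) + (h a₁ - h a₂) = (h a₃ - h a₂) + (h a₄ - h a₃)`
  exact ⟨_, _, _, _, h1, h2, h4, h5, h3, h6, by ring⟩

lemma SingularBranch.HasSigns.unique {p : M} {B : SingularBranch m f p} {s s' r r' : ℤ}
    (hs : B.HasSigns (canonicalDirection side m f c) s s')
    (hr : B.HasSigns (canonicalDirection side m f c) r r') : s = r ∧ s' = r' := by
  have h2 := B.eventually_mem_openArcSet hf hm hperp
  have key : ∀ {x y : ℤ} {t : ℝ}, t ∈ Ioo (-B.ε) B.ε ∧ B.γ t ∈ openArcSet m f →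
      B.ρ t • B.E t = (x * ‖B.ρ t • B.E t‖) • canonicalDirection side m f c (B.γ t) →
      B.ρ t • B.E t = (y * ‖B.ρ t • B.E t‖) • canonicalDirection side m f c (B.γ t) → x = y := by
    intro x y t ht h3 h4
    have h5 := (isCanonicalDirection_canonicalDirection hf hm hperp hc hh ht.2).1
    have h6 : canonicalDirection side m f c (B.γ t) ≠ 0 := fun h0 => by simp [h0] at h5
    have h7 : B.ρ t • B.E t ≠ 0 := smul_ne_zero ((B.mem_foldSet_iff hf hm ht.1).1
      (openArcSet_subset_foldSet hf hm ht.2)) (B.ne_zero t ht.1)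
    have h8 := smul_left_injective ℝ h6 (h3.symm.trans h4)
    exact_mod_cast mul_right_cancel₀ (norm_ne_zero_iff.2 h7) h8
  constructor
  · obtain ⟨t, ⟨h3, h4⟩, h5⟩ := ((hs.1.and hr.1).and
      (nhdsWithin_mono _ (fun x (hx : 0 < x) => hx.ne') h2)).exists
    exact key h5 h3 h4
  · obtain ⟨t, ⟨h3, h4⟩, h5⟩ := ((hs.2.and hr.2).and
      (nhdsWithin_mono _ (fun x (hx : x < 0) => hx.ne) h2)).exists
    exact key h5 h3 h4

end

end

noncomputable section

/-! ### Local flows on one-dimensional spaces -/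

/-- `G Γ t` says that the curve `Γ` is an integral curve at the time `t` of a local flow on the
subset `O` of a space, without rest points and with one-dimensional orbits: integral curves are
determined by their positions at one time, and through each point of `O` there passes one that
sweeps out a neighbourhood in `O`. -/
structure IsLocalFlow {X : Type*} [TopologicalSpace X] (O : Set X) (G : (ℝ → X) → ℝ → Prop) :
    Prop where
  congr : ∀ {Γ Γ' : ℝ → X} {t : ℝ}, Γ =ᶠ[𝓝 t] Γ' → G Γ t → G Γ' t
  mem : ∀ {Γ : ℝ → X} {t : ℝ}, G Γ t → Γ t ∈ O
  continuousAt : ∀ {Γ : ℝ → X} {t : ℝ}, G Γ t → ContinuousAt Γ t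
  shift : ∀ {Γ : ℝ → X} {t a : ℝ}, G Γ (t + a) → G (fun s => Γ (s + a)) t
  chart : ∀ p ∈ O, ∃ ε > 0, ∃ η : ℝ → X, η 0 = p ∧ (∀ t ∈ Ioo (-ε) ε, G η t) ∧
    InjOn η (Ioo (-ε) ε) ∧
    ∀ δ, 0 < δ → δ ≤ ε → ∃ U, IsOpen U ∧ U ∩ O = η '' Ioo (-δ) δ
  unique : ∀ {Γ Γ' : ℝ → X} {t : ℝ}, (∀ᶠ s in 𝓝 t, G Γ s) → (∀ᶠ s in 𝓝 t, G Γ' s) →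
    Γ t = Γ' t → Γ =ᶠ[𝓝 t] Γ'

/-- `Γ` is an integral curve on the open interval `S` that cannot be extended. -/
structure IsMaximalCurve {X : Type*} (G : (ℝ → X) → ℝ → Prop) (S : Set ℝ) (Γ : ℝ → X) :
    Prop where
  isOpen : IsOpen S
  isPreconnected : IsPreconnected S
  zero_mem : 0 ∈ S
  curve : ∀ t ∈ S, G Γ t
  subset : ∀ (S' : Set ℝ) (Γ' : ℝ → X), IsOpen S' → IsPreconnected S' → 0 ∈ S' →
    (∀ t ∈ S', G Γ' t) → Γ' 0 = Γ 0 → S' ⊆ S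

section

variable {X : Type*} [TopologicalSpace X] [T2Space X] {O : Set X} {G : (ℝ → X) → ℝ → Prop}
  (hG : IsLocalFlow O G)
include hG

/-- Integral curves on an interval are determined by their positions at one time. -/
lemma IsLocalFlow.eqOn {S : Set ℝ} (hS : IsOpen S) (hS' : IsPreconnected S) {Γ Γ' : ℝ → X}
    (h : ∀ t ∈ S, G Γ t) (h' : ∀ t ∈ S, G Γ' t) {t₀ : ℝ} (ht₀ : t₀ ∈ S) (h₀ : Γ t₀ = Γ' t₀) :
    EqOn Γ Γ' S := by
  have hev : ∀ t ∈ S, Γ t = Γ' t → Γ =ᶠ[𝓝 t] Γ' := fun t ht heq =>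
    hG.unique (eventually_of_mem (hS.mem_nhds ht) h) (eventually_of_mem (hS.mem_nhds ht) h') heq
  have hsub : S ⊆ {t | Γ =ᶠ[𝓝 t] Γ'} := by
    refine hS'.subset_of_closure_inter_subset ?_ ⟨t₀, ht₀, hev t₀ ht₀ h₀⟩ ?_
    · exact isOpen_iff_mem_nhds.2 fun t ht => (eventually_eventually_nhds.2 ht)
    · rintro t ⟨htc, htS⟩
      refine hev t htS ?_
      by_contra hne
      obtain ⟨s, hs, hs'⟩ := mem_closure_iff_nhds.1 htc _
        (((hG.continuousAt (h t htS)).ne_iff_eventually_ne (hG.continuousAt (h' t htS))).1 hne)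
      exact hs (show Γ =ᶠ[𝓝 s] Γ' from hs').self_of_nhds
  exact fun t ht => (hsub ht).self_of_nhds

lemma IsLocalFlow.exists_maximalCurve {p : X} (hp : p ∈ O) :
    ∃ S Γ, IsMaximalCurve G S Γ ∧ Γ 0 = p := by
  classical
  set 𝒮 : Set (Set ℝ) := {S | IsOpen S ∧ IsPreconnected S ∧ 0 ∈ S ∧
    ∃ Γ : ℝ → X, (∀ t ∈ S, G Γ t) ∧ Γ 0 = p} with h𝒮
  have : Nonempty X := ⟨p⟩
  choose! F hF using fun (S : Set ℝ) (hS : S ∈ 𝒮) => hS.2.2.2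
  have hagree : ∀ S ∈ 𝒮, ∀ S' ∈ 𝒮, ∀ t ∈ S, t ∈ S' → F S t = F S' t := by
    intro S hS S' hS' t ht ht'
    exact hG.eqOn (hS.1.inter hS'.1)
      (hS.2.1.ordConnected.inter hS'.2.1.ordConnected).isPreconnected
      (fun t ht => (hF S hS).1 t ht.1) (fun t ht => (hF S' hS').1 t ht.2)
      (t₀ := 0) ⟨hS.2.2.1, hS'.2.2.1⟩ ((hF S hS).2.trans (hF S' hS').2.symm) ⟨ht, ht'⟩
  set Γ : ℝ → X := fun t => if h : ∃ S ∈ 𝒮, t ∈ S then F h.choose t else p with hΓ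
  have hΓF : ∀ S ∈ 𝒮, ∀ t ∈ S, Γ t = F S t := by
    intro S hS t ht
    have h : ∃ S ∈ 𝒮, t ∈ S := ⟨S, hS, ht⟩
    simp only [hΓ, dif_pos h]
    exact hagree _ h.choose_spec.1 S hS t h.choose_spec.2 ht
  obtain ⟨ε, hε, η, hη0, hη, -, -⟩ := hG.chart p hp
  have h0 : Ioo (-ε) ε ∈ 𝒮 := ⟨isOpen_Ioo, isPreconnected_Ioo, ⟨by linarith, hε⟩, η, hη, hη0⟩
  have hΓ0 : Γ 0 = p := (hΓF _ h0 0 ⟨by linarith, hε⟩).trans (hF _ h0).2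
  refine ⟨⋃₀ 𝒮, Γ, ⟨isOpen_sUnion fun S hS => hS.1,
    isPreconnected_sUnion 0 𝒮 (fun S hS => hS.2.2.1) fun S hS => hS.2.1,
    ⟨_, h0, by linarith, hε⟩, ?_, ?_⟩, hΓ0⟩
  · rintro t ⟨S, hS, ht⟩
    refine hG.congr ?_ ((hF S hS).1 t ht)
    filter_upwards [hS.1.mem_nhds ht] with s hs using (hΓF S hS s hs).symm
  · intro S' Γ' h1 h2 h3 h4 h5
    exact subset_sUnion_of_mem ⟨h1, h2, h3, Γ', h4, h5.trans hΓ0⟩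

variable {S : Set ℝ} {Γ : ℝ → X} (hΓ : IsMaximalCurve G S Γ)
include hΓ

/-- An integral curve that meets a maximal one is a part of it. -/
lemma IsLocalFlow.subset_of_eq {J : Set ℝ} (hJ : IsOpen J) (hJ' : IsPreconnected J) {η : ℝ → X}
    (hη : ∀ t ∈ J, G η t) {t₀ : ℝ} (ht₀ : t₀ ∈ S) (ht₀' : t₀ ∈ J) (h : Γ t₀ = η t₀) :
    J ⊆ S ∧ EqOn Γ η J := by
  classical
  have heq : EqOn Γ η (S ∩ J) := hG.eqOn (hΓ.isOpen.inter hJ)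
    (hΓ.isPreconnected.ordConnected.inter hJ'.ordConnected).isPreconnected
    (fun t ht => hΓ.curve t ht.1) (fun t ht => hη t ht.2) ⟨ht₀, ht₀'⟩ h
  have hJS : J ⊆ S := by
    refine subset_union_right.trans (hΓ.subset (S ∪ J) (fun t => if t ∈ S then Γ t else η t)
      (hΓ.isOpen.union hJ) (hΓ.isPreconnected.union t₀ ht₀ ht₀' hJ') (Or.inl hΓ.zero_mem) ?_
      (if_pos hΓ.zero_mem))
    intro t ht
    by_cases htS : t ∈ S
    · refine hG.congr ?_ (hΓ.curve t htS)
      filter_upwards [hΓ.isOpen.mem_nhds htS] with s hs using (if_pos hs).symm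
    · have htJ := ht.resolve_left htS
      refine hG.congr ?_ (hη t htJ)
      filter_upwards [hJ.mem_nhds htJ] with s hs
      split_ifs with hsS
      · exact (heq ⟨hsS, hs⟩).symm
      · rfl
  exact ⟨hJS, fun t ht => heq ⟨hJS ht, ht⟩⟩

/-- The version of `IsLocalFlow.subset_of_eq` with a shift of the time. -/
lemma IsLocalFlow.subset_of_eq_shift {J : Set ℝ} (hJ : IsOpen J) (hJ' : IsPreconnected J)
    {η : ℝ → X} (hη : ∀ t ∈ J, G η t) {t₀ s₀ : ℝ} (ht₀ : t₀ ∈ S) (hs₀ : s₀ ∈ J)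
    (h : Γ t₀ = η s₀) : ∀ s ∈ J, s + (t₀ - s₀) ∈ S ∧ Γ (s + (t₀ - s₀)) = η s := by
  have h1 := hG.subset_of_eq hΓ (J := (fun t => t + (s₀ - t₀)) ⁻¹' J)
    (hJ.preimage (by fun_prop)) (by
      refine OrdConnected.isPreconnected ⟨fun x hx y hy z hz => hJ'.ordConnected.out hx hy ?_⟩
      exact ⟨by linarith [hz.1], by linarith [hz.2]⟩)
    (fun t ht => hG.shift (hη _ ht)) ht₀ (by simpa using hs₀)
    (by simpa using h)
  intro s hs
  have hr : s + (t₀ - s₀) + (s₀ - t₀) = s := by ring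
  have h2 : s + (t₀ - s₀) ∈ (fun t => t + (s₀ - t₀)) ⁻¹' J := by
    rw [mem_preimage, hr]
    exact hs
  refine ⟨h1.1 h2, (h1.2 h2).trans ?_⟩
  simp only [hr]

/-- The neighbourhoods swept out by integral curves are contained in the image of a maximal curve
or disjoint from it. -/
lemma IsLocalFlow.subset_image {U : Set X} {ε : ℝ} {η : ℝ → X}
    (hη : ∀ t ∈ Ioo (-ε) ε, G η t) {δ : ℝ} (hδ : δ ≤ ε) (hU : U ∩ O = η '' Ioo (-δ) δ) {x : X}
    (hxU : x ∈ U) (hx : x ∈ Γ '' S) : U ∩ O ⊆ Γ '' S := by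
  obtain ⟨t₀, ht₀, rfl⟩ := hx
  have h1 : Γ t₀ ∈ U ∩ O := ⟨hxU, hG.mem (hΓ.curve t₀ ht₀)⟩
  rw [hU] at h1
  obtain ⟨s₀, hs₀, h2⟩ := h1
  have hsub : Ioo (-δ) δ ⊆ Ioo (-ε) ε := Ioo_subset_Ioo (neg_le_neg hδ) hδ
  rw [hU]
  rintro _ ⟨s, hs, rfl⟩
  have h3 := hG.subset_of_eq_shift hΓ isOpen_Ioo isPreconnected_Ioo hη ht₀ (hsub hs₀) h2.symm s
    (hsub hs)
  exact ⟨_, h3.1, h3.2⟩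

/-- The image of a maximal curve is closed in `O`. -/
lemma IsLocalFlow.mem_image_of_mem_closure {q : X} (hq : q ∈ O) (hqc : q ∈ closure (Γ '' S)) :
    q ∈ Γ '' S := by
  obtain ⟨ε, hε, η, hη0, hη, -, hU⟩ := hG.chart q hq
  obtain ⟨U, hUo, hU⟩ := hU ε hε le_rfl
  have hqU : q ∈ U ∩ O := by
    rw [hU]; exact ⟨0, ⟨by linarith, hε⟩, hη0⟩
  obtain ⟨x, hxU, hx⟩ := mem_closure_iff.1 hqc U hUo hqU.1
  exact hG.subset_image hΓ hη le_rfl hU hxU hx hqU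

/-- The image of a maximal curve is a connected component, as it is relatively open and closed in
`O`. -/
lemma IsLocalFlow.image_eq : Γ '' S = connectedComponentIn O (Γ 0) := by
  have hsubO : Γ '' S ⊆ O := by
    rintro _ ⟨t, ht, rfl⟩
    exact hG.mem (hΓ.curve t ht)
  have h0 : Γ 0 ∈ Γ '' S := ⟨0, hΓ.zero_mem, rfl⟩
  refine subset_antisymm ?_ ?_
  · refine IsPreconnected.subset_connectedComponentIn ?_ h0 hsubO
    exact hΓ.isPreconnected.image _ fun t ht =>
      (hG.continuousAt (hΓ.curve t ht)).continuousWithinAt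
  · have hch : ∀ q ∈ O, ∃ U, IsOpen U ∧ q ∈ U ∧ ∀ x ∈ U, x ∈ Γ '' S → U ∩ O ⊆ Γ '' S := by
      intro q hq
      obtain ⟨ε, hε, η, hη0, hη, -, hU⟩ := hG.chart q hq
      obtain ⟨U, hUo, hU⟩ := hU ε hε le_rfl
      have hqU : q ∈ U ∩ O := by
        rw [hU]; exact ⟨0, ⟨by linarith, hε⟩, hη0⟩
      exact ⟨U, hUo, hqU.1, fun x hxU hx => hG.subset_image hΓ hη le_rfl hU hxU hx⟩
    choose! U hUo hU hUA using hch
    have hcov : ∀ x ∈ O, ∀ q ∈ Γ '' S, x ∈ U q → x ∈ Γ '' S := fun x hx q hq hxq =>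
      hUA q (hsubO hq) q (hU q (hsubO hq)) hq ⟨hxq, hx⟩
    have hcov' : ∀ x ∈ O, ∀ q ∈ O \ Γ '' S, x ∈ U q → x ∉ Γ '' S := fun x hx q hq hxq hxA =>
      hq.2 (hUA q hq.1 x hxq hxA ⟨hU q hq.1, hq.1⟩)
    have hC := connectedComponentIn_subset O (Γ 0)
    rcases isPreconnected_iff_subset_of_disjoint.1
      (isPreconnected_connectedComponentIn (F := O) (x := Γ 0))
      (⋃ q ∈ Γ '' S, U q) (⋃ q ∈ O \ Γ '' S, U q)
      (isOpen_biUnion fun q hq => hUo q (hsubO hq)) (isOpen_biUnion fun q hq => hUo q hq.1)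
      (fun x hx => by
        by_cases hxA : x ∈ Γ '' S
        · exact Or.inl (mem_biUnion hxA (hU x (hC hx)))
        · exact Or.inr (mem_biUnion (⟨hC hx, hxA⟩ : x ∈ O \ Γ '' S) (hU x (hC hx))))
      (by
        refine eq_empty_of_forall_notMem ?_
        rintro x ⟨hx, hxu, hxv⟩
        obtain ⟨q, hq, hxq⟩ := mem_iUnion₂.1 hxu
        obtain ⟨q', hq', hxq'⟩ := mem_iUnion₂.1 hxv
        exact hcov' x (hC hx) q' hq' hxq' (hcov x (hC hx) q hq hxq)) with h | h
    · intro x hx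
      obtain ⟨q, hq, hxq⟩ := mem_iUnion₂.1 (h hx)
      exact hcov x (hC hx) q hq hxq
    · obtain ⟨q, hq, hxq⟩ := mem_iUnion₂.1 (h (mem_connectedComponentIn (hsubO h0)))
      exact (hcov' _ (hsubO h0) q hq hxq h0).elim

/-- A maximal curve that is injective is a homeomorphism to its image. -/
lemma IsLocalFlow.exists_nhds_of_injOn (hinj : InjOn Γ S) {t : ℝ} (ht : t ∈ S) {N : Set ℝ}
    (hN : N ∈ 𝓝 t) : ∃ U ∈ 𝓝 (Γ t), ∀ s ∈ S, Γ s ∈ U → s ∈ N := by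
  obtain ⟨ε, hε, η, hη0, hη, -, hU⟩ := hG.chart (Γ t) (hG.mem (hΓ.curve t ht))
  obtain ⟨r, hr, hrN⟩ := Metric.mem_nhds_iff.1 hN
  obtain ⟨U, hUo, hU⟩ := hU (min r ε) (lt_min hr hε) (min_le_right _ _)
  have htU : Γ t ∈ U ∩ O := by
    rw [hU]; exact ⟨0, ⟨neg_lt_zero.2 (lt_min hr hε), lt_min hr hε⟩, hη0⟩
  refine ⟨U, hUo.mem_nhds htU.1, fun s hs hsU => hrN ?_⟩
  have h1 : Γ s ∈ U ∩ O := ⟨hsU, hG.mem (hΓ.curve s hs)⟩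
  rw [hU] at h1
  obtain ⟨s', hs', h2⟩ := h1
  have h3 := hG.subset_of_eq_shift hΓ isOpen_Ioo isPreconnected_Ioo hη ht
    (s₀ := 0) ⟨by linarith, hε⟩ hη0.symm s'
    ⟨(neg_le_neg (min_le_right _ _)).trans_lt hs'.1, hs'.2.trans_le (min_le_right _ _)⟩
  rw [sub_zero] at h3
  have h4 : s = s' + t := hinj hs h3.1 (h2.symm.trans h3.2.symm)
  rw [h4, Metric.mem_ball, Real.dist_eq, add_sub_cancel_right]
  exact (abs_lt.2 hs').trans_le (min_le_left _ _)

/-- A maximal curve that returns to one of its points can be continued for all time. -/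
lemma IsLocalFlow.eq_univ_of_eq {t₁ t₂ : ℝ} (h₁ : t₁ ∈ S) (h₂ : t₂ ∈ S) (hne : t₁ < t₂)
    (h : Γ t₁ = Γ t₂) : S = univ := by
  have hr := hG.subset_of_eq_shift hΓ hΓ.isOpen hΓ.isPreconnected hΓ.curve h₂ h₁ h.symm
  have hl := hG.subset_of_eq_shift hΓ hΓ.isOpen hΓ.isPreconnected hΓ.curve h₁ h₂ h
  have hn : ∀ n : ℕ, n * (t₂ - t₁) ∈ S ∧ -(n * (t₂ - t₁)) ∈ S := by
    intro n
    induction n with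
    | zero => simpa using hΓ.zero_mem
    | succ n ih =>
      refine ⟨?_, ?_⟩
      · convert (hr _ ih.1).1 using 1
        push_cast; ring
      · convert (hl _ ih.2).1 using 1
        push_cast; ring
  refine eq_univ_of_forall fun t => ?_
  obtain ⟨n, hnt⟩ := exists_nat_ge (|t| / (t₂ - t₁))
  rw [div_le_iff₀ (by linarith)] at hnt
  exact hΓ.isPreconnected.ordConnected.out (hn n).2 (hn n).1 (abs_le.1 hnt)

/-- A maximal curve that is not injective is periodic. -/
lemma IsLocalFlow.exists_period (hinj : ¬ InjOn Γ S) :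
    S = univ ∧ ∃ T > 0, Function.Periodic Γ T ∧
      ∀ t₁ t₂, t₁ < t₂ → Γ t₁ = Γ t₂ → T ≤ t₂ - t₁ := by
  have hex : ∃ t₁ ∈ S, ∃ t₂ ∈ S, t₁ < t₂ ∧ Γ t₁ = Γ t₂ := by
    simp only [InjOn, not_forall] at hinj
    obtain ⟨t₁, h₁, t₂, h₂, h, hne⟩ := hinj
    rcases lt_or_gt_of_ne hne with h' | h'
    · exact ⟨t₁, h₁, t₂, h₂, h', h⟩
    · exact ⟨t₂, h₂, t₁, h₁, h', h.symm⟩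
  obtain ⟨t₁, h₁, t₂, h₂, hlt, heq⟩ := hex
  have hS := hG.eq_univ_of_eq hΓ h₁ h₂ hlt heq
  subst hS
  have hper : ∀ s t, Γ s = Γ t → Function.Periodic Γ (t - s) := by
    intro s t hst u
    exact (hG.subset_of_eq_shift hΓ isOpen_univ hΓ.isPreconnected hΓ.curve (mem_univ t)
      (mem_univ s) hst.symm u (mem_univ u)).2
  -- The periods form a subgroup of the real numbers. It is discrete, as integral curves are
  -- injective for short times, hence cyclic.
  let P : AddSubgroup ℝ :=
    { carrier := {a | Function.Periodic Γ a}
      zero_mem' := fun t => by rw [add_zero]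
      add_mem' := fun ha hb => Function.Periodic.add_period ha hb
      neg_mem' := fun ha => Function.Periodic.neg ha }
  obtain ⟨ε, hε, η, hη0, hη, hηi, -⟩ := hG.chart (Γ 0) (hG.mem (hΓ.curve 0 (mem_univ 0)))
  have h0 : (0 : ℝ) ∈ Ioo (-ε) ε := ⟨by linarith, hε⟩
  have hloc := hG.subset_of_eq_shift hΓ isOpen_Ioo isPreconnected_Ioo hη (mem_univ 0) h0 hη0.symm
  have hiso : Disjoint (P : Set ℝ) (Ioo 0 ε) := by
    refine disjoint_left.2 fun a ha haε => haε.1.ne' (hηi ⟨by linarith [haε.1], haε.2⟩ h0 ?_)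
    have h1 := (hloc a ⟨by linarith [haε.1], haε.2⟩).2
    rw [sub_zero, add_zero] at h1
    have h2 := ha 0
    rw [zero_add] at h2
    rw [← h1, h2, hη0]
  obtain ⟨b, hb⟩ := AddSubgroup.cyclic_of_isolated_zero hε hiso
  have hmem : ∀ {a}, Function.Periodic Γ a → ∃ n : ℤ, n • b = a := by
    intro a ha
    have : a ∈ P := ha
    rw [hb] at this
    exact AddSubgroup.mem_closure_singleton.1 this
  have hbP : Function.Periodic Γ b := by
    have : b ∈ P := by rw [hb]; exact AddSubgroup.subset_closure rfl
    exact this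
  have hb0 : b ≠ 0 := by
    rintro rfl
    obtain ⟨n, hn⟩ := hmem (hper t₁ t₂ heq)
    rw [smul_zero] at hn
    linarith
  refine ⟨rfl, |b|, abs_pos.2 hb0, ?_, ?_⟩
  · rcases abs_choice b with h | h <;> rw [h]
    exacts [hbP, hbP.neg]
  · intro s t hst h
    obtain ⟨n, hn⟩ := hmem (hper s t h)
    have hn0 : n ≠ 0 := by
      rintro rfl
      rw [zero_smul] at hn
      linarith
    rw [← abs_of_pos (sub_pos.2 hst), ← hn, zsmul_eq_mul, abs_mul]
    have h1 : (1 : ℝ) ≤ |(n : ℝ)| := by exact_mod_cast Int.one_le_abs hn0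
    nlinarith [abs_nonneg b]

end

end

noncomputable section

/-! ### Reparametrization by arc length -/

/-- An antiderivative of a positive smooth function on an interval is a smooth change of the
parameter. -/
lemma exists_antiderivative {a b t₀ : ℝ} (ht₀ : t₀ ∈ Ioo a b) {l : ℝ → ℝ}
    (hl : ContDiffOn ℝ ∞ l (Ioo a b)) (hpos : ∀ t ∈ Ioo a b, 0 < l t) :
    ∃ e : OpenPartialHomeomorph ℝ ℝ, e.source = Ioo a b ∧ e t₀ = 0 ∧ StrictMonoOn e (Ioo a b) ∧
      (∀ t ∈ Ioo a b, ContDiffAt ℝ ∞ e t ∧ HasDerivAt e (l t) t) ∧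
      ∀ s ∈ e.target, ContDiffAt ℝ ∞ e.symm s ∧ HasDerivAt e.symm (l (e.symm s))⁻¹ s := by
  set σ : ℝ → ℝ := fun t => ∫ x in t₀..t, l x with hσ
  have hd : ∀ t ∈ Ioo a b, HasDerivAt σ (l t) t := by
    intro t ht
    refine intervalIntegral.integral_hasDerivAt_right ?_ ?_ ?_
    · exact (hl.continuousOn.mono (ordConnected_Ioo.uIcc_subset ht₀ ht)).intervalIntegrable
    · exact hl.continuousOn.stronglyMeasurableAtFilter isOpen_Ioo t ht
    · exact hl.continuousOn.continuousAt (isOpen_Ioo.mem_nhds ht)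
  have hσs : ContDiffOn ℝ ∞ σ (Ioo a b) := by
    rw [contDiffOn_infty_iff_deriv_of_isOpen isOpen_Ioo]
    exact ⟨fun t ht => (hd t ht).differentiableAt.differentiableWithinAt,
      hl.congr fun t ht => (hd t ht).deriv⟩
  have hσat : ∀ t ∈ Ioo a b, ContDiffAt ℝ ∞ σ t := fun t ht =>
    hσs.contDiffAt (isOpen_Ioo.mem_nhds ht)
  have hmono : StrictMonoOn σ (Ioo a b) := by
    refine strictMonoOn_of_deriv_pos (convex_Ioo a b) hσs.continuousOn fun t ht => ?_
    rw [interior_Ioo] at ht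
    rw [(hd t ht).deriv]
    exact hpos t ht
  have hopen : IsOpenMap ((Ioo a b).domRestrict σ) := by
    refine IsOpenMap.of_nhds_le fun t => ?_
    have h1 := ((hσat t t.2).hasStrictDerivAt' (hd t t.2) (by simp)).map_nhds_eq (hpos t t.2).ne'
    have h2 : map ((Ioo a b).domRestrict σ) (𝓝 t) = map σ (map Subtype.val (𝓝 t)) := rfl
    rw [h2, map_nhds_subtype_coe_eq_nhds t.2 (isOpen_Ioo.mem_nhds t.2), h1]
    rfl
  let e := OpenPartialHomeomorph.ofContinuousOpenRestrict hmono.injOn.bijOn_image.toPartialEquiv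
    hσs.continuousOn hopen isOpen_Ioo
  have hes : e.source = Ioo a b := rfl
  refine ⟨e, hes, intervalIntegral.integral_same, hmono, fun t ht => ⟨hσat t ht, hd t ht⟩, ?_⟩
  intro s hs
  have h1 : e.symm s ∈ Ioo a b := e.map_target hs
  exact ⟨e.contDiffAt_symm_deriv (hpos _ h1).ne' hs (hd _ h1) (hσat _ h1),
    e.hasDerivAt_symm hs (hpos _ h1).ne' (hd _ h1)⟩

end

noncomputable section

/-! ### The flow along the singular set -/

/-- A field `V` of unit vectors on a subset `O` of the singular set, tangent to the image of the
singular set and continuous in the sense that it has a constant sign along the branches. -/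
structure IsDirectionField (m : ℕ) {M : Type*} [TopologicalSpace M] [ChartedSpace (Euc m) M]
    (f : M → Euc 2) (O : Set M) (V : M → Euc 2) : Prop where
  norm_eq : ∀ p ∈ O, ‖V p‖ = 1
  subset : O ⊆ singularSet m f
  branch : ∀ p ∈ O, ∃ (B : SingularBranch m f p) (s : ℤ), (s = 1 ∨ s = -1) ∧
    ∀ t ∈ Ioo (-B.ε) B.ε, B.γ t ∈ O ∧ B.ρ t • B.E t = (s * ‖B.ρ t • B.E t‖) • V (B.γ t) ∧
      B.ρ t • B.E t ≠ 0

/-- At the time `t`, the curve `Γ` runs in the set `O`, and its image in the plane has the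
velocity `V`. -/
def IsUnitSpeedAt (m : ℕ) {M : Type*} [TopologicalSpace M] [ChartedSpace (Euc m) M]
    (f : M → Euc 2) (O : Set M) (V : M → Euc 2) (Γ : ℝ → M) (t : ℝ) : Prop :=
  Γ t ∈ O ∧ ContMDiffAt 𝓘(ℝ, ℝ) (𝓡 m) ∞ Γ t ∧ HasDerivAt (f ∘ Γ) (V (Γ t)) t

section

variable {m : ℕ} {M : Type*} [TopologicalSpace M] [ChartedSpace (Euc m) M]
  {f : M → Euc 2} {O : Set M} {V : M → Euc 2}

lemma IsDirectionField.ne_zero (hV : IsDirectionField m f O V) {p : M} (hp : p ∈ O) : V p ≠ 0 :=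
  fun h => by simpa [h] using hV.norm_eq p hp

lemma exists_isUnitSpeedAt_comp (hf : ContMDiff (𝓡 m) (𝓡 2) ∞ f) (hV : IsDirectionField m f O V)
    {a b t₀ : ℝ} (ht₀ : t₀ ∈ Ioo a b) {γ : ℝ → M} (hO : ∀ t ∈ Ioo a b, γ t ∈ O)
    (hγ : ∀ t ∈ Ioo a b, ContMDiffAt 𝓘(ℝ, ℝ) (𝓡 m) ∞ γ t)
    (hd : ∀ t ∈ Ioo a b, ∃ l > (0 : ℝ), HasDerivAt (f ∘ γ) (l • V (γ t)) t) :
    ∃ e : OpenPartialHomeomorph ℝ ℝ, e.source = Ioo a b ∧ e t₀ = 0 ∧ StrictMonoOn e (Ioo a b) ∧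
      (∀ t ∈ Ioo a b, ContDiffAt ℝ ∞ e t) ∧
      ∀ s ∈ e.target, IsUnitSpeedAt m f O V (γ ∘ e.symm) s := by
  have hfγ : ContDiffOn ℝ ∞ (f ∘ γ) (Ioo a b) := fun t ht => by
    have h1 : ContMDiffAt 𝓘(ℝ, ℝ) (𝓡 2) ∞ (f ∘ γ) t := (hf _).comp t (hγ t ht)
    exact h1.contDiffAt.contDiffWithinAt
  have hd0 : ∀ t ∈ Ioo a b, deriv (f ∘ γ) t ≠ 0 := by
    intro t ht
    obtain ⟨l, hl, h⟩ := hd t ht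
    rw [h.deriv]
    exact smul_ne_zero hl.ne' (hV.ne_zero (hO t ht))
  have hl : ContDiffOn ℝ ∞ (fun t => ‖deriv (f ∘ γ) t‖) (Ioo a b) :=
    ((contDiffOn_infty_iff_deriv_of_isOpen isOpen_Ioo).1 hfγ).2.norm ℝ hd0
  obtain ⟨e, hes, he0, hem, hed, hei⟩ := exists_antiderivative ht₀ hl
    fun t ht => norm_pos_iff.2 (hd0 t ht)
  refine ⟨e, hes, he0, hem, fun t ht => (hed t ht).1, fun s hs => ?_⟩
  have h1 : e.symm s ∈ Ioo a b := hes ▸ e.map_target hs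
  refine ⟨hO _ h1, (hγ _ h1).comp s (hei s hs).1.contMDiffAt, ?_⟩
  obtain ⟨l, hl, h⟩ := hd _ h1
  have h2 := h.scomp s (hei s hs).2
  rw [h.deriv, norm_smul, hV.norm_eq _ (hO _ h1), mul_one, Real.norm_eq_abs, abs_of_pos hl,
    inv_smul_smul₀ hl.ne'] at h2
  exact h2

/-- Around each point, a curve with unit speed, and its inverse, extended to a neighbourhood in the
manifold. -/
lemma IsDirectionField.exists_chart (hf : ContMDiff (𝓡 m) (𝓡 2) ∞ f)
    (hV : IsDirectionField m f O V) {p : M} (hp : p ∈ O) :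
    ∃ ε > 0, ∃ (η : ℝ → M) (U : Set M) (τ : M → ℝ), IsOpen U ∧ η 0 = p ∧
      (∀ t ∈ Ioo (-ε) ε, IsUnitSpeedAt m f O V η t) ∧ U ∩ O = η '' Ioo (-ε) ε ∧
      (∀ t ∈ Ioo (-ε) ε, τ (η t) = t) ∧ ∀ y ∈ U, ContMDiffAt (𝓡 m) 𝓘(ℝ, ℝ) ∞ τ y := by
  obtain ⟨B, s, hs, hB⟩ := hV.branch p hp
  have hss : (s : ℝ) * s = 1 := by rcases hs with rfl | rfl <;> norm_num
  have hmem : ∀ t ∈ Ioo (-B.ε) B.ε, (s : ℝ) * t ∈ Ioo (-B.ε) B.ε := by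
    intro t ht
    rcases hs with rfl | rfl
    · simpa using ht
    · exact ⟨by push_cast; linarith [ht.2], by push_cast; linarith [ht.1]⟩
  have hsm : ∀ t ∈ Ioo (-B.ε) B.ε,
      ContMDiffAt 𝓘(ℝ, ℝ) (𝓡 m) ∞ (fun t => B.γ (s * t)) t := by
    intro t ht
    have h1 : ContMDiffAt 𝓘(ℝ, ℝ) 𝓘(ℝ, ℝ) ∞ (fun t : ℝ => (s : ℝ) * t) t :=
      (contDiff_const.mul contDiff_id).contDiffAt.contMDiffAt
    exact (B.smooth _ (hmem t ht)).comp t h1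
  obtain ⟨e, hes, he0, hem, hed, heu⟩ := exists_isUnitSpeedAt_comp hf hV B.zero_mem
    (γ := fun t => B.γ (s * t)) (fun t ht => (hB _ (hmem t ht)).1) hsm (by
      intro t ht
      obtain ⟨-, h2, h3⟩ := hB _ (hmem t ht)
      refine ⟨‖B.ρ (s * t) • B.E (s * t)‖, norm_pos_iff.2 h3, ?_⟩
      have h4 := (B.hasDerivAt _ (hmem t ht)).scomp t ((hasDerivAt_id t).const_mul (s : ℝ))
      rw [mul_one, h2, smul_smul, ← mul_assoc, hss, one_mul] at h4
      exact h4)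
  have h0t : (0 : ℝ) ∈ e.target := by
    rw [← he0]
    exact e.map_source (hes ▸ B.zero_mem)
  obtain ⟨ε, hε, hsub⟩ := Metric.isOpen_iff.1 e.open_target 0 h0t
  rw [Real.ball_eq_Ioo, zero_sub, zero_add] at hsub
  have hsym : ∀ u ∈ Ioo (-ε) ε, e.symm u ∈ Ioo (-B.ε) B.ε := fun u hu =>
    hes ▸ e.map_target (hsub hu)
  have hπγ : ∀ t ∈ Ioo (-B.ε) B.ε, (s : ℝ) * B.π (B.γ (s * t)) = t := by
    intro t ht
    rw [B.π_γ _ (hmem t ht), ← mul_assoc, hss, one_mul]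
  have hWo : IsOpen (Ioo (-B.ε) B.ε ∩ e ⁻¹' Ioo (-ε) ε) := by
    rw [← hes]
    exact e.continuousOn.isOpen_inter_preimage e.open_source isOpen_Ioo
  have hπc : ContinuousOn (fun y => (s : ℝ) * B.π y) B.U := fun y hy =>
    ((B.smooth_π y hy).continuousAt.const_mul (s : ℝ)).continuousWithinAt
  refine ⟨ε, hε, fun u => B.γ (s * e.symm u),
    B.U ∩ (fun y => (s : ℝ) * B.π y) ⁻¹' (Ioo (-B.ε) B.ε ∩ e ⁻¹' Ioo (-ε) ε),
    fun y => e (s * B.π y), hπc.isOpen_inter_preimage B.isOpen hWo, ?_, fun u hu => heu u (hsub hu),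
    ?_, ?_, ?_⟩
  · have h1 := e.left_inv (hes ▸ B.zero_mem)
    rw [he0] at h1
    simp only [h1, mul_zero, B.zero]
  · ext y
    constructor
    · rintro ⟨⟨hyU, hyW, hye⟩, hyO⟩
      obtain ⟨t, ht, rfl⟩ := (B.mem_iff y).1 ⟨hyU, hV.subset hyO⟩
      refine ⟨_, hye, ?_⟩
      simp only
      rw [e.left_inv (hes ▸ hyW), B.π_γ t ht, ← mul_assoc, hss, one_mul]
    · rintro ⟨u, hu, rfl⟩
      have h1 := hmem _ (hsym u hu)
      refine ⟨⟨(B.γ_mem h1).1, ?_⟩, (hB _ h1).1⟩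
      rw [mem_preimage, hπγ _ (hsym u hu)]
      refine ⟨hsym u hu, ?_⟩
      rw [mem_preimage, e.right_inv (hsub hu)]
      exact hu
  · intro u hu
    simp only
    rw [hπγ _ (hsym u hu), e.right_inv (hsub hu)]
  · rintro y ⟨hyU, hyW, -⟩
    have h1 : ContMDiffAt 𝓘(ℝ, ℝ) 𝓘(ℝ, ℝ) ∞ (fun r : ℝ => e (s * r)) (B.π y) :=
      ((hed _ hyW).comp (B.π y) (contDiff_const.mul contDiff_id).contDiffAt).contMDiffAt
    exact h1.comp y (B.smooth_π y hyU)

lemma IsDirectionField.isLocalFlow (hf : ContMDiff (𝓡 m) (𝓡 2) ∞ f)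
    (hV : IsDirectionField m f O V) : IsLocalFlow O (IsUnitSpeedAt m f O V) where
  congr := by
    rintro Γ Γ' t h ⟨h1, h2, h3⟩
    have h0 := h.self_of_nhds
    refine ⟨h0 ▸ h1, h2.congr_of_eventuallyEq h.symm, ?_⟩
    rw [← h0]
    exact h3.congr_of_eventuallyEq (h.symm.fun_comp f)
  mem h := h.1
  continuousAt h := h.2.1.continuousAt
  shift := by
    rintro Γ t a ⟨h1, h2, h3⟩
    have h4 : ContMDiffAt 𝓘(ℝ, ℝ) 𝓘(ℝ, ℝ) ∞ (fun s : ℝ => s + a) t :=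
      (contDiff_id.add contDiff_const).contDiffAt.contMDiffAt
    exact ⟨h1, h2.comp t h4, h3.comp_add_const t a⟩
  chart := by
    intro p hp
    obtain ⟨ε, hε, η, U, τ, hU, hη0, hη, hUO, hτ, hτs⟩ := hV.exists_chart hf hp
    refine ⟨ε, hε, η, hη0, hη, fun t ht t' ht' h => ?_, fun δ hδ hδε => ?_⟩
    · rw [← hτ t ht, ← hτ t' ht', h]
    · refine ⟨U ∩ τ ⁻¹' Ioo (-δ) δ, ContinuousOn.isOpen_inter_preimage
        (fun y hy => (hτs y hy).continuousAt.continuousWithinAt) hU isOpen_Ioo, ?_⟩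
      have hsub : Ioo (-δ) δ ⊆ Ioo (-ε) ε := Ioo_subset_Ioo (neg_le_neg hδε) hδε
      ext y
      constructor
      · rintro ⟨⟨hyU, hyτ⟩, hyO⟩
        have h1 : y ∈ U ∩ O := ⟨hyU, hyO⟩
        rw [hUO] at h1
        obtain ⟨t, ht, rfl⟩ := h1
        rw [mem_preimage, hτ t ht] at hyτ
        exact ⟨t, hyτ, rfl⟩
      · rintro ⟨t, ht, rfl⟩
        have h1 : η t ∈ U ∩ O := by rw [hUO]; exact ⟨t, hsub ht, rfl⟩
        refine ⟨⟨h1.1, ?_⟩, h1.2⟩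
        rw [mem_preimage, hτ t (hsub ht)]
        exact ht
  unique := by
    have key : ∀ {p : M} {ε : ℝ} {η : ℝ → M} {U : Set M} {τ : M → ℝ}, IsOpen U →
        (∀ t ∈ Ioo (-ε) ε, IsUnitSpeedAt m f O V η t) → U ∩ O = η '' Ioo (-ε) ε →
        (∀ t ∈ Ioo (-ε) ε, τ (η t) = t) → (∀ y ∈ U, ContMDiffAt (𝓡 m) 𝓘(ℝ, ℝ) ∞ τ y) →
        p ∈ U → τ p = 0 → ∀ {Γ : ℝ → M} {t : ℝ}, (∀ᶠ s in 𝓝 t, IsUnitSpeedAt m f O V Γ s) →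
        Γ t = p → ∀ᶠ s in 𝓝 t, Γ s = η (s - t) := by
      intro p ε η U τ hU hη hUO hτ hτs hpU hτp Γ t hΓ hΓt
      have hUt : ∀ᶠ s in 𝓝 t, Γ s ∈ U :=
        hΓ.self_of_nhds.2.1.continuousAt.eventually_mem (hU.mem_nhds (hΓt ▸ hpU))
      -- the time along the chart grows with speed one
      have hder : ∀ᶠ s in 𝓝 t, HasDerivAt (τ ∘ Γ) 1 s ∧ Γ s = η (τ (Γ s)) := by
        have hloc : ∀ᶠ s in 𝓝 t, Γ s = η (τ (Γ s)) ∧ τ (Γ s) ∈ Ioo (-ε) ε := by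
          filter_upwards [hΓ, hUt] with s hs hsU
          have h1 : Γ s ∈ U ∩ O := ⟨hsU, hs.1⟩
          rw [hUO] at h1
          obtain ⟨u, hu, hus⟩ := h1
          rw [← hus, hτ u hu]
          exact ⟨rfl, hu⟩
        filter_upwards [hΓ, hUt, hloc, eventually_eventually_nhds.2 hloc] with s hs hsU hsl hsl'
        refine ⟨?_, hsl.1⟩
        have h1 : ContMDiffAt 𝓘(ℝ, ℝ) 𝓘(ℝ, ℝ) ∞ (τ ∘ Γ) s := (hτs _ hsU).comp s hs.2.1
        have h2 : DifferentiableAt ℝ (τ ∘ Γ) s := h1.contDiffAt.differentiableAt (by simp)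
        have h3 : HasDerivAt (f ∘ η) (V (η ((τ ∘ Γ) s))) ((τ ∘ Γ) s) := (hη _ hsl.2).2.2
        have h4 := h3.scomp s h2.hasDerivAt
        have h5 : HasDerivAt (f ∘ Γ) (deriv (τ ∘ Γ) s • V (η ((τ ∘ Γ) s))) s := by
          refine h4.congr_of_eventuallyEq ?_
          filter_upwards [hsl'] with r hr
          exact congrArg f hr.1
        have h6 := hs.2.2.unique h5
        rw [Function.comp_apply, ← hsl.1] at h6
        have h7 : deriv (τ ∘ Γ) s = 1 :=
          smul_left_injective ℝ (hV.ne_zero hs.1) (by simp only [one_smul]; exact h6.symm)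
        rw [← h7]
        exact h2.hasDerivAt
      obtain ⟨r, hr, hball⟩ := Metric.eventually_nhds_iff_ball.1 hder
      filter_upwards [Metric.ball_mem_nhds t hr] with s hs
      have h1 : EqOn (τ ∘ Γ) (fun s => s - t) (Metric.ball t r) := by
        refine Metric.isOpen_ball.eqOn_of_deriv_eq (convex_ball t r).isPreconnected
          (fun u hu => (hball u hu).1.differentiableAt.differentiableWithinAt)
          (by fun_prop) (fun u hu => ?_) (Metric.mem_ball_self hr) ?_
        · rw [(hball u hu).1.deriv]; simp
        · simp [hΓt, hτp]
      have h2 := h1 hs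
      simp only [Function.comp_apply] at h2
      rw [← h2]
      exact (hball s hs).2
    intro Γ Γ' t hΓ hΓ' h
    obtain ⟨ε, hε, η, U, τ, hU, hη0, hη, hUO, hτ, hτs⟩ := hV.exists_chart hf hΓ.self_of_nhds.1
    have h0 : (0 : ℝ) ∈ Ioo (-ε) ε := ⟨by linarith, hε⟩
    have hpU : Γ t ∈ U ∩ O := by
      rw [hUO]; exact ⟨0, h0, hη0⟩
    have hτp : τ (Γ t) = 0 := by rw [← hη0, hτ 0 h0]
    filter_upwards [key hU hη hUO hτ hτs hpU.1 hτp hΓ rfl,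
      key hU hη hUO hτ hτs hpU.1 hτp hΓ' h.symm] with s h1 h2
    rw [h1, h2]

end

end

noncomputable section

/-! ### Angles and their lifts -/

/-- The unit vector whose angle with the first axis is `θ` full turns. -/
def turnVec (θ : ℝ) : Euc 2 := !₂[Real.cos (2 * Real.pi * θ), Real.sin (2 * Real.pi * θ)]

@[simp] lemma turnVec_zero_apply (θ : ℝ) : turnVec θ 0 = Real.cos (2 * Real.pi * θ) := rfl

@[simp] lemma turnVec_one_apply (θ : ℝ) : turnVec θ 1 = Real.sin (2 * Real.pi * θ) := rfl

lemma norm_euc_two (v : Euc 2) : ‖v‖ ^ 2 = v 0 ^ 2 + v 1 ^ 2 := by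
  rw [EuclideanSpace.norm_sq_eq, Fin.sum_univ_two, Real.norm_eq_abs, Real.norm_eq_abs, sq_abs,
    sq_abs]

lemma norm_turnVec (θ : ℝ) : ‖turnVec θ‖ = 1 := by
  have h := norm_euc_two (turnVec θ)
  rw [turnVec_zero_apply, turnVec_one_apply, Real.cos_sq_add_sin_sq] at h
  exact (pow_eq_one_iff_of_nonneg (norm_nonneg _) two_ne_zero).1 h

lemma turnVec_eq_iff {θ ψ : ℝ} : turnVec θ = turnVec ψ ↔ ∃ k : ℤ, θ = ψ + k := by
  constructor
  · intro h
    have h0 := congrFun (congrArg WithLp.ofLp h) 0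
    have h1 := congrFun (congrArg WithLp.ofLp h) 1
    obtain ⟨k, hk⟩ := Real.Angle.angle_eq_iff_two_pi_dvd_sub.1 (Real.Angle.cos_sin_inj h0 h1)
    refine ⟨k, ?_⟩
    have := Real.pi_pos
    have h2 : 2 * Real.pi * (θ - ψ - k) = 0 := by linear_combination hk
    have h3 := (mul_eq_zero.1 h2).resolve_left (by positivity)
    linarith
  · rintro ⟨k, rfl⟩
    have h : 2 * Real.pi * (ψ + k) = 2 * Real.pi * ψ + k * (2 * Real.pi) := by ring
    ext i
    fin_cases i
    · change Real.cos _ = Real.cos _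
      rw [h, Real.cos_add_int_mul_two_pi]
    · change Real.sin _ = Real.sin _
      rw [h, Real.sin_add_int_mul_two_pi]

/-- A continuous field of unit vectors along the line has a continuous angle. -/
lemma exists_turnVec_eq {v : ℝ → Euc 2} (hv : Continuous v) (h1 : ∀ t, ‖v t‖ = 1) :
    ∃ θ : ℝ → ℝ, Continuous θ ∧ ∀ t, v t = turnVec (θ t) := by
  have hmem : ∀ t, (⟨v t 0, v t 1⟩ : ℂ) ∈ Submonoid.unitSphere ℂ := by
    intro t
    change (⟨v t 0, v t 1⟩ : ℂ) ∈ Metric.sphere (0 : ℂ) 1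
    rw [mem_sphere_zero_iff_norm]
    have h2 := norm_euc_two (v t)
    rw [h1, one_pow] at h2
    rw [← pow_eq_one_iff_of_nonneg (norm_nonneg _) two_ne_zero, ← Complex.normSq_eq_norm_sq,
      Complex.normSq_mk]
    linarith
  let z : C(ℝ, Circle) := ⟨fun t => ⟨_, hmem t⟩, by
    refine Continuous.subtype_mk ?_ _
    have h2 : Continuous fun t => v t 0 := by fun_prop
    have h3 : Continuous fun t => v t 1 := by fun_prop
    exact Complex.equivRealProdCLM.symm.continuous.comp (h2.prodMk h3)⟩
  obtain ⟨e, he⟩ : ∃ e : ℝ, Circle.exp e = z 0 := ⟨_, Circle.exp_arg (z 0)⟩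
  obtain ⟨F, ⟨-, hF⟩, -⟩ := Circle.isCoveringMap_exp.existsUnique_continuousMap_lifts z 0 e he
  refine ⟨fun t => F t / (2 * Real.pi), by fun_prop, fun t => ?_⟩
  have h2 := congrArg (fun w : Circle => (w : ℂ)) (congrFun hF t)
  simp only [Function.comp_apply, Circle.coe_exp] at h2
  have h3 : 2 * Real.pi * (F t / (2 * Real.pi)) = F t := by field_simp
  ext i
  fin_cases i
  · change v t 0 = Real.cos _
    rw [h3, ← Complex.exp_ofReal_mul_I_re, h2]
    rfl
  · change v t 1 = Real.sin _
    rw [h3, ← Complex.exp_ofReal_mul_I_im, h2]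
    rfl

lemma exists_eq_add_int {K : Set ℝ} (hK : IsPreconnected K) {θ ψ : ℝ → ℝ} (hθ : ContinuousOn θ K)
    (hψ : ContinuousOn ψ K) (h : ∀ t ∈ K, turnVec (θ t) = turnVec (ψ t)) :
    ∃ k : ℤ, ∀ t ∈ K, θ t = ψ t + k := by
  obtain ⟨_, ⟨k, rfl⟩, hk⟩ := hK.eqOn_const_of_mapsTo (T := range ((↑) : ℤ → ℝ))
    Int.isClosedEmbedding_coe_real.isEmbedding.isInducing.isDiscrete_range (hθ.sub hψ) (by
      intro t ht
      obtain ⟨k, hk⟩ := turnVec_eq_iff.1 (h t ht)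
      exact ⟨k, by simp [hk]⟩) (range_nonempty _)
  refine ⟨k, fun t ht => ?_⟩
  have := hk ht
  simp only [Pi.sub_apply, Function.const_apply] at this
  linarith

/-! ### Ends of curves -/

lemma tendsto_of_strictMonoOn {u : ℝ → ℝ} {a b : ℝ} (hu : StrictMonoOn u (Ioo 0 1))
    (h : u '' Ioo 0 1 = Ioo a b) :
    Tendsto u (𝓝[>] 0) (𝓝[>] a) ∧ Tendsto u (𝓝[<] 1) (𝓝[<] b) := by
  have hmem : ∀ t ∈ Ioo (0 : ℝ) 1, u t ∈ Ioo a b := fun t ht => h ▸ mem_image_of_mem u ht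
  have hab : a < b := by
    have := hmem (1 / 2) ⟨by norm_num, by norm_num⟩
    exact this.1.trans this.2
  constructor
  · rw [(nhdsGT_basis (0 : ℝ)).tendsto_iff (nhdsGT_basis_of_exists_gt ⟨b, hab⟩)]
    intro c hc
    have hc' : min c ((a + b) / 2) ∈ Ioo a b :=
      ⟨lt_min hc (by linarith), (min_le_right _ _).trans_lt (by linarith)⟩
    rw [← h] at hc'
    obtain ⟨t, ht, htc⟩ := hc'
    refine ⟨t, ht.1, fun s hs => ?_⟩
    have hs' : s ∈ Ioo (0 : ℝ) 1 := ⟨hs.1, hs.2.trans ht.2⟩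
    exact ⟨(hmem s hs').1, ((hu hs' ht hs.2).trans_eq htc).trans_le (min_le_left _ _)⟩
  · rw [(nhdsLT_basis (1 : ℝ)).tendsto_iff (nhdsLT_basis_of_exists_lt ⟨a, hab⟩)]
    intro c hc
    have hc' : max c ((a + b) / 2) ∈ Ioo a b :=
      ⟨lt_of_lt_of_le (by linarith) (le_max_right _ _), max_lt hc (by linarith)⟩
    rw [← h] at hc'
    obtain ⟨t, ht, htc⟩ := hc'
    refine ⟨t, ht.2, fun s hs => ?_⟩
    have hs' : s ∈ Ioo (0 : ℝ) 1 := ⟨ht.1.trans hs.1, hs.2⟩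
    exact ⟨(le_max_left _ _).trans_lt (htc.symm.trans_lt (hu ht hs' hs.1)), (hmem s hs').2⟩

/-- A curve in a compact space with finitely many cluster points at its end converges there. -/
lemma exists_tendsto_of_finite {X : Type*} [TopologicalSpace X] [CompactSpace X] [T2Space X]
    {γ : ℝ → X} {a b : ℝ} (hab : a < b) (hγ : ContinuousOn γ (Ioo a b)) {D : Set X} (hD : D.Finite)
    (h : ∀ x, MapClusterPt x (𝓝[<] b) γ → x ∈ D) : ∃ d ∈ D, Tendsto γ (𝓝[<] b) (𝓝 d) := by
  obtain ⟨U, hU, hdis⟩ := hD.t2_separation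
  have h1 : ∀ᶠ t in 𝓝[<] b, γ t ∈ ⋃ d ∈ D, U d := by
    by_contra hne
    have hK : IsCompact (⋃ d ∈ D, U d)ᶜ :=
      (isOpen_biUnion fun d _ => (hU d).2).isClosed_compl.isCompact
    obtain ⟨x, hx, hxc⟩ := hK.exists_mapClusterPt_of_frequently (l := 𝓝[<] b) (f := γ)
      (not_eventually.1 hne)
    exact hx (mem_biUnion (h x hxc) (hU x).1)
  obtain ⟨b', hb', hsub⟩ := (mem_nhdsLT_iff_exists_mem_Ico_Ioo_subset hab).1 h1
  obtain ⟨t₀, ht₀⟩ : (Ioo b' b).Nonempty := nonempty_Ioo.2 hb'.2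
  obtain ⟨d, hd, htd⟩ := mem_iUnion₂.1 (hsub ht₀)
  have hpre : IsPreconnected (γ '' Ioo b' b) :=
    isPreconnected_Ioo.image _ (hγ.mono (Ioo_subset_Ioo_left hb'.1))
  have hUd : γ '' Ioo b' b ⊆ U d := by
    refine hpre.subset_left_of_subset_union (v := ⋃ d' ∈ D \ {d}, U d') (hU d).2
      (isOpen_biUnion fun d _ => (hU d).2) ?_ ?_ ⟨γ t₀, ⟨t₀, ht₀, rfl⟩, htd⟩
    · refine disjoint_iUnion₂_right.2 fun d' hd' => ?_
      exact hdis hd hd'.1 (Ne.symm hd'.2)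
    · rintro _ ⟨t, ht, rfl⟩
      obtain ⟨d', hd', htd'⟩ := mem_iUnion₂.1 (hsub ht)
      by_cases hdd : d' = d
      · exact Or.inl (hdd ▸ htd')
      · exact Or.inr (mem_biUnion (show d' ∈ D \ {d} from ⟨hd', hdd⟩) htd')
  refine ⟨d, hd, le_nhds_of_unique_clusterPt fun x hx => ?_⟩
  by_contra hne
  have hxD := h x hx
  have h2 : ∀ᶠ t in 𝓝[<] b, γ t ∈ U d := by
    filter_upwards [Ioo_mem_nhdsLT hb'.2] with t ht using hUd ⟨t, ht, rfl⟩
  have h3 := (mapClusterPt_iff_frequently.1 hx) (U x) ((hU x).2.mem_nhds (hU x).1)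
  obtain ⟨t, ht, ht'⟩ := (h3.and_eventually h2).exists
  exact disjoint_left.1 (hdis hxD hd hne) ht ht'

end

noncomputable section

/-! ### Uniqueness of the winding number -/

lemma IsPreconnected.eq_Ioo_of_isOpen {S : Set ℝ} (hS : IsPreconnected S) (hSo : IsOpen S)
    (hne : S.Nonempty) (hbb : BddBelow S) (hba : BddAbove S) : S = Ioo (sInf S) (sSup S) := by
  refine subset_antisymm (fun x hx => ?_) (IsConnected.Ioo_csInf_csSup_subset ⟨hne, hS⟩ hbb hba)
  obtain ⟨r, hr, hball⟩ := Metric.isOpen_iff.1 hSo x hx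
  rw [Real.ball_eq_Ioo] at hball
  have h1 := csInf_le hbb (hball ⟨by linarith, by linarith⟩ : x - r / 2 ∈ S)
  have h2 := le_csSup hba (hball ⟨by linarith, by linarith⟩ : x + r / 2 ∈ S)
  exact ⟨by linarith, by linarith⟩

/-- An injective parametrization, by the open unit interval, of a dense part of `A` along a
direction field. -/
structure IsDirectedParam (m : ℕ) {M : Type*} [TopologicalSpace M] [ChartedSpace (Euc m) M]
    (f : M → Euc 2) (V : M → Euc 2) (A : Set M) (γ : ℝ → M) : Prop where
  mem : ∀ t ∈ Ioo (0 : ℝ) 1, γ t ∈ A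
  smooth : ∀ t ∈ Ioo (0 : ℝ) 1, ContMDiffAt 𝓘(ℝ, ℝ) (𝓡 m) ∞ γ t
  injOn : InjOn γ (Ioo 0 1)
  subset_closure : A ⊆ closure (γ '' Ioo 0 1)
  hasDerivAt : ∀ t ∈ Ioo (0 : ℝ) 1, ∃ l > (0 : ℝ), HasDerivAt (f ∘ γ) (l • V (γ t)) t

section

variable {m : ℕ} {M : Type*} [TopologicalSpace M] [T2Space M] [ChartedSpace (Euc m) M]
  {f : M → Euc 2} {O : Set M} {V : M → Euc 2} (hf : ContMDiff (𝓡 m) (𝓡 2) ∞ f)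
  (hV : IsDirectionField m f O V) {S : Set ℝ} {Γ γ : ℝ → M}
  (hΓ : IsMaximalCurve (IsUnitSpeedAt m f O V) S Γ)
include hf hV hΓ

/-- A directed parametrization is a reparametrization of a maximal integral curve. -/
lemma IsDirectedParam.exists_homeomorph (hγ : IsDirectedParam m f V (Γ '' S) γ) :
    ∃ e : OpenPartialHomeomorph ℝ ℝ, e.source = Ioo 0 1 ∧ StrictMonoOn e (Ioo 0 1) ∧
      e.target ⊆ S ∧ ∀ t ∈ Ioo (0 : ℝ) 1, Γ (e t) = γ t := by
  have hO : ∀ t ∈ Ioo (0 : ℝ) 1, γ t ∈ O := by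
    intro t ht
    obtain ⟨s, hs, h⟩ := hγ.mem t ht
    rw [← h]
    exact (hΓ.curve s hs).1
  have hhalf : (1 / 2 : ℝ) ∈ Ioo (0 : ℝ) 1 := ⟨by norm_num, by norm_num⟩
  obtain ⟨e, hes, he0, hem, -, heu⟩ := exists_isUnitSpeedAt_comp hf hV hhalf hO hγ.smooth
    hγ.hasDerivAt
  obtain ⟨c, hc, hcγ⟩ := hγ.mem _ hhalf
  have htgt : e.target = e '' Ioo 0 1 := by rw [← hes, e.image_source_eq_target]
  have hpre : IsPreconnected e.target := by
    rw [htgt]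
    exact isPreconnected_Ioo.image _ (hes ▸ e.continuousOn)
  have h0 : (0 : ℝ) ∈ e.target := by
    rw [htgt]; exact ⟨_, hhalf, he0⟩
  have hsub := (hV.isLocalFlow hf).subset_of_eq_shift hΓ e.open_target hpre heu hc h0 (by
    rw [hcγ, ← he0, Function.comp_apply, e.left_inv (hes ▸ hhalf)])
  refine ⟨e.transHomeomorph (Homeomorph.addRight c), hes, ?_, ?_, ?_⟩
  · intro s hs t ht hst
    have := hem hs ht hst
    change e s + c < e t + c
    linarith
  · intro s hs
    have h1 : s + -c ∈ e.target := hs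
    have h2 := (hsub _ h1).1
    rw [sub_zero, neg_add_cancel_right] at h2
    exact h2
  · intro t ht
    have h1 := (hsub (e t) (e.map_source (hes ▸ ht))).2
    rw [sub_zero, Function.comp_apply, e.left_inv (hes ▸ ht)] at h1
    exact h1

/-- If the maximal curve is injective, then a directed parametrization runs through all of it. -/
lemma IsDirectedParam.target_eq (hinj : InjOn Γ S) (hγ : IsDirectedParam m f V (Γ '' S) γ)
    {e : OpenPartialHomeomorph ℝ ℝ} (hes : e.source = Ioo 0 1) (heS : e.target ⊆ S)
    (heγ : ∀ t ∈ Ioo (0 : ℝ) 1, Γ (e t) = γ t) : e.target = S := by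
  have htgt : e.target = e '' Ioo 0 1 := by rw [← hes, e.image_source_eq_target]
  have hpre : e.target.OrdConnected := by
    rw [htgt]
    exact (isPreconnected_Ioo.image _ (hes ▸ e.continuousOn)).ordConnected
  -- by density each open subset of `S` meets the target
  have hdense : ∀ s ∈ S, ∀ N ∈ 𝓝 s, (N ∩ e.target).Nonempty := by
    intro s hs N hN
    obtain ⟨U, hU, hUN⟩ := (hV.isLocalFlow hf).exists_nhds_of_injOn hΓ hinj hs hN
    obtain ⟨_, hxU, t, ht, rfl⟩ := mem_closure_iff_nhds.1 (hγ.subset_closure ⟨s, hs, rfl⟩) U hU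
    rw [← heγ t ht] at hxU
    have h1 : e t ∈ e.target := e.map_source (hes ▸ ht)
    exact ⟨e t, hUN _ (heS h1) hxU, h1⟩
  refine heS.antisymm fun s hs => ?_
  obtain ⟨r, hr, hball⟩ := Metric.isOpen_iff.1 hΓ.isOpen s hs
  rw [Real.ball_eq_Ioo] at hball
  have h1 : s - r / 2 ∈ S := hball ⟨by linarith, by linarith⟩
  have h2 : s + r / 2 ∈ S := hball ⟨by linarith, by linarith⟩
  obtain ⟨x, hx, hx'⟩ := hdense _ h1 _ (Iio_mem_nhds (by linarith : s - r / 2 < s))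
  obtain ⟨y, hy, hy'⟩ := hdense _ h2 _ (Ioi_mem_nhds (by linarith : s < s + r / 2))
  exact hpre.out hx' hy' ⟨le_of_lt hx, le_of_lt hy⟩

/-- If the maximal curve has the period `T`, then a directed parametrization runs through exactly
one period. -/
lemma IsDirectedParam.exists_target_eq (hS : S = univ) {T : ℝ} (hT : 0 < T)
    (hper : Function.Periodic Γ T) (hmin : ∀ t₁ t₂, t₁ < t₂ → Γ t₁ = Γ t₂ → T ≤ t₂ - t₁)
    (hγ : IsDirectedParam m f V (Γ '' S) γ)
    {e : OpenPartialHomeomorph ℝ ℝ} (hes : e.source = Ioo 0 1)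
    (heγ : ∀ t ∈ Ioo (0 : ℝ) 1, Γ (e t) = γ t) : ∃ a, e.target = Ioo a (a + T) := by
  have htgt : e.target = e '' Ioo 0 1 := by rw [← hes, e.image_source_eq_target]
  have hpre : e.target.OrdConnected := by
    rw [htgt]
    exact (isPreconnected_Ioo.image _ (hes ▸ e.continuousOn)).ordConnected
  have hmem : ∀ t ∈ Ioo (0 : ℝ) 1, e t ∈ e.target := fun t ht => e.map_source (hes ▸ ht)
  have hinj : InjOn Γ e.target := by
    rw [htgt]
    rintro _ ⟨s, hs, rfl⟩ _ ⟨t, ht, rfl⟩ h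
    rw [heγ s hs, heγ t ht] at h
    rw [hγ.injOn hs ht h]
  have hlt : ∀ x ∈ e.target, ∀ y ∈ e.target, y < x + T := by
    intro x hx y hy
    by_contra! hxy
    have h1 := hinj (hpre.out hx hy ⟨by linarith, hxy⟩) hx (hper x)
    linarith
  set x₀ := e (1 / 2)
  have hx₀ : x₀ ∈ e.target := hmem _ ⟨by norm_num, by norm_num⟩
  have hne : e.target.Nonempty := ⟨x₀, hx₀⟩
  have hbb : BddBelow e.target := ⟨x₀ - T, fun y hy => by linarith [hlt y hy x₀ hx₀]⟩
  have hba : BddAbove e.target := ⟨x₀ + T, fun y hy => (hlt x₀ hx₀ y hy).le⟩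
  set a := sInf e.target with ha
  set b := sSup e.target with hb
  have hIoo : e.target = Ioo a b :=
    hpre.isPreconnected.eq_Ioo_of_isOpen e.open_target hne hbb hba
  refine ⟨a, hIoo.trans ?_⟩
  suffices b = a + T by rw [this]
  have hle : b ≤ a + T := by
    refine csSup_le hne fun y hy => ?_
    have : y - T ≤ a := le_csInf hne fun x hx => by linarith [hlt x hx y hy]
    linarith
  by_contra hne'
  have hlt' : b < a + T := lt_of_le_of_ne hle hne'
  -- otherwise the integral curve reaches points outside the closure of the parametrized part
  set r := (a + T - b) / 2 with hr
  set s := b + r with hs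
  have hsS : s ∈ S := hS ▸ mem_univ s
  obtain ⟨ε, hε, η, hη0, hη, -, hU⟩ := (hV.isLocalFlow hf).chart (Γ s) (hΓ.curve s hsS).1
  obtain ⟨U, hUo, hU⟩ := hU (min r ε) (lt_min (by linarith) hε) (min_le_right _ _)
  have hsU : Γ s ∈ U ∩ O := by
    rw [hU]
    exact ⟨0, ⟨neg_lt_zero.2 (lt_min (by linarith) hε), lt_min (by linarith) hε⟩, hη0⟩
  obtain ⟨_, hxU, t, ht, rfl⟩ := mem_closure_iff_nhds.1 (hγ.subset_closure ⟨s, hsS, rfl⟩) U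
    (hUo.mem_nhds hsU.1)
  rw [← heγ t ht] at hxU
  have hxO : Γ (e t) ∈ U ∩ O := ⟨hxU, (hΓ.curve _ (hS ▸ mem_univ _)).1⟩
  rw [hU] at hxO
  obtain ⟨u, hu, hut⟩ := hxO
  have hu' := (hV.isLocalFlow hf).subset_of_eq_shift hΓ isOpen_Ioo isPreconnected_Ioo hη hsS
    (s₀ := 0) ⟨by linarith, hε⟩ hη0.symm u
    ⟨(neg_le_neg (min_le_right _ _)).trans_lt hu.1, hu.2.trans_le (min_le_right _ _)⟩
  rw [sub_zero] at hu'
  have het : e t ∈ Ioo a b := hIoo ▸ hmem t ht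
  have hur : |u| < r := (abs_lt.2 hu).trans_le (min_le_left _ _)
  rw [abs_lt] at hur
  have h1 := hmin (e t) (u + s) (by linarith [het.2]) (hut.symm.trans hu'.2.symm)
  linarith [het.1]

/-- The total change of the angle of the direction field does not depend on the directed
parametrization. -/
lemma IsDirectedParam.winding_unique {γ' : ℝ → M} {θ θ' : ℝ → ℝ}
    (hγ : IsDirectedParam m f V (Γ '' S) γ) (hγ' : IsDirectedParam m f V (Γ '' S) γ')
    (hθ : ContinuousOn θ (Icc 0 1)) (hθ' : ContinuousOn θ' (Icc 0 1))
    (h : ∀ t ∈ Ioo (0 : ℝ) 1, V (γ t) = turnVec (θ t))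
    (h' : ∀ t ∈ Ioo (0 : ℝ) 1, V (γ' t) = turnVec (θ' t)) :
    θ 1 - θ 0 = θ' 1 - θ' 0 := by
  obtain ⟨e, hes, hem, heS, heγ⟩ := hγ.exists_homeomorph hf hV hΓ
  obtain ⟨e', hes', hem', heS', heγ'⟩ := hγ'.exists_homeomorph hf hV hΓ
  have hlim : ∀ {φ : ℝ → ℝ}, ContinuousOn φ (Icc 0 1) →
      Tendsto φ (𝓝[>] 0) (𝓝 (φ 0)) ∧ Tendsto φ (𝓝[<] 1) (𝓝 (φ 1)) := by
    intro φ hφ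
    refine ⟨?_, ?_⟩
    · have h1 := (hφ 0 ⟨le_rfl, zero_le_one⟩).mono Ioo_subset_Icc_self
      rwa [ContinuousWithinAt, nhdsWithin_Ioo_eq_nhdsGT zero_lt_one] at h1
    · have h1 := (hφ 1 ⟨zero_le_one, le_rfl⟩).mono Ioo_subset_Icc_self
      rwa [ContinuousWithinAt, nhdsWithin_Ioo_eq_nhdsLT zero_lt_one] at h1
  by_cases hinj : InjOn Γ S
  · -- the two parametrizations differ by a monotone change of the parameter
    have ht := hγ.target_eq hf hV hΓ hinj hes heS heγ
    have ht' := hγ'.target_eq hf hV hΓ hinj hes' heS' heγ'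
    set ψ : ℝ → ℝ := fun t => e'.symm (e t) with hψ
    have hψm : ∀ t ∈ Ioo (0 : ℝ) 1, ψ t ∈ Ioo (0 : ℝ) 1 ∧ e' (ψ t) = e t := by
      intro t htm
      have h1 : e t ∈ e'.target := by rw [ht', ← ht]; exact e.map_source (hes ▸ htm)
      exact ⟨hes' ▸ e'.map_target h1, e'.right_inv h1⟩
    have hψc : ContinuousOn ψ (Ioo 0 1) := by
      refine e'.continuousOn_symm.comp (hes ▸ e.continuousOn) fun t htm => ?_
      rw [ht', ← ht]
      exact e.map_source (hes ▸ htm)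
    have hψmono : StrictMonoOn ψ (Ioo 0 1) := by
      intro s hs t htm hst
      rw [← hem'.lt_iff_lt (hψm s hs).1 (hψm t htm).1, (hψm s hs).2, (hψm t htm).2]
      exact hem hs htm hst
    have hψi : ψ '' Ioo 0 1 = Ioo 0 1 := by
      refine subset_antisymm (image_subset_iff.2 fun t htm => (hψm t htm).1) fun t htm => ?_
      have h1 : e' t ∈ e.target := by rw [ht, ← ht']; exact e'.map_source (hes' ▸ htm)
      refine ⟨e.symm (e' t), hes ▸ e.map_target h1, ?_⟩
      simp only [hψ]
      rw [e.right_inv h1, e'.left_inv (hes' ▸ htm)]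
    obtain ⟨k, hk⟩ := exists_eq_add_int isPreconnected_Ioo (hθ.mono Ioo_subset_Icc_self)
      (ψ := θ' ∘ ψ) ((hθ'.mono Ioo_subset_Icc_self).comp hψc fun t htm => (hψm t htm).1) (by
        intro t htm
        rw [← h t htm, Function.comp_apply, ← h' _ (hψm t htm).1, ← heγ t htm,
          ← heγ' _ (hψm t htm).1, (hψm t htm).2])
    obtain ⟨hψ0, hψ1⟩ := tendsto_of_strictMonoOn hψmono hψi
    have h0 : θ 0 = θ' 0 + k := by
      refine tendsto_nhds_unique_of_eventuallyEq (hlim hθ).1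
        (((hlim hθ').1.comp hψ0).add_const (k : ℝ)) ?_
      filter_upwards [Ioo_mem_nhdsGT zero_lt_one] with t htm using hk t htm
    have h1 : θ 1 = θ' 1 + k := by
      refine tendsto_nhds_unique_of_eventuallyEq (hlim hθ).2
        (((hlim hθ').2.comp hψ1).add_const (k : ℝ)) ?_
      filter_upwards [Ioo_mem_nhdsLT zero_lt_one] with t htm using hk t htm
    linarith
  · -- the total change is the change over a period
    obtain ⟨hS, T, hT, hper, hmin⟩ := (hV.isLocalFlow hf).exists_period hΓ hinj
    have hcurve : ∀ t, IsUnitSpeedAt m f O V Γ t := fun t => hΓ.curve t (hS ▸ mem_univ t)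
    have hVc : Continuous fun t => V (Γ t) := by
      have h1 : ContDiff ℝ ∞ (f ∘ Γ) := contDiff_iff_contDiffAt.2 fun t => by
        have h2 : ContMDiffAt 𝓘(ℝ, ℝ) (𝓡 2) ∞ (f ∘ Γ) t := (hf _).comp t (hcurve t).2.1
        exact h2.contDiffAt
      have h2 := h1.continuous_deriv (by simp)
      exact h2.congr fun t => (hcurve t).2.2.deriv
    obtain ⟨Θ, hΘ, hΘV⟩ := exists_turnVec_eq hVc fun t => hV.norm_eq _ (hcurve t).1
    obtain ⟨k, hk⟩ := exists_eq_add_int isPreconnected_univ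
      (θ := fun t => Θ (t + T)) (ψ := Θ) (hΘ.comp (by fun_prop)).continuousOn hΘ.continuousOn
      (fun t _ => by rw [← hΘV, ← hΘV, hper t])
    have key : ∀ {γ : ℝ → M} {θ : ℝ → ℝ} {e : OpenPartialHomeomorph ℝ ℝ},
        IsDirectedParam m f V (Γ '' S) γ → ContinuousOn θ (Icc 0 1) →
        (∀ t ∈ Ioo (0 : ℝ) 1, V (γ t) = turnVec (θ t)) → e.source = Ioo 0 1 →
        StrictMonoOn e (Ioo 0 1) → (∀ t ∈ Ioo (0 : ℝ) 1, Γ (e t) = γ t) → θ 1 - θ 0 = k := by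
      intro γ θ e hγ hθ h hes hem heγ
      obtain ⟨a, ha⟩ := hγ.exists_target_eq hf hV hΓ hS hT hper hmin hes heγ
      obtain ⟨n, hn⟩ := exists_eq_add_int isPreconnected_Ioo (hθ.mono Ioo_subset_Icc_self)
        (ψ := Θ ∘ e) (hΘ.comp_continuousOn (hes ▸ e.continuousOn)) (by
          intro t ht
          rw [← h t ht, Function.comp_apply, ← hΘV, heγ t ht])
      rw [← e.image_source_eq_target, hes] at ha
      obtain ⟨h0, h1⟩ := tendsto_of_strictMonoOn hem ha
      have h2 : θ 0 = Θ a + n := by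
        refine tendsto_nhds_unique_of_eventuallyEq (hlim hθ).1
          ((((hΘ.tendsto a).mono_left nhdsWithin_le_nhds).comp h0).add_const (n : ℝ)) ?_
        filter_upwards [Ioo_mem_nhdsGT zero_lt_one] with t ht using hn t ht
      have h3 : θ 1 = Θ (a + T) + n := by
        refine tendsto_nhds_unique_of_eventuallyEq (hlim hθ).2
          ((((hΘ.tendsto (a + T)).mono_left nhdsWithin_le_nhds).comp h1).add_const (n : ℝ)) ?_
        filter_upwards [Ioo_mem_nhdsLT zero_lt_one] with t ht using hn t ht
      have h4 := hk a (mem_univ a)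
      linarith
    rw [key hγ hθ h hes hem heγ, key hγ' hθ' h' hes' hem' heγ']

end

end

noncomputable section

/-! ### Half-branches and the ends of arcs -/

namespace SingularBranch

variable {m : ℕ} {M : Type*} [TopologicalSpace M] [ChartedSpace (Euc m) M]
  {f : M → Euc 2} {p : M} (B : SingularBranch m f p)

/-- The branch with the opposite parametrization. -/
def reverse : SingularBranch m f p :=
  have hneg : ∀ {t : ℝ}, t ∈ Ioo (-B.ε) B.ε → -t ∈ Ioo (-B.ε) B.ε := fun ht =>
    ⟨neg_lt_neg ht.2, neg_lt.1 ht.1⟩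
  have hcr : ∀ u v : Euc 2, cross (-u) (-v) = cross u v := fun u v => by
    simp only [cross, PiLp.neg_apply]; ring
  { ε := B.ε
    γ := fun t => B.γ (-t)
    U := B.U
    π := fun y => -B.π y
    ρ := fun t => B.ρ (-t)
    E := fun t => -B.E (-t)
    N := -B.N
    pos := B.pos
    zero := by rw [neg_zero, B.zero]
    isOpen := B.isOpen
    smooth := fun t ht => (B.smooth _ (hneg ht)).comp t contDiff_neg.contDiffAt.contMDiffAt
    mem_iff := by
      intro y
      rw [B.mem_iff]
      constructor
      · rintro ⟨t, ht, rfl⟩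
        exact ⟨-t, hneg ht, by simp only [neg_neg]⟩
      · rintro ⟨t, ht, rfl⟩
        exact ⟨-t, hneg ht, rfl⟩
    smooth_π := fun y hy => contDiff_neg.contDiffAt.contMDiffAt.comp y (B.smooth_π y hy)
    π_γ := fun t ht => by rw [B.π_γ _ (hneg ht), neg_neg]
    continuousAt := fun t ht => ((B.continuousAt _ (hneg ht)).comp continuous_neg.continuousAt).neg
    mem_range := by
      intro t ht
      obtain ⟨x, hx⟩ := B.mem_range _ (hneg ht)
      exact ⟨-x, by rw [map_neg, hx]; rfl⟩
    hasDerivAt := by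
      intro t ht
      have h := (B.hasDerivAt _ (hneg ht)).scomp t (hasDerivAt_neg t)
      rw [smul_neg, ← neg_one_smul ℝ]
      exact h
    cross_pos := by
      intro t ht h0
      rw [smul_neg, hcr]
      exact B.cross_pos _ (hneg ht) (neg_ne_zero.2 h0)
    cross_zero := by
      rw [smul_neg, hcr, neg_zero]
      exact B.cross_zero
    ne_zero := fun t ht => neg_ne_zero.2 (B.ne_zero _ (hneg ht))
    tangent := by
      intro t ht
      rw [B.tangent _ (hneg ht), smul_neg, ← Set.neg_singleton, Submodule.span_neg] }

/-- The open half of a branch where the parameter is positive. -/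
def half : Set M := B.γ '' Ioo 0 B.ε

lemma mem_Ioo {t : ℝ} (ht : t ∈ Ioo 0 B.ε) : t ∈ Ioo (-B.ε) B.ε :=
  ⟨(neg_lt_zero.2 B.pos).trans ht.1, ht.2⟩

lemma isPreconnected_half : IsPreconnected B.half :=
  isPreconnected_Ioo.image _ fun t ht =>
    (B.smooth t (B.mem_Ioo ht)).continuousAt.continuousWithinAt

lemma exists_isOpen_half : ∃ W, IsOpen W ∧ W ∩ singularSet m f = B.half := by
  refine ⟨B.U ∩ B.π ⁻¹' Ioi 0, ContinuousOn.isOpen_inter_preimage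
      (fun y hy => (B.smooth_π y hy).continuousAt.continuousWithinAt) B.isOpen isOpen_Ioi, ?_⟩
  ext y
  constructor
  · rintro ⟨⟨hy, hyπ⟩, hys⟩
    obtain ⟨t, ht, rfl⟩ := (B.mem_iff y).1 ⟨hy, hys⟩
    rw [mem_preimage, B.π_γ t ht] at hyπ
    exact ⟨t, ⟨hyπ, ht.2⟩, rfl⟩
  · rintro ⟨t, ht, rfl⟩
    have h := B.γ_mem (B.mem_Ioo ht)
    refine ⟨⟨h.1, ?_⟩, h.2⟩
    rw [mem_preimage, B.π_γ t (B.mem_Ioo ht)]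
    exact ht.1

/-- The function `ρ` has constant sign on the positive half of a branch. -/
lemma exists_sign_ρ : ∃ κ : ℝ, (κ = 1 ∨ κ = -1) ∧ ∀ t ∈ Ioo 0 B.ε, B.ρ t = κ * |B.ρ t| := by
  have hc : ContinuousOn (fun t => cross (B.E t) B.N) (Ioo 0 B.ε) := by
    intro t ht
    have h := B.continuousAt t (B.mem_Ioo ht)
    have h0 : ContinuousAt (fun t => B.E t 0) t := by fun_prop
    have h1 : ContinuousAt (fun t => B.E t 1) t := by fun_prop
    exact ((h0.mul_const _).sub (h1.mul_const _)).continuousWithinAt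
  have hpos : ∀ t ∈ Ioo 0 B.ε, 0 < B.ρ t * cross (B.E t) B.N := by
    intro t ht
    rw [← cross_smul_left]
    exact B.cross_pos t (B.mem_Ioo ht) ht.1.ne'
  by_cases hall : ∀ t ∈ Ioo 0 B.ε, 0 < cross (B.E t) B.N
  · refine ⟨1, Or.inl rfl, fun t ht => ?_⟩
    rw [one_mul, abs_of_pos]
    exact (pos_iff_pos_of_mul_pos (hpos t ht)).2 (hall t ht)
  · refine ⟨-1, Or.inr rfl, fun t ht => ?_⟩
    push Not at hall
    obtain ⟨t₁, ht₁, h1⟩ := hall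
    have h2 : cross (B.E t) B.N < 0 := by
      by_contra! h2
      obtain ⟨t₂, ht₂, h3⟩ := isPreconnected_Ioo.intermediate_value ht₁ ht hc ⟨h1, h2⟩
      have := hpos t₂ ht₂
      simp only at h3
      rw [h3, mul_zero] at this
      exact this.false
    have h3 : B.ρ t < 0 := by
      by_contra! h3
      have := hpos t ht
      nlinarith
    rw [abs_of_neg h3]
    ring

end SingularBranch

/-- A system of disjoint half-branches that contains the ends of all curves in `O` converging to
points outside of `O`. The half-branch with index `i` starts at `p i`, and the sign `s i` tells
whether it runs in the direction of `V` or in the opposite one. -/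
structure IsEndSystem (m : ℕ) {M : Type*} [TopologicalSpace M] [ChartedSpace (Euc m) M]
    (f : M → Euc 2) (O : Set M) (V : M → Euc 2) {ι : Type*} (p : ι → M)
    (B : ∀ i, SingularBranch m f (p i)) (s : ι → ℤ) : Prop where
  subset : O ⊆ singularSet m f
  notMem : ∀ i, p i ∉ O
  sign : ∀ i, s i = 1 ∨ s i = -1
  half : ∀ i, ∀ t ∈ Ioo 0 (B i).ε, (B i).γ t ∈ O ∧
    (B i).ρ t • (B i).E t = (s i * ‖(B i).ρ t • (B i).E t‖) • V ((B i).γ t)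
  disjoint : ∀ i j, i ≠ j → Disjoint (B i).half (B j).half
  cover : ∀ x, x ∉ O → ∃ N ∈ 𝓝 x, ∀ y ∈ N, y ∈ O → ∃ i, p i = x ∧ y ∈ (B i).half

section

variable {m : ℕ} {M : Type*} [TopologicalSpace M] [ChartedSpace (Euc m) M]
  {f : M → Euc 2} {O : Set M} {V : M → Euc 2} {ι : Type*} {p : ι → M}
  {B : ∀ i, SingularBranch m f (p i)} {s : ι → ℤ}

lemma IsEndSystem.neg (h : IsEndSystem m f O V p B s) :
    IsEndSystem m f O (fun x => -V x) p B fun i => -s i where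
  subset := h.subset
  notMem := h.notMem
  sign i := by rcases h.sign i with h1 | h1 <;> omega
  half i t ht := by
    refine ⟨(h.half i t ht).1, ?_⟩
    rw [Int.cast_neg, neg_mul, neg_smul_neg]
    exact (h.half i t ht).2
  disjoint := h.disjoint
  cover := h.cover

variable (h : IsEndSystem m f O V p B s)
include h

/-- A curve in `O` that converges to a point outside of `O` finally runs in a half-branch. -/
lemma IsEndSystem.exists_half {γ : ℝ → M} {d : M} (hd : d ∉ O)
    (hγO : ∀ u ∈ Ioo (0 : ℝ) 1, γ u ∈ O) (hγ : ContinuousOn γ (Ioo 0 1))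
    (hlim : Tendsto γ (𝓝[<] 1) (𝓝 d)) :
    ∃ i, p i = d ∧ ∃ b ∈ Ico (0 : ℝ) 1, ∀ u ∈ Ioo b 1, γ u ∈ (B i).half := by
  obtain ⟨N, hN, hNO⟩ := h.cover d hd
  obtain ⟨b, hb, hsub⟩ := (mem_nhdsLT_iff_exists_mem_Ico_Ioo_subset zero_lt_one).1
    (hlim.eventually_mem hN)
  have h01 : Ioo b 1 ⊆ Ioo 0 1 := Ioo_subset_Ioo_left hb.1
  have hex : ∀ u ∈ Ioo b 1, ∃ i, p i = d ∧ γ u ∈ (B i).half := fun u hu =>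
    hNO _ (hsub hu) (hγO u (h01 hu))
  obtain ⟨u₀, hu₀⟩ : (Ioo b 1).Nonempty := nonempty_Ioo.2 hb.2
  obtain ⟨i, hi, hui⟩ := hex u₀ hu₀
  refine ⟨i, hi, b, hb, fun u hu => ?_⟩
  by_contra hui'
  choose W hWo hW using fun i => (B i).exists_isOpen_half
  -- the half-branches are relatively open and disjoint, so that a connected set stays in one of
  -- them
  have hpre : IsPreconnected (γ '' Ioo b 1) := isPreconnected_Ioo.image _ (hγ.mono h01)
  obtain ⟨_, ⟨v, hv, rfl⟩, hv1, hv2⟩ := hpre (W i) (⋃ j ∈ {j | j ≠ i}, W j) (hWo i)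
    (isOpen_biUnion fun j _ => hWo j) (by
      rintro _ ⟨v, hv, rfl⟩
      obtain ⟨j, -, hj⟩ := hex v hv
      rw [← hW] at hj
      by_cases hji : j = i
      · exact Or.inl (hji ▸ hj.1)
      · exact Or.inr (mem_biUnion hji hj.1))
    ⟨γ u₀, ⟨u₀, hu₀, rfl⟩, (hW i ▸ hui : γ u₀ ∈ W i ∩ _).1⟩ (by
      obtain ⟨j, -, hj⟩ := hex u hu
      have hji : j ≠ i := fun hji => hui' (hji ▸ hj)
      rw [← hW] at hj
      exact ⟨γ u, ⟨u, hu, rfl⟩, mem_biUnion hji hj.1⟩)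
  obtain ⟨j, hji, hj⟩ := mem_iUnion₂.1 hv2
  have hvS := h.subset (hγO v (h01 hv))
  have h1 : γ v ∈ (B j).half := hW j ▸ ⟨hj, hvS⟩
  have h2 : γ v ∈ (B i).half := hW i ▸ ⟨hv1, hvS⟩
  exact (h.disjoint j i hji).ne_of_mem h1 h2 rfl

/-- A curve that runs in the direction of `V` and converges to a point outside of `O` finally runs
in a half-branch of negative sign, and `V` converges along it. -/
lemma IsEndSystem.exists_end {γ : ℝ → M} {d : M} (hd : d ∉ O)
    (hγO : ∀ u ∈ Ioo (0 : ℝ) 1, γ u ∈ O) (hγ : ContinuousOn γ (Ioo 0 1))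
    (hder : ∀ u ∈ Ioo (0 : ℝ) 1, ∃ l > (0 : ℝ), HasDerivAt (f ∘ γ) (l • V (γ u)) u)
    (hlim : Tendsto γ (𝓝[<] 1) (𝓝 d)) :
    ∃ i, p i = d ∧ s i = -1 ∧ (∃ b ∈ Ico (0 : ℝ) 1, ∀ u ∈ Ioo b 1, γ u ∈ (B i).half) ∧
      ∃ r : ℝ, Tendsto (fun u => V (γ u)) (𝓝[<] 1) (𝓝 (r • (B i).E 0)) := by
  obtain ⟨i, rfl, b, hb, hub⟩ := h.exists_half hd hγO hγ hlim
  have h01 : Ioo b 1 ⊆ Ioo 0 1 := Ioo_subset_Ioo_left hb.1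
  have hss : (s i : ℝ) * s i = 1 := by rcases h.sign i with h1 | h1 <;> simp [h1]
  -- the parameter on the half-branch
  set τ : ℝ → ℝ := fun u => (B i).π (γ u) with hτ
  have hτm : ∀ u ∈ Ioo b 1, τ u ∈ Ioo 0 (B i).ε ∧ (B i).γ (τ u) = γ u := by
    intro u hu
    obtain ⟨t, ht, htu⟩ := hub u hu
    simp only [hτ]
    rw [← htu, (B i).π_γ t ((B i).mem_Ioo ht)]
    exact ⟨ht, rfl⟩
  have hτ0 : Tendsto τ (𝓝[<] 1) (𝓝 0) := by
    have h1 := ((B i).smooth_π (p i) (B i).mem.1).continuousAt.tendsto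
    have h2 := (B i).π_γ 0 (B i).zero_mem
    rw [(B i).zero] at h2
    rw [h2] at h1
    exact h1.comp hlim
  have hIoo : ∀ᶠ u in 𝓝[<] (1 : ℝ), u ∈ Ioo b 1 := Ioo_mem_nhdsLT hb.2
  have hpos : ∀ u ∈ Ioo b 1, 0 < ‖(B i).ρ (τ u) • (B i).E (τ u)‖ := by
    intro u hu
    have hm := (B i).mem_Ioo (hτm u hu).1
    exact norm_pos_iff.2 (smul_ne_zero ((B i).ρ_ne_zero hm (hτm u hu).1.1.ne') ((B i).ne_zero _ hm))
  have hVeq : ∀ u ∈ Ioo b 1, ‖(B i).ρ (τ u) • (B i).E (τ u)‖ • V (γ u)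
      = (s i : ℝ) • ((B i).ρ (τ u) • (B i).E (τ u)) := by
    intro u hu
    have h1 := (h.half i (τ u) (hτm u hu).1).2
    rw [(hτm u hu).2] at h1
    conv_rhs => rw [h1, smul_smul, ← mul_assoc, hss, one_mul]
  refine ⟨i, rfl, ?_, ⟨b, hb, hub⟩, ?_⟩
  -- with a positive sign, the curve would move away from `p i`, since the function `cross (f ·) N`
  -- would increase along it
  · refine (h.sign i).resolve_left fun hs1 => ?_
    have hdw : ∀ u ∈ Ioo b 1, ∃ w > 0, HasDerivAt (fun u => cross (f (γ u)) (B i).N) w u := by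
      intro u hu
      obtain ⟨l, hl, hlu⟩ := hder u (h01 hu)
      have h1 := hlu.cross (hasDerivAt_const u (B i).N)
      refine ⟨_, ?_, h1⟩
      have h2 : cross (f (γ u)) 0 = 0 := by simp [cross]
      rw [Function.comp_apply, h2, add_zero, cross_smul_left]
      refine mul_pos hl (pos_of_mul_pos_right (a := ‖(B i).ρ (τ u) • (B i).E (τ u)‖) ?_
        (hpos u hu).le)
      rw [← cross_smul_left, hVeq u hu, hs1, Int.cast_one, one_smul]
      exact (B i).cross_pos _ ((B i).mem_Ioo (hτm u hu).1) (hτm u hu).1.1.ne'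
    have hmono : StrictMonoOn (fun u => cross (f (γ u)) (B i).N) (Ioo b 1) := by
      refine strictMonoOn_of_deriv_pos (convex_Ioo _ _) ?_ fun u hu => ?_
      · intro u hu
        obtain ⟨w, -, hw⟩ := hdw u hu
        exact hw.continuousAt.continuousWithinAt
      · rw [interior_Ioo] at hu
        obtain ⟨w, hw0, hw⟩ := hdw u hu
        rw [hw.deriv]
        exact hw0
    obtain ⟨u, hu⟩ : (Ioo b 1).Nonempty := nonempty_Ioo.2 hb.2
    have h3 : Tendsto (fun u => cross (f (γ u)) (B i).N) (𝓝[<] 1)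
        (𝓝 (cross (f ((B i).γ 0)) (B i).N)) := by
      have hc : ContinuousAt (fun t => cross (f ((B i).γ t)) (B i).N) 0 := by
        have h4 : ContinuousAt (fun t => f ((B i).γ t)) 0 :=
          ((B i).hasDerivAt 0 (B i).zero_mem).continuousAt
        have h5 : Continuous fun v : Euc 2 => cross v (B i).N := by unfold cross; fun_prop
        exact h5.continuousAt.comp h4
      refine (hc.tendsto.comp hτ0).congr' ?_
      filter_upwards [hIoo] with v hv
      simp only [Function.comp_apply, (hτm v hv).2]
    have h4 : cross (f (γ u)) (B i).N ≤ cross (f ((B i).γ 0)) (B i).N := by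
      refine ge_of_tendsto h3 ?_
      filter_upwards [Ioo_mem_nhdsLT hu.2] with v hv
      exact (hmono hu ⟨hu.1.trans hv.1, hv.2⟩ hv.1).le
    have h5 := (B i).strictMonoOn (B i).zero_mem ((B i).mem_Ioo (hτm u hu).1) (hτm u hu).1.1
    simp only [(hτm u hu).2] at h5
    exact h5.not_ge h4
  -- `V` is the normalized direction of `ρ E`, where `ρ` has constant sign and `E` is continuous up
  -- to the end and nonzero there
  · obtain ⟨κ, -, hκ⟩ := (B i).exists_sign_ρ
    refine ⟨s i * κ * ‖(B i).E 0‖⁻¹, ?_⟩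
    have hE : Tendsto (fun u => (B i).E (τ u)) (𝓝[<] 1) (𝓝 ((B i).E 0)) :=
      ((B i).continuousAt 0 (B i).zero_mem).tendsto.comp hτ0
    have hE0 : ‖(B i).E 0‖ ≠ 0 := norm_ne_zero_iff.2 ((B i).ne_zero 0 (B i).zero_mem)
    refine ((tendsto_const_nhds.mul (hE.norm.inv₀ hE0)).smul hE).congr' ?_
    filter_upwards [hIoo] with u hu
    have h1 := hVeq u hu
    have h2 := hpos u hu
    have hEu : ‖(B i).E (τ u)‖ ≠ 0 :=
      norm_ne_zero_iff.2 ((B i).ne_zero _ ((B i).mem_Ioo (hτm u hu).1))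
    have h3 : |(B i).ρ (τ u)| ≠ 0 := abs_ne_zero.2
      ((B i).ρ_ne_zero ((B i).mem_Ioo (hτm u hu).1) (hτm u hu).1.1.ne')
    rw [← smul_right_inj h2.ne', h1, smul_smul, smul_smul, norm_smul, Real.norm_eq_abs]
    congr 1
    rw [hκ _ (hτm u hu).1, abs_mul, abs_abs]
    have hκ1 : |κ| = 1 := by
      have h4 := hκ _ (hτm u hu).1
      have h5 : |(B i).ρ (τ u)| = |κ| * |(B i).ρ (τ u)| := by
        conv_lhs => rw [h4, abs_mul, abs_abs]
      exact (mul_right_cancel₀ h3 (by rw [one_mul]; exact h5)).symm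
    rw [hκ1]
    field_simp

/-- The initial version of `IsEndSystem.exists_end`. -/
lemma IsEndSystem.exists_start {γ : ℝ → M} {d : M} (hd : d ∉ O)
    (hγO : ∀ u ∈ Ioo (0 : ℝ) 1, γ u ∈ O) (hγ : ContinuousOn γ (Ioo 0 1))
    (hder : ∀ u ∈ Ioo (0 : ℝ) 1, ∃ l > (0 : ℝ), HasDerivAt (f ∘ γ) (l • V (γ u)) u)
    (hlim : Tendsto γ (𝓝[>] 0) (𝓝 d)) :
    ∃ i, p i = d ∧ s i = 1 ∧ (∃ b ∈ Ioc (0 : ℝ) 1, ∀ u ∈ Ioo 0 b, γ u ∈ (B i).half) ∧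
      ∃ r : ℝ, Tendsto (fun u => V (γ u)) (𝓝[>] 0) (𝓝 (r • (B i).E 0)) := by
  have hmem : ∀ {u : ℝ}, u ∈ Ioo (0 : ℝ) 1 → 1 - u ∈ Ioo (0 : ℝ) 1 := fun hu =>
    ⟨by linarith [hu.2], by linarith [hu.1]⟩
  have hr : Tendsto (fun u : ℝ => 1 - u) (𝓝[<] 1) (𝓝[>] 0) := by
    refine tendsto_nhdsWithin_iff.2 ⟨?_, ?_⟩
    · exact ((continuous_const.sub continuous_id).tendsto' (1 : ℝ) 0 (by simp)).mono_left
        nhdsWithin_le_nhds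
    · filter_upwards [self_mem_nhdsWithin] with u (hu : u < 1) using sub_pos.2 hu
  have hr' : Tendsto (fun u : ℝ => 1 - u) (𝓝[>] 0) (𝓝[<] 1) := by
    refine tendsto_nhdsWithin_iff.2 ⟨?_, ?_⟩
    · exact ((continuous_const.sub continuous_id).tendsto' (0 : ℝ) 1 (by simp)).mono_left
        nhdsWithin_le_nhds
    · filter_upwards [self_mem_nhdsWithin] with u (hu : 0 < u)
      exact sub_lt_self 1 hu
  obtain ⟨i, hi, hs, ⟨b, hb, hub⟩, r, hV⟩ := h.neg.exists_end (γ := fun u => γ (1 - u)) hd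
    (fun u hu => hγO _ (hmem hu))
    (hγ.comp (continuous_const.sub continuous_id).continuousOn fun u hu => hmem hu) (by
      intro u hu
      obtain ⟨l, hl, hlu⟩ := hder _ (hmem hu)
      refine ⟨l, hl, ?_⟩
      have h1 := hlu.scomp u ((hasDerivAt_id u).const_sub 1)
      rw [smul_neg, ← neg_one_smul ℝ]
      exact h1) (hlim.comp hr)
  refine ⟨i, hi, by omega,
    ⟨1 - b, ⟨by linarith [hb.2], by linarith [hb.1]⟩, fun u hu => ?_⟩, -r, ?_⟩
  · have := hub (1 - u) ⟨by linarith [hu.2], by linarith [hu.1]⟩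
    simpa using this
  · have h1 := (hV.comp hr').neg
    simpa [Function.comp_def] using h1

end

end

noncomputable section

/-! ### Existence of parametrizations -/

lemma norm_eq_of_tendsto {v : ℝ → Euc 2} {l : Filter ℝ} [l.NeBot] {L : Euc 2}
    (h1 : ∀ᶠ t in l, ‖v t‖ = 1) (h : Tendsto v l (𝓝 L)) : ‖L‖ = 1 :=
  tendsto_nhds_unique h.norm (tendsto_const_nhds.congr' (h1.mono fun _ ht => ht.symm))

/-- Lifting of angles on the closed interval for a field of unit vectors with limits at the
ends. -/
lemma exists_turnVec_eq_of_tendsto {v : ℝ → Euc 2} {L₀ L₁ : Euc 2} (hv : ContinuousOn v (Ioo 0 1))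
    (h1 : ∀ t ∈ Ioo (0 : ℝ) 1, ‖v t‖ = 1) (hL₀ : Tendsto v (𝓝[>] 0) (𝓝 L₀))
    (hL₁ : Tendsto v (𝓝[<] 1) (𝓝 L₁)) :
    ∃ θ : ℝ → ℝ, Continuous θ ∧ (∀ t ∈ Ioo (0 : ℝ) 1, v t = turnVec (θ t)) ∧
      L₀ = turnVec (θ 0) ∧ L₁ = turnVec (θ 1) := by
  have hc := continuousOn_Icc_extendFrom_Ioo hv hL₀ hL₁
  have he0 := eq_lim_at_left_extendFrom_Ioo zero_lt_one hL₀
  have he1 := eq_lim_at_right_extendFrom_Ioo zero_lt_one hL₁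
  have he := extendFrom_extends hv
  set v' := extendFrom (Ioo 0 1) v
  have hn : ∀ t ∈ Icc (0 : ℝ) 1, ‖v' t‖ = 1 := by
    intro t ht
    rcases eq_endpoints_or_mem_Ioo_of_mem_Icc ht with rfl | rfl | ht
    · rw [he0]
      exact norm_eq_of_tendsto (eventually_of_mem (Ioo_mem_nhdsGT zero_lt_one) h1) hL₀
    · rw [he1]
      exact norm_eq_of_tendsto (eventually_of_mem (Ioo_mem_nhdsLT zero_lt_one) h1) hL₁
    · rw [he t ht, h1 t ht]
  obtain ⟨θ, hθ, hθv⟩ := exists_turnVec_eq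
    (v := IccExtend zero_le_one ((Icc (0 : ℝ) 1).domRestrict v'))
    (continuousOn_iff_continuous_domRestrict.1 hc).Icc_extend' fun t =>
      hn _ (projIcc (0 : ℝ) 1 zero_le_one t).2
  have key : ∀ t ∈ Icc (0 : ℝ) 1, v' t = turnVec (θ t) := by
    intro t ht
    rw [← hθv, IccExtend_of_mem _ _ ht, domRestrict_apply]
  refine ⟨θ, hθ, fun t ht => ?_, ?_, ?_⟩
  · rw [← key t (Ioo_subset_Icc_self ht), he t ht]
  · rw [← key 0 ⟨le_rfl, zero_le_one⟩, he0]
  · rw [← key 1 ⟨zero_le_one, le_rfl⟩, he1]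

/-- Each open interval, bounded or not, is the image of the unit interval under an increasing
diffeomorphism. -/
lemma exists_image_Ioo_eq {S : Set ℝ} (hS : IsOpen S) (hS' : IsPreconnected S) (hne : S.Nonempty) :
    ∃ φ : ℝ → ℝ, φ '' Ioo 0 1 = S ∧ ∀ u ∈ Ioo (0 : ℝ) 1, ContDiffAt ℝ ∞ φ u ∧ 0 < deriv φ u := by
  have hSa : IsOpen (Real.arctan '' S) := by
    have h : Real.arctan '' S = Ioo (-(Real.pi / 2)) (Real.pi / 2) ∩ Real.tan ⁻¹' S := by
      refine subset_antisymm ?_ fun x hx => ⟨_, hx.2, Real.arctan_tan hx.1.1 hx.1.2⟩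
      rintro _ ⟨s, hs, rfl⟩
      exact ⟨Real.arctan_mem_Ioo s, by rwa [mem_preimage, Real.tan_arctan]⟩
    rw [h]
    exact Real.continuousOn_tan_Ioo.isOpen_inter_preimage isOpen_Ioo hS
  have hbd : ∀ x ∈ Real.arctan '' S, x ∈ Ioo (-(Real.pi / 2)) (Real.pi / 2) := by
    rintro _ ⟨s, -, rfl⟩
    exact Real.arctan_mem_Ioo s
  have h := (hS'.image _ Real.continuous_arctan.continuousOn).eq_Ioo_of_isOpen hSa (hne.image _)
    ⟨_, fun x hx => (hbd x hx).1.le⟩ ⟨_, fun x hx => (hbd x hx).2.le⟩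
  set a := sInf (Real.arctan '' S)
  set b := sSup (Real.arctan '' S)
  have hab : a < b := by
    obtain ⟨x, hx⟩ := hne.image Real.arctan
    rw [h] at hx
    exact hx.1.trans hx.2
  have hmem : ∀ u ∈ Ioo (0 : ℝ) 1, a + (b - a) * u ∈ Ioo a b := by
    intro u hu
    have := mul_pos (sub_pos.2 hab) hu.1
    have := mul_pos (sub_pos.2 hab) (sub_pos.2 hu.2)
    exact ⟨by linarith, by linarith⟩
  refine ⟨fun u => Real.tan (a + (b - a) * u), ?_, fun u hu => ?_⟩
  · refine subset_antisymm ?_ fun s hs => ?_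
    · rintro _ ⟨u, hu, rfl⟩
      have h1 := hmem u hu
      rw [← h] at h1
      obtain ⟨s, hs, hsu⟩ := h1
      simp only
      rwa [← hsu, Real.tan_arctan]
    · have h1 : Real.arctan s ∈ Ioo a b := h ▸ mem_image_of_mem _ hs
      have h2 : b - a ≠ 0 := (sub_pos.2 hab).ne'
      refine ⟨(Real.arctan s - a) / (b - a), ⟨div_pos (by linarith [h1.1]) (sub_pos.2 hab),
        (div_lt_one (sub_pos.2 hab)).2 (by linarith [h1.2])⟩, ?_⟩
      simp only
      rw [mul_div_cancel₀ _ h2, add_sub_cancel, Real.tan_arctan]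
  · have hcos : 0 < Real.cos (a + (b - a) * u) := by
      have h1 := hmem u hu
      rw [← h] at h1
      exact Real.cos_pos_of_mem_Ioo (hbd _ h1)
    constructor
    · have h1 : ContDiffAt ℝ ∞ (fun u => a + (b - a) * u) u := by fun_prop
      exact ContDiffAt.comp (g := Real.tan) u (Real.contDiffAt_tan.2 hcos.ne') h1
    · have h1 := ((hasDerivAt_id u).const_mul (b - a)).const_add a
      have h2 := (Real.hasDerivAt_tan hcos.ne').comp u h1
      have h3 : deriv (fun u => Real.tan (a + (b - a) * u)) u = _ := h2.deriv
      rw [h3, mul_one]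
      exact mul_pos (by positivity) (sub_pos.2 hab)

lemma image_Icc_eq_closure {X : Type*} [TopologicalSpace X] [T2Space X] {γ : ℝ → X} {A : Set X}
    (hγ : ContinuousOn γ (Icc 0 1)) (hA : ∀ t ∈ Ioo (0 : ℝ) 1, γ t ∈ A)
    (hcl : A ⊆ closure (γ '' Ioo 0 1)) : γ '' Icc 0 1 = closure A := by
  refine subset_antisymm ?_ ?_
  · rw [← closure_Ioo zero_ne_one] at hγ ⊢
    exact hγ.image_closure.trans (closure_mono (image_subset_iff.2 hA))
  · refine closure_minimal (hcl.trans ?_) (isCompact_Icc.image_of_continuousOn hγ).isClosed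
    exact closure_minimal (image_mono Ioo_subset_Icc_self)
      (isCompact_Icc.image_of_continuousOn hγ).isClosed

section

variable {m : ℕ} {M : Type*} [TopologicalSpace M] [ChartedSpace (Euc m) M]
  {f : M → Euc 2} {O : Set M} {V : M → Euc 2} (hf : ContMDiff (𝓡 m) (𝓡 2) ∞ f)

include hf in
lemma IsUnitSpeedAt.continuousAt_direction {Γ : ℝ → M} {t : ℝ}
    (h : ∀ᶠ s in 𝓝 t, IsUnitSpeedAt m f O V Γ s) : ContinuousAt (fun s => V (Γ s)) t := by
  have h1 : ContMDiffAt 𝓘(ℝ, ℝ) (𝓡 2) ∞ (f ∘ Γ) t := (hf _).comp t h.self_of_nhds.2.1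
  have h2 := (h1.contDiffAt.continuousAt_fderiv (by simp)).clm_apply
    (continuousAt_const (y := (1 : ℝ)))
  refine h2.congr ?_
  filter_upwards [h] with s hs
  exact hs.2.2.deriv

variable {S : Set ℝ} {Γ : ℝ → M}
  (hΓ : IsMaximalCurve (IsUnitSpeedAt m f O V) S Γ)
include hf hΓ

/-- An integral curve that is periodic has a closed parametrization. -/
lemma exists_closed_param (hS : S = univ) {T : ℝ} (hT : 0 < T)
    (hper : Function.Periodic Γ T) (hmin : ∀ t₁ t₂, t₁ < t₂ → Γ t₁ = Γ t₂ → T ≤ t₂ - t₁) :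
    ∃ γ : ℝ → M, ContinuousOn γ (Icc 0 1) ∧ IsDirectedParam m f V (Γ '' S) γ ∧
      γ '' Icc 0 1 = Γ '' S ∧ ContinuousOn (fun u => V (γ u)) (Ioo 0 1) ∧
      Tendsto (fun u => V (γ u)) (𝓝[>] 0) (𝓝 (V (γ 0))) ∧
      Tendsto (fun u => V (γ u)) (𝓝[<] 1) (𝓝 (V (γ 0))) := by
  subst hS
  have hcurve : ∀ t, IsUnitSpeedAt m f O V Γ t := fun t => hΓ.curve t (mem_univ t)
  have hcV : Continuous fun u : ℝ => V (Γ (T * u)) := by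
    have h1 : Continuous fun t => V (Γ t) := continuous_iff_continuousAt.2 fun t =>
      IsUnitSpeedAt.continuousAt_direction hf (Eventually.of_forall hcurve)
    exact h1.comp (continuous_const.mul continuous_id)
  have hc : Continuous fun u : ℝ => Γ (T * u) := by
    have h1 : Continuous Γ := continuous_iff_continuousAt.2 fun t => (hcurve t).2.1.continuousAt
    exact h1.comp (continuous_const.mul continuous_id)
  have him : (fun u : ℝ => Γ (T * u)) '' Icc 0 1 = Γ '' univ := by
    refine subset_antisymm ?_ ?_
    · rintro _ ⟨u, -, rfl⟩
      exact ⟨_, mem_univ _, rfl⟩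
    · rintro _ ⟨t, -, rfl⟩
      obtain ⟨y, hy, hyt⟩ := hper.exists_mem_Ico₀ hT t
      refine ⟨y / T, ⟨div_nonneg hy.1 hT.le, (div_le_one hT).2 hy.2.le⟩, ?_⟩
      simp only
      rw [mul_div_cancel₀ _ hT.ne', hyt]
  refine ⟨fun u => Γ (T * u), hc.continuousOn, ⟨?_, ?_, ?_, ?_, ?_⟩, him, hcV.continuousOn, ?_, ?_⟩
  · exact fun u _ => ⟨_, mem_univ _, rfl⟩
  · intro u _
    have h1 : ContMDiffAt 𝓘(ℝ, ℝ) 𝓘(ℝ, ℝ) ∞ (fun u : ℝ => T * u) u :=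
      (contDiff_const.mul contDiff_id).contDiffAt.contMDiffAt
    exact (hcurve (T * u)).2.1.comp u h1
  · have key : ∀ u ∈ Ioo (0 : ℝ) 1, ∀ v ∈ Ioo (0 : ℝ) 1, u < v → Γ (T * u) ≠ Γ (T * v) := by
      intro u hu v hv huv h
      have h1 := hmin _ _ (mul_lt_mul_of_pos_left huv hT) h
      have h2 : T * (v - u) < T * 1 := mul_lt_mul_of_pos_left (by linarith [hu.1, hv.2]) hT
      linarith
    intro u hu v hv h
    rcases lt_trichotomy u v with h1 | h1 | h1
    · exact absurd h (key u hu v hv h1)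
    · exact h1
    · exact absurd h.symm (key v hv u hu h1)
  · rw [← him, ← closure_Ioo zero_ne_one]
    exact hc.continuousOn.image_closure
  · intro u _
    refine ⟨T, hT, ?_⟩
    have h1 := (hcurve (T * u)).2.2.scomp u ((hasDerivAt_id u).const_mul T)
    rw [mul_one] at h1
    exact h1
  · exact (hcV.tendsto 0).mono_left nhdsWithin_le_nhds
  · refine Tendsto.mono_left ?_ nhdsWithin_le_nhds
    have h1 : Γ (T * 0) = Γ (T * 1) := by
      have := hper 0
      rw [zero_add] at this
      rw [mul_zero, mul_one, this]
    simp only [h1]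
    exact hcV.tendsto 1

variable [T2Space M] [CompactSpace M] (hV : IsDirectionField m f O V)
include hV

/-- An injective integral curve has a parametrization with end points, which do not lie in `O`. -/
lemma exists_open_param (hD : (closure O \ O).Finite) (hinj : InjOn Γ S) :
    ∃ γ : ℝ → M, ContinuousOn γ (Icc 0 1) ∧ IsDirectedParam m f V (Γ '' S) γ ∧
      γ '' Ioo 0 1 = Γ '' S ∧ γ 0 ∉ O ∧ γ 1 ∉ O ∧ ContinuousOn (fun u => V (γ u)) (Ioo 0 1) := by
  obtain ⟨φ, hφS, hφ⟩ := exists_image_Ioo_eq hΓ.isOpen hΓ.isPreconnected ⟨0, hΓ.zero_mem⟩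
  have hφm : ∀ u ∈ Ioo (0 : ℝ) 1, φ u ∈ S := fun u hu => hφS ▸ mem_image_of_mem φ hu
  have hmono : StrictMonoOn φ (Ioo 0 1) := by
    refine strictMonoOn_of_deriv_pos (convex_Ioo _ _)
      (fun u hu => (hφ u hu).1.continuousAt.continuousWithinAt) fun u hu => ?_
    rw [interior_Ioo] at hu
    exact (hφ u hu).2
  have hc : ∀ u ∈ Ioo (0 : ℝ) 1, ContinuousAt (Γ ∘ φ) u := fun u hu =>
    (hΓ.curve _ (hφm u hu)).2.1.continuousAt.comp (hφ u hu).1.continuousAt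
  have hcV : ∀ u ∈ Ioo (0 : ℝ) 1, ContinuousAt (fun u => V ((Γ ∘ φ) u)) u := by
    intro u hu
    have h1 := IsUnitSpeedAt.continuousAt_direction hf
      (eventually_of_mem (hΓ.isOpen.mem_nhds (hφm u hu)) hΓ.curve)
    exact ContinuousAt.comp (g := fun s => V (Γ s)) h1 (hφ u hu).1.continuousAt
  have hO : Γ '' S ⊆ O := by
    rintro _ ⟨t, ht, rfl⟩
    exact (hΓ.curve t ht).1
  have hcO : ContinuousOn (Γ ∘ φ) (Ioo 0 1) := fun u hu => (hc u hu).continuousWithinAt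
  -- the curve leaves each compact part of `O`
  have hcl : ∀ {l : Filter ℝ} {x : M}, MapClusterPt x l (Γ ∘ φ) → Ioo (0 : ℝ) 1 ∈ l →
      (∀ u ∈ Ioo (0 : ℝ) 1, ∃ a ∈ Ioo (0 : ℝ) 1, ∃ b ∈ Ioo (0 : ℝ) 1, u ∈ Ioo a b ∧
        (Ioo a b)ᶜ ∈ l) → x ∈ closure O \ O := by
    intro l x hx hl hl'
    have hxc : x ∈ closure (Γ '' S) := by
      refine mem_closure_iff_nhds.2 fun U hU => ?_
      obtain ⟨u, hu, hu'⟩ := ((mapClusterPt_iff_frequently.1 hx U hU).and_eventually hl).exists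
      exact ⟨_, hu, _, hφm u hu', rfl⟩
    refine ⟨closure_mono hO hxc, fun hxO => ?_⟩
    obtain ⟨t, ht, rfl⟩ := (hV.isLocalFlow hf).mem_image_of_mem_closure hΓ hxO hxc
    have htφ := ht
    rw [← hφS] at htφ
    obtain ⟨u, hu, rfl⟩ := htφ
    obtain ⟨a, ha, b, hb, hab, habl⟩ := hl' u hu
    obtain ⟨U, hU, hUN⟩ := (hV.isLocalFlow hf).exists_nhds_of_injOn hΓ hinj ht
      (Ioo_mem_nhds (hmono ha hu hab.1) (hmono hu hb hab.2))
    obtain ⟨v, hv, hv', hv''⟩ := ((mapClusterPt_iff_frequently.1 hx U hU).and_eventually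
      ((eventually_mem_set.2 hl).and (eventually_mem_set.2 habl))).exists
    have h1 := hUN _ (hφm v hv') hv
    exact hv'' ⟨(hmono.lt_iff_lt ha hv').1 h1.1, (hmono.lt_iff_lt hv' hb).1 h1.2⟩
  obtain ⟨d₁, hd₁, hlim₁⟩ := exists_tendsto_of_finite zero_lt_one hcO hD fun x hx =>
    hcl hx (Ioo_mem_nhdsLT zero_lt_one) fun u hu => by
      refine ⟨u / 2, ⟨by linarith [hu.1], by linarith [hu.2]⟩, (u + 1) / 2,
        ⟨by linarith [hu.1], by linarith [hu.2]⟩, ⟨by linarith [hu.1], by linarith [hu.2]⟩, ?_⟩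
      filter_upwards [Ioo_mem_nhdsLT (show (u + 1) / 2 < 1 by linarith [hu.2])] with v hv hv'
      exact hv.1.not_gt hv'.2
  have hr : Tendsto (fun u : ℝ => 1 - u) (𝓝[<] 1) (𝓝[>] 0) := by
    refine tendsto_nhdsWithin_iff.2 ⟨?_, ?_⟩
    · exact ((continuous_const.sub continuous_id).tendsto' (1 : ℝ) 0 (by simp)).mono_left
        nhdsWithin_le_nhds
    · filter_upwards [self_mem_nhdsWithin] with u (hu : u < 1) using sub_pos.2 hu
  have hr' : Tendsto (fun u : ℝ => 1 - u) (𝓝[>] 0) (𝓝[<] 1) := by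
    refine tendsto_nhdsWithin_iff.2 ⟨?_, ?_⟩
    · exact ((continuous_const.sub continuous_id).tendsto' (0 : ℝ) 1 (by simp)).mono_left
        nhdsWithin_le_nhds
    · filter_upwards [self_mem_nhdsWithin] with u (hu : 0 < u)
      exact sub_lt_self 1 hu
  obtain ⟨d₀, hd₀, hlim₀⟩ := exists_tendsto_of_finite zero_lt_one
    (γ := fun u => (Γ ∘ φ) (1 - u)) (hcO.comp (continuous_const.sub continuous_id).continuousOn
      fun u hu => ⟨by linarith [hu.2], by linarith [hu.1]⟩) hD fun x hx =>
    hcl (hx.of_comp hr) (Ioo_mem_nhdsGT zero_lt_one) fun u hu => by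
      refine ⟨u / 2, ⟨by linarith [hu.1], by linarith [hu.2]⟩, (u + 1) / 2,
        ⟨by linarith [hu.1], by linarith [hu.2]⟩, ⟨by linarith [hu.1], by linarith [hu.2]⟩, ?_⟩
      filter_upwards [Ioo_mem_nhdsGT (show 0 < u / 2 by linarith [hu.1])] with v hv hv'
      exact hv.2.not_gt hv'.1
  replace hlim₀ : Tendsto (Γ ∘ φ) (𝓝[>] 0) (𝓝 d₀) := by
    have h1 := hlim₀.comp hr'
    simpa [Function.comp_def] using h1
  have hext := extendFrom_extends hcO
  have hev : ∀ u ∈ Ioo (0 : ℝ) 1, extendFrom (Ioo 0 1) (Γ ∘ φ) =ᶠ[𝓝 u] Γ ∘ φ := fun u hu =>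
    eventually_of_mem (isOpen_Ioo.mem_nhds hu) hext
  have him : (Γ ∘ φ) '' Ioo 0 1 = Γ '' S := by rw [image_comp, hφS]
  have him' : extendFrom (Ioo 0 1) (Γ ∘ φ) '' Ioo 0 1 = Γ '' S := by
    rw [← him]
    exact image_congr hext
  refine ⟨extendFrom (Ioo 0 1) (Γ ∘ φ), continuousOn_Icc_extendFrom_Ioo hcO hlim₀ hlim₁,
    ⟨?_, ?_, ?_, ?_, ?_⟩, him', ?_, ?_, ?_⟩
  · exact fun u hu => him' ▸ mem_image_of_mem _ hu
  · intro u hu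
    refine ContMDiffAt.congr_of_eventuallyEq ?_ (hev u hu)
    exact (hΓ.curve _ (hφm u hu)).2.1.comp u (hφ u hu).1.contMDiffAt
  · refine InjOn.congr ?_ fun u hu => (hext u hu).symm
    exact hinj.comp hmono.injOn hφm
  · rw [him']
    exact subset_closure
  · intro u hu
    refine ⟨deriv φ u, (hφ u hu).2, ?_⟩
    rw [hext u hu]
    refine HasDerivAt.congr_of_eventuallyEq ?_ ((hev u hu).fun_comp f)
    exact (hΓ.curve _ (hφm u hu)).2.2.scomp u
      ((hφ u hu).1.differentiableAt (by simp)).hasDerivAt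
  · rw [eq_lim_at_left_extendFrom_Ioo zero_lt_one hlim₀]
    exact hd₀.2
  · rw [eq_lim_at_right_extendFrom_Ioo zero_lt_one hlim₁]
    exact hd₁.2
  · intro u hu
    refine ContinuousAt.continuousWithinAt ?_
    exact (hcV u hu).congr ((hev u hu).symm.fun_comp V)

end

end

noncomputable section

/-! ### The winding numbers of arcs modulo half turns -/

/-- The square of the direction of a nonzero plane vector as a complex number of modulus one. It
depends only on the line spanned by the vector. -/
def lineDirection (v : Euc 2) : ℂ :=
  (v 0 + v 1 * Complex.I) / (v 0 - v 1 * Complex.I)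

lemma lineDirection_smul {r : ℝ} (hr : r ≠ 0) (v : Euc 2) :
    lineDirection (r • v) = lineDirection v := by
  have hr' : (r : ℂ) ≠ 0 := Complex.ofReal_ne_zero.2 hr
  simp only [lineDirection, PiLp.smul_apply, smul_eq_mul, Complex.ofReal_mul]
  conv_rhs => rw [← mul_div_mul_left _ _ hr']
  congr 1 <;> ring

lemma add_mul_I_ne_zero {a b : ℝ} (h : a ≠ 0 ∨ b ≠ 0) : (a + b * Complex.I : ℂ) ≠ 0 := by
  intro h0
  have h1 := congrArg Complex.re h0
  have h2 := congrArg Complex.im h0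
  simp at h1 h2
  tauto

lemma apply_ne_zero_of_ne_zero {v : Euc 2} (hv : v ≠ 0) : v 0 ≠ 0 ∨ v 1 ≠ 0 := by
  by_contra! h
  exact hv (by ext i; fin_cases i; exacts [h.1, h.2])

lemma denom_ne_zero {v : Euc 2} (hv : v ≠ 0) : (v 0 - v 1 * Complex.I : ℂ) ≠ 0 := by
  have h := add_mul_I_ne_zero (a := v 0) (b := -v 1)
    ((apply_ne_zero_of_ne_zero hv).imp_right neg_ne_zero.2)
  rwa [Complex.ofReal_neg, neg_mul, ← sub_eq_add_neg] at h

lemma lineDirection_ne_zero {v : Euc 2} (hv : v ≠ 0) : lineDirection v ≠ 0 :=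
  div_ne_zero (add_mul_I_ne_zero (apply_ne_zero_of_ne_zero hv)) (denom_ne_zero hv)

lemma lineDirection_turnVec (θ : ℝ) :
    lineDirection (turnVec θ) = Complex.exp (4 * Real.pi * Complex.I * θ) := by
  have h : lineDirection (turnVec θ) = Complex.exp ((2 * Real.pi * θ : ℝ) * Complex.I) /
      Complex.exp (-(2 * Real.pi * θ : ℝ) * Complex.I) := by
    rw [Complex.exp_mul_I, Complex.exp_mul_I, lineDirection, turnVec_zero_apply,
      turnVec_one_apply, Complex.ofReal_cos, Complex.ofReal_sin, Complex.cos_neg, Complex.sin_neg,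
      neg_mul, sub_eq_add_neg]
  rw [h, ← Complex.exp_sub]
  congr 1
  push_cast
  ring

/-- Perpendicular lines have opposite directions. -/
lemma lineDirection_of_inner_eq_zero {v w : Euc 2} (hv : v ≠ 0) (hw : w ≠ 0)
    (h : inner ℝ v w = 0) : lineDirection w = -lineDirection v := by
  have h1 : (v 0 : ℂ) * w 0 + v 1 * w 1 = 0 := by
    have h2 : v 0 * w 0 + v 1 * w 1 = 0 := by
      rw [PiLp.inner_apply, Fin.sum_univ_two] at h
      simp only [RCLike.inner_apply, conj_trivial] at h
      linarith
    rw [← Complex.ofReal_mul, ← Complex.ofReal_mul, ← Complex.ofReal_add, h2, Complex.ofReal_zero]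
  rw [lineDirection, lineDirection, ← neg_div, div_eq_div_iff (denom_ne_zero hw) (denom_ne_zero hv)]
  have hI := Complex.I_sq
  linear_combination 2 * h1 - 2 * v 1 * w 1 * hI

lemma exp_eq_lineDirection_div {θ₀ θ₁ r₀ r₁ : ℝ} {v₀ v₁ : Euc 2} (h₀ : r₀ • v₀ = turnVec θ₀)
    (h₁ : r₁ • v₁ = turnVec θ₁) : Complex.exp (4 * Real.pi * Complex.I * (θ₁ - θ₀ : ℝ))
      = lineDirection v₁ / lineDirection v₀ := by
  have hr : ∀ {r θ : ℝ} {v : Euc 2}, r • v = turnVec θ → r ≠ 0 := by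
    rintro r θ v h rfl
    have := norm_turnVec θ
    rw [← h, zero_smul, norm_zero] at this
    exact zero_ne_one this
  rw [← lineDirection_smul (hr h₀) v₀, ← lineDirection_smul (hr h₁) v₁, h₀, h₁,
    lineDirection_turnVec, lineDirection_turnVec, ← Complex.exp_sub]
  congr 1
  push_cast
  ring

namespace SingularBranch

variable {m : ℕ} {M : Type*} [TopologicalSpace M] [ChartedSpace (Euc m) M]
  {f : M → Euc 2} {p : M} (B : SingularBranch m f p)

/-- A point in the open positive half of a branch. -/
def halfPoint : M := B.γ (B.ε / 2)

lemma halfPoint_mem : B.halfPoint ∈ B.half :=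
  ⟨_, ⟨half_pos B.pos, half_lt_self B.pos⟩, rfl⟩

lemma mem_closure_half : p ∈ closure B.half := by
  have h1 : (0 : ℝ) ∈ closure (Ioo 0 B.ε) := by
    rw [closure_Ioo B.pos.ne]
    exact ⟨le_rfl, B.pos.le⟩
  have h2 := (B.smooth 0 B.zero_mem).continuousAt.continuousWithinAt.mem_closure_image h1
  rwa [B.zero] at h2

end SingularBranch

section

variable {m : ℕ} {M : Type*} [TopologicalSpace M] [ChartedSpace (Euc m) M]
  {f : M → Euc 2} {O : Set M} {V : M → Euc 2} {ι : Type*} {p : ι → M}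
  {B : ∀ i, SingularBranch m f (p i)} {s : ι → ℤ} (h : IsEndSystem m f O V p B s)
include h

lemma IsEndSystem.half_subset (i : ι) : (B i).half ⊆ O := by
  rintro _ ⟨t, ht, rfl⟩
  exact (h.half i t ht).1

lemma IsEndSystem.half_subset_component {i : ι} {x y : M} (hx : x ∈ (B i).half)
    (hxy : x ∈ connectedComponentIn O y) : (B i).half ⊆ connectedComponentIn O y := by
  rw [connectedComponentIn_eq hxy]
  exact (B i).isPreconnected_half.subset_connectedComponentIn hx (h.half_subset i)

lemma IsEndSystem.component_eq_iff (i : ι) (y : M) :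
    connectedComponentIn O (B i).halfPoint = connectedComponentIn O y ↔
      (B i).half ⊆ connectedComponentIn O y := by
  have hi := h.half_subset i (B i).halfPoint_mem
  refine ⟨fun hy => ?_, fun hy => (connectedComponentIn_eq (hy (B i).halfPoint_mem)).symm⟩
  exact h.half_subset_component (B i).halfPoint_mem (hy ▸ mem_connectedComponentIn hi)

lemma IsEndSystem.closure_subset : closure O \ O ⊆ range p := by
  rintro x ⟨hx, hxO⟩
  obtain ⟨N, hN, h1⟩ := h.cover x hxO
  obtain ⟨y, hyN, hyO⟩ := mem_closure_iff_nhds.1 hx N hN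
  obtain ⟨i, hi, -⟩ := h1 y hyN hyO
  exact ⟨i, hi⟩

/-- There are finitely many components. -/
lemma IsEndSystem.finite_components [CompactSpace M] [Finite ι] (hV : IsDirectionField m f O V) :
    {A | ∃ x ∈ O, A = connectedComponentIn O x}.Finite := by
  set 𝒜 := {A | ∃ x ∈ O, A = connectedComponentIn O x}
  have hlf : LocallyFinite fun A : 𝒜 => (A : Set M) := by
    intro x
    by_cases hx : x ∈ O
    · obtain ⟨B', s', -, hB'⟩ := hV.branch x hx
      have hpre : IsPreconnected (B'.γ '' Ioo (-B'.ε) B'.ε) := isPreconnected_Ioo.image _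
        fun t ht => (B'.smooth t ht).continuousAt.continuousWithinAt
      have hsub : B'.γ '' Ioo (-B'.ε) B'.ε ⊆ O := by
        rintro _ ⟨t, ht, rfl⟩
        exact (hB' t ht).1
      refine ⟨B'.U, B'.mem_nhds, (finite_singleton ⟨_, x, hx, rfl⟩).subset ?_⟩
      rintro ⟨_, y, hy, rfl⟩ ⟨z, hzy, hzU⟩
      refine Subtype.ext ?_
      have hz := (B'.mem_iff z).1 ⟨hzU, hV.subset (connectedComponentIn_subset _ _ hzy)⟩
      have hx' : x ∈ B'.γ '' Ioo (-B'.ε) B'.ε := ⟨0, B'.zero_mem, B'.zero⟩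
      simp only
      rw [connectedComponentIn_eq hzy]
      exact (connectedComponentIn_eq (hpre.subset_connectedComponentIn hx' hsub hz)).symm
    · obtain ⟨N, hN, h1⟩ := h.cover x hx
      refine ⟨N, hN, (finite_range fun i => (⟨_, (B i).halfPoint,
        h.half_subset i (B i).halfPoint_mem, rfl⟩ : 𝒜)).subset ?_⟩
      rintro ⟨_, y, hy, rfl⟩ ⟨z, hzy, hzN⟩
      obtain ⟨i, -, hi⟩ := h1 z hzN (connectedComponentIn_subset _ _ hzy)
      exact ⟨i, Subtype.ext ((h.component_eq_iff i y).2 (h.half_subset_component hi hzy))⟩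
  have hne : ∀ A : 𝒜, ((A : Set M) ∩ univ).Nonempty := by
    rintro ⟨_, y, hy, rfl⟩
    exact ⟨y, mem_connectedComponentIn hy, mem_univ _⟩
  have hfin := hlf.finite_nonempty_inter_compact isCompact_univ
  simp only [hne, ofPred_true] at hfin
  have := finite_univ_iff.1 hfin
  exact toFinite 𝒜

/-- A component has a parametrization with a lift of angles, and modulo half turns the winding
number is determined by the lines tangent to the half-branches contained in the component. -/
lemma IsEndSystem.exists_winding [T2Space M] [CompactSpace M] [Fintype ι]
    (hf : ContMDiff (𝓡 m) (𝓡 2) ∞ f)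
    (hV : IsDirectionField m f O V) {x : M} (hx : x ∈ O) [DecidableEq (Set M)] :
    ∃ (γ : ℝ → M) (θ : ℝ → ℝ), ContinuousOn γ (Icc 0 1) ∧
      IsDirectedParam m f V (connectedComponentIn O x) γ ∧ Continuous θ ∧
      (∀ t ∈ Ioo (0 : ℝ) 1, V (γ t) = turnVec (θ t)) ∧
      Complex.exp (4 * Real.pi * Complex.I * (θ 1 - θ 0 : ℝ))
        = ∏ i with connectedComponentIn O (B i).halfPoint = connectedComponentIn O x,
          lineDirection ((B i).E 0) ^ (-s i) := by
  obtain ⟨S, Γ, hΓ, rfl⟩ := (hV.isLocalFlow hf).exists_maximalCurve hx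
  have hA := (hV.isLocalFlow hf).image_eq hΓ
  classical
  have hfil : (Finset.univ.filter fun i =>
      connectedComponentIn O (B i).halfPoint = connectedComponentIn O (Γ 0))
      = Finset.univ.filter fun i => (B i).half ⊆ Γ '' S := by
    ext i
    simp only [Finset.mem_filter, Finset.mem_univ, true_and, h.component_eq_iff, hA]
  rw [hfil, ← hA]
  have hAO : Γ '' S ⊆ O := hA ▸ connectedComponentIn_subset _ _
  by_cases hinj : InjOn Γ S
  · obtain ⟨γ, hγ, hγd, hγA, h0, h1, hcV⟩ := exists_open_param hf hΓ hV
      ((finite_range p).subset h.closure_subset) hinj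
    have hγO : ∀ u ∈ Ioo (0 : ℝ) 1, γ u ∈ O := fun u hu => hAO (hγd.mem u hu)
    have hγI := hγ.mono Ioo_subset_Icc_self
    obtain ⟨i, hi, hsi, ⟨b, hb, hbi⟩, r, hr⟩ := h.exists_end h1 hγO hγI hγd.hasDerivAt (by
      have h2 := (hγ 1 ⟨zero_le_one, le_rfl⟩).mono Ioo_subset_Icc_self
      rwa [ContinuousWithinAt, nhdsWithin_Ioo_eq_nhdsLT zero_lt_one] at h2)
    obtain ⟨j, hj, hsj, ⟨a, ha, haj⟩, r', hr'⟩ := h.exists_start h0 hγO hγI hγd.hasDerivAt (by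
      have h2 := (hγ 0 ⟨le_rfl, zero_le_one⟩).mono Ioo_subset_Icc_self
      rwa [ContinuousWithinAt, nhdsWithin_Ioo_eq_nhdsGT zero_lt_one] at h2)
    obtain ⟨θ, hθ, hθV, hθ0, hθ1⟩ := exists_turnVec_eq_of_tendsto hcV
      (fun u hu => hV.norm_eq _ (hγO u hu)) hr' hr
    refine ⟨γ, θ, hγ, hγd, hθ, hθV, ?_⟩
    have hij : i ≠ j := by
      rintro rfl
      omega
    -- the component contains exactly two half-branches, the initial and the final one: any other
    -- one would lie in a compact part of the component, and so would its base point
    have hset : (Finset.univ.filter fun k => (B k).half ⊆ Γ '' S) = {i, j} := by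
      ext k
      simp only [Finset.mem_filter, Finset.mem_univ, true_and, Finset.mem_insert,
        Finset.mem_singleton]
      constructor
      · intro hk
        by_contra! hkk
        have hsub : (B k).half ⊆ γ '' Icc a b := by
          intro y hy
          obtain ⟨u, hu, rfl⟩ : y ∈ γ '' Ioo 0 1 := hγA ▸ hk hy
          refine ⟨u, ⟨?_, ?_⟩, rfl⟩
          · by_contra! hua
            exact (h.disjoint k j hkk.2).ne_of_mem hy (haj u ⟨hu.1, hua⟩) rfl
          · by_contra! hub
            exact (h.disjoint k i hkk.1).ne_of_mem hy (hbi u ⟨hub, hu.2⟩) rfl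
        have hab : Icc a b ⊆ Ioo 0 1 := fun u hu => ⟨ha.1.trans_le hu.1, hu.2.trans_lt hb.2⟩
        have hcl := (isCompact_Icc.image_of_continuousOn (hγI.mono hab)).isClosed
        obtain ⟨u, hu, hpu⟩ := closure_minimal hsub hcl (B k).mem_closure_half
        exact h.notMem k (hpu ▸ hγO u (hab hu))
      · have key : ∀ {k : ι} {u : ℝ}, u ∈ Ioo (0 : ℝ) 1 → γ u ∈ (B k).half →
            (B k).half ⊆ Γ '' S := by
          intro k u hu hk
          have h2 := hγd.mem u hu
          rw [hA] at h2 ⊢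
          exact h.half_subset_component hk h2
        rintro (rfl | rfl)
        · obtain ⟨u, hu⟩ : (Ioo b 1).Nonempty := nonempty_Ioo.2 hb.2
          exact key ⟨hb.1.trans_lt hu.1, hu.2⟩ (hbi u hu)
        · obtain ⟨u, hu⟩ : (Ioo 0 a).Nonempty := nonempty_Ioo.2 ha.1
          exact key ⟨hu.1, hu.2.trans_le ha.2⟩ (haj u hu)
    have h2 := exp_eq_lineDirection_div hθ0 hθ1
    rw [h2, hset, Finset.prod_pair hij, hsi, hsj, neg_neg, zpow_one, zpow_neg_one, div_eq_mul_inv]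
  · obtain ⟨hS, T, hT, hper, hmin⟩ := (hV.isLocalFlow hf).exists_period hΓ hinj
    obtain ⟨γ, hγ, hγd, hγA, hcV, hr', hr⟩ := exists_closed_param hf hΓ hS hT hper hmin
    obtain ⟨θ, hθ, hθV, hθ0, hθ1⟩ := exists_turnVec_eq_of_tendsto hcV
      (fun u hu => hV.norm_eq _ (hAO (hγd.mem u hu))) hr' hr
    refine ⟨γ, θ, hγ, hγd, hθ, hθV, ?_⟩
    have hγ0 : γ 0 ∈ O := hAO (hγA ▸ mem_image_of_mem γ ⟨le_rfl, zero_le_one⟩)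
    have h2 := exp_eq_lineDirection_div ((one_smul ℝ _).trans hθ0) ((one_smul ℝ _).trans hθ1)
    rw [h2, div_self (lineDirection_ne_zero (hV.ne_zero hγ0)), Finset.prod_eq_one]
    intro k hk
    exfalso
    -- a compact component contains no half-branch
    have hk' := (Finset.mem_filter.1 hk).2
    have hcl := (isCompact_Icc.image_of_continuousOn hγ).isClosed
    rw [hγA] at hcl
    exact h.notMem k (hAO (closure_minimal hk' hcl (B k).mem_closure_half))

end

end

noncomputable section

/-! ### The canonical direction field and its half-branches -/

/-- The two open halves of the branch `B` lie in `O`, and their directions compare with `V` by the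
signs `s` (where the parameter is positive) and `s'` (where it is negative). -/
structure SingularBranch.IsSigned {m : ℕ} {M : Type*} [TopologicalSpace M] [ChartedSpace (Euc m) M]
    {f : M → Euc 2} {p : M} (B : SingularBranch m f p) (O : Set M) (V : M → Euc 2) (s s' : ℤ) :
    Prop where
  sign : s = 1 ∨ s = -1
  sign' : s' = 1 ∨ s' = -1
  pos : ∀ t ∈ Ioo 0 B.ε, B.γ t ∈ O ∧ B.ρ t • B.E t = (s * ‖B.ρ t • B.E t‖) • V (B.γ t)
  neg : ∀ t ∈ Ioo (-B.ε) 0, B.γ t ∈ O ∧ B.ρ t • B.E t = (s' * ‖B.ρ t • B.E t‖) • V (B.γ t)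

lemma SingularBranch.IsSigned.hasSigns {m : ℕ} {M : Type*} [TopologicalSpace M]
    [ChartedSpace (Euc m) M] {f : M → Euc 2} {p : M} {B : SingularBranch m f p} {O : Set M}
    {V : M → Euc 2} {s s' : ℤ} (h : B.IsSigned O V s s') : B.HasSigns V s s' :=
  ⟨eventually_of_mem (Ioo_mem_nhdsGT B.pos) fun t ht => (h.pos t ht).2,
    eventually_of_mem (Ioo_mem_nhdsLT (neg_lt_zero.2 B.pos)) fun t ht => (h.neg t ht).2⟩

universe u

section

variable {R : Type*} [Ring R] {side : R → R → Prop} {h : R → ℤ} {m : ℕ} {M : Type u}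
  [TopologicalSpace M] [T2Space M] [CompactSpace M]
  [ChartedSpace (Euc m) M] [IsManifold (𝓡 m) ∞ M] {f : M → Euc 2} {c : Euc 2 → R}
  (hf : IsGenericMap m f) (hm : 2 ≤ m) (hperp : PerpendicularCrossings m f)
  (hc : IsChessboard m f c) (hh : IsPotential side h)
include hf hm hperp hc hh

/-- Off the distinguished points the canonical directions form a direction field. -/
lemma isDirectionField_canonicalDirection :
    IsDirectionField m f (openArcSet m f) (canonicalDirection side m f c) where
  norm_eq p hp := (isCanonicalDirection_canonicalDirection hf hm hperp hc hh hp).1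
  subset p hp := hp.1
  branch p hp := by
    obtain ⟨B⟩ := nonempty_branch hf hm hp.1
    obtain ⟨s, hs, h1⟩ := B.exists_sign hf hm hperp hc hh
      fun x hx hxp => eq_of_mem_openArcSet hf hm hp hx hxp
    have h2 := B.eventually_mem_openArcSet hf hm hperp
    rw [eventually_nhdsWithin_iff] at h2
    obtain ⟨r, hr, hball⟩ := Metric.eventually_nhds_iff.1 (h1.and h2)
    refine ⟨B.shrink (min r B.ε) (lt_min hr B.pos) (min_le_right _ _), s, hs, fun t ht => ?_⟩
    have ht1 : |t| < r := (abs_lt.2 ht).trans_le (min_le_left _ _)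
    have ht2 : t ∈ Ioo (-B.ε) B.ε := abs_lt.1 ((abs_lt.2 ht).trans_le (min_le_right _ _))
    have h3 := hball (y := t) (by rwa [Real.dist_eq, sub_zero])
    have hO : B.γ t ∈ openArcSet m f := by
      by_cases h0 : t = 0
      · rw [h0, B.zero]
        exact hp
      · exact (h3.2 h0).2
    exact ⟨hO, h3.1 hO, smul_ne_zero ((B.mem_foldSet_iff hf hm ht2).1
      (openArcSet_subset_foldSet hf hm hO)) (B.ne_zero t ht2)⟩

lemma exists_hasSigns {d : M} (hd : d ∈ cuspSet m f ∪ doubleFoldSet m f)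
    (B : SingularBranch m f d) : ∃ s s' : ℤ, (s = 1 ∨ s = -1) ∧ (s' = 1 ∨ s' = -1) ∧
      B.HasSigns (canonicalDirection side m f c) s s' := by
  rcases hd with hd | ⟨-, y, hy, hyd, hfy⟩
  · obtain ⟨s, hs, h1⟩ := B.exists_hasSigns_of_mem_cuspSet hf hm hperp hc hh hd
    exact ⟨s, s, hs, hs, h1⟩
  · obtain ⟨By⟩ := nonempty_branch hf hm (foldSet_subset hf hm hy)
    obtain ⟨s, s', -, -, hs, hs', -, -, h1, -⟩ :=
      SingularBranch.exists_hasSigns_of_image_eq hf hm hperp hc hh hyd.symm hfy.symm B By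
    exact ⟨s, s', hs, hs', h1⟩

lemma exists_isSigned {d : M} (hd : d ∈ cuspSet m f ∪ doubleFoldSet m f) {N : Set M}
    (hN : N ∈ 𝓝 d) : ∃ (B : SingularBranch m f d) (s s' : ℤ),
      B.IsSigned (openArcSet m f) (canonicalDirection side m f c) s s' ∧
      ∀ t ∈ Ioo (-B.ε) B.ε, B.γ t ∈ N := by
  have hdS : d ∈ singularSet m f :=
    hd.elim (fun h1 => cuspSet_subset hf hm h1) fun h1 => foldSet_subset hf hm h1.1
  obtain ⟨B⟩ := nonempty_branch hf hm hdS
  obtain ⟨s, s', hs, hs', h1, h2⟩ := exists_hasSigns hf hm hperp hc hh hd B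
  have h3 := B.eventually_mem_openArcSet hf hm hperp
  have h4 : ∀ᶠ t in 𝓝 (0 : ℝ), B.γ t ∈ N := by
    refine (B.smooth 0 B.zero_mem).continuousAt.eventually_mem ?_
    rwa [B.zero]
  rw [eventually_nhdsWithin_iff] at h1 h2 h3
  obtain ⟨r, hr, hball⟩ := Metric.eventually_nhds_iff.1 (h1.and (h2.and (h3.and h4)))
  have hball' : ∀ t ∈ Ioo (-min r B.ε) (min r B.ε), _ := fun t ht =>
    hball (y := t) (by rw [Real.dist_eq, sub_zero]; exact (abs_lt.2 ht).trans_le (min_le_left _ _))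
  have hmin : 0 < min r B.ε := lt_min hr B.pos
  refine ⟨B.shrink (min r B.ε) hmin (min_le_right _ _), s, s', ⟨hs, hs', ?_, ?_⟩,
    fun t ht => (hball' t ht).2.2.2⟩
  · intro t ht
    have h5 := hball' t ⟨(neg_lt_zero.2 hmin).trans ht.1, ht.2⟩
    exact ⟨(h5.2.2.1 ht.1.ne').2, h5.1 ht.1⟩
  · intro t ht
    have h5 := hball' t ⟨ht.1, ht.2.trans hmin⟩
    exact ⟨(h5.2.2.1 ht.2.ne).2, h5.2.1 ht.2⟩

/-- The lines and the signs at the distinguished points cancel: at a cusp the two halves of the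
branch have the same sign, and at a double point the two lines are perpendicular, while the sign
changes along the two branches are opposite. -/
lemma prod_lineDirection_eq_one {D : Type*} [Fintype D] {e : D → M} (he : Function.Injective e)
    (hD : range e = cuspSet m f ∪ doubleFoldSet m f) (B : ∀ d, SingularBranch m f (e d))
    {s s' : D → ℤ} (hs : ∀ d, (s d = 1 ∨ s d = -1) ∧ (s' d = 1 ∨ s' d = -1) ∧
      (B d).HasSigns (canonicalDirection side m f c) (s d) (s' d)) :
    ∏ d, lineDirection ((B d).E 0) ^ (s' d - s d) = 1 := by
  have hS : ∀ d, e d ∈ singularSet m f := fun d => (B d).mem.2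
  have hex : ∀ d, ∃ d', (e d ∈ cuspSet m f → d' = d) ∧
      (e d ∉ cuspSet m f → d' ≠ d ∧ f (e d') = f (e d)) := by
    intro d
    by_cases hd : e d ∈ cuspSet m f
    · exact ⟨d, fun _ => rfl, fun h1 => absurd hd h1⟩
    · have hdD : e d ∈ cuspSet m f ∪ doubleFoldSet m f := hD ▸ mem_range_self d
      obtain ⟨hdf, y, hy, hyd, hfy⟩ := hdD.resolve_left hd
      have hyD : y ∈ range e := hD ▸ Or.inr ⟨hy, e d, hdf, hyd.symm, hfy.symm⟩
      obtain ⟨d', rfl⟩ := hyD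
      exact ⟨d', fun h1 => absurd h1 hd, fun _ => ⟨fun h1 => hyd (h1 ▸ rfl), hfy⟩⟩
  -- the involution that exchanges the two double points over a crossing and fixes the cusps
  choose g hg hg' using hex
  have hcusp : ∀ d, e d ∈ cuspSet m f → s d = s' d := by
    intro d hd
    obtain ⟨r, -, h1⟩ := (B d).exists_hasSigns_of_mem_cuspSet hf hm hperp hc hh hd
    obtain ⟨h2, h3⟩ := (hs d).2.2.unique hf hm hperp hc hh h1
    rw [h2, h3]
  have hgc : ∀ d, e d ∉ cuspSet m f → e (g d) ∉ cuspSet m f := by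
    intro d hd h1
    have h2 := mem_foldSet_of_image_eq hf hm (hS (g d)) (hS d)
      (fun h3 => (hg' d hd).1 (he h3)) (hg' d hd).2
    exact ((mem_foldSet_iff hf hm).1 h2).2 ((mem_cuspSet_iff hf hm).1 h1).2
  refine Finset.prod_involution (fun d _ => g d) ?_ ?_ (fun d _ => Finset.mem_univ _) ?_
  · intro d _
    by_cases hd : e d ∈ cuspSet m f
    · rw [hg d hd, hcusp d hd, sub_self, zpow_zero, one_mul]
    · obtain ⟨hne, hfe⟩ := hg' d hd
      have hne' : e d ≠ e (g d) := fun h1 => hne (he h1.symm)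
      obtain ⟨s₁, s₂, s₃, s₄, -, -, -, -, h1, h2, h3⟩ :=
        SingularBranch.exists_hasSigns_of_image_eq hf hm hperp hc hh hne' hfe.symm (B d) (B (g d))
      obtain ⟨h4, h5⟩ := (hs d).2.2.unique hf hm hperp hc hh h1
      obtain ⟨h6, h7⟩ := (hs (g d)).2.2.unique hf hm hperp hc hh h2
      obtain ⟨h8, h9⟩ := cross_ne_zero_of_image_eq hf hm hperp hne' hfe.symm (B d) (B (g d))
      have hρ : (B d).ρ 0 ≠ 0 := fun h0 => h8 (by rw [h0]; simp [cross])
      have hρ' : (B (g d)).ρ 0 ≠ 0 := fun h0 => h8 (by rw [h0]; simp [cross])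
      have hE := (B d).ne_zero 0 (B d).zero_mem
      have hE' := (B (g d)).ne_zero 0 (B (g d)).zero_mem
      have h10 := lineDirection_of_inner_eq_zero (smul_ne_zero hρ hE) (smul_ne_zero hρ' hE') h9
      rw [lineDirection_smul hρ, lineDirection_smul hρ'] at h10
      have h11 : s' (g d) - s (g d) = -(s' d - s d) := by omega
      have h12 : Even (s' d - s d) := by
        rcases (hs d).1 with h | h <;> rcases (hs d).2.1 with h' | h' <;> rw [h, h'] <;> decide
      rw [h10, h11, (h12.neg).neg_zpow, zpow_neg,
        mul_inv_cancel₀ (zpow_ne_zero _ (lineDirection_ne_zero hE))]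
  · intro d _ h1 h2
    have hd : e d ∈ cuspSet m f := by
      by_contra hd
      exact (hg' d hd).1 h2
    rw [hcusp d hd, sub_self, zpow_zero] at h1
    exact h1 rfl
  · intro d _
    by_cases hd : e d ∈ cuspSet m f
    · simp only [hg d hd]
    · obtain ⟨hne, hfe⟩ := hg' d hd
      obtain ⟨hne', hfe'⟩ := hg' (g d) (hgc d hd)
      exact he (eq_of_image_eq hf hm hperp (hS (g d)) (hS (g (g d))) (hS d)
        (fun h1 => hne' (he h1.symm)) (fun h1 => hne (he h1)) hfe'.symm hfe)

/-- The two halves of suitable branches at the distinguished points form an end system. -/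
lemma exists_isEndSystem : ∃ (ι : Type u) (_ : Fintype ι) (p : ι → M)
    (B : ∀ i, SingularBranch m f (p i)) (s : ι → ℤ),
    IsEndSystem m f (openArcSet m f) (canonicalDirection side m f c) p B s ∧
      ∏ i, lineDirection ((B i).E 0) ^ (-s i) = 1 := by
  have hfin : (cuspSet m f ∪ doubleFoldSet m f).Finite :=
    (finite_cuspSet hf hm).union (finite_doubleFoldSet hf hm hperp)
  obtain ⟨U, hU, hdis⟩ := hfin.t2_separation
  have hD := hfin.fintype
  choose B s s' hB hBU using fun d : ↥(cuspSet m f ∪ doubleFoldSet m f) =>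
    exists_isSigned (side := side) hf hm hperp hc hh d.2 ((hU d).2.mem_nhds (hU d).1)
  have hprod := prod_lineDirection_eq_one hf hm hperp hc hh Subtype.val_injective
    Subtype.range_coe B fun d => ⟨(hB d).sign, (hB d).sign', (hB d).hasSigns⟩
  refine ⟨↥(cuspSet m f ∪ doubleFoldSet m f) × Bool, inferInstance, fun i => i.1,
    fun i => cond i.2 (B i.1) (B i.1).reverse, fun i => cond i.2 (s i.1) (-s' i.1), ?_, ?_⟩
  · have hmem : ∀ i : ↥(cuspSet m f ∪ doubleFoldSet m f) × Bool,
        ∀ y ∈ (cond i.2 (B i.1) (B i.1).reverse).half, y ∈ U i.1 := by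
      rintro ⟨d, b⟩ y ⟨t, ht, rfl⟩
      cases b
      · exact hBU d (-t) ⟨neg_lt_neg ht.2, (neg_lt_zero.2 ht.1).trans (B d).pos⟩
      · exact hBU d t ((B d).mem_Ioo ht)
    have hπ : ∀ d, Disjoint (B d).half (B d).reverse.half := by
      intro d
      rw [Set.disjoint_left]
      rintro _ ⟨t, ht, rfl⟩ ⟨t', ht', h1⟩
      have h2 : (B d).γ (-t') = (B d).γ t := h1
      have h3 := congrArg (B d).π h2
      rw [(B d).π_γ _ ((B d).mem_Ioo ht), (B d).π_γ _
        ⟨neg_lt_neg ht'.2, (neg_lt_zero.2 ht'.1).trans (B d).pos⟩] at h3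
      linarith [ht.1, ht'.1]
    refine ⟨fun x hx => hx.1, fun i hi => hi.2 i.1.2, ?_, ?_, ?_, ?_⟩
    · rintro ⟨d, b⟩
      cases b
      · rcases (hB d).sign' with h1 | h1 <;> simp [h1]
      · exact (hB d).sign
    · rintro ⟨d, b⟩ t ht
      cases b
      · have h1 := (hB d).neg (-t) ⟨neg_lt_neg ht.2, neg_lt_zero.2 ht.1⟩
        refine ⟨h1.1, ?_⟩
        change (B d).ρ (-t) • -(B d).E (-t) = ((-s' d : ℤ) * ‖(B d).ρ (-t) • -(B d).E (-t)‖) •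
          canonicalDirection side m f c ((B d).γ (-t))
        rw [smul_neg, norm_neg, Int.cast_neg, neg_mul, neg_smul, ← h1.2]
      · exact (hB d).pos t ht
    · rintro ⟨d, b⟩ ⟨d', b'⟩ hij
      by_cases hd : d = d'
      · subst hd
        cases b <;> cases b'
        · exact absurd rfl hij
        · exact (hπ d).symm
        · exact hπ d
        · exact absurd rfl hij
      · exact (hdis d.2 d'.2 fun h1 => hd (Subtype.ext h1)).mono (hmem (d, b)) (hmem (d', b'))
    · intro x hx
      by_cases hxS : x ∈ singularSet m f
      · have hxD : x ∈ cuspSet m f ∪ doubleFoldSet m f := by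
          by_contra h1
          exact hx ⟨hxS, h1⟩
        refine ⟨(B ⟨x, hxD⟩).U, (B ⟨x, hxD⟩).mem_nhds, fun y hy hyO => ?_⟩
        obtain ⟨t, ht, rfl⟩ := ((B ⟨x, hxD⟩).mem_iff y).1 ⟨hy, hyO.1⟩
        rcases lt_trichotomy t 0 with h0 | rfl | h0
        · refine ⟨(⟨x, hxD⟩, false), rfl, -t, ⟨neg_pos.2 h0, neg_lt.1 ht.1⟩, ?_⟩
          change (B ⟨x, hxD⟩).γ (- -t) = _
          rw [neg_neg]
        · rw [(B ⟨x, hxD⟩).zero] at hyO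
          exact absurd hyO hx
        · exact ⟨(⟨x, hxD⟩, true), rfl, t, ⟨h0, ht.2⟩, rfl⟩
      · exact ⟨_, (hf.isClosed_singularSet hm).isOpen_compl.mem_nhds hxS,
          fun y hy hyO => absurd hyO.1 hy⟩
  · rw [Fintype.prod_prod_type, ← hprod]
    refine Finset.prod_congr rfl fun d _ => ?_
    -- the reversed half-branch contributes the same line, and its sign is `-s'`
    have h1 : lineDirection ((B d).reverse.E 0) = lineDirection ((B d).E 0) := by
      change lineDirection (-(B d).E (-0)) = _
      rw [neg_zero, ← neg_one_smul ℝ, lineDirection_smul (by norm_num)]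
    rw [Fintype.prod_bool]
    simp only [cond_true, cond_false]
    rw [h1, neg_neg, ← zpow_add₀ (lineDirection_ne_zero ((B d).ne_zero 0 (B d).zero_mem))]
    congr 1
    ring

end

end

noncomputable section

/-! ### The cumulative winding number -/

section

variable {R : Type*} [Ring R] {side : R → R → Prop} {h : R → ℤ} {m : ℕ} {M : Type*}
  [TopologicalSpace M] [T2Space M] [CompactSpace M]
  [ChartedSpace (Euc m) M] [IsManifold (𝓡 m) ∞ M] {f : M → Euc 2} {c : Euc 2 → R}
  (hf : IsGenericMap m f) (hm : 2 ≤ m) (hperp : PerpendicularCrossings m f)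
  (hc : IsChessboard m f c) (hh : IsPotential side h)
include hf hm hperp hc hh

/-- A parametrization in the canonical direction with a lift of angles computes the winding
number. -/
lemma isArcWinding_of_isDirectedParam {A : Set M} (hA : A ⊆ openArcSet m f) {γ : ℝ → M}
    {θ : ℝ → ℝ} (hγ : ContinuousOn γ (Icc 0 1))
    (hγd : IsDirectedParam m f (canonicalDirection side m f c) A γ)
    (hθ : ContinuousOn θ (Icc 0 1))
    (hθV : ∀ t ∈ Ioo (0 : ℝ) 1, canonicalDirection side m f c (γ t) = turnVec (θ t)) :
    IsArcWinding side m f c A (θ 1 - θ 0) := by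
  refine ⟨γ, ⟨hγ, fun t ht => (hγd.smooth t ht).contMDiffWithinAt, hγd.injOn,
    image_subset_iff.2 hγd.mem, image_Icc_eq_closure hγ hγd.mem hγd.subset_closure⟩, ?_,
    θ, hθ, ?_, rfl⟩
  · intro t ht
    obtain ⟨l, hl, hd⟩ := hγd.hasDerivAt t ht
    obtain ⟨h1, -, a, b, hs, hab⟩ := isCanonicalDirection_canonicalDirection hf hm hperp hc hh
      (hA (hγd.mem t ht))
    set v := l • canonicalDirection side m f c (γ t) with hv
    have hv0 : v ≠ 0 := smul_ne_zero hl.ne' fun h0 => by simp [h0] at h1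
    have hg : HasDerivAt (fun s : ℝ => f (γ t) + s • quarterTurn v) (quarterTurn v) 0 := by
      simpa using ((hasDerivAt_id (0 : ℝ)).smul_const (quarterTurn v)).const_add (f (γ t))
    obtain ⟨h2, h3⟩ := hs.smul_pos hl _ _ hg (by simp) (exists_cross_pos hv0)
    have hneg : Tendsto (fun s : ℝ => -s) (𝓝[>] 0) (𝓝[<] 0) := by
      simpa using tendsto_neg_nhdsGT (a := (0 : ℝ))
    rw [hd.deriv]
    filter_upwards [h2, hneg.eventually h3] with s hs1 hs2
    rw [neg_smul, ← sub_eq_add_neg] at hs2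
    rw [Function.comp_apply, hs1, hs2]
    exact hab
  · intro t ht
    obtain ⟨l, hl, hd⟩ := hγd.hasDerivAt t ht
    rw [hd.deriv, hθV t ht, norm_smul, norm_turnVec, mul_one, Real.norm_eq_abs, abs_of_pos hl]
    refine ⟨smul_ne_zero hl.ne' fun h0 => ?_, rfl⟩
    have h1 := norm_turnVec (θ t)
    rw [h0, norm_zero] at h1
    exact zero_ne_one h1

/-- Each winding number is computed by a parametrization in the canonical direction. -/
lemma IsArcWinding.exists_isDirectedParam {A : Set M} (hA : A ⊆ openArcSet m f) {w : ℝ}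
    (hw : IsArcWinding side m f c A w) : ∃ (γ : ℝ → M) (θ : ℝ → ℝ),
      IsDirectedParam m f (canonicalDirection side m f c) A γ ∧ ContinuousOn θ (Icc 0 1) ∧
      (∀ t ∈ Ioo (0 : ℝ) 1, canonicalDirection side m f c (γ t) = turnVec (θ t)) ∧
      w = θ 1 - θ 0 := by
  obtain ⟨γ, ⟨hγ, hsm, hinj, hγA, hcl⟩, hor, θ, hθ, hθd, hw⟩ := hw
  have hmem : ∀ t ∈ Ioo (0 : ℝ) 1, γ t ∈ A := fun t ht => hγA (mem_image_of_mem γ ht)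
  have hsm' : ∀ t ∈ Ioo (0 : ℝ) 1, ContMDiffAt 𝓘(ℝ, ℝ) (𝓡 m) ∞ γ t := fun t ht =>
    (hsm t ht).contMDiffAt (isOpen_Ioo.mem_nhds ht)
  have key : ∀ t ∈ Ioo (0 : ℝ) 1, HasDerivAt (f ∘ γ) (deriv (f ∘ γ) t) t ∧
      0 < ‖deriv (f ∘ γ) t‖ ∧
      deriv (f ∘ γ) t = ‖deriv (f ∘ γ) t‖ • canonicalDirection side m f c (γ t) := by
    intro t ht
    have hO := hA (hmem t ht)
    have h0 := (hθd t ht).1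
    have hd : HasDerivAt (f ∘ γ) (deriv (f ∘ γ) t) t :=
      (differentiableAt_of_deriv_ne_zero h0).hasDerivAt
    have hr : deriv (f ∘ γ) t ∈ range (mfderiv (𝓡 m) (𝓡 2) f (γ t)) := by
      have h1 := mfderiv_comp t ((hf.1 (γ t)).mdifferentiableAt (by simp))
        ((hsm' t ht).mdifferentiableAt (by simp))
      rw [mfderiv_eq_fderiv] at h1
      refine ⟨mfderiv 𝓘(ℝ, ℝ) (𝓡 m) γ t (1 : ℝ), ?_⟩
      exact (DFunLike.congr_fun h1 (1 : ℝ)).symm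
    obtain ⟨a, b, hab, hs⟩ := exists_sidesAt hf hm hperp hc hO hr h0
    have hg : HasDerivAt (fun s : ℝ => f (γ t) + s • quarterTurn (deriv (f ∘ γ) t))
        (quarterTurn (deriv (f ∘ γ) t)) 0 := by
      simpa using ((hasDerivAt_id (0 : ℝ)).smul_const (quarterTurn _)).const_add (f (γ t))
    obtain ⟨h2, h3⟩ := hs _ _ hg (by simp) (exists_cross_pos h0)
    have hneg : Tendsto (fun s : ℝ => -s) (𝓝[>] 0) (𝓝[<] 0) := by
      simpa using tendsto_neg_nhdsGT (a := (0 : ℝ))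
    obtain ⟨s, hs1, hs2, hs3⟩ := (h2.and ((hneg.eventually h3).and (hor t ht))).exists
    rw [neg_smul, ← sub_eq_add_neg] at hs2
    rw [Function.comp_apply, hs1, hs2] at hs3
    obtain ⟨-, h4⟩ := eq_smul_canonicalDirection hf hm hperp hc hh hO hr h0 hs
    -- by the orientation of the curve, the sign in the direction is `1`
    have h5 : h b - h a = 1 := by
      rcases hh a b hab with h6 | h6
      · omega
      · exact absurd hs3 h6.2.1
    rw [h5, Int.cast_one, one_mul] at h4
    exact ⟨hd, norm_pos_iff.2 h0, h4⟩
  refine ⟨γ, θ, ⟨hmem, hsm', hinj, ?_, fun t ht => ?_⟩, hθ, fun t ht => ?_, hw⟩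
  · rw [← closure_Ioo zero_ne_one] at hγ hcl
    exact (subset_closure.trans hcl.ge).trans hγ.image_closure
  · obtain ⟨h1, h2, h3⟩ := key t ht
    exact ⟨_, h2, h3 ▸ h1⟩
  · obtain ⟨-, h2, h3⟩ := key t ht
    exact smul_right_injective _ h2.ne' (h3.symm.trans (hθd t ht).2)

/-- The cumulative winding number is defined and a half-integer, for each way of reading off a
coorientation from the values of a chessboard function. -/
lemma cumulativeWinding_mem_half_int : CumulativeWindingDefined side m f c ∧
    ∃ k : ℤ, cumulativeWinding side m f c = (k : ℝ) / 2 := by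
  classical
  obtain ⟨ι, _, p, B, s, hE, hprod⟩ := exists_isEndSystem hf hm hperp hc hh
  have hV := isDirectionField_canonicalDirection hf hm hperp hc hh
  have hfin : (arcs m f).Finite := hE.finite_components hV
  have hex : ∀ A ∈ arcs m f, ∃ w, IsArcWinding side m f c A w ∧
      (∀ w', IsArcWinding side m f c A w' → w' = w) ∧
      Complex.exp (4 * Real.pi * Complex.I * (w : ℝ))
        = ∏ i with connectedComponentIn (openArcSet m f) (B i).halfPoint = A,
          lineDirection ((B i).E 0) ^ (-s i) := by
    rintro _ ⟨x, hx, rfl⟩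
    obtain ⟨γ, θ, hγ, hγd, hθ, hθV, hexp⟩ := hE.exists_winding hf.1 hV hx
    have hsub := connectedComponentIn_subset (openArcSet m f) x
    refine ⟨θ 1 - θ 0, isArcWinding_of_isDirectedParam hf hm hperp hc hh hsub hγ hγd
      hθ.continuousOn hθV, fun w hw => ?_, hexp⟩
    obtain ⟨γ', θ', hγd', hθ', hθV', rfl⟩ :=
      hw.exists_isDirectedParam hf hm hperp hc hh hsub
    obtain ⟨S, Γ, hΓ, rfl⟩ := (hV.isLocalFlow hf.1).exists_maximalCurve hx
    rw [← (hV.isLocalFlow hf.1).image_eq hΓ] at hγd hγd'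
    exact hγd'.winding_unique hf.1 hV hΓ hγd hθ' hθ.continuousOn hθV' hθV
  have hspec : ∀ A ∈ arcs m f, Complex.exp (4 * Real.pi * Complex.I * arcWinding side m f c A)
      = ∏ i with connectedComponentIn (openArcSet m f) (B i).halfPoint = A,
        lineDirection ((B i).E 0) ^ (-s i) := by
    intro A hA
    obtain ⟨w, hw, huniq, hexp⟩ := hex A hA
    rw [← hexp, huniq (arcWinding side m f c A) (Classical.epsilon_spec ⟨w, hw⟩)]
  refine ⟨⟨hfin, fun A hA => ?_⟩, ?_⟩
  · obtain ⟨w, hw, huniq, -⟩ := hex A hA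
    exact ⟨w, hw, huniq⟩
  · have hsum : cumulativeWinding side m f c = ∑ A ∈ hfin.toFinset, arcWinding side m f c A :=
      finsum_mem_eq_finite_toFinset_sum _ hfin
    have hone : Complex.exp (4 * Real.pi * Complex.I * cumulativeWinding side m f c) = 1 := by
      rw [hsum, Complex.ofReal_sum, Finset.mul_sum, Complex.exp_sum,
        Finset.prod_congr rfl fun A hA => hspec A (hfin.mem_toFinset.1 hA),
        Finset.prod_fiberwise_of_maps_to
          (g := fun i => connectedComponentIn (openArcSet m f) (B i).halfPoint), hprod]
      exact fun i _ => hfin.mem_toFinset.2 ⟨_, hE.half_subset i (B i).halfPoint_mem, rfl⟩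
    obtain ⟨n, hn⟩ := Complex.exp_eq_one_iff.1 hone
    refine ⟨n, ?_⟩
    have h1 : (2 * Real.pi * Complex.I : ℂ) ≠ 0 := Complex.two_pi_I_ne_zero
    have h2 : (2 * cumulativeWinding side m f c : ℂ) = n := by
      refine mul_left_cancel₀ h1 ?_
      linear_combination hn
    have h3 : 2 * cumulativeWinding side m f c = n := by exact_mod_cast h2
    linarith

end

end
theorem propositionl (m : ℕ) (hm : 2 ≤ m) {M : Type*} [TopologicalSpace M] [T2Space M]
    [CompactSpace M] [ChartedSpace (Euc m) M] [IsManifold (𝓡 m) ∞ M]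
    (f : M → Euc 2) (hf : IsGenericMap m f) (hperp : PerpendicularCrossings m f) :
    (∀ c : Euc 2 → ℤ, IsChessboard m f c →
      CumulativeWindingDefined intSide m f c ∧
        ∃ k : ℤ, cumulativeWinding intSide m f c = (k : ℝ) / 2) ∧
    (∀ c : Euc 2 → ZMod 2, IsChessboard m f c →
      CumulativeWindingDefined modTwoSide m f c ∧
        ∃ k : ℤ, cumulativeWinding modTwoSide m f c = (k : ℝ) / 2) :=
  ⟨fun _ hc => cumulativeWinding_mem_half_int hf hm hperp hc isPotential_intSide,
    fun _ hc => cumulativeWinding_mem_half_int hf hm hperp hc isPotential_modTwoSide⟩
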